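/- Let $0<|a|<M$, $r_\pm=M\pm\sqrt{M^2-a^2}$, $\Delta=r^2-2Mr+a^2$, $\kappa_\pm=\frac{r_\pm-r_\mp}{2(r_\pm^2+a^2)}$, and let $r^*,\bar r$ be functions on $(r_-,r_+)$ with $\frac{dr^*}{dr}=\frac{r^2+a^2}{\Delta}$, $\frac{d\bar r}{dr}=\frac a\Delta$. In Boyer–Lindquist coordinates $(t,r,\theta,\varphi)$ on the Kerr interior $\mathcal M=\mathbb R\times(r_-,r_+)\times\mathbb S^2$ put $v_\pm=r^*\pm t$, $\varphi_\pm=\varphi\pm\bar r$, $V^\pm=e^{\kappa_+v_\pm}$, $\Phi=\varphi-\frac{at}{r_+^2+a^2}$. Let $\underline{\mathcal M}=[0,\infty)_{V^+}\times[0,\infty)_{V^-}\times\mathbb S^2_{(\theta,\Phi)}$ be $\mathcal M$ with the left event horizon $\mathcal H_l^+=\{V^+=0\}$ and the right event horizon $\mathcal H_r^+=\{V^-=0\}$ attached, with bifurcation sphere $\mathbb S^2_b=\{V^+=V^-=0\}$. A smooth spin $2$-weighted function on $\underline{\mathcal M}$ is a function $\alpha(m,m)$ on $\{\theta\ne0,\pi\}$,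 where $\alpha$ is a smooth symmetric $2$-covariant tensor field on $\underline{\mathcal M}$ and $m=\frac1{\sqrt2}(\partial_\theta+\frac i{\sin\theta}\partial_\Phi)$. Let $s=2$, $$\mathring{\slashed\Delta}_{[s]}f=\tfrac1{\sin\theta}\partial_\theta(\sin\theta\,\partial_\theta f)+\tfrac1{\sin^2\theta}\partial_\varphi^2f+2si\tfrac{\cos\theta}{\sin^2\theta}\partial_\varphi f-\big(s^2\tfrac{\cos^2\theta}{\sin^2\theta}-s\big)f,$$ and in the coordinates $(v_\pm,r,\theta,\varphi_\pm)$ let $\widetilde Z_{1,\pm}=-\sin\varphi_\pm\partial_\theta+\cos\varphi_\pm(-\frac{is}{\sin\theta}-\frac{\cos\theta}{\sin\theta}\partial_{\varphi_\pm})$, $\widetilde Z_{2,\pm}=-\cos\varphi_\pm\partial_\theta-\sin\varphi_\pm(-\frac{is}{\sin\theta}-\frac{\cos\theta}{\sin\theta}\partial_{\varphi_\pm})$, $\widetilde Z_{3,\pm}=\partial_{\varphi_\pm}$, and $\mathcal Q=a^2\sin^2\theta\,\partial_{v_\pm}^2\mp2isa\cos\theta\,\partial_{v_\pm}+\mathring{\slashed\Delta}_{[s]}$.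 We write $\mathrm{vol}_{\mathbb S^2}=\sin\theta\,d\theta\,d\varphi$. **Assumptions.** Let $\psi$ and $(V^+)^{-2}\psi$ be smooth spin $2$-weighted functions on $\underline{\mathcal M}$ and let $\psi$ satisfy on $\mathcal M\cup(\mathcal H_r^+\setminus\mathbb S^2_b)$ the Teukolsky equation, in $(v_+,r,\theta,\varphi_+)$ coordinates $$a^2\sin^2\theta\,\partial_{v_+}^2\psi+2a\,\partial_{v_+}\partial_{\varphi_+}\psi+2(r^2+a^2)\partial_{v_+}\partial_r\psi+2a\,\partial_{\varphi_+}\partial_r\psi+\Delta\partial_r^2\psi+2\big(r(1-2s)-isa\cos\theta\big)\partial_{v_+}\psi+2(r-M)(1-s)\partial_r\psi+\mathring{\slashed\Delta}_{[s]}\psi-2s\psi=0 .$$ Let $p_0\ge2$ be an integer and $2<q_r<2p_0\le q_l$ real numbers. Assume that $$\int_{\mathcal H_r^+\cap\{v_+\ge1\}}v_+^{q_r}\,\big|\widetilde Z_{1,+}^{i_1}\widetilde Z_{2,+}^{i_2}\widetilde Z_{3,+}^{i_3}\partial_{v_+}^jf\big|^2\,\mathrm{vol}_{\mathbb S^2}dv_+<\infty\qquad(i_1+i_2+i_3+j\le1)$$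 for all $f\in\{g,\partial_{v_+}g,\mathcal Qg\}$, $g=\partial_{v_+}^{n_1}\partial_{\varphi_+}^{n_2}\partial_r^{n_3}\psi$, $n_1+n_2\le2$, $n_3\le2$; and that, with $\hat\psi=\Delta^{-2}\psi$, which is smooth on $\mathcal H_l^+\setminus\mathbb S^2_b$, $$\int_{\mathcal H_l^+\cap\{v_-\ge1\}}v_-^{q_l}\,\big|\widetilde Z_{1,-}^{i_1}\widetilde Z_{2,-}^{i_2}\widetilde Z_{3,-}^{i_3}\partial_{v_-}^jf\big|^2\,\mathrm{vol}_{\mathbb S^2}dv_-<\infty\qquad(i_1+i_2+i_3+j\le1)$$ for all $f\in\{g,\partial_{v_-}g,\mathcal Qg\}$, $g=\partial_{v_-}^{n_1}\partial_{\varphi_-}^{n_2}\partial_r^{n_3}\hat\psi$ (coordinates $(v_-,r,\theta,\varphi_-)$), $n_1+n_2+n_3\le2$. Let $\chi:\mathbb R\to(0,\infty)$ be smooth with $\chi(v)=v^{q_r}$ for $v\ge1$ and $\chi(v)=|v|^{q_l}$ for $v\le-1$. **Conclusions.** In the coordinates $(v_+,r,\theta,\varphi_+)$ the following hold. 1. (Energy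 estimate.) For every $r_{\mathrm{red}}\in(r_-,r_+)$ there are $r_{\mathrm{ered}}\in(r_-,r_{\mathrm{red}})$ and $C>0$ with $$\int_{\{r_-<r\le r_{\mathrm{ered}}\}}\chi(v_+)\Big(|\partial_r\psi|^2+|\partial_{v_+}\psi|^2+\sum_i|\widetilde Z_{i,+}\psi|^2+|\psi|^2\Big)\mathrm{vol}_{\mathbb S^2}dv_+dr\le C,$$ $$\sup_{r'\in(r_-,r_{\mathrm{ered}}]}\int_{\{r=r'\}}\chi(v_+)\Big(|\Delta||\partial_r\psi|^2+|\partial_{v_+}\psi|^2+\sum_i|\widetilde Z_{i,+}\psi|^2+|\psi|^2\Big)\mathrm{vol}_{\mathbb S^2}dv_+\le C .$$ 2. (Extension to the left Cauchy horizon $\mathcal{CH}_l^+=\mathbb R_{v_+}\times\{r=r_-\}\times\mathbb S^2$.) As $r\to r_-$, $\psi(\cdot\,;r)$ converges in $L^2(\mathbb R\times\mathbb S^2,\mathrm{vol}_{\mathbb S^2}dv_+)$ to a limit $\psi(\cdot\,;r_-)$, and $\int_{\mathbb R\times\mathbb S^2}\chi(v_+)|\psi(\cdot\,;r_-)|^2\,\mathrm{vol}_{\mathbb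 S^2}dv_+<\infty$. 3. (Backwards propagation.) Let $v_0\in\mathbb R$ and $\Sigma=\{f^-=v_0\}$, where $f^-=v_--r+r_-$; $\Sigma$ is a graph $r=r_\Sigma(v_+)$ over $\mathbb R_{v_+}\times\mathbb S^2$. There is $C>0$ such that for all sufficiently large $v'$ both integrals below are finite and $$\Big|\int_{\mathcal{CH}_l^+\cap\{v_+\ge v'\}}|\psi(\cdot\,;r_-)|^2\,\mathrm{vol}_{\mathbb S^2}dv_+-\int_{\Sigma\cap\{v_+\ge v'\}}|\psi|^2\,\mathrm{vol}_{\mathbb S^2}dv_+\Big|\le C\,e^{\frac12\kappa_-v'}$$ (recall $\kappa_-<0$). Consequently, for every $p>0$, $\int_{\mathcal{CH}_l^+\cap\{v_+\ge1\}}v_+^p|\psi(\cdot\,;r_-)|^2\,\mathrm{vol}_{\mathbb S^2}dv_+<\infty$ if and only if $\int_{\Sigma\cap\{v_+\ge1\}}v_+^p|\psi|^2\,\mathrm{vol}_{\mathbb S^2}dv_+<\infty$. -/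

import Mathlib

open Set Filter Topology MeasureTheory
open scoped ContDiff

namespace Kerr

/-! ## Kerr parameters and radial functions

`a` is the specific angular momentum, `M` the mass.  The real numbers `c` and `b` are the free
constants of integration in the two radial functions `rStar` and `rBar`. -/

/-- The radius of the Cauchy horizon. -/
noncomputable def rm (a M : ℝ) : ℝ := M - Real.sqrt (M ^ 2 - a ^ 2)

/-- The radius of the event horizon. -/
noncomputable def rp (a M : ℝ) : ℝ := M + Real.sqrt (M ^ 2 - a ^ 2)

/-- `Δ = r² - 2 M r + a²`. -/
def Delta (a M r : ℝ) : ℝ := r ^ 2 - 2 * M * r + a ^ 2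

/-- Surface gravity of the event horizon (positive). -/
noncomputable def kp (a M : ℝ) : ℝ := (rp a M - rm a M) / (2 * ((rp a M) ^ 2 + a ^ 2))

/-- Surface gravity of the Cauchy horizon (negative). -/
noncomputable def km (a M : ℝ) : ℝ := (rm a M - rp a M) / (2 * ((rm a M) ^ 2 + a ^ 2))

/-- Angular velocity of the event horizon. -/
noncomputable def omegaP (a M : ℝ) : ℝ := a / ((rp a M) ^ 2 + a ^ 2)

/-- The general antiderivative of `(r² + a²) / Δ` on `(r₋, r₊)`. -/
noncomputable def rStar (a M c r : ℝ) : ℝ :=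
  c + r + 1 / (2 * kp a M) * Real.log (rp a M - r) + 1 / (2 * km a M) * Real.log (r - rm a M)

/-- The general antiderivative of `a / Δ` on `(r₋, r₊)`. -/
noncomputable def rBar (a M b r : ℝ) : ℝ :=
  b + a / (rp a M - rm a M) * (Real.log (rp a M - r) - Real.log (r - rm a M))

/-- The part of `rStar` that is regular at `r₊`, i.e. `rStar = log (r₊ - r) / (2 κ₊) + regP`. -/
noncomputable def regP (a M c r : ℝ) : ℝ := c + r + 1 / (2 * km a M) * Real.log (r - rm a M)

/-- The function `ω₊ rStar - rBar`, written in the form that is regular at `r₊`. -/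
noncomputable def phiP (a M c b r : ℝ) : ℝ :=
  omegaP a M * (c + r) - b + a / rp a M * Real.log (r - rm a M)

section RadialFacts

variable {a M : ℝ}

theorem sq_lt (haM : |a| < M) : 0 < M ^ 2 - a ^ 2 := by
  have h0 : 0 ≤ |a| := abs_nonneg a
  have : |a| ^ 2 < M ^ 2 := by nlinarith
  rw [sq_abs] at this
  linarith

theorem rm_lt_rp (haM : |a| < M) : rm a M < rp a M := by
  have := Real.sqrt_pos.2 (sq_lt haM)
  unfold rm rp
  linarith

theorem Delta_eq (haM : |a| < M) (r : ℝ) : Delta a M r = (r - rp a M) * (r - rm a M) := by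
  have := Real.mul_self_sqrt (sq_lt haM).le
  unfold Delta rm rp
  nlinarith

theorem rm_pos (ha : 0 < |a|) (haM : |a| < M) : 0 < rm a M := by
  have hM : 0 < M := ha.trans haM
  have ha2 : 0 < a ^ 2 := by positivity [abs_pos.1 ha]
  have : Real.sqrt (M ^ 2 - a ^ 2) < M := by
    rw [Real.sqrt_lt' hM]
    linarith
  unfold rm
  linarith

theorem rp_sq (haM : |a| < M) : (rp a M) ^ 2 + a ^ 2 = 2 * M * rp a M := by
  have h := Delta_eq haM (rp a M)
  unfold Delta at h
  nlinarith

theorem rm_sq (haM : |a| < M) : (rm a M) ^ 2 + a ^ 2 = 2 * M * rm a M := by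
  have h := Delta_eq haM (rm a M)
  unfold Delta at h
  nlinarith

theorem rp_add_rm : rp a M + rm a M = 2 * M := by
  unfold rm rp
  ring

theorem kp_pos (ha : 0 < |a|) (haM : |a| < M) : 0 < kp a M := by
  have h1 := rm_pos ha haM
  have h2 := rm_lt_rp haM
  unfold kp
  apply div_pos <;> nlinarith [sq_nonneg a]

theorem km_neg (ha : 0 < |a|) (haM : |a| < M) : km a M < 0 := by
  have h1 := rm_pos ha haM
  have h2 := rm_lt_rp haM
  unfold km
  apply div_neg_of_neg_of_pos <;> nlinarith [sq_nonneg a]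

/-- `rStar` has the required derivative. -/
theorem hasDerivAt_rStar (ha : 0 < |a|) (haM : |a| < M) (c : ℝ) {r : ℝ}
    (hr : r ∈ Ioo (rm a M) (rp a M)) :
    HasDerivAt (rStar a M c) ((r ^ 2 + a ^ 2) / Delta a M r) r := by
  have h1 : rp a M - r ≠ 0 := by linarith [hr.2]
  have h2 : r - rm a M ≠ 0 := by linarith [hr.1]
  have h3 : r - rp a M ≠ 0 := by linarith [hr.2]
  have hm := rm_pos ha haM
  have hlt := rm_lt_rp haM
  have hd : rp a M - rm a M ≠ 0 := by linarith
  have hd' : rm a M - rp a M ≠ 0 := by linarith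
  have e1 : HasDerivAt (fun x => Real.log (rp a M - x)) (-1 / (rp a M - r)) r :=
    ((hasDerivAt_id r).const_sub (rp a M)).log h1
  have e2 : HasDerivAt (fun x => Real.log (x - rm a M)) (1 / (r - rm a M)) r :=
    ((hasDerivAt_id r).sub_const (rm a M)).log h2
  have e := (((hasDerivAt_id r).const_add c).add (e1.const_mul (1 / (2 * kp a M)))).add
    (e2.const_mul (1 / (2 * km a M)))
  refine e.congr_deriv ?_
  rw [Delta_eq haM]
  have hkp : 1 / (2 * kp a M) = (2 * M * rp a M) / (rp a M - rm a M) := by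
    have hp : rp a M ^ 2 + a ^ 2 ≠ 0 := by nlinarith [sq_nonneg a]
    rw [← rp_sq haM]
    unfold kp
    field_simp
  have hkm : 1 / (2 * km a M) = (2 * M * rm a M) / (rm a M - rp a M) := by
    have hp : rm a M ^ 2 + a ^ 2 ≠ 0 := by nlinarith [sq_nonneg a]
    rw [← rm_sq haM]
    unfold km
    field_simp
  rw [hkp, hkm]
  have ha2 : a ^ 2 = 2 * M * rp a M - rp a M ^ 2 := by linarith [rp_sq haM]
  rw [ha2, ← rp_add_rm (a := a) (M := M)]
  have hd'' : rm a M - rp a M = -(rp a M - rm a M) := by ring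
  have h1' : rp a M - r = -(r - rp a M) := by ring
  rw [hd'', h1']
  field_simp
  ring

/-- `rBar` has the required derivative. -/
theorem hasDerivAt_rBar (haM : |a| < M) (b : ℝ) {r : ℝ}
    (hr : r ∈ Ioo (rm a M) (rp a M)) :
    HasDerivAt (rBar a M b) (a / Delta a M r) r := by
  have h1 : rp a M - r ≠ 0 := by linarith [hr.2]
  have h2 : r - rm a M ≠ 0 := by linarith [hr.1]
  have h3 : r - rp a M ≠ 0 := by linarith [hr.2]
  have hlt := rm_lt_rp haM
  have hd : rp a M - rm a M ≠ 0 := by linarith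
  have e1 : HasDerivAt (fun x => Real.log (rp a M - x)) (-1 / (rp a M - r)) r :=
    ((hasDerivAt_id r).const_sub (rp a M)).log h1
  have e2 : HasDerivAt (fun x => Real.log (x - rm a M)) (1 / (r - rm a M)) r :=
    ((hasDerivAt_id r).sub_const (rm a M)).log h2
  have e := ((e1.sub e2).const_mul (a / (rp a M - rm a M))).const_add b
  refine e.congr_deriv ?_
  rw [Delta_eq haM]
  have h1' : rp a M - r = -(r - rp a M) := by ring
  rw [h1']
  field_simp
  ring

theorem rStar_eq_regP (c r : ℝ) :
    rStar a M c r = 1 / (2 * kp a M) * Real.log (rp a M - r) + regP a M c r := by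
  unfold rStar regP
  ring

/-- `phiP` is the function `ω₊ rStar - rBar`. -/
theorem phiP_eq (ha : 0 < |a|) (haM : |a| < M) (c b r : ℝ) :
    phiP a M c b r = omegaP a M * rStar a M c r - rBar a M b r := by
  have hm := rm_pos ha haM
  have hlt := rm_lt_rp haM
  have hd : rp a M - rm a M ≠ 0 := by linarith
  have hd' : rm a M - rp a M ≠ 0 := by linarith
  have hp0 : rp a M ≠ 0 := by linarith
  have hM : M ≠ 0 := by linarith
  have hkp : omegaP a M * (1 / (2 * kp a M)) = a / (rp a M - rm a M) := by
    have hp : rp a M ^ 2 + a ^ 2 ≠ 0 := by nlinarith [sq_nonneg a]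
    unfold kp omegaP
    field_simp
  have hkm : omegaP a M * (1 / (2 * km a M)) = a / rp a M - a / (rp a M - rm a M) := by
    have hp : rp a M ^ 2 + a ^ 2 ≠ 0 := by nlinarith [sq_nonneg a]
    have hq : rm a M ^ 2 + a ^ 2 ≠ 0 := by nlinarith [sq_nonneg a]
    have hd'' : rm a M - rp a M = -(rp a M - rm a M) := by ring
    unfold km omegaP
    rw [rm_sq haM, rp_sq haM, hd'']
    field_simp
    ring
  unfold phiP rBar rStar
  linear_combination (-Real.log (rp a M - r)) * hkp - Real.log (r - rm a M) * hkm

end RadialFacts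

/-! ## Spin 2-weighted functions

The black hole interior together with its event horizons (and bifurcation sphere) is the manifold
with corners `[0,∞) × [0,∞) × S²` with Kruskal-like coordinates `(V⁺, V⁻, θ, Φ)`.
The sphere is the unit sphere of `ℝ³`. -/

/-- The ambient space `ℝ × ℝ × ℝ³` of `[0,∞) × [0,∞) × S²`. -/
abbrev Amb : Type := ℝ × ℝ × EuclideanSpace ℝ (Fin 3)

/-- The point of the unit sphere with polar angles `(θ, Φ)`. -/
noncomputable def sphPt (θ Φ : ℝ) : EuclideanSpace ℝ (Fin 3) :=
  !₂[Real.sin θ * Real.cos Φ, Real.sin θ * Real.sin Φ, Real.cos θ]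

/-- The unit vector field `∂_θ`. -/
noncomputable def frame1 (θ Φ : ℝ) : Amb :=
  (0, 0, !₂[Real.cos θ * Real.cos Φ, Real.cos θ * Real.sin Φ, -Real.sin θ])

/-- The unit vector field `(sin θ)⁻¹ ∂_Φ`. -/
noncomputable def frame2 (Φ : ℝ) : Amb :=
  (0, 0, !₂[-Real.sin Φ, Real.cos Φ, 0])

/-- `f` is a smooth spin 2-weighted function on `[0,∞) × [0,∞) × S²`: away from the poles
`f = α(m, m)` with `m = (∂_θ + i (sin θ)⁻¹ ∂_Φ) / √2`, for some smooth symmetric 2-covariant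
tensor field `α`.  Smooth tensor fields on `[0,∞) × [0,∞) × S²` are exactly the restrictions of
smooth tensor fields on `[0,∞) × [0,∞) × (ℝ³ \ {0})`; by symmetry
`α(m, m) = (α(e₁, e₁) - α(e₂, e₂)) / 2 + i α(e₁, e₂)`. -/
def IsSpin2 (f : ℝ → ℝ → ℝ → ℝ → ℂ) : Prop :=
  ∃ α : Amb → (Amb →L[ℝ] Amb →L[ℝ] ℝ),
    ContDiffOn ℝ ∞ α (Ici (0 : ℝ) ×ˢ Ici (0 : ℝ) ×ˢ ({0}ᶜ : Set (EuclideanSpace ℝ (Fin 3)))) ∧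
    (∀ x u w, α x u w = α x w u) ∧
    ∀ Vp Vm θ Φ : ℝ, 0 ≤ Vp → 0 ≤ Vm → θ ∈ Ioo 0 Real.pi →
      f Vp Vm θ Φ =
        (((α (Vp, Vm, sphPt θ Φ) (frame1 θ Φ) (frame1 θ Φ)
            - α (Vp, Vm, sphPt θ Φ) (frame2 Φ) (frame2 Φ)) / 2 : ℝ) : ℂ)
          + Complex.I * ((α (Vp, Vm, sphPt θ Φ) (frame1 θ Φ) (frame2 Φ) : ℝ) : ℂ)

/-! ## The two systems of Eddington-Finkelstein-like coordinates

Both are used for `r₋ < r ≤ r₊`, where `r = r₊` is the right (left) event horizon without the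
bifurcation sphere. -/

/-- A function of `(V⁺, V⁻, θ, Φ)` expressed in the coordinates `(v₊, r, θ, φ₊)`. -/
noncomputable def inPlus (a M c b : ℝ) (f : ℝ → ℝ → ℝ → ℝ → ℂ) : ℝ → ℝ → ℝ → ℝ → ℂ :=
  fun v r θ φ =>
    f (Real.exp (kp a M * v))
      (Real.exp (-(kp a M * v)) * ((rp a M - r) * Real.exp (2 * kp a M * regP a M c r)))
      θ (φ - omegaP a M * v + phiP a M c b r)

/-- A function of `(V⁺, V⁻, θ, Φ)` expressed in the coordinates `(v₋, r, θ, φ₋)`. -/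
noncomputable def inMinus (a M c b : ℝ) (f : ℝ → ℝ → ℝ → ℝ → ℂ) : ℝ → ℝ → ℝ → ℝ → ℂ :=
  fun v r θ φ =>
    f (Real.exp (-(kp a M * v)) * ((rp a M - r) * Real.exp (2 * kp a M * regP a M c r)))
      (Real.exp (kp a M * v))
      θ (φ + omegaP a M * v - phiP a M c b r)

/-- The field `Δ⁻² ψ` in the coordinates `(v₋, r, θ, φ₋)`, regular up to `r = r₊`, in terms of
`ψt = (V⁺)⁻² ψ`; note `V⁺ / Δ = - exp (-κ₊ v₋ + 2 κ₊ regP) / (r - r₋)`. -/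
noncomputable def hatField (a M c b : ℝ) (ψt : ℝ → ℝ → ℝ → ℝ → ℂ) : ℝ → ℝ → ℝ → ℝ → ℂ :=
  fun v r θ φ =>
    (((Real.exp (-(kp a M * v)) * Real.exp (2 * kp a M * regP a M c r) / (r - rm a M)) ^ 2 : ℝ) : ℂ)
      * inMinus a M c b ψt v r θ φ

section CoordinateFacts

variable {a M : ℝ}

theorem exp_rStar (ha : 0 < |a|) (haM : |a| < M) (c : ℝ) {r : ℝ} (hr : r < rp a M) :
    (rp a M - r) * Real.exp (2 * kp a M * regP a M c r)
      = Real.exp (2 * kp a M * rStar a M c r) := by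
  have hk := (kp_pos ha haM).ne'
  have e : 2 * kp a M * rStar a M c r
      = Real.log (rp a M - r) + 2 * kp a M * regP a M c r := by
    rw [rStar_eq_regP]
    field_simp
  rw [e, Real.exp_add, Real.exp_log (by linarith)]

/-- In Boyer-Lindquist coordinates `(t, r, θ, φ)`, `V⁺ = exp (κ₊ v₊)`, `V⁻ = exp (κ₊ v₋)` and
`Φ = φ - ω₊ t`, where `v₊ = t + rStar`, `v₋ = rStar - t`, `φ₊ = φ + rBar`. -/
theorem inPlus_eq (ha : 0 < |a|) (haM : |a| < M) (c b : ℝ) (f : ℝ → ℝ → ℝ → ℝ → ℂ)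
    (t θ φ : ℝ) {r : ℝ} (hr : r < rp a M) :
    inPlus a M c b f (t + rStar a M c r) r θ (φ + rBar a M b r)
      = f (Real.exp (kp a M * (t + rStar a M c r))) (Real.exp (kp a M * (rStar a M c r - t)))
          θ (φ - omegaP a M * t) := by
  unfold inPlus
  rw [exp_rStar ha haM c hr, ← Real.exp_add, phiP_eq ha haM]
  congr 1 <;> ring_nf

/-- The same for `v₋ = rStar - t`, `φ₋ = φ - rBar`. -/
theorem inMinus_eq (ha : 0 < |a|) (haM : |a| < M) (c b : ℝ) (f : ℝ → ℝ → ℝ → ℝ → ℂ)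
    (t θ φ : ℝ) {r : ℝ} (hr : r < rp a M) :
    inMinus a M c b f (rStar a M c r - t) r θ (φ - rBar a M b r)
      = f (Real.exp (kp a M * (t + rStar a M c r))) (Real.exp (kp a M * (rStar a M c r - t)))
          θ (φ - omegaP a M * t) := by
  unfold inMinus
  rw [exp_rStar ha haM c hr, ← Real.exp_add, phiP_eq ha haM]
  congr 1 <;> ring_nf

end CoordinateFacts

/-! ## Differential operators on functions of `(v, r, θ, φ)` -/

/-- `∂_v`. -/
noncomputable def pV (g : ℝ → ℝ → ℝ → ℝ → ℂ) : ℝ → ℝ → ℝ → ℝ → ℂ :=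
  fun v r θ φ => deriv (fun x => g x r θ φ) v

/-- `∂_r` on `r₋ < r ≤ r₊`, one-sided at the boundary `r = r₊`. -/
noncomputable def pR (a M : ℝ) (g : ℝ → ℝ → ℝ → ℝ → ℂ) : ℝ → ℝ → ℝ → ℝ → ℂ :=
  fun v r θ φ => derivWithin (fun x => g v x θ φ) (Ioc (rm a M) (rp a M)) r

/-- `∂_θ`. -/
noncomputable def pTheta (g : ℝ → ℝ → ℝ → ℝ → ℂ) : ℝ → ℝ → ℝ → ℝ → ℂ :=
  fun v r θ φ => deriv (fun x => g v r x φ) θ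

/-- `∂_φ`. -/
noncomputable def pPhi (g : ℝ → ℝ → ℝ → ℝ → ℂ) : ℝ → ℝ → ℝ → ℝ → ℂ :=
  fun v r θ φ => deriv (fun x => g v r θ x) φ

/-- The three spin `s`-weighted angular operators. -/
noncomputable def Z (s : ℝ) : Fin 3 → (ℝ → ℝ → ℝ → ℝ → ℂ) → ℝ → ℝ → ℝ → ℝ → ℂ :=
  ![fun g v r θ φ =>
      -(Real.sin φ : ℂ) * pTheta g v r θ φ
        + (Real.cos φ : ℂ) * (-Complex.I * s * (1 / (Real.sin θ : ℂ)) * g v r θ φ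
            - (Real.cos θ : ℂ) / (Real.sin θ : ℂ) * pPhi g v r θ φ),
    fun g v r θ φ =>
      -(Real.cos φ : ℂ) * pTheta g v r θ φ
        - (Real.sin φ : ℂ) * (-Complex.I * s * (1 / (Real.sin θ : ℂ)) * g v r θ φ
            - (Real.cos θ : ℂ) / (Real.sin θ : ℂ) * pPhi g v r θ φ),
    pPhi]

/-- The spin `s`-weighted Laplacian on the sphere. -/
noncomputable def spinLap (s : ℝ) (g : ℝ → ℝ → ℝ → ℝ → ℂ) : ℝ → ℝ → ℝ → ℝ → ℂ :=
  fun v r θ φ =>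
    1 / (Real.sin θ : ℂ) * deriv (fun x => (Real.sin x : ℂ) * pTheta g v r x φ) θ
      + 1 / (Real.sin θ : ℂ) ^ 2 * pPhi (pPhi g) v r θ φ
      + 2 * s * Complex.I * ((Real.cos θ : ℂ) / (Real.sin θ : ℂ) ^ 2) * pPhi g v r θ φ
      - ((s : ℂ) ^ 2 * ((Real.cos θ : ℂ) ^ 2 / (Real.sin θ : ℂ) ^ 2) - s) * g v r θ φ

/-- The spin `s`-weighted Carter operator in `(v₊, r, θ, φ₊)` coordinates. -/
noncomputable def carterPlus (a s : ℝ) (g : ℝ → ℝ → ℝ → ℝ → ℂ) : ℝ → ℝ → ℝ → ℝ → ℂ :=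
  fun v r θ φ =>
    (a : ℂ) ^ 2 * (Real.sin θ : ℂ) ^ 2 * pV (pV g) v r θ φ
      - 2 * Complex.I * s * a * (Real.cos θ : ℂ) * pV g v r θ φ + spinLap s g v r θ φ

/-- The spin `s`-weighted Carter operator in `(v₋, r, θ, φ₋)` coordinates. -/
noncomputable def carterMinus (a s : ℝ) (g : ℝ → ℝ → ℝ → ℝ → ℂ) : ℝ → ℝ → ℝ → ℝ → ℂ :=
  fun v r θ φ =>
    (a : ℂ) ^ 2 * (Real.sin θ : ℂ) ^ 2 * pV (pV g) v r θ φ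
      + 2 * Complex.I * s * a * (Real.cos θ : ℂ) * pV g v r θ φ + spinLap s g v r θ φ

/-- The Teukolsky operator of spin `s` in `(v₊, r, θ, φ₊)` coordinates. -/
noncomputable def teukolsky (a M s : ℝ) (g : ℝ → ℝ → ℝ → ℝ → ℂ) : ℝ → ℝ → ℝ → ℝ → ℂ :=
  fun v r θ φ =>
    (a : ℂ) ^ 2 * (Real.sin θ : ℂ) ^ 2 * pV (pV g) v r θ φ
      + 2 * a * pV (pPhi g) v r θ φ
      + 2 * ((r : ℂ) ^ 2 + (a : ℂ) ^ 2) * pV (pR a M g) v r θ φ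
      + 2 * a * pPhi (pR a M g) v r θ φ
      + (Delta a M r : ℂ) * pR a M (pR a M g) v r θ φ
      + 2 * ((r : ℂ) * (1 - 2 * s) - Complex.I * s * a * (Real.cos θ : ℂ)) * pV g v r θ φ
      + 2 * ((r : ℂ) - M) * (1 - s) * pR a M g v r θ φ
      + spinLap s g v r θ φ - 2 * s * g v r θ φ

/-! ## Measures -/

/-- `sin θ dθ dφ` on the coordinate domain `(0, π) × (0, 2π)` of the sphere. -/
noncomputable def sphMeasure : Measure (ℝ × ℝ) :=
  (volume.restrict (Ioo 0 Real.pi ×ˢ Ioo 0 (2 * Real.pi))).withDensity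
    (fun x => ENNReal.ofReal (Real.sin x.1))

/-- `dv ⊗ vol_{S²}` on `ℝ × S²`, with points `(v, θ, φ)`. -/
noncomputable def cyl : Measure (ℝ × ℝ × ℝ) := (volume : Measure ℝ).prod sphMeasure

/-! ## Assumptions on the field -/

/-- `ψ` is the Teukolsky field and `ψt = (V⁺)⁻² ψ`, both as functions of `(V⁺, V⁻, θ, Φ)`; both are
smooth spin 2-weighted up to and including the event horizons, and the Teukolsky equation holds in
the interior and on the right event horizon. -/
structure RegularField (a M c b : ℝ) (ψ ψt : ℝ → ℝ → ℝ → ℝ → ℂ) : Prop where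
  spin : IsSpin2 ψ
  spin_t : IsSpin2 ψt
  quot : ∀ Vp Vm θ Φ : ℝ, 0 ≤ Vp → 0 ≤ Vm → θ ∈ Ioo 0 Real.pi →
    ψ Vp Vm θ Φ = (Vp : ℂ) ^ 2 * ψt Vp Vm θ Φ
  equation : ∀ v r θ φ : ℝ, r ∈ Ioc (rm a M) (rp a M) → θ ∈ Ioo 0 Real.pi →
    teukolsky a M 2 (inPlus a M c b ψ) v r θ φ = 0

/-- For `r₋ < r < r₊`, `hatField` is `Δ⁻² ψ`. -/
theorem RegularField.hatField_eq {a M c b : ℝ} {ψ ψt : ℝ → ℝ → ℝ → ℝ → ℂ} (haM : |a| < M)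
    (h : RegularField a M c b ψ ψt) {v r θ φ : ℝ} (hr : r ∈ Ioo (rm a M) (rp a M))
    (hθ : θ ∈ Ioo 0 Real.pi) :
    hatField a M c b ψt v r θ φ
      = inMinus a M c b ψ v r θ φ / ((Delta a M r ^ 2 : ℝ) : ℂ) := by
  have h1 : 0 < rp a M - r := by linarith [hr.2]
  have h2 : r - rm a M ≠ 0 := by linarith [hr.1]
  have h3 : r - rp a M ≠ 0 := by linarith [hr.2]
  unfold hatField inMinus
  have key : (Real.exp (-(kp a M * v)) * Real.exp (2 * kp a M * regP a M c r) / (r - rm a M)) ^ 2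
      = (Real.exp (-(kp a M * v)) * ((rp a M - r) * Real.exp (2 * kp a M * regP a M c r))) ^ 2
        / Delta a M r ^ 2 := by
    rw [Delta_eq haM]
    have h1' : rp a M - r = -(r - rp a M) := by ring
    rw [h1']
    field_simp
    try ring
  rw [h.quot _ _ _ _ (by positivity) (by positivity) hθ, key, Complex.ofReal_div,
    Complex.ofReal_pow (Real.exp _ * _)]
  ring

/-- `∑ |Z₁^{i₁} Z₂^{i₂} Z₃^{i₃} ∂_v^j f|²` over `i₁ + i₂ + i₃ + j ≤ 1`, for spin `2`. -/
noncomputable def tangEnergy (f : ℝ → ℝ → ℝ → ℝ → ℂ) (v r θ φ : ℝ) : ℝ :=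
  ‖f v r θ φ‖ ^ 2 + ∑ i : Fin 3, ‖Z 2 i f v r θ φ‖ ^ 2 + ‖pV f v r θ φ‖ ^ 2

/-- `∫_{r = r₊, v ≥ 1} v^q ∑ |Z₁^{i₁} Z₂^{i₂} Z₃^{i₃} ∂_v^j f|² vol_{S²} dv < ∞`. -/
def HorizonFinite (a M q : ℝ) (f : ℝ → ℝ → ℝ → ℝ → ℂ) : Prop :=
  ∫⁻ x in {x : ℝ × ℝ × ℝ | 1 ≤ x.1},
    ENNReal.ofReal (x.1 ^ q * tangEnergy f x.1 (rp a M) x.2.1 x.2.2) ∂cyl < ⊤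

/-- Decay along the right event horizon; here `g = ψ` in `(v₊, r, θ, φ₊)` coordinates. -/
def DecayRight (a M q : ℝ) (g : ℝ → ℝ → ℝ → ℝ → ℂ) : Prop :=
  ∀ i j k : ℕ, i + j ≤ 2 → k ≤ 2 →
    HorizonFinite a M q (pV^[i] (pPhi^[j] ((pR a M)^[k] g))) ∧
    HorizonFinite a M q (pV (pV^[i] (pPhi^[j] ((pR a M)^[k] g)))) ∧
    HorizonFinite a M q (carterPlus a 2 (pV^[i] (pPhi^[j] ((pR a M)^[k] g))))

/-- Decay along the left event horizon; here `g = Δ⁻² ψ` in `(v₋, r, θ, φ₋)` coordinates. -/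
def DecayLeft (a M q : ℝ) (g : ℝ → ℝ → ℝ → ℝ → ℂ) : Prop :=
  ∀ i j k : ℕ, i + j + k ≤ 2 →
    HorizonFinite a M q (pV^[i] (pPhi^[j] ((pR a M)^[k] g))) ∧
    HorizonFinite a M q (pV (pV^[i] (pPhi^[j] ((pR a M)^[k] g)))) ∧
    HorizonFinite a M q (carterMinus a 2 (pV^[i] (pPhi^[j] ((pR a M)^[k] g))))

/-- A smooth positive weight equal to `v^{qr}` for `v ≥ 1` and to `|v|^{ql}` for `v ≤ -1`. -/
structure IsWeight (qr ql : ℝ) (χ : ℝ → ℝ) : Prop where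
  smooth : ContDiff ℝ ∞ χ
  pos : ∀ v, 0 < χ v
  right : ∀ v, 1 ≤ v → χ v = v ^ qr
  left : ∀ v, v ≤ -1 → χ v = |v| ^ ql

/-! ## The quantities in the estimates -/

/-- `w |∂_r g|² + |∂_v g|² + ∑ᵢ |Zᵢ g|² + |g|²`, for spin `2`. -/
noncomputable def energyDensity (a M w : ℝ) (g : ℝ → ℝ → ℝ → ℝ → ℂ) (v r θ φ : ℝ) : ℝ :=
  w * ‖pR a M g v r θ φ‖ ^ 2 + ‖pV g v r θ φ‖ ^ 2
    + ∑ i : Fin 3, ‖Z 2 i g v r θ φ‖ ^ 2 + ‖g v r θ φ‖ ^ 2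

/-- `g` on the hypersurface of constant `r`, as a function of `(v₊, θ, φ₊)`. -/
def slice (g : ℝ → ℝ → ℝ → ℝ → ℂ) (r : ℝ) : ℝ × ℝ × ℝ → ℂ :=
  fun x => g x.1 r x.2.1 x.2.2

/-- `f⁻ = v₋ - r + r₋` as a function of `(v₊, r)`, with `v₋ = 2 rStar - v₊`. -/
noncomputable def fMinus (a M c v r : ℝ) : ℝ := (2 * rStar a M c r - v) - r + rm a M

/-- For every `v₊` there is exactly one `r ∈ (r₋, r₊)` with `f⁻ = v₀`. -/
theorem existsUnique_fMinus {a M : ℝ} (ha : 0 < |a|) (haM : |a| < M) (c v₀ v : ℝ) :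
    ∃! r, r ∈ Ioo (rm a M) (rp a M) ∧ fMinus a M c v r = v₀ := by
  have hlt := rm_lt_rp haM
  have hkp := kp_pos ha haM
  have hkm := km_neg ha haM
  have hder : ∀ r ∈ Ioo (rm a M) (rp a M),
      HasDerivAt (fMinus a M c v) (2 * ((r ^ 2 + a ^ 2) / Delta a M r) - 1) r := by
    intro r hr
    have e := (((((hasDerivAt_rStar ha haM c hr).const_mul 2).sub_const v).sub
      (hasDerivAt_id r)).add_const (rm a M))
    exact e
  have hcont : ContinuousOn (fMinus a M c v) (Ioo (rm a M) (rp a M)) := fun r hr =>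
    (hder r hr).continuousAt.continuousWithinAt
  have hanti : StrictAntiOn (fMinus a M c v) (Ioo (rm a M) (rp a M)) := by
    refine strictAntiOn_of_deriv_neg (convex_Ioo _ _) hcont ?_
    intro r hr
    rw [interior_Ioo] at hr
    rw [(hder r hr).deriv]
    have hD : Delta a M r < 0 := by
      rw [Delta_eq haM]
      exact mul_neg_of_neg_of_pos (by linarith [hr.2]) (by linarith [hr.1])
    have : (r ^ 2 + a ^ 2) / Delta a M r ≤ 0 :=
      div_nonpos_of_nonneg_of_nonpos (by positivity) hD.le
    linarith
  have hform : fMinus a M c v = fun r => (2 * c + r - v + rm a M)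
      + (1 / kp a M * Real.log (rp a M - r) + 1 / km a M * Real.log (r - rm a M)) := by
    funext r
    unfold fMinus rStar
    have h1 := hkp.ne'
    have h2 := hkm.ne
    field_simp
    ring
  have hlogL : Tendsto (fun r => Real.log (r - rm a M)) (𝓝[>] (rm a M)) atBot := by
    refine Real.tendsto_log_nhdsGT_zero.comp ?_
    refine tendsto_nhdsWithin_iff.2 ⟨?_, ?_⟩
    · have : Tendsto (fun r => r - rm a M) (𝓝 (rm a M)) (𝓝 (rm a M - rm a M)) :=
        (continuous_id.sub continuous_const).tendsto _
      rw [sub_self] at this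
      exact this.mono_left nhdsWithin_le_nhds
    · filter_upwards [self_mem_nhdsWithin] with r hr
      exact sub_pos.2 (mem_Ioi.1 hr)
  have hlogR : Tendsto (fun r => Real.log (rp a M - r)) (𝓝[<] (rp a M)) atBot := by
    refine Real.tendsto_log_nhdsGT_zero.comp ?_
    refine tendsto_nhdsWithin_iff.2 ⟨?_, ?_⟩
    · have : Tendsto (fun r => rp a M - r) (𝓝 (rp a M)) (𝓝 (rp a M - rp a M)) :=
        (continuous_const.sub continuous_id).tendsto _
      rw [sub_self] at this
      exact this.mono_left nhdsWithin_le_nhds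
    · filter_upwards [self_mem_nhdsWithin] with r hr
      exact sub_pos.2 (mem_Iio.1 hr)
  have hpoly : Continuous (fun r : ℝ => 2 * c + r - v + rm a M) := by fun_prop
  have hL : Tendsto (fMinus a M c v) (𝓝[>] (rm a M)) atTop := by
    rw [hform]
    refine ((hpoly.tendsto (rm a M)).mono_left nhdsWithin_le_nhds).add_atTop ?_
    have e1 : Tendsto (fun r => 1 / kp a M * Real.log (rp a M - r)) (𝓝[>] (rm a M))
        (𝓝 (1 / kp a M * Real.log (rp a M - rm a M))) := by
      have : ContinuousAt (fun r => 1 / kp a M * Real.log (rp a M - r)) (rm a M) := by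
        refine continuousAt_const.mul (ContinuousAt.log ?_ (by linarith))
        exact continuousAt_const.sub continuousAt_id
      exact this.tendsto.mono_left nhdsWithin_le_nhds
    exact e1.add_atTop (hlogL.const_mul_atBot_of_neg (one_div_neg.2 hkm))
  have hR : Tendsto (fMinus a M c v) (𝓝[<] (rp a M)) atBot := by
    rw [hform]
    refine ((hpoly.tendsto (rp a M)).mono_left nhdsWithin_le_nhds).add_atBot ?_
    have e1 : Tendsto (fun r => 1 / km a M * Real.log (r - rm a M)) (𝓝[<] (rp a M))
        (𝓝 (1 / km a M * Real.log (rp a M - rm a M))) := by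
      have : ContinuousAt (fun r => 1 / km a M * Real.log (r - rm a M)) (rp a M) := by
        refine continuousAt_const.mul (ContinuousAt.log ?_ (by linarith))
        exact continuousAt_id.sub continuousAt_const
      exact this.tendsto.mono_left nhdsWithin_le_nhds
    exact (hlogR.const_mul_atBot (one_div_pos.2 hkp)).atBot_add e1
  have hl1 : 𝓝[<] (rp a M) ≤ 𝓟 (Ioo (rm a M) (rp a M)) :=
    le_principal_iff.2 (Ioo_mem_nhdsLT hlt)
  have hl2 : 𝓝[>] (rm a M) ≤ 𝓟 (Ioo (rm a M) (rp a M)) :=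
    le_principal_iff.2 (Ioo_mem_nhdsGT hlt)
  obtain ⟨r, hr, hrv⟩ :=
    isPreconnected_Ioo.intermediate_value_Iii hl1 hl2 hcont hR hL (mem_univ v₀)
  exact ⟨r, ⟨hr, hrv⟩, fun r' h' => hanti.injOn h'.1 hr (h'.2.trans hrv.symm)⟩

open Classical in
/-- The hypersurface `Σ = {f⁻ = v₀}` as a graph over `v₊`: the unique `r ∈ (r₋, r₊)` with
`f⁻ (v₊, r) = v₀`. -/
noncomputable def rSigma (a M c v₀ v : ℝ) : ℝ :=
  if h : ∃ r, r ∈ Ioo (rm a M) (rp a M) ∧ fMinus a M c v r = v₀ then h.choose else 0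

theorem rSigma_spec {a M : ℝ} (ha : 0 < |a|) (haM : |a| < M) (c v₀ v : ℝ) :
    rSigma a M c v₀ v ∈ Ioo (rm a M) (rp a M) ∧ fMinus a M c v (rSigma a M c v₀ v) = v₀ := by
  have h := (existsUnique_fMinus ha haM c v₀ v).exists
  unfold rSigma
  rw [dif_pos h]
  exact h.choose_spec

/-- `g` on `Σ = {f⁻ = v₀}`, as a function of `(v₊, θ, φ₊)`. -/
noncomputable def onSigma (a M c v₀ : ℝ) (g : ℝ → ℝ → ℝ → ℝ → ℂ) : ℝ × ℝ × ℝ → ℂ :=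
  fun x => g x.1 (rSigma a M c v₀ x.1) x.2.1 x.2.2

end Kerr

open Kerr

namespace Kerr

/-! The estimates evolve along the hypersurfaces of constant r, with r decreasing towards the
future, and the tool is a multiplier estimate. The equation `opGen` u = F is paired with (Δ/2 - 1)
u_r + (r² + a²) u_v + k u_φ, the sum of two future directed null derivatives. The flux of the
resulting current through a slice of constant r, plus a multiple of |u|², controls -Δ |u_r|² and all
tangential derivatives (`exists_coercive`). The bulk contains (br - (r - M)) |u_r|², where br is the
coefficient of u_r in the equation. If this coefficient is positive modulo a multiple of -Δ, the
bulk controls |u_r|² without degeneration. All other terms can then be absorbed in the flux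
(`exists_master`), and Grönwall's inequality in r closes the estimate (`divergence_identity`,
`hasDerivAt_energy`, `gronwall_backward`, `exists_weighted_estimate`).

Everything depends on that sign. For ψ itself br = -2 (r - M), so the coefficient is -3 (r - M). It
is positive near the Cauchy horizon, where the spin turns the blue-shift into an effective
red-shift, and negative at the event horizon. At the right event horizon each commutation with ∂_r
adds 2 (r - M) to br; after two of them br = 2 (r - M) and the coefficient is r - M > 0
(`RegularPair.eqn_pR_pR`). This is why two transversal derivatives of the data enter. At the left
event horizon Δ⁻² ψ, in the coordinates (v₋, r, θ, φ₋), solves an equation with br = 6 (r - M)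
(`opT_pull`, `RegularPair.eqn_rescaled`). Away from the event horizon a multiple of -Δ makes the
coefficient for ψ positive all the way down to r₋ (`RegularPair.exists_teukSys_interior`).

The weights in v satisfy |g'| ≤ ε g + q, where ε is fixed by the pointwise inequality and q has
compact support. To have finite integrals they are multiplied by cut-offs that move with r. The
r-derivative of the cut-offs is nonnegative and dominates the flux through their edges, and monotone
convergence removes them (`cutW_reg`, `exists_energy_ineq`).

The decay on the two event horizons is first moved to a slice r = ρ < r₊ (`horizon_estimate`). On
that slice the left data are brought to (v₊, φ₊) by the reflection v₋ = 2 r* - v₊ and a rotation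
(`RegularPair.left_transfer`). The two halves together give the χ-weighted data from which
`interior_estimate` runs down to r₋, with constants independent of the final radius.

The nondegenerate bulk term finally gives G = ∫ |∂_r ψ|² dr with ∫ χ G < ∞. By Cauchy–Schwarz,
|ψ(r') - ψ(r)|² ≤ |r' - r| G pointwise, so ψ converges as r → r₋, with a rate
(`InteriorBound.exists_sliceLimit`). On Σ one has r - r₋ ≤ A exp(κ₋ v₊) (`exists_rSigma_sub_le`).
The difference of |ψ|² on the Cauchy horizon and on Σ is therefore at most exp(κ₋ v₊ / 2) times the
integrable function |ψ|² + 2 A G. This gives the backwards estimate, and since the exponential beats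
every power of v₊ also the equivalence of polynomial decay.

The poles of the sphere are handled by `SpinReg`: a smooth spin-weighted function extends smoothly
to all real angles, and ∂_φ + 2 i cos θ annihilates it at θ = 0 and θ = π. Hence the covariant
derivative stays bounded and no boundary term appears there. -/

/-! ## Smooth functions of `(v, r, θ, φ)` -/

/-- The region `r₋ < r ≤ r₊`, with arbitrary real angles. -/
def dom (a M : ℝ) : Set (ℝ × ℝ × ℝ × ℝ) := univ ×ˢ Ioc (rm a M) (rp a M) ×ˢ univ ×ˢ univ

/-- The uncurried form of a function of four real variables. -/
def unc {E : Type*} (g : ℝ → ℝ → ℝ → ℝ → E) : ℝ × ℝ × ℝ × ℝ → E :=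
  fun x => g x.1 x.2.1 x.2.2.1 x.2.2.2

/-- `g` is smooth on `dom a M`, up to the boundary `r = r₊`. -/
def Sm (a M : ℝ) (g : ℝ → ℝ → ℝ → ℝ → ℂ) : Prop := ContDiffOn ℝ ∞ (unc g) (dom a M)

/-- The partial derivative in the constant direction `e`. -/
noncomputable def pd (a M : ℝ) (e : ℝ × ℝ × ℝ × ℝ) (g : ℝ → ℝ → ℝ → ℝ → ℂ) :
    ℝ → ℝ → ℝ → ℝ → ℂ :=
  fun v r θ φ => fderivWithin ℝ (unc g) (dom a M) (v, r, θ, φ) e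

/-- Equality on `dom a M`. -/
def EqD (a M : ℝ) (f g : ℝ → ℝ → ℝ → ℝ → ℂ) : Prop :=
  ∀ v r θ φ, r ∈ Ioc (rm a M) (rp a M) → f v r θ φ = g v r θ φ

section Smoothness

variable {a M : ℝ} {f g : ℝ → ℝ → ℝ → ℝ → ℂ}

theorem mem_dom {v r θ φ : ℝ} : (v, r, θ, φ) ∈ dom a M ↔ r ∈ Ioc (rm a M) (rp a M) := by
  simp [dom]

theorem convex_dom : Convex ℝ (dom a M) :=
  convex_univ.prod ((convex_Ioc _ _).prod (convex_univ.prod convex_univ))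

theorem interior_dom : interior (dom a M) =
    (univ : Set ℝ) ×ˢ Ioo (rm a M) (rp a M) ×ˢ (univ : Set ℝ) ×ˢ (univ : Set ℝ) := by
  simp [dom, interior_prod_eq]

theorem dom_subset_closure_interior (haM : |a| < M) :
    dom a M ⊆ closure (interior (dom a M)) := by
  rw [interior_dom, closure_prod_eq, closure_prod_eq, closure_Ioo (rm_lt_rp haM).ne]
  rintro ⟨v, r, θ, φ⟩ h
  have := mem_dom.1 h
  simp [this.1.le, this.2]

theorem uniqueDiffOn_dom (haM : |a| < M) : UniqueDiffOn ℝ (dom a M) := by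
  refine uniqueDiffOn_convex convex_dom ?_
  rw [interior_dom]
  have := rm_lt_rp haM
  exact ⟨(0, (rm a M + rp a M) / 2, 0, 0), by simp; constructor <;> linarith⟩

theorem Sm.pd (haM : |a| < M) (hg : Sm a M g) (e : ℝ × ℝ × ℝ × ℝ) : Sm a M (pd a M e g) := by
  have h : ContDiffOn ℝ ∞ (fderivWithin ℝ (unc g) (dom a M)) (dom a M) :=
    hg.fderivWithin (uniqueDiffOn_dom haM) (by simp)
  exact h.clm_apply contDiffOn_const

theorem EqD.pd (h : EqD a M f g) (e : ℝ × ℝ × ℝ × ℝ) : EqD a M (pd a M e f) (pd a M e g) := by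
  intro v r θ φ hr
  have hs : EqOn (unc f) (unc g) (dom a M) := fun ⟨v, r, θ, φ⟩ hx => h v r θ φ (mem_dom.1 hx)
  unfold Kerr.pd
  rw [fderivWithin_congr hs (hs (mem_dom.2 hr))]

theorem Sm.congr (hg : Sm a M g) (h : EqD a M f g) : Sm a M f :=
  ContDiffOn.congr hg fun ⟨v, r, θ, φ⟩ hx => h v r θ φ (mem_dom.1 hx)

theorem EqD.symm (h : EqD a M f g) : EqD a M g f := fun v r θ φ hr => (h v r θ φ hr).symm

theorem EqD.trans {k : ℝ → ℝ → ℝ → ℝ → ℂ} (h : EqD a M f g) (h' : EqD a M g k) : EqD a M f k :=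
  fun v r θ φ hr => (h v r θ φ hr).trans (h' v r θ φ hr)

/-- This one chain rule serves the four partial derivatives and the change of coordinates in
`Sm.hasDerivAt_pull_r`. The curve only has to stay in `dom a M`, so the boundary r = r₊ is included.
-/
theorem Sm.hasDerivWithinAt_line (hg : Sm a M g) {c : ℝ → ℝ × ℝ × ℝ × ℝ} {e : ℝ × ℝ × ℝ × ℝ}
    {t : ℝ} {s : Set ℝ} (hc : HasDerivWithinAt c e s t) (hs : MapsTo c s (dom a M))
    (ht : c t ∈ dom a M) :
    HasDerivWithinAt (unc g ∘ c) (fderivWithin ℝ (unc g) (dom a M) (c t) e) s t :=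
  (((hg.differentiableOn (by simp)) _ ht).hasFDerivWithinAt).comp_hasDerivWithinAt t hc hs

theorem Sm.hasDerivAt_v' (hg : Sm a M g) {v r θ φ : ℝ} (hr : r ∈ Ioc (rm a M) (rp a M)) :
    HasDerivAt (fun x => g x r θ φ) (Kerr.pd a M (1, 0, 0, 0) g v r θ φ) v := by
  have hc : HasDerivWithinAt (fun x : ℝ => (x, r, θ, φ)) (1, 0, 0, 0) univ v := by
    exact (hasDerivWithinAt_id v univ).prodMk ((hasDerivWithinAt_const v univ r).prodMk
      ((hasDerivWithinAt_const v univ θ).prodMk (hasDerivWithinAt_const v univ φ)))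
  have := hg.hasDerivWithinAt_line hc (fun x _ => mem_dom.2 hr) (mem_dom.2 hr)
  exact hasDerivWithinAt_univ.1 this

theorem Sm.hasDerivWithinAt_r' (hg : Sm a M g) {v r θ φ : ℝ} (hr : r ∈ Ioc (rm a M) (rp a M)) :
    HasDerivWithinAt (fun x => g v x θ φ) (Kerr.pd a M (0, 1, 0, 0) g v r θ φ)
      (Ioc (rm a M) (rp a M)) r := by
  have hc : HasDerivWithinAt (fun x : ℝ => (v, x, θ, φ)) (0, 1, 0, 0)
      (Ioc (rm a M) (rp a M)) r := by
    exact (hasDerivWithinAt_const r _ v).prodMk ((hasDerivWithinAt_id r _).prodMk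
      ((hasDerivWithinAt_const r _ θ).prodMk (hasDerivWithinAt_const r _ φ)))
  exact hg.hasDerivWithinAt_line hc (fun x hx => mem_dom.2 hx) (mem_dom.2 hr)

theorem Sm.hasDerivAt_theta' (hg : Sm a M g) {v r θ φ : ℝ} (hr : r ∈ Ioc (rm a M) (rp a M)) :
    HasDerivAt (fun x => g v r x φ) (Kerr.pd a M (0, 0, 1, 0) g v r θ φ) θ := by
  have hc : HasDerivWithinAt (fun x : ℝ => (v, r, x, φ)) (0, 0, 1, 0) univ θ := by
    exact (hasDerivWithinAt_const θ _ v).prodMk ((hasDerivWithinAt_const θ _ r).prodMk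
      ((hasDerivWithinAt_id θ _).prodMk (hasDerivWithinAt_const θ _ φ)))
  have := hg.hasDerivWithinAt_line hc (fun x _ => mem_dom.2 hr) (mem_dom.2 hr)
  exact hasDerivWithinAt_univ.1 this

theorem Sm.hasDerivAt_phi' (hg : Sm a M g) {v r θ φ : ℝ} (hr : r ∈ Ioc (rm a M) (rp a M)) :
    HasDerivAt (fun x => g v r θ x) (Kerr.pd a M (0, 0, 0, 1) g v r θ φ) φ := by
  have hc : HasDerivWithinAt (fun x : ℝ => (v, r, θ, x)) (0, 0, 0, 1) univ φ := by
    exact (hasDerivWithinAt_const φ _ v).prodMk ((hasDerivWithinAt_const φ _ r).prodMk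
      ((hasDerivWithinAt_const φ _ θ).prodMk (hasDerivWithinAt_id φ _)))
  have := hg.hasDerivWithinAt_line hc (fun x _ => mem_dom.2 hr) (mem_dom.2 hr)
  exact hasDerivWithinAt_univ.1 this

theorem Sm.pV_eq (hg : Sm a M g) : EqD a M (pV g) (Kerr.pd a M (1, 0, 0, 0) g) :=
  fun _ _ _ _ hr => (hg.hasDerivAt_v' hr).deriv

theorem Sm.pR_eq (hg : Sm a M g) : EqD a M (pR a M g) (Kerr.pd a M (0, 1, 0, 0) g) :=
  fun _ r _ _ hr => (hg.hasDerivWithinAt_r' hr).derivWithin (uniqueDiffOn_Ioc _ _ r hr)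

theorem Sm.pTheta_eq (hg : Sm a M g) : EqD a M (pTheta g) (Kerr.pd a M (0, 0, 1, 0) g) :=
  fun _ _ _ _ hr => (hg.hasDerivAt_theta' hr).deriv

theorem Sm.pPhi_eq (hg : Sm a M g) : EqD a M (pPhi g) (Kerr.pd a M (0, 0, 0, 1) g) :=
  fun _ _ _ _ hr => (hg.hasDerivAt_phi' hr).deriv

theorem Sm.pV (haM : |a| < M) (hg : Sm a M g) : Sm a M (pV g) := (hg.pd haM _).congr hg.pV_eq
theorem Sm.pR (haM : |a| < M) (hg : Sm a M g) : Sm a M (pR a M g) := (hg.pd haM _).congr hg.pR_eq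
theorem Sm.pTheta (haM : |a| < M) (hg : Sm a M g) : Sm a M (pTheta g) :=
  (hg.pd haM _).congr hg.pTheta_eq
theorem Sm.pPhi (haM : |a| < M) (hg : Sm a M g) : Sm a M (pPhi g) :=
  (hg.pd haM _).congr hg.pPhi_eq

theorem Sm.hasDerivAt_v (hg : Sm a M g) {v r θ φ : ℝ} (hr : r ∈ Ioc (rm a M) (rp a M)) :
    HasDerivAt (fun x => g x r θ φ) (Kerr.pV g v r θ φ) v := by
  rw [hg.pV_eq v r θ φ hr]; exact hg.hasDerivAt_v' hr

theorem Sm.hasDerivWithinAt_r (hg : Sm a M g) {v r θ φ : ℝ} (hr : r ∈ Ioc (rm a M) (rp a M)) :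
    HasDerivWithinAt (fun x => g v x θ φ) (Kerr.pR a M g v r θ φ) (Ioc (rm a M) (rp a M)) r := by
  rw [hg.pR_eq v r θ φ hr]; exact hg.hasDerivWithinAt_r' hr

theorem Sm.hasDerivAt_r (hg : Sm a M g) {v r θ φ : ℝ} (hr : r ∈ Ioo (rm a M) (rp a M)) :
    HasDerivAt (fun x => g v x θ φ) (Kerr.pR a M g v r θ φ) r :=
  (hg.hasDerivWithinAt_r (Ioo_subset_Ioc_self hr)).hasDerivAt (Ioc_mem_nhds hr.1 hr.2)

theorem Sm.hasDerivAt_theta (hg : Sm a M g) {v r θ φ : ℝ} (hr : r ∈ Ioc (rm a M) (rp a M)) :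
    HasDerivAt (fun x => g v r x φ) (Kerr.pTheta g v r θ φ) θ := by
  rw [hg.pTheta_eq v r θ φ hr]; exact hg.hasDerivAt_theta' hr

theorem Sm.hasDerivAt_phi (hg : Sm a M g) {v r θ φ : ℝ} (hr : r ∈ Ioc (rm a M) (rp a M)) :
    HasDerivAt (fun x => g v r θ x) (Kerr.pPhi g v r θ φ) φ := by
  rw [hg.pPhi_eq v r θ φ hr]; exact hg.hasDerivAt_phi' hr

/-- Symmetry of the second derivative holds up to r = r₊ because every point of `dom a M` is a limit
of interior points. -/
theorem Sm.pd_comm (haM : |a| < M) (hg : Sm a M g) (e e' : ℝ × ℝ × ℝ × ℝ) :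
    EqD a M (Kerr.pd a M e (Kerr.pd a M e' g)) (Kerr.pd a M e' (Kerr.pd a M e g)) := by
  intro v r θ φ hr
  have hx : (v, r, θ, φ) ∈ dom a M := mem_dom.2 hr
  have hd : DifferentiableWithinAt ℝ (fderivWithin ℝ (unc g) (dom a M)) (dom a M) (v, r, θ, φ) := by
    have h : ContDiffOn ℝ ∞ (fderivWithin ℝ (unc g) (dom a M)) (dom a M) :=
      hg.fderivWithin (uniqueDiffOn_dom haM) (by simp)
    exact (h.differentiableOn (by simp)) _ hx
  have key : ∀ k k' : ℝ × ℝ × ℝ × ℝ, Kerr.pd a M k (Kerr.pd a M k' g) v r θ φ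
      = fderivWithin ℝ (fderivWithin ℝ (unc g) (dom a M)) (dom a M) (v, r, θ, φ) k k' := by
    intro k k'
    have h1 := hd.hasFDerivWithinAt.clm_apply
      (hasFDerivWithinAt_const k' (v, r, θ, φ) (dom a M))
    have h2 := h1.fderivWithin (uniqueDiffOn_dom haM _ hx)
    change fderivWithin ℝ (fun y => fderivWithin ℝ (unc g) (dom a M) y k') (dom a M)
      (v, r, θ, φ) k = _
    rw [h2]
    simp
  rw [key, key]
  have hsymm : IsSymmSndFDerivWithinAt ℝ (unc g) (dom a M) (v, r, θ, φ) := by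
    refine (hg _ hx).isSymmSndFDerivWithinAt (n := ∞) ?_ (uniqueDiffOn_dom haM)
      (dom_subset_closure_interior haM hx) hx
    rw [minSmoothness_of_isRCLikeNormedField]
    exact WithTop.coe_le_coe.2 le_top
  exact hsymm e e'

theorem EqD.pV (h : EqD a M f g) : EqD a M (pV f) (pV g) := fun v r θ φ hr => by
  unfold Kerr.pV
  congr 1
  funext x
  exact h x r θ φ hr

theorem EqD.pPhi (h : EqD a M f g) : EqD a M (pPhi f) (pPhi g) := fun v r θ φ hr => by
  unfold Kerr.pPhi
  congr 1
  funext x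
  exact h v r θ x hr

theorem EqD.pTheta (h : EqD a M f g) : EqD a M (pTheta f) (pTheta g) := fun v r θ φ hr => by
  unfold Kerr.pTheta
  congr 1
  funext x
  exact h v r x φ hr

theorem Sm.pV_pR (haM : |a| < M) (hg : Sm a M g) :
    EqD a M (Kerr.pV (Kerr.pR a M g)) (Kerr.pR a M (Kerr.pV g)) :=
  (((hg.pR haM).pV_eq).trans (hg.pR_eq.pd _)).trans ((hg.pd_comm haM _ _).trans
    (((hg.pV haM).pR_eq).trans (hg.pV_eq.pd _)).symm)

theorem Sm.pPhi_pR (haM : |a| < M) (hg : Sm a M g) :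
    EqD a M (Kerr.pPhi (Kerr.pR a M g)) (Kerr.pR a M (Kerr.pPhi g)) :=
  (((hg.pR haM).pPhi_eq).trans (hg.pR_eq.pd _)).trans ((hg.pd_comm haM _ _).trans
    (((hg.pPhi haM).pR_eq).trans (hg.pPhi_eq.pd _)).symm)

theorem Sm.pTheta_pR (haM : |a| < M) (hg : Sm a M g) :
    EqD a M (Kerr.pTheta (Kerr.pR a M g)) (Kerr.pR a M (Kerr.pTheta g)) :=
  (((hg.pR haM).pTheta_eq).trans (hg.pR_eq.pd _)).trans ((hg.pd_comm haM _ _).trans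
    (((hg.pTheta haM).pR_eq).trans (hg.pTheta_eq.pd _)).symm)

theorem Sm.pV_pPhi (haM : |a| < M) (hg : Sm a M g) :
    EqD a M (Kerr.pV (Kerr.pPhi g)) (Kerr.pPhi (Kerr.pV g)) :=
  (((hg.pPhi haM).pV_eq).trans (hg.pPhi_eq.pd _)).trans ((hg.pd_comm haM _ _).trans
    (((hg.pV haM).pPhi_eq).trans (hg.pV_eq.pd _)).symm)

theorem Sm.pV_pTheta (haM : |a| < M) (hg : Sm a M g) :
    EqD a M (Kerr.pV (Kerr.pTheta g)) (Kerr.pTheta (Kerr.pV g)) :=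
  (((hg.pTheta haM).pV_eq).trans (hg.pTheta_eq.pd _)).trans ((hg.pd_comm haM _ _).trans
    (((hg.pV haM).pTheta_eq).trans (hg.pV_eq.pd _)).symm)

theorem Sm.pPhi_pTheta (haM : |a| < M) (hg : Sm a M g) :
    EqD a M (Kerr.pPhi (Kerr.pTheta g)) (Kerr.pTheta (Kerr.pPhi g)) :=
  (((hg.pTheta haM).pPhi_eq).trans (hg.pTheta_eq.pd _)).trans ((hg.pd_comm haM _ _).trans
    (((hg.pPhi haM).pTheta_eq).trans (hg.pPhi_eq.pd _)).symm)

theorem Sm.add (hf : Sm a M f) (hg : Sm a M g) :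
    Sm a M (fun v r θ φ => f v r θ φ + g v r θ φ) := ContDiffOn.add hf hg

theorem Sm.mul (hf : Sm a M f) (hg : Sm a M g) :
    Sm a M (fun v r θ φ => f v r θ φ * g v r θ φ) := ContDiffOn.mul hf hg

theorem sm_of_contDiff {k : ℝ × ℝ × ℝ × ℝ → ℂ} (hk : ContDiff ℝ ∞ k) :
    Sm a M (fun v r θ φ => k (v, r, θ, φ)) := hk.contDiffOn

/-- `∂_φ g + 2 i cos θ g`, for spin `2`. -/
noncomputable def covPhi (g : ℝ → ℝ → ℝ → ℝ → ℂ) : ℝ → ℝ → ℝ → ℝ → ℂ :=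
  fun v r θ φ => pPhi g v r θ φ + 2 * Complex.I * (Real.cos θ : ℂ) * g v r θ φ

/-- The covariant derivative `(sin θ)⁻¹ (∂_φ + 2 i cos θ)`. -/
noncomputable def covD (g : ℝ → ℝ → ℝ → ℝ → ℂ) : ℝ → ℝ → ℝ → ℝ → ℂ :=
  fun v r θ φ => covPhi g v r θ φ / (Real.sin θ : ℂ)

/-- A smooth function that behaves at the poles like a spin `2`-weighted function. -/
structure SpinReg (a M : ℝ) (g : ℝ → ℝ → ℝ → ℝ → ℂ) : Prop where
  sm : Sm a M g
  per : ∀ v r θ φ, g v r θ (φ + 2 * Real.pi) = g v r θ φ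
  north : ∀ v r φ, r ∈ Ioc (rm a M) (rp a M) → covPhi g v r 0 φ = 0
  south : ∀ v r φ, r ∈ Ioc (rm a M) (rp a M) → covPhi g v r Real.pi φ = 0

theorem sm_cos : Sm a M (fun _ _ θ _ => (Real.cos θ : ℂ)) := by
  refine sm_of_contDiff (k := fun x => (Real.cos x.2.2.1 : ℂ)) ?_
  exact Complex.ofRealCLM.contDiff.comp (Real.contDiff_cos.comp (by fun_prop))

theorem sm_const (c : ℂ) : Sm a M (fun _ _ _ _ => c) := sm_of_contDiff (k := fun _ => c)
  contDiff_const

theorem Sm.covPhi (haM : |a| < M) (hg : Sm a M g) : Sm a M (covPhi g) :=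
  (hg.pPhi haM).add (((sm_const (2 * Complex.I)).mul sm_cos).mul hg)

theorem covPhi_pV (haM : |a| < M) (hg : Sm a M g) :
    EqD a M (covPhi (pV g)) (pV (covPhi g)) := by
  intro v r θ φ hr
  have h := (((hg.pPhi haM).hasDerivAt_v (v := v) (θ := θ) (φ := φ) hr).add
    ((hg.hasDerivAt_v (v := v) (θ := θ) (φ := φ) hr).const_mul
      (2 * Complex.I * (Real.cos θ : ℂ)))).deriv
  rw [hg.pV_pPhi haM v r θ φ hr] at h
  exact h.symm

theorem covPhi_pPhi (haM : |a| < M) (hg : Sm a M g) :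
    EqD a M (covPhi (pPhi g)) (pPhi (covPhi g)) := by
  intro v r θ φ hr
  exact (((hg.pPhi haM).hasDerivAt_phi (v := v) (θ := θ) (φ := φ) hr).add
    ((hg.hasDerivAt_phi (v := v) (θ := θ) (φ := φ) hr).const_mul
      (2 * Complex.I * (Real.cos θ : ℂ)))).deriv.symm

theorem covPhi_pR (haM : |a| < M) (hg : Sm a M g) :
    EqD a M (covPhi (pR a M g)) (pR a M (covPhi g)) := by
  intro v r θ φ hr
  have h := (((hg.pPhi haM).hasDerivWithinAt_r (v := v) (θ := θ) (φ := φ) hr).add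
    ((hg.hasDerivWithinAt_r (v := v) (θ := θ) (φ := φ) hr).const_mul
      (2 * Complex.I * (Real.cos θ : ℂ)))).derivWithin (uniqueDiffOn_Ioc _ _ r hr)
  rw [← hg.pPhi_pR haM v r θ φ hr] at h
  exact h.symm

/-- The pole conditions are identities in v, r and φ, so they may be differentiated in these
variables. A θ-derivative would not preserve them. -/
theorem SpinReg.pV (haM : |a| < M) (hg : SpinReg a M g) : SpinReg a M (pV g) where
  sm := hg.sm.pV haM
  per v r θ φ := by unfold Kerr.pV; simp only [hg.per]
  north v r φ hr := by
    rw [covPhi_pV haM hg.sm v r 0 φ hr]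
    unfold Kerr.pV
    simp only [fun x => hg.north x r φ hr, deriv_const]
  south v r φ hr := by
    rw [covPhi_pV haM hg.sm v r Real.pi φ hr]
    unfold Kerr.pV
    simp only [fun x => hg.south x r φ hr, deriv_const]

theorem SpinReg.pPhi (haM : |a| < M) (hg : SpinReg a M g) : SpinReg a M (pPhi g) where
  sm := hg.sm.pPhi haM
  per v r θ φ := by
    unfold Kerr.pPhi
    rw [← deriv_comp_add_const]
    simp only [hg.per]
  north v r φ hr := by
    rw [covPhi_pPhi haM hg.sm v r 0 φ hr]
    unfold Kerr.pPhi
    simp only [fun x => hg.north v r x hr, deriv_const]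
  south v r φ hr := by
    rw [covPhi_pPhi haM hg.sm v r Real.pi φ hr]
    unfold Kerr.pPhi
    simp only [fun x => hg.south v r x hr, deriv_const]

theorem SpinReg.pR (haM : |a| < M) (hg : SpinReg a M g) : SpinReg a M (pR a M g) where
  sm := hg.sm.pR haM
  per v r θ φ := by unfold Kerr.pR; simp only [hg.per]
  north v r φ hr := by
    rw [covPhi_pR haM hg.sm v r 0 φ hr]
    unfold Kerr.pR
    rw [derivWithin_congr (f := fun _ => (0 : ℂ)) (fun x hx => hg.north v x φ hx)
      (hg.north v r φ hr)]
    simp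
  south v r φ hr := by
    rw [covPhi_pR haM hg.sm v r Real.pi φ hr]
    unfold Kerr.pR
    rw [derivWithin_congr (f := fun _ => (0 : ℂ)) (fun x hx => hg.south v x φ hx)
      (hg.south v r φ hr)]
    simp

theorem Sm.continuousOn (hg : Sm a M g) : ContinuousOn (unc g) (dom a M) := ContDiffOn.continuousOn hg

theorem isCompact_box (N r₁ : ℝ) :
    IsCompact (Icc (-N) N ×ˢ Icc r₁ (rp a M) ×ˢ Icc 0 Real.pi ×ˢ Icc 0 (2 * Real.pi)) :=
  isCompact_Icc.prod (isCompact_Icc.prod (isCompact_Icc.prod isCompact_Icc))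

theorem Sm.bounded (hg : Sm a M g) (N : ℝ) {r₁ : ℝ} (hr₁ : rm a M < r₁) :
    ∃ C : ℝ, 0 ≤ C ∧ ∀ v r θ φ, |v| ≤ N → r ∈ Icc r₁ (rp a M) → θ ∈ Icc 0 Real.pi →
      φ ∈ Icc 0 (2 * Real.pi) → ‖g v r θ φ‖ ≤ C := by
  have hc : ContinuousOn (unc g)
      (Icc (-N) N ×ˢ Icc r₁ (rp a M) ×ˢ Icc 0 Real.pi ×ˢ Icc 0 (2 * Real.pi)) := by
    refine hg.continuousOn.mono ?_
    rintro ⟨v, r, θ, φ⟩ ⟨_, h, _⟩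
    exact mem_dom.2 ⟨hr₁.trans_le h.1, h.2⟩
  obtain ⟨C, hC⟩ := (isCompact_box N r₁).exists_bound_of_continuousOn hc
  refine ⟨max C 0, le_max_right _ _, fun v r θ φ hv hr hθ hφ => le_max_of_le_left ?_⟩
  exact hC (v, r, θ, φ) ⟨abs_le.1 hv, hr, hθ, hφ⟩

theorem min_le_sin {θ : ℝ} (hθ : θ ∈ Ioo 0 Real.pi) :
    2 / Real.pi * min θ (Real.pi - θ) ≤ Real.sin θ := by
  have hp := Real.pi_pos
  rcases le_total θ (Real.pi / 2) with h | h
  · rw [min_eq_left (by linarith)]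
    exact Real.mul_le_sin hθ.1.le h
  · rw [min_eq_right (by linarith), ← Real.sin_pi_sub]
    exact Real.mul_le_sin (by linarith [hθ.2]) (by linarith)

/-- The numerator `covPhi g` vanishes at both poles and has a bounded θ-derivative, so it is at most
C times the distance to the nearer pole. That distance is comparable to sin θ. -/
theorem SpinReg.covD_bounded (haM : |a| < M) (hg : SpinReg a M g) (N : ℝ) {r₁ : ℝ}
    (hr₁ : rm a M < r₁) :
    ∃ C : ℝ, 0 ≤ C ∧ ∀ v r θ φ, |v| ≤ N → r ∈ Icc r₁ (rp a M) → θ ∈ Ioo 0 Real.pi →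
      φ ∈ Icc 0 (2 * Real.pi) → ‖covD g v r θ φ‖ ≤ C := by
  obtain ⟨C, hC0, hC⟩ := ((hg.sm.covPhi haM).pTheta haM).bounded N hr₁
  have hp := Real.pi_pos
  refine ⟨C * (Real.pi / 2), by positivity, fun v r θ φ hv hr hθ hφ => ?_⟩
  have hr' : r ∈ Ioc (rm a M) (rp a M) := ⟨hr₁.trans_le hr.1, hr.2⟩
  have hs := Real.sin_pos_of_mem_Ioo hθ
  have hmv : ∀ x y, x ∈ Icc 0 Real.pi → y ∈ Icc 0 Real.pi →
      ‖covPhi g v r y φ - covPhi g v r x φ‖ ≤ C * ‖y - x‖ := by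
    intro x y hx hy
    exact (convex_Icc 0 Real.pi).norm_image_sub_le_of_norm_hasDerivWithin_le
      (fun z hz => ((hg.sm.covPhi haM).hasDerivAt_theta hr').hasDerivWithinAt)
      (fun z hz => hC v r z φ hv hr hz hφ) hx hy
  have h1 := hmv 0 θ ⟨le_rfl, hp.le⟩ ⟨hθ.1.le, hθ.2.le⟩
  have h2 := hmv Real.pi θ ⟨hp.le, le_rfl⟩ ⟨hθ.1.le, hθ.2.le⟩
  rw [hg.north v r φ hr', sub_zero, sub_zero, Real.norm_of_nonneg hθ.1.le] at h1
  rw [hg.south v r φ hr', sub_zero, Real.norm_eq_abs, abs_sub_comm,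
    abs_of_pos (by linarith [hθ.2])] at h2
  have h3 : ‖covPhi g v r θ φ‖ ≤ C * min θ (Real.pi - θ) := by
    rcases min_choice θ (Real.pi - θ) with h | h <;> rw [h] <;> assumption
  unfold covD
  rw [norm_div, Complex.norm_real, Real.norm_of_nonneg hs.le, div_le_iff₀ hs]
  calc ‖covPhi g v r θ φ‖ ≤ C * min θ (Real.pi - θ) := h3
    _ = C * (Real.pi / 2) * (2 / Real.pi * min θ (Real.pi - θ)) := by field_simp
    _ ≤ C * (Real.pi / 2) * Real.sin θ := by gcongr; exact min_le_sin hθ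

end Smoothness


/-! ## Integrals over `ℝ × S²` of locally bounded continuous integrands -/

/-- The real inner product of two complex numbers. -/
def ip (p q : ℂ) : ℝ := p.re * q.re + p.im * q.im

theorem abs_ip_le (p q : ℂ) : |ip p q| ≤ ‖p‖ * ‖q‖ := by
  have h : ip p q = (p * (starRingEnd ℂ) q).re := by simp [ip]
  rw [h]
  refine (Complex.abs_re_le_norm _).trans ?_
  simp

theorem ip_self (p : ℂ) : ip p p = ‖p‖ ^ 2 := by
  rw [← Complex.normSq_eq_norm_sq, Complex.normSq_apply]; rfl

/-- The region `r₋ < r ≤ r₊`, `0 < θ < π`. -/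
def regn (a M : ℝ) : Set (ℝ × ℝ × ℝ × ℝ) :=
  univ ×ˢ Ioc (rm a M) (rp a M) ×ˢ Ioo 0 Real.pi ×ˢ univ

/-- Continuous on `regn a M` and bounded for bounded `v` and `r` bounded away from `r₋`. -/
structure BC {E : Type*} [NormedAddCommGroup E] (a M : ℝ) (f : ℝ → ℝ → ℝ → ℝ → E) : Prop where
  cont : ContinuousOn (unc f) (regn a M)
  bdd : ∀ N r₁ : ℝ, rm a M < r₁ → ∃ C : ℝ, 0 ≤ C ∧ ∀ v r θ φ, |v| ≤ N → r ∈ Icc r₁ (rp a M) →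
    θ ∈ Ioo 0 Real.pi → φ ∈ Icc 0 (2 * Real.pi) → ‖f v r θ φ‖ ≤ C

/-- `f` vanishes for `|v| > N`, as long as `r₁ ≤ r ≤ r₊`. -/
def VSupp {E : Type*} [Zero E] (a M N r₁ : ℝ) (f : ℝ → ℝ → ℝ → ℝ → E) : Prop :=
  ∀ v r θ φ, r ∈ Icc r₁ (rp a M) → N < |v| → f v r θ φ = 0

/-- `dv dθ dφ` on `ℝ × (0, π) × (0, 2π)`. -/
noncomputable def flat : Measure (ℝ × ℝ × ℝ) :=
  volume.restrict (univ ×ˢ Ioo 0 Real.pi ×ˢ Ioo 0 (2 * Real.pi))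

section BC

variable {a M : ℝ} {E : Type*} [NormedAddCommGroup E]

theorem mem_regn {v r θ φ : ℝ} :
    (v, r, θ, φ) ∈ regn a M ↔ r ∈ Ioc (rm a M) (rp a M) ∧ θ ∈ Ioo 0 Real.pi := by
  simp [regn]

theorem regn_subset_dom : regn a M ⊆ dom a M := fun ⟨_, _, _, _⟩ h => mem_dom.2 (mem_regn.1 h).1

theorem Sm.bc {g : ℝ → ℝ → ℝ → ℝ → ℂ} (hg : Sm a M g) : BC a M g where
  cont := hg.continuousOn.mono regn_subset_dom
  bdd N r₁ hr₁ := by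
    obtain ⟨C, h0, h⟩ := hg.bounded N hr₁
    exact ⟨C, h0, fun v r θ φ hv hr hθ hφ => h v r θ φ hv hr (Ioo_subset_Icc_self hθ) hφ⟩

theorem SpinReg.bc_covD (haM : |a| < M) {g : ℝ → ℝ → ℝ → ℝ → ℂ} (hg : SpinReg a M g) :
    BC a M (covD g) where
  cont := by
    refine ContinuousOn.div ((hg.sm.covPhi haM).continuousOn.mono regn_subset_dom) ?_ ?_
    · exact (Complex.continuous_ofReal.comp (Real.continuous_sin.comp (by fun_prop))).continuousOn
    · rintro ⟨v, r, θ, φ⟩ h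
      exact Complex.ofReal_ne_zero.2 (Real.sin_pos_of_mem_Ioo (mem_regn.1 h).2).ne'
  bdd N r₁ hr₁ := hg.covD_bounded haM N hr₁

theorem BC.add {f g : ℝ → ℝ → ℝ → ℝ → E} (hf : BC a M f) (hg : BC a M g) :
    BC a M (fun v r θ φ => f v r θ φ + g v r θ φ) where
  cont := hf.cont.add hg.cont
  bdd N r₁ hr₁ := by
    obtain ⟨C, h0, h⟩ := hf.bdd N r₁ hr₁
    obtain ⟨C', h0', h'⟩ := hg.bdd N r₁ hr₁
    exact ⟨C + C', by positivity, fun v r θ φ hv hr hθ hφ => (norm_add_le _ _).trans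
      (add_le_add (h v r θ φ hv hr hθ hφ) (h' v r θ φ hv hr hθ hφ))⟩

theorem BC.neg {f : ℝ → ℝ → ℝ → ℝ → E} (hf : BC a M f) : BC a M (fun v r θ φ => -f v r θ φ) where
  cont := hf.cont.neg
  bdd N r₁ hr₁ := by
    obtain ⟨C, h0, h⟩ := hf.bdd N r₁ hr₁
    exact ⟨C, h0, fun v r θ φ hv hr hθ hφ => by rw [norm_neg]; exact h v r θ φ hv hr hθ hφ⟩

theorem BC.sub {f g : ℝ → ℝ → ℝ → ℝ → E} (hf : BC a M f) (hg : BC a M g) :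
    BC a M (fun v r θ φ => f v r θ φ - g v r θ φ) := by
  simpa only [sub_eq_add_neg] using hf.add hg.neg

theorem BC.smul [NormedSpace ℝ E] {k : ℝ → ℝ → ℝ → ℝ → ℝ} {f : ℝ → ℝ → ℝ → ℝ → E}
    (hk : BC a M k) (hf : BC a M f) : BC a M (fun v r θ φ => k v r θ φ • f v r θ φ) where
  cont := hk.cont.smul hf.cont
  bdd N r₁ hr₁ := by
    obtain ⟨C, h0, h⟩ := hk.bdd N r₁ hr₁
    obtain ⟨C', h0', h'⟩ := hf.bdd N r₁ hr₁
    refine ⟨C * C', by positivity, fun v r θ φ hv hr hθ hφ => ?_⟩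
    rw [norm_smul]
    exact mul_le_mul (h v r θ φ hv hr hθ hφ) (h' v r θ φ hv hr hθ hφ) (norm_nonneg _) h0

theorem BC.mul {k f : ℝ → ℝ → ℝ → ℝ → ℝ}
    (hk : BC a M k) (hf : BC a M f) : BC a M (fun v r θ φ => k v r θ φ * f v r θ φ) :=
  hk.smul hf

theorem BC.cmul {k f : ℝ → ℝ → ℝ → ℝ → ℂ}
    (hk : BC a M k) (hf : BC a M f) : BC a M (fun v r θ φ => k v r θ φ * f v r θ φ) where
  cont := hk.cont.mul hf.cont
  bdd N r₁ hr₁ := by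
    obtain ⟨C, h0, h⟩ := hk.bdd N r₁ hr₁
    obtain ⟨C', h0', h'⟩ := hf.bdd N r₁ hr₁
    refine ⟨C * C', by positivity, fun v r θ φ hv hr hθ hφ => ?_⟩
    rw [norm_mul]
    exact mul_le_mul (h v r θ φ hv hr hθ hφ) (h' v r θ φ hv hr hθ hφ) (norm_nonneg _) h0

theorem BC.ip {p q : ℝ → ℝ → ℝ → ℝ → ℂ} (hp : BC a M p) (hq : BC a M q) :
    BC a M (fun v r θ φ => ip (p v r θ φ) (q v r θ φ)) where
  cont := by
    have h1 := Complex.continuous_re.comp_continuousOn hp.cont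
    have h2 := Complex.continuous_im.comp_continuousOn hp.cont
    have h3 := Complex.continuous_re.comp_continuousOn hq.cont
    have h4 := Complex.continuous_im.comp_continuousOn hq.cont
    exact (h1.mul h3).add (h2.mul h4)
  bdd N r₁ hr₁ := by
    obtain ⟨C, h0, h⟩ := hp.bdd N r₁ hr₁
    obtain ⟨C', h0', h'⟩ := hq.bdd N r₁ hr₁
    refine ⟨C * C', by positivity, fun v r θ φ hv hr hθ hφ => (abs_ip_le _ _).trans ?_⟩
    exact mul_le_mul (h v r θ φ hv hr hθ hφ) (h' v r θ φ hv hr hθ hφ) (norm_nonneg _) h0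

theorem bc_of_continuousOn_vr {k : ℝ → ℝ → E}
    (hk : ContinuousOn (fun x : ℝ × ℝ => k x.1 x.2) (univ ×ˢ Ioc (rm a M) (rp a M))) :
    BC a M (fun v r _ _ => k v r) where
  cont := by
    have : ContinuousOn (fun x : ℝ × ℝ × ℝ × ℝ => (x.1, x.2.1)) (regn a M) := by fun_prop
    exact hk.comp this (fun ⟨v, r, θ, φ⟩ h => ⟨mem_univ _, (mem_regn.1 h).1⟩)
  bdd N r₁ hr₁ := by
    have hc : IsCompact (Icc (-N) N ×ˢ Icc r₁ (rp a M)) := isCompact_Icc.prod isCompact_Icc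
    obtain ⟨C, hC⟩ := hc.exists_bound_of_continuousOn
      (hk.mono fun ⟨v, r⟩ h => ⟨mem_univ _, hr₁.trans_le h.2.1, h.2.2⟩)
    exact ⟨max C 0, le_max_right _ _, fun v r θ φ hv hr _ _ =>
      le_max_of_le_left (hC (v, r) ⟨abs_le.1 hv, hr⟩)⟩

theorem bc_of_continuous_r {k : ℝ → E} (hk : Continuous k) : BC a M (fun _ r _ _ => k r) :=
  bc_of_continuousOn_vr (k := fun _ r => k r) (hk.comp continuous_snd).continuousOn

theorem bc_of_continuous_theta {k : ℝ → E} (hk : Continuous k) : BC a M (fun _ _ θ _ => k θ) where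
  cont := (hk.comp (by fun_prop : Continuous fun x : ℝ × ℝ × ℝ × ℝ => x.2.2.1)).continuousOn
  bdd N r₁ hr₁ := by
    obtain ⟨C, hC⟩ := (isCompact_Icc (a := (0 : ℝ)) (b := Real.pi)).exists_bound_of_continuousOn
      hk.continuousOn
    exact ⟨max C 0, le_max_right _ _, fun v r θ φ _ _ hθ _ =>
      le_max_of_le_left (hC θ (Ioo_subset_Icc_self hθ))⟩

theorem bc_const (c : E) : BC a M (fun _ _ _ _ => c) := bc_of_continuous_r continuous_const

theorem flat_eq : flat = (volume : Measure ℝ).prod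
    ((volume.restrict (Ioo 0 Real.pi)).prod (volume.restrict (Ioo 0 (2 * Real.pi)))) := by
  rw [flat, Measure.prod_restrict, ← Measure.restrict_univ (μ := (volume : Measure ℝ)),
    Measure.prod_restrict, Measure.restrict_univ]
  rfl

theorem measurableSet_flat :
    MeasurableSet ((univ : Set ℝ) ×ˢ Ioo 0 Real.pi ×ˢ Ioo 0 (2 * Real.pi)) :=
  MeasurableSet.univ.prod (measurableSet_Ioo.prod measurableSet_Ioo)

theorem BC.aestronglyMeasurable {f : ℝ → ℝ → ℝ → ℝ → E} (hf : BC a M f) {r : ℝ}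
    (hr : r ∈ Ioc (rm a M) (rp a M)) :
    AEStronglyMeasurable (fun x : ℝ × ℝ × ℝ => f x.1 r x.2.1 x.2.2) flat := by
  refine ContinuousOn.aestronglyMeasurable ?_ measurableSet_flat
  have : ContinuousOn (fun x : ℝ × ℝ × ℝ => (x.1, r, x.2.1, x.2.2))
      ((univ : Set ℝ) ×ˢ Ioo 0 Real.pi ×ˢ Ioo 0 (2 * Real.pi)) := by fun_prop
  exact hf.cont.comp this fun ⟨v, θ, φ⟩ h => mem_regn.2 ⟨hr, h.2.1⟩

/-- A dominating function for integrands supported in `|v| ≤ N`. -/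
noncomputable def slabBound (N C : ℝ) : ℝ × ℝ × ℝ → ℝ :=
  (Icc (-N) N ×ˢ (univ : Set (ℝ × ℝ))).indicator fun _ => C

theorem integrable_slabBound (N C : ℝ) : Integrable (slabBound N C) flat := by
  have hm : MeasurableSet (Icc (-N) N ×ˢ (univ : Set (ℝ × ℝ))) :=
    measurableSet_Icc.prod MeasurableSet.univ
  refine (integrable_indicator_iff hm).2 (integrableOn_const ?_)
  rw [flat_eq, Measure.prod_prod]
  refine ENNReal.mul_ne_top (by simp) ?_
  rw [← univ_prod_univ, Measure.prod_prod]
  simp [ENNReal.mul_ne_top]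

theorem ae_flat : ∀ᵐ x ∂flat, x.2.1 ∈ Ioo 0 Real.pi ∧ x.2.2 ∈ Ioo 0 (2 * Real.pi) := by
  filter_upwards [ae_restrict_mem measurableSet_flat] with x hx
  exact hx.2

/-- A single integrable bound works for all r in [r₁, r₊] at once, as differentiation under the
integral sign requires. -/
theorem BC.exists_slabBound {f : ℝ → ℝ → ℝ → ℝ → E} (hf : BC a M f) {N r₁ : ℝ}
    (hr₁ : rm a M < r₁) (hN : VSupp a M N r₁ f) :
    ∃ C, ∀ᵐ x ∂flat, ∀ r ∈ Icc r₁ (rp a M), ‖f x.1 r x.2.1 x.2.2‖ ≤ slabBound N C x := by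
  obtain ⟨C, h0, h⟩ := hf.bdd N r₁ hr₁
  refine ⟨C, ?_⟩
  filter_upwards [ae_flat] with x hx r hr
  by_cases hv : |x.1| ≤ N
  · have : x ∈ Icc (-N) N ×ˢ (univ : Set (ℝ × ℝ)) := ⟨abs_le.1 hv, mem_univ _⟩
    rw [slabBound, indicator_of_mem this]
    exact h _ _ _ _ hv hr hx.1 (Ioo_subset_Icc_self hx.2)
  · rw [hN _ _ _ _ hr (not_le.1 hv), norm_zero]
    exact indicator_nonneg (fun _ _ => h0) _

theorem BC.integrable {f : ℝ → ℝ → ℝ → ℝ → E} (hf : BC a M f) {N r₁ r : ℝ}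
    (hr₁ : rm a M < r₁) (hr : r ∈ Icc r₁ (rp a M)) (hN : VSupp a M N r₁ f) :
    Integrable (fun x : ℝ × ℝ × ℝ => f x.1 r x.2.1 x.2.2) flat := by
  obtain ⟨C, hC⟩ := hf.exists_slabBound hr₁ hN
  refine (integrable_slabBound N C).mono' (hf.aestronglyMeasurable ⟨hr₁.trans_le hr.1, hr.2⟩) ?_
  filter_upwards [hC] with x hx using hx r hr

theorem BC.continuousOn_integral [NormedSpace ℝ E] {f : ℝ → ℝ → ℝ → ℝ → E} (hf : BC a M f)
    {N r₁ : ℝ} (hr₁ : rm a M < r₁) (hN : VSupp a M N r₁ f) :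
    ContinuousOn (fun r => ∫ x, f x.1 r x.2.1 x.2.2 ∂flat) (Icc r₁ (rp a M)) := by
  obtain ⟨C, hC⟩ := hf.exists_slabBound hr₁ hN
  refine continuousOn_of_dominated
    (fun r hr => hf.aestronglyMeasurable ⟨hr₁.trans_le hr.1, hr.2⟩) (bound := slabBound N C)
    (fun r hr => ?_) (integrable_slabBound N C) ?_
  · filter_upwards [hC] with x hx using hx r hr
  · filter_upwards [ae_flat] with x hx
    have : ContinuousOn (fun r : ℝ => (x.1, r, x.2.1, x.2.2)) (Icc r₁ (rp a M)) := by fun_prop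
    exact hf.cont.comp this fun r hr => mem_regn.2 ⟨⟨hr₁.trans_le hr.1, hr.2⟩, hx.1⟩

theorem BC.hasDerivAt_integral [NormedSpace ℝ E] {f f' : ℝ → ℝ → ℝ → ℝ → E} (hf : BC a M f)
    (hf' : BC a M f') {N r₁ r : ℝ} (hr₁ : rm a M < r₁) (hr : r ∈ Ioo r₁ (rp a M))
    (hN : VSupp a M N r₁ f) (hN' : VSupp a M N r₁ f')
    (hder : ∀ v r θ φ, r ∈ Ioo r₁ (rp a M) → θ ∈ Ioo 0 Real.pi →
      HasDerivAt (fun y => f v y θ φ) (f' v r θ φ) r) :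
    HasDerivAt (fun r => ∫ x, f x.1 r x.2.1 x.2.2 ∂flat) (∫ x, f' x.1 r x.2.1 x.2.2 ∂flat) r := by
  obtain ⟨C, hC⟩ := hf'.exists_slabBound hr₁ hN'
  refine (hasDerivAt_integral_of_dominated_loc_of_deriv_le (𝕜 := ℝ) (s := Ioo r₁ (rp a M))
    (Ioo_mem_nhds hr.1 hr.2) ?_ (hf.integrable hr₁ (Ioo_subset_Icc_self hr) hN)
    (F' := fun r x => f' x.1 r x.2.1 x.2.2)
    (hf'.aestronglyMeasurable ⟨hr₁.trans hr.1, hr.2.le⟩) (bound := slabBound N C) ?_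
    (integrable_slabBound N C) ?_).2
  · filter_upwards [Ioo_mem_nhds hr.1 hr.2] with y hy
    exact hf.aestronglyMeasurable ⟨hr₁.trans hy.1, hy.2.le⟩
  · filter_upwards [hC] with x hx y hy using hx y (Ioo_subset_Icc_self hy)
  · filter_upwards [ae_flat] with x hx y hy
    exact hder _ _ _ _ hy hx.1

/-- With v as the innermost variable, almost every line carries an integrable function with
integrable derivative, and such a derivative has integral zero over ℝ. -/
theorem integral_deriv_v {f f' : ℝ → ℝ → ℝ → ℝ → ℝ} (hf' : BC a M f')
    (hf : BC a M f) {N r₁ r : ℝ}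
    (hr₁ : rm a M < r₁) (hr : r ∈ Icc r₁ (rp a M)) (hN : VSupp a M N r₁ f)
    (hN' : VSupp a M N r₁ f')
    (hder : ∀ v θ φ, θ ∈ Ioo 0 Real.pi → HasDerivAt (fun y => f y r θ φ) (f' v r θ φ) v) :
    ∫ x, f' x.1 r x.2.1 x.2.2 ∂flat = 0 := by
  have hi' := hf'.integrable hr₁ hr hN'
  have hi := hf.integrable hr₁ hr hN
  rw [flat_eq] at hi' hi ⊢
  rw [integral_prod_symm _ hi']
  refine integral_eq_zero_of_ae ?_
  have hae : ∀ᵐ y ∂((volume.restrict (Ioo 0 Real.pi)).prod (volume.restrict (Ioo 0 (2 * Real.pi)))),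
      y.1 ∈ Ioo 0 Real.pi := by
    rw [Measure.prod_restrict]
    filter_upwards [ae_restrict_mem (measurableSet_Ioo.prod measurableSet_Ioo)] with y hy using hy.1
  filter_upwards [hi'.prod_left_ae, hi.prod_left_ae, hae] with y hy' hy hθ
  exact integral_eq_zero_of_hasDerivAt_of_integrable (fun v => hder v _ _ hθ) hy' hy

/-- The boundary values at φ = 0 and φ = 2π cancel by periodicity. -/
theorem integral_deriv_phi {f f' : ℝ → ℝ → ℝ → ℝ → ℝ} (hf' : BC a M f') {N r₁ r : ℝ}
    (hr₁ : rm a M < r₁) (hr : r ∈ Icc r₁ (rp a M)) (hN' : VSupp a M N r₁ f')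
    (hper : ∀ v θ φ, f v r θ (φ + 2 * Real.pi) = f v r θ φ)
    (hder : ∀ v θ φ, θ ∈ Ioo 0 Real.pi → HasDerivAt (fun y => f v r θ y) (f' v r θ φ) φ) :
    ∫ x, f' x.1 r x.2.1 x.2.2 ∂flat = 0 := by
  have hi' := hf'.integrable hr₁ hr hN'
  rw [flat_eq] at hi' ⊢
  rw [integral_prod _ hi']
  refine integral_eq_zero_of_ae ?_
  filter_upwards [hi'.prod_right_ae] with v hv
  rw [integral_prod _ hv]
  refine integral_eq_zero_of_ae ?_
  filter_upwards [hv.prod_right_ae, ae_restrict_mem measurableSet_Ioo] with θ hθ hθ'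
  have h2 : (0 : ℝ) ≤ 2 * Real.pi := by positivity
  rw [← integral_Ioc_eq_integral_Ioo, ← intervalIntegral.integral_of_le h2]
  rw [intervalIntegral.integral_eq_sub_of_hasDerivAt (f := fun y => f v r θ y)
    (fun φ _ => hder v θ φ hθ')]
  · have := hper v θ 0
    rw [zero_add] at this
    simp [this]
  · rw [intervalIntegrable_iff_integrableOn_Ioo_of_le h2]
    exact hθ

/-- The factor sin θ from the area element kills the boundary terms at the poles, since f is
bounded. -/
theorem integral_deriv_theta {f f' : ℝ → ℝ → ℝ → ℝ → ℝ} (hf' : BC a M f') {N r₁ r : ℝ}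
    (hr₁ : rm a M < r₁) (hr : r ∈ Icc r₁ (rp a M)) (hN' : VSupp a M N r₁ f')
    (hN : BC a M f)
    (hder : ∀ v θ φ, θ ∈ Ioo 0 Real.pi →
      HasDerivAt (fun y => Real.sin y * f v r y φ) (f' v r θ φ) θ) :
    ∫ x, f' x.1 r x.2.1 x.2.2 ∂flat = 0 := by
  have hi' := hf'.integrable hr₁ hr hN'
  rw [flat_eq] at hi' ⊢
  rw [integral_prod _ hi']
  refine integral_eq_zero_of_ae ?_
  filter_upwards [hi'.prod_right_ae] with v hv
  rw [integral_prod_symm _ hv]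
  refine integral_eq_zero_of_ae ?_
  filter_upwards [hv.prod_left_ae, ae_restrict_mem measurableSet_Ioo] with φ hφ hφ'
  have h2 := Real.pi_pos
  rw [← integral_Ioc_eq_integral_Ioo, ← intervalIntegral.integral_of_le h2.le]
  obtain ⟨C, h0, hC⟩ := hN.bdd |v| r₁ hr₁
  -- Nothing is known about f at the poles themselves, so one-sided limits replace boundary values.
  have hlim : ∀ x : ℝ, Real.sin x = 0 → ∀ s : Set ℝ, s ∈ 𝓝[s] x → Ioo 0 Real.pi ∈ 𝓝[s] x →
      Tendsto (fun y => Real.sin y * f v r y φ) (𝓝[s] x) (𝓝 0) := by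
    intro x hx s _ hs'
    have hsin : Tendsto (fun y => |Real.sin y| * C) (𝓝[s] x) (𝓝 0) := by
      have : Continuous fun y => |Real.sin y| * C := by fun_prop
      have := (this.tendsto x).mono_left (nhdsWithin_le_nhds (s := s))
      rwa [hx, abs_zero, zero_mul] at this
    refine squeeze_zero_norm' ?_ hsin
    filter_upwards [hs'] with y hy
    rw [norm_mul, Real.norm_eq_abs]
    gcongr
    exact hC v r y φ le_rfl hr hy (Ioo_subset_Icc_self hφ')
  have := intervalIntegral.integral_eq_sub_of_hasDerivAt_of_tendsto h2
    (fun θ hθ => hder v θ φ hθ) ?_ (hlim 0 Real.sin_zero _ self_mem_nhdsWithin (Ioo_mem_nhdsGT h2))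
    (hlim Real.pi Real.sin_pi _ self_mem_nhdsWithin (Ioo_mem_nhdsLT h2))
  · rw [this]; simp
  · rw [intervalIntegrable_iff_integrableOn_Ioo_of_le h2.le]
    exact hφ

end BC

/-! ## The measure `cyl` -/

theorem cyl_eq : cyl = flat.withDensity (fun x => ENNReal.ofReal (Real.sin x.2.1)) := by
  rw [cyl, sphMeasure, flat_eq, prod_withDensity_right, Measure.prod_restrict]
  · rfl
  · fun_prop

theorem measurable_sinDensity :
    Measurable fun x : ℝ × ℝ × ℝ => ENNReal.ofReal (Real.sin x.2.1) := by fun_prop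

theorem cyl_absolutelyContinuous : cyl ≪ flat := by
  rw [cyl_eq]; exact withDensity_absolutelyContinuous _ _

theorem ae_cyl : ∀ᵐ x ∂cyl, x.2.1 ∈ Ioo 0 Real.pi ∧ x.2.2 ∈ Ioo 0 (2 * Real.pi) :=
  cyl_absolutelyContinuous.ae_le ae_flat

theorem lintegral_cyl {f : ℝ × ℝ × ℝ → ENNReal} (hf : AEMeasurable f flat) :
    ∫⁻ x, f x ∂cyl = ∫⁻ x, ENNReal.ofReal (Real.sin x.2.1) * f x ∂flat := by
  rw [cyl_eq, lintegral_withDensity_eq_lintegral_mul₀ measurable_sinDensity.aemeasurable hf]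
  rfl


/-! ## The energy current at a point

`x, y, z, t` stand for the derivatives `u_r, u_v, u_φ, u_θ` and `Y` for the covariant derivative
`(sin θ)⁻¹ (∂_φ + 2 i cos θ) u`.  The multiplier is `α u_r + h u_v + k u_φ`, `α = Δ / 2 - 1`. -/

section Current

/-- The angular part of the gradient form. -/
def curQ (A k : ℝ) (y z t Y : ℂ) : ℝ := A * ip y y + 2 * k * ip y z + ip t t + ip Y Y

/-- `h y + k z`. -/
def curL (h k : ℝ) (y z : ℂ) : ℂ := h * y + k * z

/-- The multiplier. -/
noncomputable def curW (h D k : ℝ) (x y z : ℂ) : ℂ := ((D / 2 - 1 : ℝ) : ℂ) * x + curL h k y z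

/-- The flux through hypersurfaces of constant `r`. -/
noncomputable def curR (A h D k : ℝ) (x y z t Y : ℂ) : ℝ :=
  ip (curL h k y z) (curL h k y z) + D * ip x (curL h k y z)
    + (D / 2 - 1) * (1 / 2 * D * ip x x - 1 / 2 * curQ A k y z t Y)

/-- The flux through hypersurfaces of constant `v`. -/
noncomputable def curV (A h D k : ℝ) (x y z t Y : ℂ) : ℝ :=
  -h * ip x x + (D / 2 - 1) * (A * ip x y + k * ip x z)
    + (A * ip y (curL h k y z) + k * ip z (curL h k y z)) - 1 / 2 * h * curQ A k y z t Y

/-- The bulk term caused by the `r`-dependence of the coefficients. -/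
noncomputable def curBulk (A h D k h' D' : ℝ) (x y z t Y : ℂ) : ℝ :=
  D' / 2 * (1 / 2 * D * ip x x - 1 / 2 * curQ A k y z t Y) + 1 / 2 * (D / 2 - 1) * D' * ip x x
    + 2 * h * h' * ip y y + 2 * k * h' * ip y z + h' * D * ip x y + D' * ip x (curL h k y z)

theorem ip_comm (p q : ℂ) : ip p q = ip q p := by unfold ip; ring
theorem ip_add_left (p q w : ℂ) : ip (p + q) w = ip p w + ip q w := by
  simp only [ip, Complex.add_re, Complex.add_im]; ring
theorem ip_sub_left (p q w : ℂ) : ip (p - q) w = ip p w - ip q w := by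
  simp only [ip, Complex.sub_re, Complex.sub_im]; ring
theorem ip_ofReal_mul_left (c : ℝ) (p w : ℂ) : ip (c * p) w = c * ip p w := by
  simp [ip]; ring
theorem ip_add_right (p q w : ℂ) : ip w (p + q) = ip w p + ip w q := by
  rw [ip_comm, ip_add_left, ip_comm p, ip_comm q]
theorem ip_ofReal_mul_right (c : ℝ) (p w : ℂ) : ip w (c * p) = c * ip w p := by
  rw [ip_comm, ip_ofReal_mul_left, ip_comm]

theorem mul_ip_bound {c C P Q : ℝ} {p q : ℂ} (hc : |c| ≤ C) (hp : ‖p‖ ≤ P) (hq : ‖q‖ ≤ Q) :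
    |c * ip p q| ≤ C * (P * Q) := by
  rw [abs_mul]
  have h1 := abs_ip_le p q
  have h2 : ‖p‖ * ‖q‖ ≤ P * Q := mul_le_mul hp hq (norm_nonneg _) ((norm_nonneg _).trans hp)
  exact mul_le_mul hc (h1.trans h2) (abs_nonneg _) ((abs_nonneg _).trans hc)

theorem ip_bound {P Q : ℝ} {p q : ℂ} (hp : ‖p‖ ≤ P) (hq : ‖q‖ ≤ Q) :
    |ip p q| ≤ P * Q := by
  simpa using mul_ip_bound (c := 1) (C := 1) (by simp) hp hq

/-- The bounds on the coefficients at a point. -/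
structure PtBound (B ρ A h D k h' D' s c : ℝ) : Prop where
  oneB : 1 ≤ B
  rhoPos : 0 < ρ
  hA : A = k ^ 2 * s ^ 2
  hm : ρ ≤ h - k ^ 2 * s ^ 2
  hh : |h| ≤ B
  D0 : D ≤ 0
  hD : |D| ≤ B
  hα : |D / 2 - 1| ≤ B
  hk : |k| ≤ B
  hk2 : k ^ 2 ≤ B
  hh' : |h'| ≤ B
  hD' : |D'| ≤ B
  hs : |s| ≤ 1
  hc : |c| ≤ 1

variable {B ρ A h D k h' D' s c : ℝ} {x y z t Y u : ℂ}

/-- `|u_v| + |u_θ| + |D u| + |u|`. -/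
noncomputable def tangNorm (y t Y u : ℂ) : ℝ := ‖y‖ + ‖t‖ + ‖Y‖ + ‖u‖

/-- `|u_v|² + |u_θ|² + |D u|² + |u|²`. -/
noncomputable def tangSq (y t Y u : ℂ) : ℝ := ‖y‖ ^ 2 + ‖t‖ ^ 2 + ‖Y‖ ^ 2 + ‖u‖ ^ 2

theorem tangSq_nonneg (y t Y u : ℂ) : 0 ≤ tangSq y t Y u := by unfold tangSq; positivity

theorem tangNorm_sq_le (y t Y u : ℂ) : tangNorm y t Y u ^ 2 ≤ 4 * tangSq y t Y u := by
  unfold tangNorm tangSq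
  nlinarith [sq_nonneg (‖y‖ - ‖t‖), sq_nonneg (‖y‖ - ‖Y‖), sq_nonneg (‖y‖ - ‖u‖),
    sq_nonneg (‖t‖ - ‖Y‖), sq_nonneg (‖t‖ - ‖u‖), sq_nonneg (‖Y‖ - ‖u‖)]

theorem norm_z_le (hs : |s| ≤ 1) (hc : |c| ≤ 1) (hz : z = s * Y - 2 * Complex.I * c * u) :
    ‖z‖ ≤ ‖Y‖ + 2 * ‖u‖ := by
  rw [hz]
  refine (norm_sub_le _ _).trans (add_le_add ?_ ?_)
  · rw [norm_mul, Complex.norm_real, Real.norm_eq_abs]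
    exact mul_le_of_le_one_left (norm_nonneg _) hs
  · simp only [norm_mul, Complex.norm_real, Real.norm_eq_abs, Complex.norm_I, mul_one,
      Complex.norm_ofNat]
    nlinarith [norm_nonneg u, mul_le_of_le_one_left (norm_nonneg u) hc]

theorem curL_norm_le (hB : PtBound B ρ A h D k h' D' s c)
    (hz : z = s * Y - 2 * Complex.I * c * u) :
    ‖curL h k y z‖ ≤ 3 * B * tangNorm y t Y u := by
  have h1 := norm_z_le hB.hs hB.hc hz
  have h2 : ‖curL h k y z‖ ≤ |h| * ‖y‖ + |k| * ‖z‖ := by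
    refine (norm_add_le _ _).trans (le_of_eq ?_)
    simp
  have h3 : |h| * ‖y‖ ≤ B * ‖y‖ := by gcongr; exact hB.hh
  have h4 : |k| * ‖z‖ ≤ B * (‖Y‖ + 2 * ‖u‖) :=
    mul_le_mul hB.hk h1 (norm_nonneg _) (by linarith [hB.oneB])
  have hB0 := hB.oneB
  unfold tangNorm
  nlinarith [norm_nonneg y, norm_nonneg t, norm_nonneg Y, norm_nonneg u,
    mul_nonneg (by linarith : 0 ≤ B) (norm_nonneg y), mul_nonneg (by linarith : 0 ≤ B) (norm_nonneg t),
    mul_nonneg (by linarith : 0 ≤ B) (norm_nonneg Y), mul_nonneg (by linarith : 0 ≤ B) (norm_nonneg u)]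

theorem abs_A_le (hB : PtBound B ρ A h D k h' D' s c) : |A| ≤ B := by
  have : s ^ 2 ≤ 1 := by
    have := hB.hs
    rw [← sq_abs]; nlinarith [abs_nonneg s]
  rw [hB.hA, abs_of_nonneg (by positivity)]
  nlinarith [sq_nonneg k, sq_nonneg s, hB.hk2]

theorem curQ_abs_le (hB : PtBound B ρ A h D k h' D' s c)
    (hz : z = s * Y - 2 * Complex.I * c * u) :
    |curQ A k y z t Y| ≤ 7 * B * tangNorm y t Y u ^ 2 := by
  have h1 := norm_z_le hB.hs hB.hc hz
  set σ := tangNorm y t Y u with hσ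
  have hy : ‖y‖ ≤ σ := by rw [hσ]; unfold tangNorm; nlinarith [norm_nonneg y, norm_nonneg t, norm_nonneg Y, norm_nonneg u]
  have ht : ‖t‖ ≤ σ := by rw [hσ]; unfold tangNorm; nlinarith [norm_nonneg y, norm_nonneg t, norm_nonneg Y, norm_nonneg u]
  have hY : ‖Y‖ ≤ σ := by rw [hσ]; unfold tangNorm; nlinarith [norm_nonneg y, norm_nonneg t, norm_nonneg Y, norm_nonneg u]
  have hz' : ‖z‖ ≤ 2 * σ := by
    rw [hσ]; unfold tangNorm; nlinarith [norm_nonneg y, norm_nonneg t, norm_nonneg Y, norm_nonneg u]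
  have e1 := mul_ip_bound (abs_A_le hB) hy hy
  have e2 : |(2 * k) * ip y z| ≤ (2 * B) * (σ * (2 * σ)) :=
    mul_ip_bound (by rw [abs_mul, abs_two]; linarith [hB.hk]) hy hz'
  have e3 := ip_bound ht ht
  have e4 := ip_bound hY hY
  rw [abs_le] at *
  unfold curQ
  have := hB.oneB
  constructor <;> nlinarith [sq_nonneg σ]

/-- The only term quadratic in u_r is -h |u_r|², which has a sign. Every other term carries a
tangential factor. -/
theorem curV_abs_le (hB : PtBound B ρ A h D k h' D' s c)
    (hz : z = s * Y - 2 * Complex.I * c * u) :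
    |curV A h D k x y z t Y + h * ‖x‖ ^ 2|
      ≤ 3 * B ^ 2 * (‖x‖ * tangNorm y t Y u) + 13 * B ^ 2 * tangNorm y t Y u ^ 2 := by
  have h1 := norm_z_le hB.hs hB.hc hz
  have hL := curL_norm_le (t := t) (y := y) hB hz
  have hq := curQ_abs_le (t := t) (y := y) hB hz
  have hA := abs_A_le hB
  set σ := tangNorm y t Y u with hσ
  have hy : ‖y‖ ≤ σ := by rw [hσ]; unfold tangNorm; nlinarith [norm_nonneg y, norm_nonneg t, norm_nonneg Y, norm_nonneg u]
  have hz' : ‖z‖ ≤ 2 * σ := by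
    rw [hσ]; unfold tangNorm; nlinarith [norm_nonneg y, norm_nonneg t, norm_nonneg Y, norm_nonneg u]
  have hB1 := hB.oneB
  have hBB : ∀ {p q : ℝ}, |p| ≤ B → |q| ≤ B → |p * q| ≤ B ^ 2 := fun {p q} hp hq => by
    rw [abs_mul, sq]; exact mul_le_mul hp hq (abs_nonneg _) (by linarith)
  have e1 := mul_ip_bound (hBB hB.hα hA) (le_refl ‖x‖) hy
  have e2 := mul_ip_bound (hBB hB.hα hB.hk) (le_refl ‖x‖) hz'
  have e3 := mul_ip_bound hA hy hL
  have e4 := mul_ip_bound hB.hk hz' hL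
  have e5 : |h * curQ A k y z t Y| ≤ B * (7 * B * σ ^ 2) := by
    rw [abs_mul]; exact mul_le_mul hB.hh hq (abs_nonneg _) (by linarith)
  have key : curV A h D k x y z t Y + h * ‖x‖ ^ 2 = ((D / 2 - 1) * A) * ip x y
      + ((D / 2 - 1) * k) * ip x z + A * ip y (curL h k y z) + k * ip z (curL h k y z)
      - 1 / 2 * (h * curQ A k y z t Y) := by
    unfold curV; rw [ip_self x]; ring
  rw [key]
  rw [abs_le] at *
  constructor <;> nlinarith [sq_nonneg (B * σ)]

theorem norm_sq_add_le (p q : ℂ) : ‖p + q‖ ^ 2 ≤ 2 * ‖p‖ ^ 2 + 2 * ‖q‖ ^ 2 := by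
  have := norm_add_le p q
  have : ‖p + q‖ ^ 2 ≤ (‖p‖ + ‖q‖) ^ 2 := by gcongr
  nlinarith [sq_nonneg (‖p‖ - ‖q‖)]

/-- Completing squares exhibits the positivity: all terms are nonnegative for D ≤ 0 except the last
product, which comes from the spin and is of lower order in u. The derivative u_v occurs only inside
the two squares and in that product, so it has to be recovered separately. -/
theorem curR_eq (hB : PtBound B ρ A h D k h' D' s c)
    (hz : z = s * Y - 2 * Complex.I * c * u) :
    curR A h D k x y z t Y = ‖curL h k y z + ((D / 2 : ℝ) : ℂ) * x‖ ^ 2 - D / 2 * ‖x‖ ^ 2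
      + 1 / 2 * (1 - D / 2) * (‖t‖ ^ 2 + ‖Y + ((k * s : ℝ) : ℂ) * y‖ ^ 2
        - 4 * k * c * ip y (Complex.I * u)) := by
  rw [hz]
  simp only [← ip_self]
  unfold curR curQ curL ip
  rw [hB.hA]
  simp
  ring

/-- Eliminating u_φ and the covariant derivative in favour of the two squares of `curR_eq` leaves
u_v with the coefficient h - k² s². In the application this is r² + a² cos² θ, which is bounded
below. -/
theorem norm_y_sq_le (hB : PtBound B ρ A h D k h' D' s c)
    (hz : z = s * Y - 2 * Complex.I * c * u) :
    ρ ^ 2 * ‖y‖ ^ 2 ≤ 16 * B ^ 2 * (‖curL h k y z + ((D / 2 : ℝ) : ℂ) * x‖ ^ 2 - D / 2 * ‖x‖ ^ 2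
      + ‖Y + ((k * s : ℝ) : ℂ) * y‖ ^ 2 + ‖u‖ ^ 2) := by
  have hB1 := hB.oneB
  have hid : ((h - k ^ 2 * s ^ 2 : ℝ) : ℂ) * y
      = ((curL h k y z + ((D / 2 : ℝ) : ℂ) * x) + -(((D / 2 : ℝ) : ℂ) * x))
        + (-(((k * s : ℝ) : ℂ) * (Y + ((k * s : ℝ) : ℂ) * y))
          + ((2 * k * c : ℝ) : ℂ) * (Complex.I * u)) := by
    rw [hz]; unfold curL; push_cast; ring
  have hn : ‖((h - k ^ 2 * s ^ 2 : ℝ) : ℂ) * y‖ ^ 2 = (h - k ^ 2 * s ^ 2) ^ 2 * ‖y‖ ^ 2 := by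
    rw [norm_mul, mul_pow, Complex.norm_real, Real.norm_eq_abs, sq_abs]
  have h0 : ρ ^ 2 * ‖y‖ ^ 2 ≤ (h - k ^ 2 * s ^ 2) ^ 2 * ‖y‖ ^ 2 := by
    have := hB.hm; have := hB.rhoPos
    gcongr
  rw [← hn, hid] at h0
  have e0 := norm_sq_add_le ((curL h k y z + ((D / 2 : ℝ) : ℂ) * x) + -(((D / 2 : ℝ) : ℂ) * x))
    (-(((k * s : ℝ) : ℂ) * (Y + ((k * s : ℝ) : ℂ) * y)) + ((2 * k * c : ℝ) : ℂ) * (Complex.I * u))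
  have e1 := norm_sq_add_le (curL h k y z + ((D / 2 : ℝ) : ℂ) * x) (-(((D / 2 : ℝ) : ℂ) * x))
  have e2 := norm_sq_add_le (-(((k * s : ℝ) : ℂ) * (Y + ((k * s : ℝ) : ℂ) * y)))
    (((2 * k * c : ℝ) : ℂ) * (Complex.I * u))
  have n1 : ‖-(((D / 2 : ℝ) : ℂ) * x)‖ ^ 2 = (D / 2) ^ 2 * ‖x‖ ^ 2 := by
    rw [norm_neg, norm_mul, mul_pow, Complex.norm_real, Real.norm_eq_abs, sq_abs]
  have n2 : ‖-(((k * s : ℝ) : ℂ) * (Y + ((k * s : ℝ) : ℂ) * y))‖ ^ 2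
      = (k * s) ^ 2 * ‖Y + ((k * s : ℝ) : ℂ) * y‖ ^ 2 := by
    rw [norm_neg, norm_mul, mul_pow, Complex.norm_real, Real.norm_eq_abs, sq_abs]
  have n3 : ‖((2 * k * c : ℝ) : ℂ) * (Complex.I * u)‖ ^ 2 = (2 * k * c) ^ 2 * ‖u‖ ^ 2 := by
    rw [norm_mul, norm_mul, Complex.norm_I, one_mul, mul_pow, Complex.norm_real,
      Real.norm_eq_abs, sq_abs]
  rw [n1] at e1
  rw [n2, n3] at e2
  have k2 : k ^ 2 ≤ B ^ 2 := sq_le_sq' (abs_le.1 hB.hk).1 (abs_le.1 hB.hk).2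
  have s2 : s ^ 2 ≤ 1 := by
    have := sq_le_sq' (abs_le.1 hB.hs).1 (abs_le.1 hB.hs).2; simpa using this
  have c2 : c ^ 2 ≤ 1 := by
    have := sq_le_sq' (abs_le.1 hB.hc).1 (abs_le.1 hB.hc).2; simpa using this
  -- One factor D is bounded by B and the other one is kept, so that only the degenerate quantity -D
  -- |u_r|² appears.
  have b1 : (D / 2) ^ 2 ≤ B ^ 2 * (-(D / 2)) := by
    have hD1 := (abs_le.1 hB.hD).1
    have hD0 := hB.D0
    have : (D / 2) ^ 2 = (-(D / 2)) * (-(D / 2)) := by ring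
    rw [this]
    apply mul_le_mul_of_nonneg_right _ (by linarith)
    nlinarith
  have b2 : (k * s) ^ 2 ≤ B ^ 2 := by
    rw [mul_pow]
    calc k ^ 2 * s ^ 2 ≤ B ^ 2 * 1 := mul_le_mul k2 s2 (sq_nonneg _) (sq_nonneg _)
      _ = B ^ 2 := mul_one _
  have b3 : (2 * k * c) ^ 2 ≤ 4 * B ^ 2 := by
    have : k ^ 2 * c ^ 2 ≤ B ^ 2 * 1 := mul_le_mul k2 c2 (sq_nonneg _) (sq_nonneg _)
    nlinarith
  have m1 := mul_le_mul_of_nonneg_right b1 (sq_nonneg ‖x‖)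
  have m2 := mul_le_mul_of_nonneg_right b2 (sq_nonneg ‖Y + ((k * s : ℝ) : ℂ) * y‖)
  have m3 := mul_le_mul_of_nonneg_right b3 (sq_nonneg ‖u‖)
  have m4 : ‖curL h k y z + ((D / 2 : ℝ) : ℂ) * x‖ ^ 2
      ≤ B ^ 2 * ‖curL h k y z + ((D / 2 : ℝ) : ℂ) * x‖ ^ 2 :=
    le_mul_of_one_le_left (sq_nonneg _) (by nlinarith)
  have p1 : 0 ≤ B ^ 2 * ‖curL h k y z + ((D / 2 : ℝ) : ℂ) * x‖ ^ 2 := by positivity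
  have p2 : 0 ≤ B ^ 2 * ‖Y + ((k * s : ℝ) : ℂ) * y‖ ^ 2 := by positivity
  have p3 : 0 ≤ B ^ 2 * ‖u‖ ^ 2 := by positivity
  have p4 : 0 ≤ B ^ 2 * (-(D / 2)) * ‖x‖ ^ 2 := by
    have := hB.D0
    have : 0 ≤ -(D / 2) := by linarith
    positivity
  linarith

/-- Coercivity of the flux through hypersurfaces of constant `r`. -/
theorem exists_coercive (B ρ : ℝ) (hB1 : 1 ≤ B) (hρ : 0 < ρ) : ∃ Z c₀ : ℝ, 0 < Z ∧ 0 < c₀ ∧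
    ∀ {A h D k h' D' s c : ℝ} {x y z t Y u : ℂ}, PtBound B ρ A h D k h' D' s c →
      z = s * Y - 2 * Complex.I * c * u →
      c₀ * (-D * ‖x‖ ^ 2 + tangSq y t Y u) ≤ curR A h D k x y z t Y + Z * ‖u‖ ^ 2 := by
  -- K is the constant of `norm_y_sq_le`. The choice of δ gives B δ K = 1/8, so the spin term takes
  -- up only a fraction of the squares. The constant c₀ is a quarter of the reciprocal of the factor
  -- in `hup`.
  set K := 16 * B ^ 2 / ρ ^ 2 with hK
  have hK0 : 0 < K := by positivity
  set δ := 1 / (8 * B * K) with hδ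
  have hδ0 : 0 < δ := by positivity
  set c₀ := 1 / (4 * (1 + 2 * K * (1 + 2 * B ^ 2) + 4)) with hc₀
  have hc₀0 : 0 < c₀ := by positivity
  -- The part 4 B³ / δ of Z pays for the spin term; the rest supplies the missing |u|².
  refine ⟨4 * B ^ 3 / δ + 1 + 1, c₀, by positivity, hc₀0, ?_⟩
  intro A h D k h' D' s c x y z t Y u hB hz
  have hy := norm_y_sq_le (x := x) (y := y) hB hz
  rw [curR_eq hB hz]
  set L := ‖curL h k y z + ((D / 2 : ℝ) : ℂ) * x‖ ^ 2 with hL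
  set P := ‖Y + ((k * s : ℝ) : ℂ) * y‖ ^ 2 with hP
  set X := -D * ‖x‖ ^ 2 with hX
  have hD0 := hB.D0
  have hX0 : 0 ≤ X := mul_nonneg (by linarith) (sq_nonneg _)
  have hL0 : 0 ≤ L := sq_nonneg _
  have hP0 : 0 ≤ P := sq_nonneg _
  have hy' : ‖y‖ ^ 2 ≤ K * (L + X / 2 + P + ‖u‖ ^ 2) := by
    rw [hK, div_mul_eq_mul_div, le_div_iff₀ (by positivity)]
    calc ‖y‖ ^ 2 * ρ ^ 2 = ρ ^ 2 * ‖y‖ ^ 2 := by ring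
      _ ≤ _ := hy
      _ = _ := by rw [hX]; ring
  have hip : 4 * k * c * ip y (Complex.I * u) ≤ δ * ‖y‖ ^ 2 + 4 * B ^ 2 / δ * ‖u‖ ^ 2 := by
    have h1 : |(4 * k * c) * ip y (Complex.I * u)| ≤ (4 * B) * (‖y‖ * ‖u‖) := by
      refine mul_ip_bound ?_ le_rfl (by simp)
      rw [abs_mul, abs_mul]
      have : |k| * |c| ≤ B * 1 := mul_le_mul hB.hk hB.hc (abs_nonneg _) (by linarith)
      norm_num
      nlinarith
    have h2 : (4 * B) * (‖y‖ * ‖u‖) ≤ δ * ‖y‖ ^ 2 + 4 * B ^ 2 / δ * ‖u‖ ^ 2 := by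
      have : δ * ‖y‖ ^ 2 + 4 * B ^ 2 / δ * ‖u‖ ^ 2 - (4 * B) * (‖y‖ * ‖u‖)
          = (δ * ‖y‖ - 2 * B * ‖u‖) ^ 2 / δ := by field_simp; ring
      have h3 : 0 ≤ (δ * ‖y‖ - 2 * B * ‖u‖) ^ 2 / δ := by positivity
      linarith
    exact (le_abs_self _).trans (h1.trans h2)
  have hDB : 1 / 2 * (1 - D / 2) ≤ B := by
    have h1 := (abs_le.1 hB.hα).1
    linarith
  have hDl : 1 / 2 ≤ 1 / 2 * (1 - D / 2) := by linarith
  have hY : ‖Y‖ ^ 2 ≤ 2 * P + 2 * B ^ 2 * ‖y‖ ^ 2 := by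
    have h1 := norm_sq_add_le (Y + ((k * s : ℝ) : ℂ) * y) (-(((k * s : ℝ) : ℂ) * y))
    rw [add_neg_cancel_right, norm_neg, norm_mul, mul_pow ‖((k * s : ℝ) : ℂ)‖, Complex.norm_real,
      Real.norm_eq_abs, sq_abs] at h1
    have k2 : k ^ 2 ≤ B ^ 2 := sq_le_sq' (abs_le.1 hB.hk).1 (abs_le.1 hB.hk).2
    have s2 : s ^ 2 ≤ 1 := by
      have := sq_le_sq' (abs_le.1 hB.hs).1 (abs_le.1 hB.hs).2; simpa using this
    have b2 : (k * s) ^ 2 ≤ B ^ 2 := by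
      rw [mul_pow]
      calc k ^ 2 * s ^ 2 ≤ B ^ 2 * 1 := mul_le_mul k2 s2 (sq_nonneg _) (sq_nonneg _)
        _ = B ^ 2 := mul_one _
    have := mul_le_mul_of_nonneg_right b2 (sq_nonneg ‖y‖)
    linarith
  -- lower bound for the flux
  have hflux : L + X / 2 + 1 / 2 * (‖t‖ ^ 2 + P) - B * (δ * ‖y‖ ^ 2 + 4 * B ^ 2 / δ * ‖u‖ ^ 2)
      ≤ L - D / 2 * ‖x‖ ^ 2 + 1 / 2 * (1 - D / 2) *
        (‖t‖ ^ 2 + P - 4 * k * c * ip y (Complex.I * u)) := by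
    have q1 : 1 / 2 * (‖t‖ ^ 2 + P) ≤ 1 / 2 * (1 - D / 2) * (‖t‖ ^ 2 + P) :=
      mul_le_mul_of_nonneg_right hDl (by positivity)
    have q2 : 1 / 2 * (1 - D / 2) * (4 * k * c * ip y (Complex.I * u))
        ≤ B * (δ * ‖y‖ ^ 2 + 4 * B ^ 2 / δ * ‖u‖ ^ 2) :=
      (mul_le_mul_of_nonneg_left hip (by linarith)).trans
        (mul_le_mul_of_nonneg_right hDB (by positivity))
    have q3 : X / 2 = -(D / 2 * ‖x‖ ^ 2) := by rw [hX]; ring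
    rw [mul_sub (1 / 2 * (1 - D / 2))]
    linarith
  have hBδ : B * (δ * ‖y‖ ^ 2) ≤ 1 / 8 * (L + X / 2 + P + ‖u‖ ^ 2) := by
    calc B * (δ * ‖y‖ ^ 2) ≤ B * (δ * (K * (L + X / 2 + P + ‖u‖ ^ 2))) := by gcongr
      _ = 1 / 8 * (L + X / 2 + P + ‖u‖ ^ 2) := by rw [hδ]; field_simp
  have hBu : B * (4 * B ^ 2 / δ * ‖u‖ ^ 2) = 4 * B ^ 3 / δ * ‖u‖ ^ 2 := by ring
  -- upper bound for the controlled quantity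
  have hup : X + tangSq y t Y u ≤
      (1 + 2 * K * (1 + 2 * B ^ 2) + 4) * (L + X + P + ‖u‖ ^ 2 + ‖t‖ ^ 2) := by
    unfold tangSq
    have hu0 := sq_nonneg ‖u‖
    have ht0 := sq_nonneg ‖t‖
    have g1 : (1 + 2 * B ^ 2) * ‖y‖ ^ 2
        ≤ (1 + 2 * B ^ 2) * (K * (L + X / 2 + P + ‖u‖ ^ 2)) := by gcongr
    have g2 : (1 + 2 * B ^ 2) * (K * (L + X / 2 + P + ‖u‖ ^ 2)) ≤
        2 * K * (1 + 2 * B ^ 2) * (L + X + P + ‖u‖ ^ 2 + ‖t‖ ^ 2) := by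
      have g3 : 0 ≤ K * (1 + 2 * B ^ 2) := by positivity
      calc _ = K * (1 + 2 * B ^ 2) * (L + X / 2 + P + ‖u‖ ^ 2) := by ring
        _ ≤ K * (1 + 2 * B ^ 2) * (2 * (L + X + P + ‖u‖ ^ 2 + ‖t‖ ^ 2)) :=
          mul_le_mul_of_nonneg_left (by linarith) g3
        _ = _ := by ring
    have g4 : (1 + 2 * K * (1 + 2 * B ^ 2) + 4) * (L + X + P + ‖u‖ ^ 2 + ‖t‖ ^ 2)
        = 5 * (L + X + P + ‖u‖ ^ 2 + ‖t‖ ^ 2)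
          + 2 * K * (1 + 2 * B ^ 2) * (L + X + P + ‖u‖ ^ 2 + ‖t‖ ^ 2) := by ring
    linarith
  have hfin : c₀ * (X + tangSq y t Y u) ≤ 1 / 4 * (L + X + P + ‖u‖ ^ 2 + ‖t‖ ^ 2) := by
    calc c₀ * (X + tangSq y t Y u) ≤ c₀ * ((1 + 2 * K * (1 + 2 * B ^ 2) + 4) *
          (L + X + P + ‖u‖ ^ 2 + ‖t‖ ^ 2)) := by gcongr
      _ = _ := by rw [hc₀]; field_simp
  have hu0 := sq_nonneg ‖u‖
  have ht0 := sq_nonneg ‖t‖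
  linarith

/-- The flux through hypersurfaces of constant `r` is bounded by the first derivatives. -/
theorem curR_le (hB : PtBound B ρ A h D k h' D' s c)
    (hz : z = s * Y - 2 * Complex.I * c * u) :
    curR A h D k x y z t Y ≤ 200 * B ^ 3 * (-D * ‖x‖ ^ 2 + tangSq y t Y u) := by
  have hL := curL_norm_le (t := t) (y := y) hB hz
  have hq := curQ_abs_le (t := t) (y := y) hB hz
  have hσ := tangNorm_sq_le y t Y u
  have hB1 := hB.oneB
  have hD0 := hB.D0
  have hS := tangSq_nonneg y t Y u
  have hσ0 : 0 ≤ tangNorm y t Y u := by unfold tangNorm; positivity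
  set σ := tangNorm y t Y u
  set S := tangSq y t Y u
  have hDB : 1 - D / 2 ≤ B := by have h1 := (abs_le.1 hB.hα).1; linarith
  have e1 : ip (curL h k y z) (curL h k y z) ≤ 9 * B ^ 2 * σ ^ 2 := by
    rw [ip_self]
    calc ‖curL h k y z‖ ^ 2 ≤ (3 * B * σ) ^ 2 := by gcongr
      _ = _ := by ring
  have e2 : D * ip x (curL h k y z) ≤ -D * (‖x‖ ^ 2 + 9 * B ^ 2 * σ ^ 2) := by
    have h1 := ip_bound (le_refl ‖x‖) hL
    have h2 : ‖x‖ * (3 * B * σ) ≤ ‖x‖ ^ 2 + 9 * B ^ 2 * σ ^ 2 := by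
      nlinarith [sq_nonneg (‖x‖ - 3 * B * σ), sq_nonneg ‖x‖, sq_nonneg (B * σ)]
    have h3 := (abs_le.1 (h1.trans h2)).1
    nlinarith
  have e3 : (1 - D / 2) * (1 / 2 * curQ A k y z t Y) ≤ B * (1 / 2 * (7 * B * σ ^ 2)) := by
    have := (le_abs_self _).trans hq
    calc _ ≤ (1 - D / 2) * (1 / 2 * (7 * B * σ ^ 2)) := by
            apply mul_le_mul_of_nonneg_left _ (by linarith); linarith
      _ ≤ _ := mul_le_mul_of_nonneg_right hDB (by positivity)
  have e4 : (D / 2 - 1) * (1 / 2 * D * ip x x) ≤ B * (-D * ‖x‖ ^ 2) := by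
    rw [ip_self]
    have : (D / 2 - 1) * (1 / 2 * D * ‖x‖ ^ 2) = (1 - D / 2) * (1 / 2 * (-D * ‖x‖ ^ 2)) := by ring
    rw [this]
    have h0 : 0 ≤ -D * ‖x‖ ^ 2 := mul_nonneg (by linarith) (sq_nonneg _)
    calc _ ≤ B * (1 / 2 * (-D * ‖x‖ ^ 2)) := mul_le_mul_of_nonneg_right hDB (by linarith)
      _ ≤ _ := by apply mul_le_mul_of_nonneg_left _ (by linarith); linarith
  have e5 : -D * (9 * B ^ 2 * σ ^ 2) ≤ 2 * B * (9 * B ^ 2 * σ ^ 2) := by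
    apply mul_le_mul_of_nonneg_right _ (by positivity); linarith
  have hX0 : 0 ≤ -D * ‖x‖ ^ 2 := mul_nonneg (by linarith) (sq_nonneg _)
  have hB2 : B ^ 2 ≤ B ^ 3 := pow_le_pow_right₀ hB1 (by norm_num)
  have hB3 : B ≤ B ^ 3 := le_self_pow₀ hB1 (by norm_num)
  have f1 : B ^ 2 * σ ^ 2 ≤ B ^ 3 * σ ^ 2 := by gcongr
  have f2 : B ^ 3 * σ ^ 2 ≤ B ^ 3 * (4 * S) := by gcongr
  have f3 : B * (-D * ‖x‖ ^ 2) ≤ B ^ 3 * (-D * ‖x‖ ^ 2) := by gcongr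
  have f4 : -D * ‖x‖ ^ 2 ≤ B * (-D * ‖x‖ ^ 2) := le_mul_of_one_le_left hX0 hB1
  have f5 : 0 ≤ B ^ 3 * (-D * ‖x‖ ^ 2) := by positivity
  have f6 : 0 ≤ B ^ 3 * S := by positivity
  unfold curR
  nlinarith

end Current


/-! ### The pointwise energy inequality. -/

section Master

/-- The bulk term, the equation and the zeroth order energy together. -/
noncomputable def curLow (A h D k h' D' br Z : ℝ) (bv b : ℂ) (x y z t Y u F : ℂ) : ℝ :=
  curBulk A h D k h' D' x y z t Y + ip (F - br * x - bv * y - b * u) (curW h D k x y z)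
    + 2 * Z * ip u x

variable {B ρ A h D k h' D' s c br Z : ℝ} {x y z t Y u F bv b : ℂ}

/-- Among the terms quadratic in u_r, the current contributes -D'/2, the term br u_r of the equation
contributes br through the part -u_r of the multiplier, and the remainder carries a factor D. All
other terms contain a tangential derivative, u or F. -/
theorem curLow_ge (hB : PtBound B ρ A h D k h' D' s c)
    (hz : z = s * Y - 2 * Complex.I * c * u) (hbr : |br| ≤ B) (hbv : ‖bv‖ ≤ B) (hb : ‖b‖ ≤ B)
    (hZ : 0 ≤ Z) :
    (br - D' / 2) * ‖x‖ ^ 2 - B * (-D * ‖x‖ ^ 2)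
      - (20 * B ^ 2 + 2 * Z) * (‖x‖ * (tangNorm y t Y u + ‖F‖))
      - 30 * B ^ 2 * (tangNorm y t Y u + ‖F‖) ^ 2 ≤ curLow A h D k h' D' br Z bv b x y z t Y u F := by
  have hz1 := norm_z_le hB.hs hB.hc hz
  have hL := curL_norm_le (t := t) (y := y) hB hz
  have hq := curQ_abs_le (t := t) (y := y) hB hz
  have hB1 := hB.oneB
  have hB0 : 0 ≤ B := by linarith
  obtain ⟨σ, hσ⟩ : ∃ σ, σ = tangNorm y t Y u + ‖F‖ := ⟨_, rfl⟩
  have n1 := norm_nonneg y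
  have n2 := norm_nonneg t
  have n3 := norm_nonneg Y
  have n4 := norm_nonneg u
  have n5 := norm_nonneg F
  have hσ0 : 0 ≤ σ := by rw [hσ]; unfold tangNorm; positivity
  have hσt : tangNorm y t Y u ≤ σ := by rw [hσ]; linarith
  have hσt0 : 0 ≤ tangNorm y t Y u := by unfold tangNorm; positivity
  have hy : ‖y‖ ≤ σ := by rw [hσ]; unfold tangNorm; linarith
  have hu : ‖u‖ ≤ σ := by rw [hσ]; unfold tangNorm; linarith
  have hF : ‖F‖ ≤ σ := by rw [hσ]; linarith
  have hz' : ‖z‖ ≤ 2 * σ := by rw [hσ]; unfold tangNorm; linarith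
  have hL' : ‖curL h k y z‖ ≤ 3 * B * σ := hL.trans (by gcongr)
  have hq' : |curQ A k y z t Y| ≤ 7 * B * σ ^ 2 := hq.trans (by gcongr)
  have hG : ‖F - bv * y - b * u‖ ≤ 3 * B * σ := by
    have g1 : ‖bv * y‖ ≤ B * σ := by rw [norm_mul]; exact mul_le_mul hbv hy n1 hB0
    have g2 : ‖b * u‖ ≤ B * σ := by rw [norm_mul]; exact mul_le_mul hb hu n4 hB0
    have g3 := norm_sub_le (F - bv * y) (b * u)
    have g4 := norm_sub_le F (bv * y)
    have g5 : σ ≤ B * σ := le_mul_of_one_le_left hσ0 hB1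
    linarith
  rw [← hσ]
  have hBB : ∀ {p q : ℝ}, |p| ≤ B → |q| ≤ B → |p * q| ≤ B ^ 2 := fun {p q} hp hq => by
    rw [abs_mul, sq]; exact mul_le_mul hp hq (abs_nonneg _) hB0
  have e1 := mul_ip_bound (hBB hB.hh' hB.hD) (le_refl ‖x‖) hy
  have e2 := mul_ip_bound hB.hD' (le_refl ‖x‖) hL'
  have e3 := mul_ip_bound hB.hα (le_refl ‖x‖) hG
  have e4 := mul_ip_bound hbr (le_refl ‖x‖) hL'
  have e5 := mul_ip_bound (show |2 * Z| ≤ 2 * Z by rw [abs_of_nonneg (by linarith)])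
    (le_refl ‖x‖) hu
  have e6 : |D' * curQ A k y z t Y| ≤ B * (7 * B * σ ^ 2) := by
    rw [abs_mul]; exact mul_le_mul hB.hD' hq' (abs_nonneg _) hB0
  have e7 := mul_ip_bound (hBB hB.hh hB.hh') hy hy
  have e8 := mul_ip_bound (hBB hB.hk hB.hh') hy hz'
  have e9 := ip_bound hL' hG
  have e10 : |(D' - br) * (-D * ‖x‖ ^ 2)| ≤ 2 * B * (-D * ‖x‖ ^ 2) := by
    have h0 : 0 ≤ -D * ‖x‖ ^ 2 := mul_nonneg (by linarith [hB.D0]) (sq_nonneg _)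
    rw [abs_mul, abs_of_nonneg h0]
    apply mul_le_mul_of_nonneg_right _ h0
    exact (abs_sub _ _).trans (by linarith [hB.hD'])
  -- Sorted by degree in x: quadratic terms, then linear terms, then terms without x.
  have key : curLow A h D k h' D' br Z bv b x y z t Y u F = (br - D' / 2) * ‖x‖ ^ 2
      - 1 / 2 * ((D' - br) * (-D * ‖x‖ ^ 2))
      + ((h' * D) * ip x y + D' * ip x (curL h k y z) + (D / 2 - 1) * ip x (F - bv * y - b * u)
        - br * ip x (curL h k y z) + 2 * Z * ip x u)
      + (-(1 / 4) * (D' * curQ A k y z t Y) + 2 * ((h * h') * ip y y) + 2 * ((k * h') * ip y z)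
        + ip (curL h k y z) (F - bv * y - b * u)) := by
    have hsplit : F - br * x - bv * y - b * u = (F - bv * y - b * u) - br * x := by ring
    unfold curLow curBulk
    rw [hsplit]
    generalize F - bv * y - b * u = G
    unfold curW
    simp only [ip_sub_left, ip_add_right, ip_ofReal_mul_left, ip_ofReal_mul_right]
    rw [← ip_self x, ip_comm G x, ip_comm u x, ip_comm G (curL h k y z)]
    ring
  rw [key]
  have b1 := (abs_le.1 e1).1
  have b2 := (abs_le.1 e2).1
  have b3 := (abs_le.1 e3).1
  have b4 := (abs_le.1 e4).2
  have b5 := (abs_le.1 e5).1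
  have b6 := (abs_le.1 e6).2
  have b7 := (abs_le.1 e7).1
  have b8 := (abs_le.1 e8).1
  have b9 := (abs_le.1 e9).1
  have b10 := (abs_le.1 e10).2
  have p1 : 0 ≤ B ^ 2 * (‖x‖ * σ) := by positivity
  have p2 : 0 ≤ B ^ 2 * σ ^ 2 := by positivity
  linarith

set_option maxHeartbeats 2000000 in
/-- The pointwise form of the energy estimate: `Wv, Wr` are the derivatives of the weight `W`. -/
theorem exists_master (B ρ c₁ K : ℝ) (hB1 : 1 ≤ B) (hρ : 0 < ρ) (hc₁ : 0 < c₁) (hK : 0 ≤ K) :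
    ∃ Z c₀ C lam C₁ ε : ℝ, 0 < Z ∧ 0 < c₀ ∧ 0 < C ∧ 0 < lam ∧ 0 < C₁ ∧ 0 < ε ∧
    ∀ {A h D k h' D' s c br : ℝ} {x y z t Y u F bv b : ℂ}, PtBound B ρ A h D k h' D' s c →
      z = s * Y - 2 * Complex.I * c * u → |br| ≤ B → ‖bv‖ ≤ B → ‖b‖ ≤ B →
      c₁ ≤ br - D' / 2 + K * (-D) →
      c₀ * (-D * ‖x‖ ^ 2 + tangSq y t Y u) ≤ curR A h D k x y z t Y + Z * ‖u‖ ^ 2 ∧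
      curR A h D k x y z t Y + Z * ‖u‖ ^ 2 ≤ C * (-D * ‖x‖ ^ 2 + tangSq y t Y u) ∧
      ∀ {W Wv Wr q σ₁ σ₂ μ : ℝ}, 0 ≤ W → 0 ≤ q → 0 ≤ σ₁ → 0 ≤ σ₂ → C₁ ≤ μ → C₁ ≤ μ * (-D) →
        Wr = lam * σ₁ + μ * σ₂ → |Wv + σ₁ - σ₂| ≤ ε * W + q →
        W * (c₁ / 2 * ‖x‖ ^ 2 - C * (curR A h D k x y z t Y + Z * ‖u‖ ^ 2) - C * ‖F‖ ^ 2)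
            - C * q * (‖x‖ ^ 2 + tangSq y t Y u)
          ≤ Wv * curV A h D k x y z t Y + Wr * (curR A h D k x y z t Y + Z * ‖u‖ ^ 2)
            + W * curLow A h D k h' D' br Z bv b x y z t Y u F := by
  obtain ⟨Z, c₀, hZ, hc₀, hco⟩ := exists_coercive B ρ hB1 hρ
  -- C₂ bounds |curV|, and C₃ bounds it from above by tangential terms alone. P is the coefficient
  -- of the mixed terms of `curLow_ge`, and C₄ results from splitting them by Young's inequality at
  -- the price c₁/4 |u_r|². The choice of ε makes the slow variation of the weight cost another c₁/4
  -- |u_r|², so that c₁/2 remains.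
  obtain ⟨C₂, hC₂⟩ : ∃ X : ℝ, X = 100 * B ^ 2 := ⟨_, rfl⟩
  obtain ⟨C₃, hC₃⟩ : ∃ X : ℝ, X = (100 * B ^ 4 / ρ + 100 * B ^ 2) := ⟨_, rfl⟩
  obtain ⟨P, hP⟩ : ∃ X : ℝ, X = 20 * B ^ 2 + 2 * Z := ⟨_, rfl⟩
  obtain ⟨C₄, hC₄⟩ : ∃ X : ℝ, X = 5 * (P ^ 2 / c₁ + 30 * B ^ 2) := ⟨_, rfl⟩
  obtain ⟨ε, hε⟩ : ∃ X : ℝ, X = c₁ / (4 * C₂) := ⟨_, rfl⟩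
  obtain ⟨C, hC⟩ : ∃ X : ℝ, X = 200 * B ^ 3 + Z + (B + K) / c₀ + C₄ / c₀ + C₄ + C₂ + ε * C₂ / c₀ := ⟨_, rfl⟩
  have hB0 : 0 < B := by linarith
  have hC₂0 : 0 < C₂ := by rw [hC₂]; positivity
  have hC₃0 : 0 < C₃ := by rw [hC₃]; positivity
  have hC₄0 : 0 < C₄ := by rw [hC₄]; positivity
  have hε0 : 0 < ε := by rw [hε]; positivity
  have hC0 : 0 < C := by rw [hC]; positivity
  refine ⟨Z, c₀, C, C₃ / c₀, C₂ / c₀, ε, hZ, hc₀, by positivity, by positivity, by positivity,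
    hε0, ?_⟩
  intro A h D k h' D' s c br x y z t Y u F bv b hB hz hbr hbv hb hκ
  have hcoer := hco (x := x) (y := y) (t := t) hB hz
  have hup := curR_le (x := x) (y := y) (t := t) hB hz
  have hV := curV_abs_le (x := x) (y := y) (t := t) hB hz
  have hlow := curLow_ge (x := x) (y := y) (t := t) (F := F) hB hz hbr hbv hb hZ.le
  rw [← hP] at hlow
  have hσ := tangNorm_sq_le y t Y u
  have hS0 := tangSq_nonneg y t Y u
  have hD0 := hB.D0
  have hX0 : 0 ≤ -D * ‖x‖ ^ 2 := mul_nonneg (by linarith) (sq_nonneg _)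
  have hσ0 : 0 ≤ tangNorm y t Y u := by unfold tangNorm; positivity
  have hu_le : ‖u‖ ^ 2 ≤ tangSq y t Y u := by unfold tangSq; linarith [sq_nonneg ‖y‖, sq_nonneg ‖t‖, sq_nonneg ‖Y‖]
  have hh : |h| ≤ B := hB.hh
  have hhρ : ρ ≤ h := by linarith [hB.hm, mul_nonneg (sq_nonneg k) (sq_nonneg s)]
  generalize curLow A h D k h' D' br Z bv b x y z t Y u F = low at *
  generalize curV A h D k x y z t Y = jv at *
  generalize he : curR A h D k x y z t Y + Z * ‖u‖ ^ 2 = e at *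
  generalize tangNorm y t Y u = σ at *
  generalize tangSq y t Y u = S at *
  have hX : 0 ≤ ‖x‖ ^ 2 := sq_nonneg _
  have hCge : 200 * B ^ 3 + Z ≤ C := by
    have : 0 ≤ (B + K) / c₀ + C₄ / c₀ + C₄ + C₂ + ε * C₂ / c₀ := by positivity
    linarith
  have he_up : e ≤ C * (-D * ‖x‖ ^ 2 + S) := by
    have h1 : Z * ‖u‖ ^ 2 ≤ Z * (-D * ‖x‖ ^ 2 + S) := by gcongr; linarith
    have h2 : (200 * B ^ 3 + Z) * (-D * ‖x‖ ^ 2 + S) ≤ C * (-D * ‖x‖ ^ 2 + S) := by gcongr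
    linarith
  refine ⟨hcoer, he_up, ?_⟩
  have he0 : 0 ≤ e := (by positivity : 0 ≤ c₀ * (-D * ‖x‖ ^ 2 + S)).trans hcoer
  have hSe : S ≤ e / c₀ := by
    rw [le_div_iff₀ hc₀]; linarith [mul_nonneg hc₀.le hX0]
  have hDXe : -D * ‖x‖ ^ 2 ≤ e / c₀ := by
    rw [le_div_iff₀ hc₀]; linarith [mul_nonneg hc₀.le hS0]
  -- bounds for the `v`-flux
  have hxσ : ‖x‖ * σ ≤ 1 / 2 * (‖x‖ ^ 2 + σ ^ 2) := by nlinarith [sq_nonneg (‖x‖ - σ)]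
  have hjv : |jv| ≤ C₂ * (‖x‖ ^ 2 + S) := by
    have h1 : |jv| ≤ |jv + h * ‖x‖ ^ 2| + |h| * ‖x‖ ^ 2 := by
      have := abs_sub (jv + h * ‖x‖ ^ 2) (h * ‖x‖ ^ 2)
      rw [add_sub_cancel_right, abs_mul, abs_of_nonneg hX] at this
      exact this
    have h2 : |h| * ‖x‖ ^ 2 ≤ B ^ 2 * ‖x‖ ^ 2 := by
      gcongr; exact hh.trans (le_self_pow₀ hB1 (by norm_num))
    have h3 : 3 * B ^ 2 * (‖x‖ * σ) ≤ 3 * B ^ 2 * (1 / 2 * (‖x‖ ^ 2 + σ ^ 2)) := by gcongr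
    have h4 : B ^ 2 * σ ^ 2 ≤ B ^ 2 * (4 * S) := by gcongr
    have h5 : 0 ≤ B ^ 2 * ‖x‖ ^ 2 := by positivity
    have h6 : 0 ≤ B ^ 2 * S := by positivity
    rw [hC₂]
    linarith
  -- From above, the term -h |u_r|² with h ≥ ρ absorbs the mixed terms, so no |u_r|² survives.
  have hjvneg : jv ≤ C₃ * S := by
    have h1 := (abs_le.1 hV).2
    have h2 : 3 * B ^ 2 * (‖x‖ * σ) ≤ ρ * ‖x‖ ^ 2 + 9 * B ^ 4 / (4 * ρ) * σ ^ 2 := by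
      have : ρ * ‖x‖ ^ 2 + 9 * B ^ 4 / (4 * ρ) * σ ^ 2 - 3 * B ^ 2 * (‖x‖ * σ)
          = (ρ * ‖x‖ - 3 * B ^ 2 / 2 * σ) ^ 2 / ρ := by field_simp; ring
      have h3 : 0 ≤ (ρ * ‖x‖ - 3 * B ^ 2 / 2 * σ) ^ 2 / ρ := by positivity
      linarith
    have h3 : ρ * ‖x‖ ^ 2 ≤ h * ‖x‖ ^ 2 := by gcongr
    have h4 : 9 * B ^ 4 / (4 * ρ) * σ ^ 2 ≤ 9 * B ^ 4 / (4 * ρ) * (4 * S) := by gcongr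
    have h5 : 13 * B ^ 2 * σ ^ 2 ≤ 13 * B ^ 2 * (4 * S) := by gcongr
    have h6 : C₃ * S = 9 * B ^ 4 / (4 * ρ) * (4 * S) + 13 * B ^ 2 * (4 * S)
        + (91 * B ^ 4 / ρ + 48 * B ^ 2) * S := by
      rw [hC₃]; field_simp; ring
    have h7 : 0 ≤ (91 * B ^ 4 / ρ + 48 * B ^ 2) * S := by positivity
    linarith
  -- the lower bound for the bulk
  have hlow' : 3 * c₁ / 4 * ‖x‖ ^ 2 - ((B + K) / c₀ + C₄ / c₀) * e - C₄ * ‖F‖ ^ 2 ≤ low := by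
    have h1 : P * (‖x‖ * (σ + ‖F‖)) ≤ c₁ / 4 * ‖x‖ ^ 2 + P ^ 2 / c₁ * (σ + ‖F‖) ^ 2 := by
      have : c₁ / 4 * ‖x‖ ^ 2 + P ^ 2 / c₁ * (σ + ‖F‖) ^ 2 - P * (‖x‖ * (σ + ‖F‖))
          = (c₁ / 2 * ‖x‖ - P * (σ + ‖F‖)) ^ 2 / c₁ := by field_simp; ring
      have h3 : 0 ≤ (c₁ / 2 * ‖x‖ - P * (σ + ‖F‖)) ^ 2 / c₁ := by positivity
      linarith
    have h2 : (σ + ‖F‖) ^ 2 ≤ 5 * S + 5 * ‖F‖ ^ 2 := by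
      nlinarith [sq_nonneg (σ - 4 * ‖F‖)]
    have h3 : (P ^ 2 / c₁ + 30 * B ^ 2) * (σ + ‖F‖) ^ 2
        ≤ (P ^ 2 / c₁ + 30 * B ^ 2) * (5 * S + 5 * ‖F‖ ^ 2) := by gcongr
    have h4 : (P ^ 2 / c₁ + 30 * B ^ 2) * (5 * S + 5 * ‖F‖ ^ 2) = C₄ * S + C₄ * ‖F‖ ^ 2 := by
      rw [hC₄]; ring
    rw [h4] at h3
    have h5 : C₄ * S ≤ C₄ / c₀ * e := by
      calc C₄ * S ≤ C₄ * (e / c₀) := by gcongr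
        _ = _ := by ring
    have h6 : (B + K) * (-D * ‖x‖ ^ 2) ≤ (B + K) / c₀ * e := by
      calc (B + K) * (-D * ‖x‖ ^ 2) ≤ (B + K) * (e / c₀) := by gcongr
        _ = _ := by ring
    have h7 : c₁ * ‖x‖ ^ 2 ≤ (br - D' / 2) * ‖x‖ ^ 2 + K * (-D * ‖x‖ ^ 2) := by
      have := mul_le_mul_of_nonneg_right hκ hX
      linarith
    linarith
  intro W Wv Wr q σ₁ σ₂ μ hW hq hσ₁ hσ₂ hμ hμD hWr hWv
  -- Right edge of the cut-off: only the upper bound of the v-flux matters, so a fixed slope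
  -- suffices.
  have hs1 : 0 ≤ σ₁ * (C₃ / c₀ * e - jv) := by
    refine mul_nonneg hσ₁ ?_
    have : C₃ * S ≤ C₃ * (e / c₀) := by gcongr
    have h2 : C₃ * (e / c₀) = C₃ / c₀ * e := by ring
    linarith
  -- Left edge: here |u_r|² has to be dominated, and the energy contains it only with the factor -D.
  -- This is the reason for the second condition C₁ ≤ μ (-D).
  have hs2 : 0 ≤ σ₂ * (μ * e + jv) := by
    refine mul_nonneg hσ₂ ?_
    have hμ0 : 0 ≤ μ := le_trans (by positivity) hμ
    have h1 : μ * (c₀ * (-D * ‖x‖ ^ 2 + S)) ≤ μ * e := by gcongr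
    have h2 : C₂ / c₀ * c₀ = C₂ := by field_simp
    have h3 : C₂ / c₀ * (c₀ * ‖x‖ ^ 2) ≤ μ * (-D) * (c₀ * ‖x‖ ^ 2) := by gcongr
    have h4 : C₂ / c₀ * (c₀ * S) ≤ μ * (c₀ * S) := by gcongr
    have h5 := (abs_le.1 hjv).1
    rw [← mul_assoc, h2] at h3 h4
    linarith
  have hp : -((ε * W + q) * (C₂ * (‖x‖ ^ 2 + S))) ≤ (Wv + σ₁ - σ₂) * jv := by
    have h1 : |(Wv + σ₁ - σ₂) * jv| ≤ (ε * W + q) * (C₂ * (‖x‖ ^ 2 + S)) := by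
      rw [abs_mul]
      exact mul_le_mul hWv hjv (abs_nonneg _) (by positivity)
    exact (abs_le.1 h1).1
  have hid : Wv * jv + Wr * e = (Wv + σ₁ - σ₂) * jv + σ₁ * (C₃ / c₀ * e - jv)
      + σ₂ * (μ * e + jv) := by rw [hWr]; ring
  have hεC : ε * C₂ = c₁ / 4 := by rw [hε]; field_simp
  have hWlow := mul_le_mul_of_nonneg_left hlow' hW
  have f1 : ε * W * (C₂ * (‖x‖ ^ 2 + S)) ≤ W * (c₁ / 4 * ‖x‖ ^ 2) + W * (ε * C₂ / c₀ * e) := by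
    have : ε * W * (C₂ * (‖x‖ ^ 2 + S)) = W * (ε * C₂ * ‖x‖ ^ 2) + W * (ε * C₂ * S) := by ring
    rw [this, hεC]
    have h8 : c₁ / 4 * S ≤ c₁ / 4 / c₀ * e := by
      calc c₁ / 4 * S ≤ c₁ / 4 * (e / c₀) := by gcongr
        _ = _ := by ring
    have := mul_le_mul_of_nonneg_left h8 hW
    linarith
  have f2 : C₂ * q * (‖x‖ ^ 2 + S) ≤ C * q * (‖x‖ ^ 2 + S) := by
    have : C₂ ≤ C := by
      have : 0 ≤ 200 * B ^ 3 + Z + (B + K) / c₀ + C₄ / c₀ + C₄ + ε * C₂ / c₀ := by positivity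
      linarith
    gcongr
  have f3 : W * (((B + K) / c₀ + C₄ / c₀ + ε * C₂ / c₀) * e) ≤ W * (C * e) := by
    have : (B + K) / c₀ + C₄ / c₀ + ε * C₂ / c₀ ≤ C := by
      have : 0 ≤ 200 * B ^ 3 + Z + C₄ + C₂ := by positivity
      linarith
    gcongr
  have f4 : W * (C₄ * ‖F‖ ^ 2) ≤ W * (C * ‖F‖ ^ 2) := by
    have : C₄ ≤ C := by
      have : 0 ≤ 200 * B ^ 3 + Z + (B + K) / c₀ + C₄ / c₀ + C₂ + ε * C₂ / c₀ := by positivity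
      linarith
    gcongr
  rw [hid]
  linarith

end Master


/-! ### Derivatives of the currents and the divergence identity. -/

section Derivative

/-- The derivative of `curQ`. -/
def derQ (A k : ℝ) (y z t Y y' z' t' Y' : ℂ) : ℝ :=
  A * (ip y' y + ip y y') + 2 * k * (ip y' z + ip y z') + (ip t' t + ip t t') + (ip Y' Y + ip Y Y')

/-- The derivative of `curR` along `r`. -/
noncomputable def derR (A h D k h' D' : ℝ) (x y z t Y x' y' z' t' Y' : ℂ) : ℝ :=
  (ip (h' * y + curL h k y' z') (curL h k y z) + ip (curL h k y z) (h' * y + curL h k y' z'))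
    + (D' * ip x (curL h k y z)
      + D * (ip x' (curL h k y z) + ip x (h' * y + curL h k y' z')))
    + (D' / 2 * (1 / 2 * D * ip x x - 1 / 2 * curQ A k y z t Y)
      + (D / 2 - 1) * ((1 / 2 * D' * ip x x + 1 / 2 * D * (ip x' x + ip x x'))
        - 1 / 2 * derQ A k y z t Y y' z' t' Y'))

/-- The derivative of `curV` along `v`. -/
noncomputable def derV (A h D k : ℝ) (x y z t Y x' y' z' t' Y' : ℂ) : ℝ :=
  -h * (ip x' x + ip x x')
    + (D / 2 - 1) * (A * (ip x' y + ip x y') + k * (ip x' z + ip x z'))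
    + (A * (ip y' (curL h k y z) + ip y (curL h k y' z'))
      + k * (ip z' (curL h k y z) + ip z (curL h k y' z')))
    - 1 / 2 * h * derQ A k y z t Y y' z' t' Y'

/-- The flux through hypersurfaces of constant `φ`, without the angular contribution. -/
noncomputable def curPhi (A h D k : ℝ) (x y t Y : ℂ) : ℝ :=
  (D / 2 - 1) * k * (ip x y + ip x x) + h * k * ip y y
    - k * (1 / 2 * A * ip y y + 1 / 2 * D * ip x x + 1 / 2 * ip t t + 1 / 2 * ip Y Y)

/-- The derivative of `curPhi`. -/
noncomputable def derPhi (A h D k : ℝ) (x y t Y x' y' t' Y' : ℂ) : ℝ :=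
  (D / 2 - 1) * k * ((ip x' y + ip x y') + (ip x' x + ip x x')) + h * k * (ip y' y + ip y y')
    - k * (1 / 2 * A * (ip y' y + ip y y') + 1 / 2 * D * (ip x' x + ip x x')
      + 1 / 2 * (ip t' t + ip t t') + 1 / 2 * (ip Y' Y + ip Y Y'))

/-- A purely algebraic identity, multiplied by s = sin θ, which is the density of the area element.
Lt stands for ∂_θ (sin θ u_θ). The three hypotheses say how the covariant derivative acts on u_r,
u_v and u_φ. The four groups on the left are the derivatives in r, v, φ and θ; on the right the
principal part of the operator is paired with the multiplier. -/
theorem divergence_identity (A s c h D k h' D' : ℝ)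
    (x y z t Y xr yr yv yp xp zp tr tv tp Yr Yv Yp Lt : ℂ)
    (hYr : s * Yr = xp + 2 * Complex.I * c * x) (hYv : s * Yv = yp + 2 * Complex.I * c * y)
    (hYp : s * Yp = zp + 2 * Complex.I * c * z) :
    s * derR A h D k h' D' x y z t Y xr yr xp tr Yr
      + s * derV A h D k x y z t Y yr yv yp tv Yv
      + (s * derPhi A h D k x y t Y xp yp tp Yp
        + (ip Yp (curW h D k x y z) + ip Y (curW h D k xp yp zp)))
      + (ip Lt (curW h D k x y z) + s * ip t (curW h D k tr tv tp))
    = s * curBulk A h D k h' D' x y z t Y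
      + ip (s * (A * yv + 2 * k * yp + 2 * h * yr + 2 * k * xp + D * xr)
        + Lt + Yp + 2 * Complex.I * c * Y) (curW h D k x y z) := by
  have e1 := congrArg Complex.re hYr
  have e2 := congrArg Complex.im hYr
  have e3 := congrArg Complex.re hYv
  have e4 := congrArg Complex.im hYv
  have e5 := congrArg Complex.re hYp
  have e6 := congrArg Complex.im hYp
  simp at e1 e2 e3 e4 e5 e6
  unfold derR derV derPhi curBulk derQ curQ ip curW curL
  simp
  linear_combination (-(D / 2 - 1)) * Y.re * e1 + (-(D / 2 - 1)) * Y.im * e2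
    - h * Y.re * e3 - h * Y.im * e4 - k * Y.re * e5 - k * Y.im * e6

theorem hasDerivAt_ip {p q : ℝ → ℂ} {p' q' : ℂ} {x : ℝ} (hp : HasDerivAt p p' x)
    (hq : HasDerivAt q q' x) :
    HasDerivAt (fun y => ip (p y) (q y)) (ip p' (q x) + ip (p x) q') x := by
  have hre : ∀ {f : ℝ → ℂ} {f' : ℂ}, HasDerivAt f f' x → HasDerivAt (fun y => (f y).re) f'.re x :=
    fun h => (Complex.reCLM.hasFDerivAt.comp_hasDerivAt x h)
  have him : ∀ {f : ℝ → ℂ} {f' : ℂ}, HasDerivAt f f' x → HasDerivAt (fun y => (f y).im) f'.im x :=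
    fun h => (Complex.imCLM.hasFDerivAt.comp_hasDerivAt x h)
  refine (((hre hp).mul (hre hq)).add ((him hp).mul (him hq))).congr_deriv ?_
  unfold ip
  ring

variable {x y z t Y : ℝ → ℂ} {x' y' z' t' Y' : ℂ} {p : ℝ}

theorem hasDerivAt_curL (h k : ℝ) (hy : HasDerivAt y y' p) (hz : HasDerivAt z z' p) :
    HasDerivAt (fun s => curL h k (y s) (z s)) (curL h k y' z') p :=
  (hy.const_mul _).add (hz.const_mul _)

theorem hasDerivAt_curQ (A k : ℝ) (hy : HasDerivAt y y' p) (hz : HasDerivAt z z' p)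
    (ht : HasDerivAt t t' p) (hY : HasDerivAt Y Y' p) :
    HasDerivAt (fun s => curQ A k (y s) (z s) (t s) (Y s))
      (derQ A k (y p) (z p) (t p) (Y p) y' z' t' Y') p :=
  ((((hasDerivAt_ip hy hy).const_mul A).add ((hasDerivAt_ip hy hz).const_mul (2 * k))).add
    (hasDerivAt_ip ht ht)).add (hasDerivAt_ip hY hY)

theorem hasDerivAt_curR (A k : ℝ) {h D : ℝ → ℝ} {h' D' : ℝ} (hh : HasDerivAt h h' p)
    (hD : HasDerivAt D D' p) (hx : HasDerivAt x x' p) (hy : HasDerivAt y y' p)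
    (hz : HasDerivAt z z' p) (ht : HasDerivAt t t' p) (hY : HasDerivAt Y Y' p) :
    HasDerivAt (fun s => curR A (h s) (D s) k (x s) (y s) (z s) (t s) (Y s))
      (derR A (h p) (D p) k h' D' (x p) (y p) (z p) (t p) (Y p) x' y' z' t' Y') p := by
  have hL : HasDerivAt (fun s => curL (h s) k (y s) (z s))
      (h' * y p + curL (h p) k y' z') p := by
    refine ((hh.ofReal_comp.mul hy).add (hz.const_mul (k : ℂ))).congr_deriv ?_
    unfold curL
    ring
  have hα : HasDerivAt (fun s => D s / 2 - 1) (D' / 2) p := (hD.div_const 2).sub_const 1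
  have h1 := hasDerivAt_ip hL hL
  have h2 := hD.mul (hasDerivAt_ip hx hL)
  have h3 := hα.mul (((hD.const_mul (1 / 2)).mul (hasDerivAt_ip hx hx)).sub
    ((hasDerivAt_curQ A k hy hz ht hY).const_mul (1 / 2)))
  exact (h1.add h2).add h3

theorem hasDerivAt_curV (A h D k : ℝ) (hx : HasDerivAt x x' p) (hy : HasDerivAt y y' p)
    (hz : HasDerivAt z z' p) (ht : HasDerivAt t t' p) (hY : HasDerivAt Y Y' p) :
    HasDerivAt (fun s => curV A h D k (x s) (y s) (z s) (t s) (Y s))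
      (derV A h D k (x p) (y p) (z p) (t p) (Y p) x' y' z' t' Y') p := by
  have hL := hasDerivAt_curL h k hy hz
  exact ((((hasDerivAt_ip hx hx).const_mul (-h)).add
    ((((hasDerivAt_ip hx hy).const_mul A).add ((hasDerivAt_ip hx hz).const_mul k)).const_mul
      (D / 2 - 1))).add (((hasDerivAt_ip hy hL).const_mul A).add
      ((hasDerivAt_ip hz hL).const_mul k))).sub
    ((hasDerivAt_curQ A k hy hz ht hY).const_mul (1 / 2 * h))

theorem hasDerivAt_curPhi (A h D k : ℝ) (hx : HasDerivAt x x' p) (hy : HasDerivAt y y' p)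
    (ht : HasDerivAt t t' p) (hY : HasDerivAt Y Y' p) :
    HasDerivAt (fun s => curPhi A h D k (x s) (y s) (t s) (Y s))
      (derPhi A h D k (x p) (y p) (t p) (Y p) x' y' t' Y') p :=
  ((((hasDerivAt_ip hx hy).add (hasDerivAt_ip hx hx)).const_mul ((D / 2 - 1) * k)).add
    ((hasDerivAt_ip hy hy).const_mul (h * k))).sub
    (((((hasDerivAt_ip hy hy).const_mul (1 / 2 * A)).add
      ((hasDerivAt_ip hx hx).const_mul (1 / 2 * D))).add
      ((hasDerivAt_ip ht ht).const_mul (1 / 2))).add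
      ((hasDerivAt_ip hY hY).const_mul (1 / 2)) |>.const_mul k)

theorem hasDerivAt_curW (h D k : ℝ) (hx : HasDerivAt x x' p) (hy : HasDerivAt y y' p)
    (hz : HasDerivAt z z' p) :
    HasDerivAt (fun s => curW h D k (x s) (y s) (z s)) (curW h D k x' y' z') p :=
  (hx.const_mul _).add (hasDerivAt_curL h k hy hz)

end Derivative

/-! ### Continuity and boundedness of the currents. -/

section BCCurrents

variable {a M k : ℝ} {A h D h' D' : ℝ → ℝ → ℝ → ℝ → ℝ}
  {x y z t Y x' y' z' t' Y' : ℝ → ℝ → ℝ → ℝ → ℂ}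

theorem BC.ofReal (hh : BC a M h) : BC a M (fun v r θ φ => ((h v r θ φ : ℝ) : ℂ)) where
  cont := Complex.continuous_ofReal.comp_continuousOn hh.cont
  bdd N r₁ hr₁ := by
    obtain ⟨C, h0, h⟩ := hh.bdd N r₁ hr₁
    exact ⟨C, h0, fun v r θ φ hv hr hθ hφ => by
      rw [Complex.norm_real]; exact h v r θ φ hv hr hθ hφ⟩

theorem BC.curL (hh : BC a M h) (hy : BC a M y) (hz : BC a M z) :
    BC a M (fun v r θ φ => curL (h v r θ φ) k (y v r θ φ) (z v r θ φ)) :=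
  (hh.ofReal.cmul hy).add ((bc_const _).cmul hz)

theorem BC.curW (hh : BC a M h) (hD : BC a M D) (hx : BC a M x) (hy : BC a M y) (hz : BC a M z) :
    BC a M (fun v r θ φ => curW (h v r θ φ) (D v r θ φ) k (x v r θ φ) (y v r θ φ) (z v r θ φ)) := by
  have h1 : BC a M (fun v r θ φ => D v r θ φ / 2 - 1) := by
    simpa only [div_eq_mul_inv] using (hD.mul (bc_const _)).sub (bc_const _)
  exact (h1.ofReal.cmul hx).add (hh.curL hy hz)

theorem BC.curQ (hA : BC a M A) (hy : BC a M y) (hz : BC a M z) (ht : BC a M t) (hY : BC a M Y) :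
    BC a M (fun v r θ φ =>
      curQ (A v r θ φ) k (y v r θ φ) (z v r θ φ) (t v r θ φ) (Y v r θ φ)) :=
  (((hA.mul (hy.ip hy)).add ((bc_const _).mul (hy.ip hz))).add (ht.ip ht)).add (hY.ip hY)

theorem BC.derQ (hA : BC a M A) (hy : BC a M y) (hz : BC a M z) (ht : BC a M t) (hY : BC a M Y)
    (hy' : BC a M y') (hz' : BC a M z') (ht' : BC a M t') (hY' : BC a M Y') :
    BC a M (fun v r θ φ => derQ (A v r θ φ) k (y v r θ φ) (z v r θ φ) (t v r θ φ) (Y v r θ φ)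
      (y' v r θ φ) (z' v r θ φ) (t' v r θ φ) (Y' v r θ φ)) :=
  (((hA.mul ((hy'.ip hy).add (hy.ip hy'))).add ((bc_const _).mul ((hy'.ip hz).add (hy.ip hz')))).add
    ((ht'.ip ht).add (ht.ip ht'))).add ((hY'.ip hY).add (hY.ip hY'))

theorem BC.halfSub (hD : BC a M D) : BC a M (fun v r θ φ => D v r θ φ / 2 - 1) := by
  simpa only [div_eq_mul_inv] using (hD.mul (bc_const _)).sub (bc_const _)

theorem BC.curR (hA : BC a M A) (hh : BC a M h) (hD : BC a M D) (hx : BC a M x) (hy : BC a M y)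
    (hz : BC a M z) (ht : BC a M t) (hY : BC a M Y) :
    BC a M (fun v r θ φ => curR (A v r θ φ) (h v r θ φ) (D v r θ φ) k
      (x v r θ φ) (y v r θ φ) (z v r θ φ) (t v r θ φ) (Y v r θ φ)) := by
  have hL : BC a M _ := hh.curL (k := k) hy hz
  exact ((hL.ip hL).add (hD.mul (hx.ip hL))).add (hD.halfSub.mul
    ((((bc_const _).mul hD).mul (hx.ip hx)).sub ((bc_const _).mul (hA.curQ hy hz ht hY))))

theorem BC.derR (hA : BC a M A) (hh : BC a M h) (hD : BC a M D) (hh' : BC a M h') (hD' : BC a M D')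
    (hx : BC a M x) (hy : BC a M y) (hz : BC a M z) (ht : BC a M t) (hY : BC a M Y)
    (hx' : BC a M x') (hy' : BC a M y') (hz' : BC a M z') (ht' : BC a M t') (hY' : BC a M Y') :
    BC a M (fun v r θ φ => derR (A v r θ φ) (h v r θ φ) (D v r θ φ) k (h' v r θ φ) (D' v r θ φ)
      (x v r θ φ) (y v r θ φ) (z v r θ φ) (t v r θ φ) (Y v r θ φ)
      (x' v r θ φ) (y' v r θ φ) (z' v r θ φ) (t' v r θ φ) (Y' v r θ φ)) := by
  have hL : BC a M _ := hh.curL (k := k) hy hz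
  have hL' : BC a M _ := (hh'.ofReal.cmul hy).add (hh.curL (k := k) hy' hz')
  have hD2 : BC a M (fun v r θ φ => D' v r θ φ / 2) := by
    simpa only [div_eq_mul_inv] using hD'.mul (bc_const _)
  exact (((hL'.ip hL).add (hL.ip hL')).add ((hD'.mul (hx.ip hL)).add
    (hD.mul ((hx'.ip hL).add (hx.ip hL'))))).add ((hD2.mul
    ((((bc_const _).mul hD).mul (hx.ip hx)).sub ((bc_const _).mul (hA.curQ hy hz ht hY)))).add
    (hD.halfSub.mul (((((bc_const _).mul hD').mul (hx.ip hx)).add (((bc_const _).mul hD).mul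
      ((hx'.ip hx).add (hx.ip hx')))).sub ((bc_const _).mul
      (hA.derQ hy hz ht hY hy' hz' ht' hY')))))

theorem BC.curV (hA : BC a M A) (hh : BC a M h) (hD : BC a M D) (hx : BC a M x) (hy : BC a M y)
    (hz : BC a M z) (ht : BC a M t) (hY : BC a M Y) :
    BC a M (fun v r θ φ => curV (A v r θ φ) (h v r θ φ) (D v r θ φ) k
      (x v r θ φ) (y v r θ φ) (z v r θ φ) (t v r θ φ) (Y v r θ φ)) := by
  have hL : BC a M _ := hh.curL (k := k) hy hz
  exact (((hh.neg.mul (hx.ip hx)).add (hD.halfSub.mul ((hA.mul (hx.ip hy)).add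
    ((bc_const _).mul (hx.ip hz))))).add ((hA.mul (hy.ip hL)).add ((bc_const _).mul
    (hz.ip hL)))).sub (((bc_const _).mul hh).mul (hA.curQ hy hz ht hY))

theorem BC.derV (hA : BC a M A) (hh : BC a M h) (hD : BC a M D)
    (hx : BC a M x) (hy : BC a M y) (hz : BC a M z) (ht : BC a M t) (hY : BC a M Y)
    (hx' : BC a M x') (hy' : BC a M y') (hz' : BC a M z') (ht' : BC a M t') (hY' : BC a M Y') :
    BC a M (fun v r θ φ => derV (A v r θ φ) (h v r θ φ) (D v r θ φ) k
      (x v r θ φ) (y v r θ φ) (z v r θ φ) (t v r θ φ) (Y v r θ φ)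
      (x' v r θ φ) (y' v r θ φ) (z' v r θ φ) (t' v r θ φ) (Y' v r θ φ)) := by
  have hL : BC a M _ := hh.curL (k := k) hy hz
  have hL' : BC a M _ := hh.curL (k := k) hy' hz'
  exact (((hh.neg.mul ((hx'.ip hx).add (hx.ip hx'))).add (hD.halfSub.mul
    ((hA.mul ((hx'.ip hy).add (hx.ip hy'))).add
    ((bc_const _).mul ((hx'.ip hz).add (hx.ip hz')))))).add
    ((hA.mul ((hy'.ip hL).add (hy.ip hL'))).add ((bc_const _).mul
    ((hz'.ip hL).add (hz.ip hL'))))).sub (((bc_const _).mul hh).mul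
    (hA.derQ hy hz ht hY hy' hz' ht' hY'))

theorem BC.derPhi (hA : BC a M A) (hh : BC a M h) (hD : BC a M D)
    (hx : BC a M x) (hy : BC a M y) (ht : BC a M t) (hY : BC a M Y)
    (hx' : BC a M x') (hy' : BC a M y') (ht' : BC a M t') (hY' : BC a M Y') :
    BC a M (fun v r θ φ => derPhi (A v r θ φ) (h v r θ φ) (D v r θ φ) k
      (x v r θ φ) (y v r θ φ) (t v r θ φ) (Y v r θ φ)
      (x' v r θ φ) (y' v r θ φ) (t' v r θ φ) (Y' v r θ φ)) := by
  exact (((hD.halfSub.mul (bc_const _)).mul (((hx'.ip hy).add (hx.ip hy')).add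
    ((hx'.ip hx).add (hx.ip hx')))).add ((hh.mul (bc_const _)).mul
    ((hy'.ip hy).add (hy.ip hy')))).sub ((bc_const _).mul
    ((((((bc_const _).mul hA).mul ((hy'.ip hy).add (hy.ip hy'))).add
    (((bc_const _).mul hD).mul ((hx'.ip hx).add (hx.ip hx')))).add
    ((bc_const _).mul ((ht'.ip ht).add (ht.ip ht')))).add
    ((bc_const _).mul ((hY'.ip hY).add (hY.ip hY')))))

end BCCurrents


/-! ## The energy identity for generalised Teukolsky operators -/

/-- Teukolsky operators of spin `2` with general lower order coefficients.  Here `k = ± a`. -/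
noncomputable def opGen (a M k : ℝ) (br : ℝ → ℝ) (bv : ℝ → ℝ → ℂ) (b : ℂ)
    (u : ℝ → ℝ → ℝ → ℝ → ℂ) : ℝ → ℝ → ℝ → ℝ → ℂ :=
  fun v r θ φ =>
    (a : ℂ) ^ 2 * (Real.sin θ : ℂ) ^ 2 * pV (pV u) v r θ φ
      + 2 * k * pV (pPhi u) v r θ φ
      + 2 * ((r : ℂ) ^ 2 + (a : ℂ) ^ 2) * pV (pR a M u) v r θ φ
      + 2 * k * pPhi (pR a M u) v r θ φ
      + (Delta a M r : ℂ) * pR a M (pR a M u) v r θ φ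
      + bv r θ * pV u v r θ φ + (br r : ℂ) * pR a M u v r θ φ
      + spinLap 2 u v r θ φ + b * u v r θ φ

/-- The flux density of `u` through hypersurfaces of constant `r`, with a zeroth order term. -/
noncomputable def eDens (a M k Z : ℝ) (u : ℝ → ℝ → ℝ → ℝ → ℂ) (v r θ φ : ℝ) : ℝ :=
  curR (k ^ 2 * Real.sin θ ^ 2) (r ^ 2 + a ^ 2) (Delta a M r) k (pR a M u v r θ φ)
    (pV u v r θ φ) (pPhi u v r θ φ) (pTheta u v r θ φ) (covD u v r θ φ) + Z * ‖u v r θ φ‖ ^ 2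

/-- The flux density of `u` through hypersurfaces of constant `v`. -/
noncomputable def eFlux (a M k : ℝ) (u : ℝ → ℝ → ℝ → ℝ → ℂ) (v r θ φ : ℝ) : ℝ :=
  curV (k ^ 2 * Real.sin θ ^ 2) (r ^ 2 + a ^ 2) (Delta a M r) k (pR a M u v r θ φ)
    (pV u v r θ φ) (pPhi u v r θ φ) (pTheta u v r θ φ) (covD u v r θ φ)

/-- The bulk density of `u`. -/
noncomputable def eLow (a M k Z : ℝ) (br : ℝ → ℝ) (bv : ℝ → ℝ → ℂ) (b : ℂ)
    (u F : ℝ → ℝ → ℝ → ℝ → ℂ) (v r θ φ : ℝ) : ℝ :=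
  curLow (k ^ 2 * Real.sin θ ^ 2) (r ^ 2 + a ^ 2) (Delta a M r) k (2 * r) (2 * (r - M)) (br r) Z
    (bv r θ) (b + 2) (pR a M u v r θ φ)
    (pV u v r θ φ) (pPhi u v r θ φ) (pTheta u v r θ φ) (covD u v r θ φ) (u v r θ φ) (F v r θ φ)

/-- A weight `W (v, r)` with partial derivatives `Wv, Wr`, supported in `|v| ≤ N` for
`r₁ ≤ r ≤ r₊`. -/
structure WeightReg (a M N r₁ : ℝ) (W Wv Wr : ℝ → ℝ → ℝ) : Prop where
  cont : ContinuousOn (fun x : ℝ × ℝ => W x.1 x.2) (univ ×ˢ Ioc (rm a M) (rp a M))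
  contV : ContinuousOn (fun x : ℝ × ℝ => Wv x.1 x.2) (univ ×ˢ Ioc (rm a M) (rp a M))
  contR : ContinuousOn (fun x : ℝ × ℝ => Wr x.1 x.2) (univ ×ˢ Ioc (rm a M) (rp a M))
  derV : ∀ v r, r ∈ Ioc (rm a M) (rp a M) → HasDerivAt (fun x => W x r) (Wv v r) v
  derR : ∀ v r, r ∈ Ioo (rm a M) (rp a M) → HasDerivAt (fun x => W v x) (Wr v r) r
  supp : ∀ v r, r ∈ Icc r₁ (rp a M) → N < |v| → W v r = 0 ∧ Wv v r = 0 ∧ Wr v r = 0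

section Energy

variable {a M k N r₁ : ℝ} {W Wv Wr : ℝ → ℝ → ℝ} {u F : ℝ → ℝ → ℝ → ℝ → ℂ}
  {br : ℝ → ℝ} {bv : ℝ → ℝ → ℂ} {b : ℂ}

theorem bc_A : BC a M (fun _ _ θ _ => k ^ 2 * Real.sin θ ^ 2) :=
  bc_of_continuous_theta (k := fun θ => k ^ 2 * Real.sin θ ^ 2) (by fun_prop)

theorem bc_h : BC a M (fun _ r _ _ => r ^ 2 + a ^ 2) :=
  bc_of_continuous_r (k := fun r => r ^ 2 + a ^ 2) (by fun_prop)

theorem bc_Delta : BC a M (fun _ r _ _ => Delta a M r) :=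
  bc_of_continuous_r (k := fun r => Delta a M r) (by unfold Delta; fun_prop)

theorem bc_h' : BC a M (fun _ r _ _ => 2 * r) :=
  bc_of_continuous_r (k := fun r : ℝ => 2 * r) (by fun_prop)

theorem bc_Delta' : BC a M (fun _ r _ _ => 2 * (r - M)) :=
  bc_of_continuous_r (k := fun r : ℝ => 2 * (r - M)) (by fun_prop)

theorem bc_sin : BC a M (fun _ _ θ _ => Real.sin θ) :=
  bc_of_continuous_theta Real.continuous_sin

theorem SpinReg.bc_eDens (haM : |a| < M) (hu : SpinReg a M u) (Z : ℝ) :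
    BC a M (eDens a M k Z u) := by
  have h0 := hu.sm.bc
  have h1 := (bc_A (k := k)).curR (k := k) bc_h bc_Delta (hu.sm.pR haM).bc (hu.sm.pV haM).bc
    (hu.sm.pPhi haM).bc (hu.sm.pTheta haM).bc (hu.bc_covD haM)
  have h2 := (bc_const Z).mul (h0.ip h0)
  have := h1.add h2
  simp only [ip_self] at this
  exact this

theorem hasDerivAt_covD_v (haM : |a| < M) (hu : Sm a M u) {v r θ φ : ℝ}
    (hr : r ∈ Ioc (rm a M) (rp a M)) :
    HasDerivAt (fun x => covD u x r θ φ) (covD (pV u) v r θ φ) v := by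
  have := ((hu.covPhi haM).hasDerivAt_v (v := v) (θ := θ) (φ := φ) hr).div_const (Real.sin θ : ℂ)
  rwa [← covPhi_pV haM hu v r θ φ hr] at this

theorem hasDerivAt_covD_phi (haM : |a| < M) (hu : Sm a M u) {v r θ φ : ℝ}
    (hr : r ∈ Ioc (rm a M) (rp a M)) :
    HasDerivAt (fun x => covD u v r θ x) (covD (pPhi u) v r θ φ) φ := by
  have := ((hu.covPhi haM).hasDerivAt_phi (v := v) (θ := θ) (φ := φ) hr).div_const (Real.sin θ : ℂ)
  rwa [← covPhi_pPhi haM hu v r θ φ hr] at this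

theorem hasDerivAt_covD_r (haM : |a| < M) (hu : Sm a M u) {v r θ φ : ℝ}
    (hr : r ∈ Ioo (rm a M) (rp a M)) :
    HasDerivAt (fun x => covD u v x θ φ) (covD (pR a M u) v r θ φ) r := by
  have := ((hu.covPhi haM).hasDerivAt_r (v := v) (θ := θ) (φ := φ) hr).div_const (Real.sin θ : ℂ)
  rwa [← covPhi_pR haM hu v r θ φ (Ioo_subset_Ioc_self hr)] at this

/-- The spin-weighted Laplacian in terms of covariant derivatives. -/
theorem sin_mul_spinLap {v r θ φ : ℝ} (hθ : θ ∈ Ioo 0 Real.pi) :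
    (Real.sin θ : ℂ) * spinLap 2 u v r θ φ
      = deriv (fun x => (Real.sin x : ℂ) * pTheta u v r x φ) θ + covD (pPhi u) v r θ φ
        + 2 * Complex.I * (Real.cos θ : ℂ) * covD u v r θ φ
        + (Real.sin θ : ℂ) * (2 * u v r θ φ) := by
  have hs : (Real.sin θ : ℂ) ≠ 0 := Complex.ofReal_ne_zero.2 (Real.sin_pos_of_mem_Ioo hθ).ne'
  unfold spinLap covD covPhi
  push_cast at hs ⊢
  field_simp
  ring_nf
  rw [Complex.I_sq]
  ring

theorem hasDerivAt_sin_pTheta (haM : |a| < M) (hu : Sm a M u) {v r θ φ : ℝ}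
    (hr : r ∈ Ioc (rm a M) (rp a M)) :
    HasDerivAt (fun x => (Real.sin x : ℂ) * pTheta u v r x φ)
      ((Real.cos θ : ℂ) * pTheta u v r θ φ + (Real.sin θ : ℂ) * pTheta (pTheta u) v r θ φ) θ :=
  (Real.hasDerivAt_sin θ).ofReal_comp.mul ((hu.pTheta haM).hasDerivAt_theta hr)

theorem hasDerivAt_Delta (a M r : ℝ) : HasDerivAt (Delta a M) (2 * (r - M)) r := by
  have := (((hasDerivAt_id r).pow 2).sub ((hasDerivAt_id r).const_mul (2 * M))).add_const (a ^ 2)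
  refine this.congr_deriv ?_
  simp
  ring

theorem hasDerivAt_h (a r : ℝ) : HasDerivAt (fun r => r ^ 2 + a ^ 2) (2 * r) r := by
  have := ((hasDerivAt_id r).pow 2).add_const (a ^ 2)
  refine this.congr_deriv ?_
  simp

-- The divergence theorem on a slice. The r-derivative of the energy integrand differs from the
-- claimed integrand by derivatives in v, φ and θ. These integrate to zero by the support of the
-- weight, by periodicity, and by the factor sin θ respectively.
set_option maxHeartbeats 1000000 in
theorem hasDerivAt_energy (haM : |a| < M) (hk : k ^ 2 = a ^ 2) (Z : ℝ) (hu : SpinReg a M u)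
    (hr₁ : rm a M < r₁) (hW : WeightReg a M N r₁ W Wv Wr)
    (heq : ∀ v r θ φ, r ∈ Ioo (rm a M) (rp a M) → θ ∈ Ioo 0 Real.pi →
      opGen a M k br bv b u v r θ φ = F v r θ φ) {r : ℝ} (hr : r ∈ Ioo r₁ (rp a M)) :
    Integrable (fun x : ℝ × ℝ × ℝ => Real.sin x.2.1 *
        (Wv x.1 r * eFlux a M k u x.1 r x.2.1 x.2.2 + Wr x.1 r * eDens a M k Z u x.1 r x.2.1 x.2.2
          + W x.1 r * eLow a M k Z br bv b u F x.1 r x.2.1 x.2.2)) flat ∧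
    HasDerivAt (fun r => ∫ x, Real.sin x.2.1 * (W x.1 r * eDens a M k Z u x.1 r x.2.1 x.2.2) ∂flat)
      (∫ x, Real.sin x.2.1 *
        (Wv x.1 r * eFlux a M k u x.1 r x.2.1 x.2.2 + Wr x.1 r * eDens a M k Z u x.1 r x.2.1 x.2.2
          + W x.1 r * eLow a M k Z br bv b u F x.1 r x.2.1 x.2.2) ∂flat) r := by
  have hIoo : ∀ {ρ}, ρ ∈ Ioo r₁ (rp a M) → ρ ∈ Ioo (rm a M) (rp a M) := fun h =>
    ⟨hr₁.trans h.1, h.2⟩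
  have hIoc : ∀ {ρ}, ρ ∈ Icc r₁ (rp a M) → ρ ∈ Ioc (rm a M) (rp a M) := fun h =>
    ⟨hr₁.trans_le h.1, h.2⟩
  have hrr := hIoo hr
  have hrc := Ioo_subset_Ioc_self hrr
  have s0 := hu.sm
  have sx := hu.pR haM
  have sy := hu.pV haM
  have sz := hu.pPhi haM
  have st := hu.sm.pTheta haM
  have bx := sx.sm.bc
  have bY := hu.bc_covD haM
  have bxr := (sx.pR haM).sm.bc
  have byr := (sx.pV haM).sm.bc
  have bxp := (sx.pPhi haM).sm.bc
  have byv := (sy.pV haM).sm.bc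
  have byp := (sz.pV haM).sm.bc
  have bzp := (sz.pPhi haM).sm.bc
  have btr := (st.pR haM).bc
  have btv := (st.pV haM).bc
  have btp := (st.pPhi haM).bc
  have btt := (st.pTheta haM).bc
  have bYr := sx.bc_covD haM
  have bYv := sy.bc_covD haM
  have bYp := sz.bc_covD haM
  have bA := bc_A (a := a) (M := M) (k := k)
  have bh := bc_h (a := a) (M := M)
  have bD := bc_Delta (a := a) (M := M)
  have bW := bc_of_continuousOn_vr hW.cont
  have bWv := bc_of_continuousOn_vr hW.contV
  have bWr := bc_of_continuousOn_vr hW.contR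
  have bs := bc_sin (a := a) (M := M)
  have bc : BC a M (fun _ _ θ _ => Real.cos θ) := bc_of_continuous_theta Real.continuous_cos
  have be := hu.bc_eDens (k := k) haM Z
  -- the four derivative integrands
  let f' : ℝ → ℝ → ℝ → ℝ → ℝ := fun v r θ φ => Real.sin θ * (Wr v r * eDens a M k Z u v r θ φ
    + W v r * (derR (k ^ 2 * Real.sin θ ^ 2) (r ^ 2 + a ^ 2) (Delta a M r) k (2 * r) (2 * (r - M))
      (pR a M u v r θ φ) (pV u v r θ φ) (pPhi u v r θ φ) (pTheta u v r θ φ) (covD u v r θ φ)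
      (pR a M (pR a M u) v r θ φ) (pV (pR a M u) v r θ φ) (pPhi (pR a M u) v r θ φ)
      (pR a M (pTheta u) v r θ φ) (covD (pR a M u) v r θ φ)
      + Z * (ip (pR a M u v r θ φ) (u v r θ φ) + ip (u v r θ φ) (pR a M u v r θ φ))))
  let gV : ℝ → ℝ → ℝ → ℝ → ℝ := fun v r θ φ => Real.sin θ * (W v r * eFlux a M k u v r θ φ)
  let gV' : ℝ → ℝ → ℝ → ℝ → ℝ := fun v r θ φ => Real.sin θ * (Wv v r * eFlux a M k u v r θ φ
    + W v r * derV (k ^ 2 * Real.sin θ ^ 2) (r ^ 2 + a ^ 2) (Delta a M r) k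
      (pR a M u v r θ φ) (pV u v r θ φ) (pPhi u v r θ φ) (pTheta u v r θ φ) (covD u v r θ φ)
      (pV (pR a M u) v r θ φ) (pV (pV u) v r θ φ) (pV (pPhi u) v r θ φ)
      (pV (pTheta u) v r θ φ) (covD (pV u) v r θ φ))
  let w : ℝ → ℝ → ℝ → ℝ → ℂ := fun v r θ φ => curW (r ^ 2 + a ^ 2) (Delta a M r) k
    (pR a M u v r θ φ) (pV u v r θ φ) (pPhi u v r θ φ)
  let wp : ℝ → ℝ → ℝ → ℝ → ℂ := fun v r θ φ => curW (r ^ 2 + a ^ 2) (Delta a M r) k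
    (pPhi (pR a M u) v r θ φ) (pV (pPhi u) v r θ φ) (pPhi (pPhi u) v r θ φ)
  let wt : ℝ → ℝ → ℝ → ℝ → ℂ := fun v r θ φ => curW (r ^ 2 + a ^ 2) (Delta a M r) k
    (pR a M (pTheta u) v r θ φ) (pV (pTheta u) v r θ φ) (pPhi (pTheta u) v r θ φ)
  let gP : ℝ → ℝ → ℝ → ℝ → ℝ := fun v r θ φ => W v r * (Real.sin θ *
      curPhi (k ^ 2 * Real.sin θ ^ 2) (r ^ 2 + a ^ 2) (Delta a M r) k
      (pR a M u v r θ φ) (pV u v r θ φ) (pTheta u v r θ φ) (covD u v r θ φ)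
      + ip (covD u v r θ φ) (w v r θ φ))
  let gP' : ℝ → ℝ → ℝ → ℝ → ℝ := fun v r θ φ => W v r * (Real.sin θ *
      derPhi (k ^ 2 * Real.sin θ ^ 2) (r ^ 2 + a ^ 2) (Delta a M r) k
      (pR a M u v r θ φ) (pV u v r θ φ) (pTheta u v r θ φ) (covD u v r θ φ)
      (pPhi (pR a M u) v r θ φ) (pV (pPhi u) v r θ φ) (pPhi (pTheta u) v r θ φ)
      (covD (pPhi u) v r θ φ)
      + (ip (covD (pPhi u) v r θ φ) (w v r θ φ) + ip (covD u v r θ φ) (wp v r θ φ)))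
  let gT : ℝ → ℝ → ℝ → ℝ → ℝ := fun v r θ φ => W v r * ip (pTheta u v r θ φ) (w v r θ φ)
  let gT' : ℝ → ℝ → ℝ → ℝ → ℝ := fun v r θ φ =>
    Real.cos θ * (W v r * ip (pTheta u v r θ φ) (w v r θ φ))
    + Real.sin θ * (W v r * (ip (pTheta (pTheta u) v r θ φ) (w v r θ φ)
      + ip (pTheta u v r θ φ) (wt v r θ φ)))
  have bw : BC a M w := bh.curW bD bx sy.sm.bc sz.sm.bc
  have bwp : BC a M wp := bh.curW bD bxp byp bzp
  have bwt : BC a M wt := bh.curW bD btr btv btp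
  have bf' : BC a M f' := bs.mul ((bWr.mul be).add (bW.mul ((bA.derR bh bD bc_h' bc_Delta'
    bx sy.sm.bc sz.sm.bc st.bc bY bxr byr bxp btr bYr).add ((bc_const Z).mul
    ((bx.ip s0.bc).add (s0.bc.ip bx))))))
  have bFl : BC a M (eFlux a M k u) := bA.curV bh bD bx sy.sm.bc sz.sm.bc st.bc bY
  have bgV : BC a M gV := bs.mul (bW.mul bFl)
  have bgV' : BC a M gV' := bs.mul ((bWv.mul bFl).add (bW.mul
    (bA.derV bh bD bx sy.sm.bc sz.sm.bc st.bc bY byr byv byp btv bYv)))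
  have bgP' : BC a M gP' := bW.mul ((bs.mul (bA.derPhi bh bD bx sy.sm.bc st.bc bY bxp byp btp
    bYp)).add ((bYp.ip bw).add (bY.ip bwp)))
  have bgT : BC a M gT := bW.mul (st.bc.ip bw)
  have bgT' : BC a M gT' := (bc.mul (bW.mul (st.bc.ip bw))).add (bs.mul (bW.mul
    ((btt.ip bw).add (st.bc.ip bwt))))
  have vf : VSupp a M N r₁ (fun v r θ φ => Real.sin θ * (W v r * eDens a M k Z u v r θ φ)) :=
    fun v r θ φ hr hv => by simp [(hW.supp v r hr hv).1]
  have vf' : VSupp a M N r₁ f' := fun v r θ φ hr hv => by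
    simp [f', (hW.supp v r hr hv).1, (hW.supp v r hr hv).2.2]
  have vgV : VSupp a M N r₁ gV := fun v r θ φ hr hv => by simp [gV, (hW.supp v r hr hv).1]
  have vgV' : VSupp a M N r₁ gV' := fun v r θ φ hr hv => by
    simp [gV', (hW.supp v r hr hv).1, (hW.supp v r hr hv).2.1]
  have vgP' : VSupp a M N r₁ gP' := fun v r θ φ hr hv => by simp [gP', (hW.supp v r hr hv).1]
  have vgT' : VSupp a M N r₁ gT' := fun v r θ φ hr hv => by simp [gT', (hW.supp v r hr hv).1]
  have hrI := Ioo_subset_Icc_self hr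
  -- the derivative of the energy
  have D0 : HasDerivAt (fun r => ∫ x, Real.sin x.2.1 * (W x.1 r * eDens a M k Z u x.1 r x.2.1 x.2.2)
      ∂flat) (∫ x, f' x.1 r x.2.1 x.2.2 ∂flat) r := by
    refine BC.hasDerivAt_integral
      (f := fun v r θ φ => Real.sin θ * (W v r * eDens a M k Z u v r θ φ))
      (bs.mul (bW.mul be)) bf' hr₁ hr vf vf' ?_
    intro v ρ θ φ hρ hθ
    have hρ' := hIoo hρ
    have hρc := Ioo_subset_Ioc_self hρ'
    have d1 : HasDerivAt (fun x => pV u v x θ φ) (pV (pR a M u) v ρ θ φ) ρ := by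
      rw [s0.pV_pR haM v ρ θ φ hρc]; exact sy.sm.hasDerivAt_r hρ'
    have d2 : HasDerivAt (fun x => pPhi u v x θ φ) (pPhi (pR a M u) v ρ θ φ) ρ := by
      rw [s0.pPhi_pR haM v ρ θ φ hρc]; exact sz.sm.hasDerivAt_r hρ'
    have dR := hasDerivAt_curR (k ^ 2 * Real.sin θ ^ 2) k (hasDerivAt_h a ρ)
      (hasDerivAt_Delta a M ρ) (sx.sm.hasDerivAt_r (v := v) (θ := θ) (φ := φ) hρ') d1 d2
      (st.hasDerivAt_r (v := v) (θ := θ) (φ := φ) hρ')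
      (hasDerivAt_covD_r (v := v) (θ := θ) (φ := φ) haM s0 hρ')
    have d0 := s0.hasDerivAt_r (v := v) (θ := θ) (φ := φ) hρ'
    have dE : HasDerivAt (fun x => eDens a M k Z u v x θ φ) _ ρ :=
      (dR.add ((hasDerivAt_ip d0 d0).const_mul Z)).congr_of_eventuallyEq
        (Eventually.of_forall fun s => by simp [eDens, ip_self])
    exact ((hW.derR v ρ hρ').mul dE).const_mul (Real.sin θ)
  have I0 := bf'.integrable hr₁ hrI vf'
  have I1 := bgV'.integrable hr₁ hrI vgV'
  have I2 := bgP'.integrable hr₁ hrI vgP'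
  have I3 := bgT'.integrable hr₁ hrI vgT'
  have E1 : ∫ x, gV' x.1 r x.2.1 x.2.2 ∂flat = 0 := by
    refine integral_deriv_v bgV' bgV hr₁ hrI vgV vgV' ?_
    intro v θ φ hθ
    have d1 : HasDerivAt (fun x => eFlux a M k u x r θ φ) _ v :=
      hasDerivAt_curV (k ^ 2 * Real.sin θ ^ 2) (r ^ 2 + a ^ 2) (Delta a M r) k
        (sx.sm.hasDerivAt_v (v := v) (θ := θ) (φ := φ) hrc) (sy.sm.hasDerivAt_v hrc)
        (sz.sm.hasDerivAt_v hrc) (st.hasDerivAt_v hrc) (hasDerivAt_covD_v haM s0 hrc)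
    exact ((hW.derV v r hrc).mul d1).const_mul (Real.sin θ)
  have E2 : ∫ x, gP' x.1 r x.2.1 x.2.2 ∂flat = 0 := by
    refine integral_deriv_phi (f := gP) bgP' hr₁ hrI vgP' ?_ ?_
    · intro v θ φ
      have st_per : pTheta u v r θ (φ + 2 * Real.pi) = pTheta u v r θ φ := by
        unfold pTheta; simp only [hu.per]
      have Y_per : covD u v r θ (φ + 2 * Real.pi) = covD u v r θ φ := by
        unfold covD covPhi; rw [hu.per, sz.per]
      simp only [gP, w, sx.per, sy.per, sz.per, st_per, Y_per]
    · intro v θ φ hθ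
      have d1 := sx.sm.hasDerivAt_phi (v := v) (θ := θ) (φ := φ) hrc
      have d2 : HasDerivAt (fun x => pV u v r θ x) (pV (pPhi u) v r θ φ) φ := by
        rw [s0.pV_pPhi haM v r θ φ hrc]; exact sy.sm.hasDerivAt_phi hrc
      have d3 := sz.sm.hasDerivAt_phi (v := v) (θ := θ) (φ := φ) hrc
      have d4 := st.hasDerivAt_phi (v := v) (θ := θ) (φ := φ) hrc
      have d5 := hasDerivAt_covD_phi (v := v) (θ := θ) (φ := φ) haM s0 hrc
      exact (((hasDerivAt_curPhi (k ^ 2 * Real.sin θ ^ 2) (r ^ 2 + a ^ 2) (Delta a M r) k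
        d1 d2 d4 d5).const_mul (Real.sin θ)).add (hasDerivAt_ip d5
        (hasDerivAt_curW (r ^ 2 + a ^ 2) (Delta a M r) k d1 d2 d3))).const_mul (W v r)
  have E3 : ∫ x, gT' x.1 r x.2.1 x.2.2 ∂flat = 0 := by
    refine integral_deriv_theta (f := gT) bgT' hr₁ hrI vgT' bgT ?_
    intro v θ φ hθ
    have d1 : HasDerivAt (fun x => pR a M u v r x φ) (pR a M (pTheta u) v r θ φ) θ := by
      rw [← s0.pTheta_pR haM v r θ φ hrc]; exact sx.sm.hasDerivAt_theta hrc
    have d2 : HasDerivAt (fun x => pV u v r x φ) (pV (pTheta u) v r θ φ) θ := by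
      rw [s0.pV_pTheta haM v r θ φ hrc]; exact sy.sm.hasDerivAt_theta hrc
    have d3 : HasDerivAt (fun x => pPhi u v r x φ) (pPhi (pTheta u) v r θ φ) θ := by
      rw [s0.pPhi_pTheta haM v r θ φ hrc]; exact sz.sm.hasDerivAt_theta hrc
    exact (Real.hasDerivAt_sin θ).mul (((hasDerivAt_ip (st.hasDerivAt_theta hrc)
      (hasDerivAt_curW (r ^ 2 + a ^ 2) (Delta a M r) k d1 d2 d3))).const_mul (W v r))
  have hsum : ∀ᵐ x ∂flat, f' x.1 r x.2.1 x.2.2 + gV' x.1 r x.2.1 x.2.2 + gP' x.1 r x.2.1 x.2.2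
      + gT' x.1 r x.2.1 x.2.2 = Real.sin x.2.1 *
        (Wv x.1 r * eFlux a M k u x.1 r x.2.1 x.2.2 + Wr x.1 r * eDens a M k Z u x.1 r x.2.1 x.2.2
          + W x.1 r * eLow a M k Z br bv b u F x.1 r x.2.1 x.2.2) := by
    filter_upwards [ae_flat] with x hx
    obtain ⟨v, θ, φ⟩ := x
    have hθ : θ ∈ Ioo 0 Real.pi := hx.1
    have hs : (Real.sin θ : ℂ) ≠ 0 := Complex.ofReal_ne_zero.2 (Real.sin_pos_of_mem_Ioo hθ).ne'
    have hcov : ∀ g : ℝ → ℝ → ℝ → ℝ → ℂ, (Real.sin θ : ℂ) * covD g v r θ φ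
        = pPhi g v r θ φ + 2 * Complex.I * (Real.cos θ : ℂ) * g v r θ φ := by
      intro g; unfold covD covPhi; field_simp
    have hYv : (Real.sin θ : ℂ) * covD (pV u) v r θ φ
        = pV (pPhi u) v r θ φ + 2 * Complex.I * (Real.cos θ : ℂ) * pV u v r θ φ := by
      rw [hcov, s0.pV_pPhi haM v r θ φ hrc]
    have hid := divergence_identity (k ^ 2 * Real.sin θ ^ 2) (Real.sin θ) (Real.cos θ)
      (r ^ 2 + a ^ 2) (Delta a M r) k (2 * r) (2 * (r - M))
      (pR a M u v r θ φ) (pV u v r θ φ) (pPhi u v r θ φ) (pTheta u v r θ φ) (covD u v r θ φ)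
      (pR a M (pR a M u) v r θ φ) (pV (pR a M u) v r θ φ) (pV (pV u) v r θ φ)
      (pV (pPhi u) v r θ φ) (pPhi (pR a M u) v r θ φ) (pPhi (pPhi u) v r θ φ)
      (pR a M (pTheta u) v r θ φ) (pV (pTheta u) v r θ φ) (pPhi (pTheta u) v r θ φ)
      (covD (pR a M u) v r θ φ) (covD (pV u) v r θ φ) (covD (pPhi u) v r θ φ)
      ((Real.cos θ : ℂ) * pTheta u v r θ φ + (Real.sin θ : ℂ) * pTheta (pTheta u) v r θ φ)
      (hcov _) hYv (hcov _)
    have hlap := sin_mul_spinLap (u := u) (v := v) (r := r) (φ := φ) hθ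
    rw [(hasDerivAt_sin_pTheta haM s0 hrc).deriv] at hlap
    have hpde := heq v r θ φ hrr hθ
    -- The equation times sin θ, with the Laplacian written through covariant derivatives. That form
    -- of the Laplacian contains an extra 2 u, hence b + 2; the hypothesis k² = a² matches the
    -- coefficients of u_vv.
    have hop : (Real.sin θ : ℂ) * (((k ^ 2 * Real.sin θ ^ 2 : ℝ) : ℂ) * pV (pV u) v r θ φ
          + 2 * k * pV (pPhi u) v r θ φ + 2 * ((r ^ 2 + a ^ 2 : ℝ) : ℂ) * pV (pR a M u) v r θ φ
          + 2 * k * pPhi (pR a M u) v r θ φ + (Delta a M r : ℂ) * pR a M (pR a M u) v r θ φ)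
        + ((Real.cos θ : ℂ) * pTheta u v r θ φ + (Real.sin θ : ℂ) * pTheta (pTheta u) v r θ φ)
        + covD (pPhi u) v r θ φ + 2 * Complex.I * (Real.cos θ : ℂ) * covD u v r θ φ
        = (Real.sin θ : ℝ) * (F v r θ φ - (br r : ℂ) * pR a M u v r θ φ - bv r θ * pV u v r θ φ
          - (b + 2) * u v r θ φ) := by
      rw [← hpde, hk]
      unfold opGen
      push_cast at hlap ⊢
      linear_combination (-1 : ℂ) * hlap
    rw [hop, ip_ofReal_mul_left] at hid
    have hcosip : ip ((Real.cos θ : ℂ) * pTheta u v r θ φ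
        + (Real.sin θ : ℂ) * pTheta (pTheta u) v r θ φ) (w v r θ φ)
        = Real.cos θ * ip (pTheta u v r θ φ) (w v r θ φ)
          + Real.sin θ * ip (pTheta (pTheta u) v r θ φ) (w v r θ φ) := by
      rw [ip_add_left, ip_ofReal_mul_left, ip_ofReal_mul_left]
    rw [hcosip] at hid
    simp only [f', gV', gP', gT', eLow, curLow]
    rw [ip_comm (pR a M u v r θ φ) (u v r θ φ)]
    linear_combination W v r * hid
  have J1 : Integrable (fun x : ℝ × ℝ × ℝ => f' x.1 r x.2.1 x.2.2 + gV' x.1 r x.2.1 x.2.2) flat :=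
    I0.add I1
  have J2 : Integrable (fun x : ℝ × ℝ × ℝ => f' x.1 r x.2.1 x.2.2 + gV' x.1 r x.2.1 x.2.2
    + gP' x.1 r x.2.1 x.2.2) flat := J1.add I2
  refine ⟨(J2.add I3).congr hsum, ?_⟩
  rw [← integral_congr_ae hsum, integral_add J2 I3, integral_add J1 I2, integral_add I0 I1,
    E1, E2, E3]
  simpa only [add_zero] using D0

end Energy


/-! ## Grönwall's inequality backwards in `r` -/

theorem gronwall_backward {E E' B : ℝ → ℝ} {r₁ r₂ c C D : ℝ} (h12 : r₁ ≤ r₂) (hC : 0 ≤ C)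
    (hc : 0 ≤ c) (hD : 0 ≤ D) (hE : ContinuousOn E (Icc r₁ r₂)) (hB : ContinuousOn B (Icc r₁ r₂))
    (hB0 : ∀ r ∈ Icc r₁ r₂, 0 ≤ B r) (hder : ∀ r ∈ Ioo r₁ r₂, HasDerivAt E (E' r) r)
    (hineq : ∀ r ∈ Ioo r₁ r₂, c * B r - C * E r - D ≤ E' r) :
    E r₁ + c * ∫ r in r₁..r₂, B r ≤ Real.exp (C * (r₂ - r₁)) * (E r₂ + D * (r₂ - r₁)) := by
  set e₂ := Real.exp (C * (r₂ - r₁)) with he₂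
  -- The differential inequality makes G increasing: the integrating factor lies between 1 and e₂ on
  -- [r₁, r₂], which is harmless in front of B ≥ 0 and costs e₂ in front of D. The claim is G r₁ ≤ G
  -- r₂.
  let G : ℝ → ℝ := fun r =>
    Real.exp (C * (r - r₁)) * E r - c * (∫ s in r₁..r, B s) + D * e₂ * (r - r₁)
  have hBi : IntervalIntegrable B volume r₁ r₂ := hB.intervalIntegrable_of_Icc h12
  have hint : ContinuousOn (fun r => ∫ s in r₁..r, B s) (Icc r₁ r₂) :=
    intervalIntegral.continuousOn_primitive_interval (by
      rw [uIcc_of_le h12]; exact hB.integrableOn_Icc) |>.mono (by rw [uIcc_of_le h12])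
  have hG : ContinuousOn G (Icc r₁ r₂) := by
    refine ContinuousOn.add (ContinuousOn.sub (ContinuousOn.mul ?_ hE) (hint.const_smul c)) ?_
    · exact (by fun_prop : Continuous fun r => Real.exp (C * (r - r₁))).continuousOn
    · exact (by fun_prop : Continuous fun r => D * e₂ * (r - r₁)).continuousOn
  have hmono : MonotoneOn G (Icc r₁ r₂) := by
    refine monotoneOn_of_hasDerivWithinAt_nonneg (convex_Icc _ _) hG
      (f' := fun r => (C * Real.exp (C * (r - r₁)) * E r + Real.exp (C * (r - r₁)) * E' r)
        - c * B r + D * e₂) ?_ ?_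
    · intro r hr
      rw [interior_Icc] at hr ⊢
      have d1 : HasDerivAt (fun r => Real.exp (C * (r - r₁))) (C * Real.exp (C * (r - r₁))) r := by
        have := (((hasDerivAt_id r).sub_const r₁).const_mul C).exp
        refine this.congr_deriv ?_
        simp [mul_comm]
      have d2 : HasDerivAt (fun r => ∫ s in r₁..r, B s) (B r) r := by
        have hsub : ContinuousOn B (Ioo r₁ r₂) := hB.mono Ioo_subset_Icc_self
        have hca : ContinuousAt B r := hsub.continuousAt (Ioo_mem_nhds hr.1 hr.2)
        refine intervalIntegral.integral_hasDerivAt_right ?_ ?_ hca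
        · exact hBi.mono_set (by
            rw [uIcc_of_le h12, uIcc_of_le hr.1.le]; exact Icc_subset_Icc_right hr.2.le)
        · exact hsub.stronglyMeasurableAtFilter isOpen_Ioo r hr
      have := ((d1.mul (hder r hr)).sub (d2.const_mul c)).add
        (((hasDerivAt_id r).sub_const r₁).const_mul (D * e₂))
      refine (this.congr_deriv ?_).hasDerivWithinAt
      simp
    · intro r hr
      rw [interior_Icc] at hr
      have h1 : 1 ≤ Real.exp (C * (r - r₁)) :=
        Real.one_le_exp (mul_nonneg hC (by linarith [hr.1]))
      have h2 : Real.exp (C * (r - r₁)) ≤ e₂ := by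
        rw [he₂]; apply Real.exp_le_exp.2
        exact mul_le_mul_of_nonneg_left (by linarith [hr.2]) hC
      have h3 := mul_le_mul_of_nonneg_left (hineq r hr) (by linarith : 0 ≤ Real.exp (C * (r - r₁)))
      have h4 : c * B r ≤ Real.exp (C * (r - r₁)) * (c * B r) :=
        le_mul_of_one_le_left (mul_nonneg hc (hB0 r (Ioo_subset_Icc_self hr))) h1
      have h5 : Real.exp (C * (r - r₁)) * D ≤ e₂ * D := mul_le_mul_of_nonneg_right h2 hD
      linarith
  have := hmono (left_mem_Icc.2 h12) (right_mem_Icc.2 h12) h12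
  simp only [G, sub_self, mul_zero, Real.exp_zero, one_mul, intervalIntegral.integral_same,
    sub_zero, add_zero] at this
  linarith

/-! ## Bounds on the coefficients -/

theorem Delta_nonpos {a M : ℝ} (haM : |a| < M) {r : ℝ} (hr : r ∈ Icc (rm a M) (rp a M)) :
    Delta a M r ≤ 0 := by
  rw [Delta_eq haM]
  exact mul_nonpos_of_nonpos_of_nonneg (by linarith [hr.2]) (by linarith [hr.1])

theorem exists_ptBound {a M : ℝ} (ha : 0 < |a|) (haM : |a| < M) (B₀ : ℝ) :
    ∃ B ρ : ℝ, B₀ ≤ B ∧ 1 ≤ B ∧ 0 < ρ ∧ ∀ k r θ : ℝ, k ^ 2 = a ^ 2 →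
      r ∈ Icc (rm a M) (rp a M) →
      PtBound B ρ (k ^ 2 * Real.sin θ ^ 2) (r ^ 2 + a ^ 2) (Delta a M r) k (2 * r) (2 * (r - M))
        (Real.sin θ) (Real.cos θ) := by
  have hm := rm_pos ha haM
  have hM : 0 < M := ha.trans haM
  have hsum := rp_add_rm (a := a) (M := M)
  have ha2 : a ^ 2 ≤ M ^ 2 := by have := sq_lt haM; linarith
  -- The value ρ = r₋² is admissible because r² + a² - a² sin² θ ≥ r² ≥ r₋². The upper bounds follow
  -- from |a| ≤ M and 0 < r ≤ 2 M.
  refine ⟨1 + |B₀| + 10 * M ^ 2 + 10 * M, rm a M ^ 2, ?_, ?_, by positivity, ?_⟩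
  · have := le_abs_self B₀; nlinarith
  · have := abs_nonneg B₀; nlinarith
  intro k r θ hk hr
  have h0 := abs_nonneg B₀
  have hr0 : 0 < r := hm.trans_le hr.1
  have hr2 : r ≤ 2 * M := by linarith [hr.2]
  have hD0 := Delta_nonpos haM hr
  have hDl : -(4 * M ^ 2) ≤ Delta a M r := by unfold Delta; nlinarith [sq_nonneg (r - M), sq_nonneg a]
  have hk' : |k| ≤ M := abs_le_of_sq_le_sq (by rw [hk]; exact ha2) hM.le
  have hs1 : Real.sin θ ^ 2 ≤ 1 := Real.sin_sq_le_one θ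
  refine ⟨by nlinarith, by positivity, rfl, ?_, ?_, hD0, ?_, ?_, ?_, ?_, ?_, ?_,
    Real.abs_sin_le_one θ, Real.abs_cos_le_one θ⟩
  · rw [hk]
    have h1 : rm a M ^ 2 ≤ r ^ 2 := by gcongr; exact hr.1
    nlinarith [sq_nonneg a]
  · rw [abs_of_nonneg (by positivity)]; nlinarith
  · rw [abs_of_nonpos hD0]; nlinarith
  · rw [abs_of_nonpos (by linarith)]; nlinarith
  · nlinarith
  · rw [hk]; nlinarith
  · rw [abs_of_pos (by linarith)]; nlinarith
  · rw [abs_le]; constructor <;> nlinarith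

/-! ## Weights -/

/-- A positive function comparable with `v ^ q` for `v ≥ 1`, of slow variation for large `R`. -/
noncomputable def wgt (R q v : ℝ) : ℝ := (R + (Real.sqrt (1 + v ^ 2) + v)) ^ q

theorem sqrt_add_pos (v : ℝ) : 0 < Real.sqrt (1 + v ^ 2) + v := by
  have : |v| < Real.sqrt (1 + v ^ 2) := by
    rw [← Real.sqrt_sq_eq_abs]; exact Real.sqrt_lt_sqrt (sq_nonneg v) (by linarith)
  linarith [neg_abs_le v]

section Wgt

variable {R q : ℝ}

theorem wgt_pos (hR : 0 < R) (v : ℝ) : 0 < wgt R q v :=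
  Real.rpow_pos_of_pos (by linarith [sqrt_add_pos v]) q

theorem hasDerivAt_wgt (hR : 0 < R) (v : ℝ) :
    HasDerivAt (wgt R q)
      ((v / Real.sqrt (1 + v ^ 2) + 1) * q * (R + (Real.sqrt (1 + v ^ 2) + v)) ^ (q - 1)) v := by
  have h1 : HasDerivAt (fun v : ℝ => 1 + v ^ 2) (2 * v) v := by
    simpa using ((hasDerivAt_id v).pow 2).const_add 1
  have h2 := h1.sqrt (by positivity)
  have h3 := ((h2.add (hasDerivAt_id v)).const_add R).rpow_const (p := q)
    (Or.inl (by have := sqrt_add_pos v; simp; linarith))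
  refine h3.congr_deriv ?_
  have : Real.sqrt (1 + v ^ 2) ≠ 0 := by positivity
  have e : 2 * v / (2 * Real.sqrt (1 + v ^ 2)) = v / Real.sqrt (1 + v ^ 2) := by field_simp
  rw [e]
  rfl

theorem contDiff_wgt (hR : 0 < R) : ContDiff ℝ 1 (wgt R q) := by
  unfold wgt
  rw [contDiff_iff_contDiffAt]
  intro v
  refine ContDiffAt.rpow_const_of_ne ?_ (by linarith [sqrt_add_pos v])
  refine contDiffAt_const.add (ContDiffAt.add (ContDiffAt.sqrt ?_ (by positivity)) contDiffAt_id)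
  fun_prop

/-- The shift R keeps the base of the power above R, so the logarithmic derivative can be made
smaller than any ε prescribed by the energy inequality. -/
theorem abs_deriv_wgt_le (hR : 0 < R) (hq : 0 ≤ q) (v : ℝ) :
    |deriv (wgt R q) v| ≤ 2 * q / R * wgt R q v := by
  rw [(hasDerivAt_wgt hR v).deriv]
  have hpos : 0 < R + (Real.sqrt (1 + v ^ 2) + v) := by linarith [sqrt_add_pos v]
  have hs : 0 < Real.sqrt (1 + v ^ 2) := by positivity
  have hvs : |v / Real.sqrt (1 + v ^ 2)| ≤ 1 := by
    rw [abs_div, abs_of_pos hs, div_le_one hs]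
    exact Real.abs_le_sqrt (by linarith)
  have hv1 := abs_le.1 hvs
  rw [Real.rpow_sub_one hpos.ne', abs_mul, abs_mul, abs_of_nonneg hq,
    abs_of_nonneg (by linarith [hv1.1]), abs_of_nonneg (by positivity)]
  unfold wgt
  have h2 : (R + (Real.sqrt (1 + v ^ 2) + v)) ^ q / (R + (Real.sqrt (1 + v ^ 2) + v))
      ≤ (R + (Real.sqrt (1 + v ^ 2) + v)) ^ q / R := by
    gcongr
    linarith [sqrt_add_pos v]
  calc _ ≤ 2 * q * ((R + (Real.sqrt (1 + v ^ 2) + v)) ^ q / R) := by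
        gcongr
        linarith [hv1.2]
    _ = _ := by ring

theorem rpow_le_wgt (hR : 0 < R) (hq : 0 ≤ q) {v : ℝ} (hv : 0 ≤ v) : v ^ q ≤ wgt R q v := by
  unfold wgt
  gcongr
  linarith [Real.sqrt_nonneg (1 + v ^ 2)]

theorem wgt_le_rpow (hR : 0 < R) (hq : 0 ≤ q) {v : ℝ} (hv : 1 ≤ v) :
    wgt R q v ≤ (R + 3) ^ q * v ^ q := by
  rw [← Real.mul_rpow (by linarith) (by linarith)]
  unfold wgt
  have : Real.sqrt (1 + v ^ 2) ≤ 2 * v := by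
    rw [Real.sqrt_le_left (by linarith)]; nlinarith
  have h2 := sqrt_add_pos v
  refine Real.rpow_le_rpow (by linarith) ?_ hq
  nlinarith

theorem wgt_le_of_nonpos (hR : 0 < R) (hq : 0 ≤ q) {v : ℝ} (hv : v ≤ 0) :
    wgt R q v ≤ (R + 1) ^ q := by
  unfold wgt
  have h2 := sqrt_add_pos v
  refine Real.rpow_le_rpow (by linarith) ?_ hq
  have : Real.sqrt (1 + v ^ 2) ≤ 1 - v := by
    rw [Real.sqrt_le_left (by linarith)]; nlinarith
  linarith

end Wgt

/-- A smooth step from `0` to `1` on `[0, 1]`. -/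
noncomputable abbrev stp : ℝ → ℝ := Real.smoothTransition

theorem hasDerivAt_stp (x : ℝ) : HasDerivAt stp (deriv stp x) x :=
  ((Real.smoothTransition.contDiff (n := 1)).differentiable (by simp) x).hasDerivAt

theorem continuous_deriv_stp : Continuous (deriv stp) :=
  (Real.smoothTransition.contDiff (n := 1)).continuous_deriv (by simp)

theorem deriv_stp_nonneg (x : ℝ) : 0 ≤ deriv stp x := Real.smoothTransition.monotone.deriv_nonneg

theorem deriv_stp_of_neg {x : ℝ} (hx : x < 0) : deriv stp x = 0 := by
  have : stp =ᶠ[𝓝 x] fun _ => 0 := by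
    filter_upwards [Iio_mem_nhds hx] with y hy using Real.smoothTransition.zero_of_nonpos hy.le
  rw [this.deriv_eq]; simp

theorem deriv_stp_of_one_lt {x : ℝ} (hx : 1 < x) : deriv stp x = 0 := by
  have : stp =ᶠ[𝓝 x] fun _ => 1 := by
    filter_upwards [Ioi_mem_nhds hx] with y hy using Real.smoothTransition.one_of_one_le (le_of_lt hy)
  rw [this.deriv_eq]; simp

/-- A weight `g v`, cut off for large `|v|`. -/
noncomputable def cutW (a M : ℝ) (g : ℝ → ℝ) (n l L v r : ℝ) : ℝ :=
  g v * stp (n - v + l * (r - rp a M)) * stp (n + v + L * Real.log (r - rm a M))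

/-- The `v`-derivative of `cutW`. -/
noncomputable def cutWv (a M : ℝ) (g : ℝ → ℝ) (n l L v r : ℝ) : ℝ :=
  deriv g v * stp (n - v + l * (r - rp a M)) * stp (n + v + L * Real.log (r - rm a M))
    - g v * deriv stp (n - v + l * (r - rp a M)) * stp (n + v + L * Real.log (r - rm a M))
    + g v * stp (n - v + l * (r - rp a M)) * deriv stp (n + v + L * Real.log (r - rm a M))

/-- The `r`-derivative of `cutW`. -/
noncomputable def cutWr (a M : ℝ) (g : ℝ → ℝ) (n l L v r : ℝ) : ℝ :=
  l * (g v * deriv stp (n - v + l * (r - rp a M)) * stp (n + v + L * Real.log (r - rm a M)))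
    + L / (r - rm a M) *
      (g v * stp (n - v + l * (r - rp a M)) * deriv stp (n + v + L * Real.log (r - rm a M)))

/-- Both cut-offs increase with r, so the r-derivative of the weight is available to dominate the
flux through their edges. The right edge has the constant slope l. The logarithm gives the left edge
the slope L / (r - r₋), whose product with -Δ is L (r₊ - r) and does not degenerate at r₋. The
logarithm is largest at r₊, which bounds the support uniformly in r. -/
theorem cutW_reg {a M : ℝ} {g : ℝ → ℝ} (hg : ContDiff ℝ 1 g) {n l L : ℝ}
    (hl : 0 ≤ l) (hL : 0 ≤ L) (r₁ : ℝ) (hr₁ : rm a M < r₁) :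
    WeightReg a M (n + L * |Real.log (rp a M - rm a M)|) r₁ (cutW a M g n l L) (cutWv a M g n l L)
      (cutWr a M g n l L) := by
  have hpos : ∀ x ∈ (univ : Set ℝ) ×ˢ Ioc (rm a M) (rp a M), x.2 - rm a M ≠ 0 := fun x hx => by
    have := hx.2.1; linarith
  have clog : ContinuousOn (fun x : ℝ × ℝ => n + x.1 + L * Real.log (x.2 - rm a M))
      (univ ×ˢ Ioc (rm a M) (rp a M)) := by
    refine ContinuousOn.add (by fun_prop) (continuousOn_const.mul (ContinuousOn.log (by fun_prop) hpos))
  have cg : ContinuousOn (fun x : ℝ × ℝ => g x.1) (univ ×ˢ Ioc (rm a M) (rp a M)) :=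
    (hg.continuous.comp continuous_fst).continuousOn
  have cg' : ContinuousOn (fun x : ℝ × ℝ => deriv g x.1) (univ ×ˢ Ioc (rm a M) (rp a M)) :=
    ((hg.continuous_deriv (by simp)).comp continuous_fst).continuousOn
  have cs : Continuous stp := Real.smoothTransition.continuous
  have c1 : ContinuousOn (fun x : ℝ × ℝ => stp (n - x.1 + l * (x.2 - rp a M)))
      (univ ×ˢ Ioc (rm a M) (rp a M)) := (cs.comp (by fun_prop)).continuousOn
  have c1' : ContinuousOn (fun x : ℝ × ℝ => deriv stp (n - x.1 + l * (x.2 - rp a M)))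
      (univ ×ˢ Ioc (rm a M) (rp a M)) := (continuous_deriv_stp.comp (by fun_prop)).continuousOn
  have c2 := cs.comp_continuousOn clog
  have c2' := continuous_deriv_stp.comp_continuousOn clog
  have cq : ContinuousOn (fun x : ℝ × ℝ => L / (x.2 - rm a M))
      (univ ×ˢ Ioc (rm a M) (rp a M)) := ContinuousOn.div (by fun_prop) (by fun_prop) hpos
  refine ⟨(cg.mul c1).mul c2, (((cg'.mul c1).mul c2).sub ((cg.mul c1').mul c2)).add
    ((cg.mul c1).mul c2'), (((cg.mul c1').mul c2).const_smul l).add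
    (cq.mul ((cg.mul c1).mul c2')), ?_, ?_, ?_⟩
  · intro v r hr
    have d0 : HasDerivAt g (deriv g v) v := (hg.differentiable (by simp) v).hasDerivAt
    have d1 : HasDerivAt (fun x => stp (n - x + l * (r - rp a M)))
        (deriv stp (n - v + l * (r - rp a M)) * (-1)) v :=
      (hasDerivAt_stp _).comp v (((hasDerivAt_id v).const_sub n).add_const _)
    have d2 : HasDerivAt (fun x => stp (n + x + L * Real.log (r - rm a M)))
        (deriv stp (n + v + L * Real.log (r - rm a M)) * 1) v :=
      (hasDerivAt_stp _).comp v (((hasDerivAt_id v).const_add n).add_const _)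
    refine ((d0.mul d1).mul d2).congr_deriv ?_
    unfold cutWv
    simp
    ring
  · intro v r hr
    have hne : r - rm a M ≠ 0 := by linarith [hr.1]
    have d1 : HasDerivAt (fun x => stp (n - v + l * (x - rp a M)))
        (deriv stp (n - v + l * (r - rp a M)) * (l * 1)) r :=
      (hasDerivAt_stp _).comp r ((((hasDerivAt_id r).sub_const _).const_mul l).const_add _)
    have d2 : HasDerivAt (fun x => stp (n + v + L * Real.log (x - rm a M)))
        (deriv stp (n + v + L * Real.log (r - rm a M)) * (L * (1 / (r - rm a M)))) r :=
      (hasDerivAt_stp _).comp r (((((hasDerivAt_id r).sub_const _).log hne).const_mul L).const_add _)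
    refine (((d1.const_mul (g v)).mul d2)).congr_deriv ?_
    unfold cutWr
    ring
  · intro v r hr hv
    have h0 := abs_nonneg (Real.log (rp a M - rm a M))
    have h00 : 0 ≤ L * |Real.log (rp a M - rm a M)| := by positivity
    rcases lt_abs.1 hv with h | h
    · have h1 : n - v + l * (r - rp a M) < 0 := by
        have : l * (r - rp a M) ≤ 0 := mul_nonpos_of_nonneg_of_nonpos hl (by linarith [hr.2])
        linarith
      simp [cutW, cutWv, cutWr, deriv_stp_of_neg h1, Real.smoothTransition.zero_of_nonpos h1.le]
    · have h1 : n + v + L * Real.log (r - rm a M) < 0 := by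
        have : Real.log (r - rm a M) ≤ Real.log (rp a M - rm a M) :=
          Real.log_le_log (by linarith [hr.1]) (by linarith [hr.2])
        have h2 : L * Real.log (r - rm a M) ≤ L * |Real.log (rp a M - rm a M)| := by
          gcongr; exact this.trans (le_abs_self _)
        linarith
      simp [cutW, cutWv, cutWr, deriv_stp_of_neg h1, Real.smoothTransition.zero_of_nonpos h1.le]


/-! ## Tangential energies -/

/-- `|f_v|² + |f_θ|² + |D f|² + |f|²`. -/
noncomputable def tangD (f : ℝ → ℝ → ℝ → ℝ → ℂ) (v r θ φ : ℝ) : ℝ :=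
  tangSq (pV f v r θ φ) (pTheta f v r θ φ) (covD f v r θ φ) (f v r θ φ)

theorem tangD_nonneg (f : ℝ → ℝ → ℝ → ℝ → ℂ) (v r θ φ : ℝ) : 0 ≤ tangD f v r θ φ :=
  tangSq_nonneg _ _ _ _

section Tang

variable {a M N r₁ : ℝ} {W Wv Wr : ℝ → ℝ → ℝ} {f : ℝ → ℝ → ℝ → ℝ → ℂ}

theorem BC.norm_sq {f : ℝ → ℝ → ℝ → ℝ → ℂ} (hf : BC a M f) :
    BC a M (fun v r θ φ => ‖f v r θ φ‖ ^ 2) := by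
  simpa only [ip_self] using hf.ip hf

theorem SpinReg.bc_tangD (haM : |a| < M) (hf : SpinReg a M f) : BC a M (tangD f) :=
  (((hf.pV haM).sm.bc.norm_sq.add (hf.sm.pTheta haM).bc.norm_sq).add
    (hf.bc_covD haM).norm_sq).add hf.sm.bc.norm_sq

/-- The `r`-derivative of `tangD f`. -/
noncomputable def derTang (a M : ℝ) (f : ℝ → ℝ → ℝ → ℝ → ℂ) (v r θ φ : ℝ) : ℝ :=
  2 * (ip (pV f v r θ φ) (pV (pR a M f) v r θ φ)
    + ip (pTheta f v r θ φ) (pTheta (pR a M f) v r θ φ)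
    + ip (covD f v r θ φ) (covD (pR a M f) v r θ φ) + ip (f v r θ φ) (pR a M f v r θ φ))

theorem two_mul_ip_ge (p q : ℂ) : -(‖p‖ ^ 2 + ‖q‖ ^ 2) ≤ 2 * ip p q := by
  have h := (abs_le.1 (abs_ip_le p q)).1
  nlinarith [sq_nonneg (‖p‖ - ‖q‖)]

theorem derTang_ge (v r θ φ : ℝ) :
    -(tangD f v r θ φ + tangD (pR a M f) v r θ φ) ≤ derTang a M f v r θ φ := by
  have h1 := two_mul_ip_ge (pV f v r θ φ) (pV (pR a M f) v r θ φ)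
  have h2 := two_mul_ip_ge (pTheta f v r θ φ) (pTheta (pR a M f) v r θ φ)
  have h3 := two_mul_ip_ge (covD f v r θ φ) (covD (pR a M f) v r θ φ)
  have h4 := two_mul_ip_ge (f v r θ φ) (pR a M f v r θ φ)
  unfold derTang tangD tangSq
  linarith

theorem SpinReg.bc_derTang (haM : |a| < M) (hf : SpinReg a M f) : BC a M (derTang a M f) :=
  (bc_const (2 : ℝ)).mul (((((hf.pV haM).sm.bc.ip ((hf.pR haM).pV haM).sm.bc).add
    ((hf.sm.pTheta haM).bc.ip ((hf.pR haM).sm.pTheta haM).bc)).add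
    ((hf.bc_covD haM).ip ((hf.pR haM).bc_covD haM))).add (hf.sm.bc.ip (hf.pR haM).sm.bc))

theorem hasDerivAt_tangD (haM : |a| < M) (hf : SpinReg a M f) {v r θ φ : ℝ}
    (hr : r ∈ Ioo (rm a M) (rp a M)) :
    HasDerivAt (fun x => tangD f v x θ φ) (derTang a M f v r θ φ) r := by
  have hrc := Ioo_subset_Ioc_self hr
  have d1 : HasDerivAt (fun x => pV f v x θ φ) (pV (pR a M f) v r θ φ) r := by
    rw [hf.sm.pV_pR haM v r θ φ hrc]; exact (hf.pV haM).sm.hasDerivAt_r hr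
  have d2 : HasDerivAt (fun x => pTheta f v x θ φ) (pTheta (pR a M f) v r θ φ) r := by
    rw [hf.sm.pTheta_pR haM v r θ φ hrc]; exact (hf.sm.pTheta haM).hasDerivAt_r hr
  have d3 := hasDerivAt_covD_r (v := v) (θ := θ) (φ := φ) haM hf.sm hr
  have d4 := hf.sm.hasDerivAt_r (v := v) (θ := θ) (φ := φ) hr
  have := (((hasDerivAt_ip d1 d1).add (hasDerivAt_ip d2 d2)).add (hasDerivAt_ip d3 d3)).add
    (hasDerivAt_ip d4 d4)
  refine (this.congr_of_eventuallyEq (Eventually.of_forall fun s => ?_)).congr_deriv ?_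
  · simp [tangD, tangSq, ip_self]
  · unfold derTang
    rw [ip_comm (pV (pR a M f) v r θ φ), ip_comm (pTheta (pR a M f) v r θ φ),
      ip_comm (covD (pR a M f) v r θ φ), ip_comm (pR a M f v r θ φ)]
    ring

/-- For the auxiliary fields of a system, plain differentiation along r replaces a wave equation:
their tangential energies change at a rate governed by ∂_r f, which belongs to the next field of the
system. -/
theorem hasDerivAt_tangEnergy (haM : |a| < M) (hf : SpinReg a M f)
    (hr₁ : rm a M < r₁) (hW : WeightReg a M N r₁ W Wv Wr) {r : ℝ} (hr : r ∈ Ioo r₁ (rp a M)) :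
    Integrable (fun x : ℝ × ℝ × ℝ => Real.sin x.2.1 * (Wr x.1 r * tangD f x.1 r x.2.1 x.2.2
        + W x.1 r * derTang a M f x.1 r x.2.1 x.2.2)) flat ∧
    HasDerivAt (fun r => ∫ x, Real.sin x.2.1 * (W x.1 r * tangD f x.1 r x.2.1 x.2.2) ∂flat)
      (∫ x, Real.sin x.2.1 * (Wr x.1 r * tangD f x.1 r x.2.1 x.2.2
        + W x.1 r * derTang a M f x.1 r x.2.1 x.2.2) ∂flat) r := by
  have bW := bc_of_continuousOn_vr hW.cont
  have bWr := bc_of_continuousOn_vr hW.contR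
  have bf := hf.bc_tangD haM
  have b1 : BC a M (fun v r θ φ => Real.sin θ * (W v r * tangD f v r θ φ)) :=
    bc_sin.mul (bW.mul bf)
  have b2 : BC a M (fun v r θ φ => Real.sin θ * (Wr v r * tangD f v r θ φ
      + W v r * derTang a M f v r θ φ)) :=
    bc_sin.mul ((bWr.mul bf).add (bW.mul (hf.bc_derTang haM)))
  have v1 : VSupp a M N r₁ (fun v r θ φ => Real.sin θ * (W v r * tangD f v r θ φ)) :=
    fun v r θ φ hr hv => by simp [(hW.supp v r hr hv).1]
  have v2 : VSupp a M N r₁ (fun v r θ φ => Real.sin θ * (Wr v r * tangD f v r θ φ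
      + W v r * derTang a M f v r θ φ)) := fun v r θ φ hr hv => by
    simp [(hW.supp v r hr hv).1, (hW.supp v r hr hv).2.2]
  refine ⟨b2.integrable hr₁ (Ioo_subset_Icc_self hr) v2,
    BC.hasDerivAt_integral b1 b2 hr₁ hr v1 v2 ?_⟩
  intro v ρ θ φ hρ _
  have hρ' : ρ ∈ Ioo (rm a M) (rp a M) := ⟨hr₁.trans hρ.1, hρ.2⟩
  exact ((hW.derR v ρ hρ').mul (hasDerivAt_tangD haM hf hρ')).const_mul (Real.sin θ)

end Tang

theorem integral_add_add {α : Type*} [MeasurableSpace α] {μ : Measure α} {f g h : α → ℝ}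
    (hf : Integrable f μ) (hg : Integrable g μ) (hh : Integrable h μ) :
    ∫ x, f x ∂μ + ∫ x, g x ∂μ + ∫ x, h x ∂μ = ∫ x, (f x + g x + h x) ∂μ := by
  rw [← integral_add hf hg]
  exact (integral_add (hf.add hg) hh).symm

theorem integral_sub_sub {α : Type*} [MeasurableSpace α] {μ : Measure α} {f g h : α → ℝ}
    (hf : Integrable f μ) (hg : Integrable g μ) (hh : Integrable h μ) :
    ∫ x, f x ∂μ - ∫ x, g x ∂μ - ∫ x, h x ∂μ = ∫ x, (f x - g x - h x) ∂μ := by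
  rw [← integral_sub hf hg]
  exact (integral_sub (hf.sub hg) hh).symm

/-! ## Energy estimates for systems -/

/-- A solution `u` of a generalised Teukolsky equation whose source is controlled by `f₁`, together
with `f₁`, `f₀` whose `r`-derivatives are controlled by `u` and `f₁`. -/
structure TeukSys (a M k B₀ c₁ K r₀ r₂ : ℝ) (br : ℝ → ℝ) (bv : ℝ → ℝ → ℂ) (b : ℂ)
    (u F f₁ f₀ : ℝ → ℝ → ℝ → ℝ → ℂ) : Prop where
  regU : SpinReg a M u
  reg₁ : SpinReg a M f₁
  reg₀ : SpinReg a M f₀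
  eqn : ∀ v r θ φ, r ∈ Ioo (rm a M) (rp a M) → θ ∈ Ioo 0 Real.pi →
    opGen a M k br bv b u v r θ φ = F v r θ φ
  boundF : ∀ v r θ φ, r ∈ Ioc (rm a M) (rp a M) → θ ∈ Ioo 0 Real.pi →
    ‖F v r θ φ‖ ^ 2 ≤ B₀ * tangD f₁ v r θ φ
  bound₁ : ∀ v r θ φ, r ∈ Ioc (rm a M) (rp a M) → θ ∈ Ioo 0 Real.pi →
    tangD (pR a M f₁) v r θ φ ≤ tangD u v r θ φ
  bound₀ : ∀ v r θ φ, r ∈ Ioc (rm a M) (rp a M) → θ ∈ Ioo 0 Real.pi →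
    tangD (pR a M f₀) v r θ φ ≤ tangD f₁ v r θ φ
  hbr : ∀ r ∈ Ioc r₀ r₂, |br r| ≤ B₀
  hbv : ∀ r θ, r ∈ Ioc r₀ r₂ → ‖bv r θ‖ ≤ B₀
  hb : ‖b + 2‖ ≤ B₀
  hκ : ∀ r ∈ Ioc r₀ r₂, c₁ ≤ br r - (r - M) + K * (-Delta a M r)

/-- The total energy density of a system. -/
noncomputable def eTot (a M k Z : ℝ) (u f₁ f₀ : ℝ → ℝ → ℝ → ℝ → ℂ) (v r θ φ : ℝ) : ℝ :=
  eDens a M k Z u v r θ φ + tangD f₁ v r θ φ + tangD f₀ v r θ φ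

/-- The energy density of a system up to constants. -/
noncomputable def dTot (a M : ℝ) (u f₁ f₀ : ℝ → ℝ → ℝ → ℝ → ℂ) (v r θ φ : ℝ) : ℝ :=
  -Delta a M r * ‖pR a M u v r θ φ‖ ^ 2 + tangD u v r θ φ + tangD f₁ v r θ φ + tangD f₀ v r θ φ

theorem pPhi_eq_covD {u : ℝ → ℝ → ℝ → ℝ → ℂ} {v r θ φ : ℝ} (hθ : θ ∈ Ioo 0 Real.pi) :
    pPhi u v r θ φ = (Real.sin θ : ℂ) * covD u v r θ φ
      - 2 * Complex.I * (Real.cos θ : ℂ) * u v r θ φ := by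
  have hs : (Real.sin θ : ℂ) ≠ 0 := Complex.ofReal_ne_zero.2 (Real.sin_pos_of_mem_Ioo hθ).ne'
  unfold covD covPhi
  push_cast at hs ⊢
  field_simp
  ring

/-- `(g, q)` is an admissible pair: `g` is a weight of slow variation up to `q`. -/
structure SlowWeight (ε N₀ : ℝ) (g q : ℝ → ℝ) : Prop where
  smooth : ContDiff ℝ 1 g
  nonneg : ∀ v, 0 ≤ g v
  contq : Continuous q
  qnonneg : ∀ v, 0 ≤ q v
  qsupp : ∀ v, N₀ < |v| → q v = 0
  slow : ∀ v, |deriv g v| ≤ ε * g v + q v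

theorem cutW_nonneg {a M : ℝ} {g : ℝ → ℝ} (hg : ∀ v, 0 ≤ g v) (n l L v r : ℝ) :
    0 ≤ cutW a M g n l L v r :=
  mul_nonneg (mul_nonneg (hg v) (Real.smoothTransition.nonneg _)) (Real.smoothTransition.nonneg _)

theorem cutW_le {a M : ℝ} {g : ℝ → ℝ} (hg : ∀ v, 0 ≤ g v) (n l L v r : ℝ) :
    cutW a M g n l L v r ≤ g v := by
  unfold cutW
  have h1 := Real.smoothTransition.le_one (n - v + l * (r - rp a M))
  have h2 := Real.smoothTransition.le_one (n + v + L * Real.log (r - rm a M))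
  have h3 : g v * stp (n - v + l * (r - rp a M)) ≤ g v := mul_le_of_le_one_right (hg v) h1
  exact (mul_le_of_le_one_right (mul_nonneg (hg v) (Real.smoothTransition.nonneg _)) h2).trans h3

set_option maxHeartbeats 1000000 in
/-- The energy inequality for systems, with constants that do not depend on the fields. -/
theorem exists_energy_ineq {a M : ℝ} (ha : 0 < |a|) (haM : |a| < M) (B₀ c₁ K : ℝ) (hc₁ : 0 < c₁)
    (hK : 0 ≤ K) :
    ∃ Z c₀ C lam C₁ ε : ℝ, 0 < c₀ ∧ 0 < C ∧ 0 < lam ∧ 0 < C₁ ∧ 0 < ε ∧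
    ∀ {k r₀ r₂ : ℝ} {br : ℝ → ℝ} {bv : ℝ → ℝ → ℂ} {b : ℂ} {u F f₁ f₀ : ℝ → ℝ → ℝ → ℝ → ℂ},
      k ^ 2 = a ^ 2 → rm a M ≤ r₀ → r₂ ≤ rp a M → TeukSys a M k B₀ c₁ K r₀ r₂ br bv b u F f₁ f₀ →
      (∀ v r θ φ, r ∈ Ioc r₀ r₂ → θ ∈ Ioo 0 Real.pi →
        c₀ * dTot a M u f₁ f₀ v r θ φ ≤ eTot a M k Z u f₁ f₀ v r θ φ ∧
        eTot a M k Z u f₁ f₀ v r θ φ ≤ C * dTot a M u f₁ f₀ v r θ φ) ∧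
      ∀ {g q : ℝ → ℝ} {n L N₀ r₁ : ℝ}, SlowWeight ε N₀ g q → 0 ≤ L → r₀ < r₁ →
        (∀ v r, r ∈ Ioo r₁ r₂ → (g v = 0 ∨ deriv stp (n + v + L * Real.log (r - rm a M)) = 0) ∨
          (C₁ ≤ L / (r - rm a M) ∧ C₁ ≤ L / (r - rm a M) * (-Delta a M r))) →
        ∀ r ∈ Ioo r₁ r₂, ∃ E' : ℝ,
          HasDerivAt (fun r => ∫ x, Real.sin x.2.1 *
            (cutW a M g n lam L x.1 r * eTot a M k Z u f₁ f₀ x.1 r x.2.1 x.2.2) ∂flat) E' r ∧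
          c₁ / 2 * (∫ x, Real.sin x.2.1 *
              (cutW a M g n lam L x.1 r * ‖pR a M u x.1 r x.2.1 x.2.2‖ ^ 2) ∂flat)
            - C * (∫ x, Real.sin x.2.1 *
              (cutW a M g n lam L x.1 r * eTot a M k Z u f₁ f₀ x.1 r x.2.1 x.2.2) ∂flat)
            - C * (∫ x, Real.sin x.2.1 * (q x.1 *
              (‖pR a M u x.1 r x.2.1 x.2.2‖ ^ 2 + tangD u x.1 r x.2.1 x.2.2)) ∂flat) ≤ E' := by
  obtain ⟨B, ρ, hB0, hB1, hρ, hpt⟩ := exists_ptBound ha haM B₀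
  obtain ⟨Z, c₀, C, lam, C₁, ε, hZ, hc₀, hC, hlam, hC₁, hε, hmaster⟩ :=
    exists_master B ρ c₁ K hB1 hρ hc₁ hK
  -- Besides C, the summand 1/c₀ pays for `tangD u` coming from ∂_r f₁, C |B₀| for the source, and 2
  -- + 1 for the energies of f₁ and f₀ produced by `derTang_ge`.
  obtain ⟨C', hC'⟩ : ∃ X : ℝ, X = C + 1 / c₀ + C * |B₀| + 2 + 1 := ⟨_, rfl⟩
  have hC'C : C ≤ C' := by
    rw [hC']
    have : 0 ≤ 1 / c₀ + C * |B₀| := by positivity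
    linarith
  have hC'1 : 1 ≤ C' := by
    rw [hC']
    have : 0 ≤ C + 1 / c₀ + C * |B₀| := by positivity
    linarith
  refine ⟨Z, min c₀ 1, C', lam, C₁, ε, by positivity, by linarith, hlam, hC₁, hε, ?_⟩
  intro k r₀ r₂ br bv b u F f₁ f₀ hk hr₀ hr₂ S
  have hIcc : ∀ {r}, r ∈ Ioc r₀ r₂ → r ∈ Icc (rm a M) (rp a M) := fun h =>
    ⟨hr₀.trans h.1.le, h.2.trans hr₂⟩
  have hIoc : ∀ {r}, r ∈ Ioc r₀ r₂ → r ∈ Ioc (rm a M) (rp a M) := fun h =>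
    ⟨hr₀.trans_lt h.1, h.2.trans hr₂⟩
  have key := fun (v r θ φ : ℝ) (hr : r ∈ Ioc r₀ r₂) (hθ : θ ∈ Ioo 0 Real.pi) =>
    hmaster (x := pR a M u v r θ φ) (y := pV u v r θ φ) (t := pTheta u v r θ φ)
      (F := F v r θ φ) (hpt k r θ hk (hIcc hr)) (pPhi_eq_covD (u := u) (v := v) (r := r) (φ := φ) hθ)
      ((S.hbr r hr).trans hB0) ((S.hbv r θ hr).trans hB0) (S.hb.trans hB0)
      (by have := S.hκ r hr; linarith)
  have hX : ∀ v r θ φ, r ∈ Ioc r₀ r₂ → 0 ≤ -Delta a M r * ‖pR a M u v r θ φ‖ ^ 2 :=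
    fun v r θ φ hr => mul_nonneg (by linarith [Delta_nonpos haM (hIcc hr)]) (sq_nonneg _)
  refine ⟨?_, ?_⟩
  · intro v r θ φ hr hθ
    obtain ⟨k1, k2, -⟩ := key v r θ φ hr hθ
    have h0 := hX v r θ φ hr
    have hu := tangD_nonneg u v r θ φ
    have h1 := tangD_nonneg f₁ v r θ φ
    have h2 := tangD_nonneg f₀ v r θ φ
    have m1 := min_le_left c₀ 1
    have m2 := min_le_right c₀ 1
    change c₀ * (-Delta a M r * ‖pR a M u v r θ φ‖ ^ 2 + tangD u v r θ φ)
      ≤ eDens a M k Z u v r θ φ at k1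
    change eDens a M k Z u v r θ φ
      ≤ C * (-Delta a M r * ‖pR a M u v r θ φ‖ ^ 2 + tangD u v r θ φ) at k2
    unfold dTot eTot
    constructor
    · have := mul_le_mul_of_nonneg_right m1 (add_nonneg h0 hu)
      have := mul_le_mul_of_nonneg_right m2 (add_nonneg h1 h2)
      linarith
    · have := mul_le_mul_of_nonneg_right hC'C (add_nonneg h0 hu)
      have := mul_le_mul_of_nonneg_right hC'1 (add_nonneg h1 h2)
      linarith
  · intro g q n L N₀ r₁ hg hL hr₁ hμ r hr
    have hr₁' : rm a M < r₁ := hr₀.trans_lt hr₁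
    have hW := cutW_reg (a := a) (M := M) hg.smooth (n := n) hlam.le hL r₁ hr₁'
    set N := n + L * |Real.log (rp a M - rm a M)| with hN
    set W := cutW a M g n lam L with hWdef
    have hrr : r ∈ Ioo r₁ (rp a M) := ⟨hr.1, hr.2.trans_le hr₂⟩
    have hr' : r ∈ Ioc r₀ r₂ := ⟨hr₁.trans hr.1, hr.2.le⟩
    have hrI := Ioo_subset_Icc_self hrr
    obtain ⟨i1, d1⟩ := hasDerivAt_energy haM hk Z S.regU hr₁' hW S.eqn hrr
    obtain ⟨i2, d2⟩ := hasDerivAt_tangEnergy haM S.reg₁ hr₁' hW hrr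
    obtain ⟨i3, d3⟩ := hasDerivAt_tangEnergy haM S.reg₀ hr₁' hW hrr
    have bW : BC a M (fun v r _ _ => W v r) := bc_of_continuousOn_vr hW.cont
    have bq : BC a M (fun v _ _ _ => q v) :=
      bc_of_continuousOn_vr (k := fun v _ => q v) (hg.contq.comp continuous_fst).continuousOn
    have bx := (S.regU.pR haM).sm.bc.norm_sq
    have be : BC a M (eTot a M k Z u f₁ f₀) :=
      ((S.regU.bc_eDens haM Z).add (S.reg₁.bc_tangD haM)).add (S.reg₀.bc_tangD haM)
    have vW : ∀ {f : ℝ → ℝ → ℝ → ℝ → ℝ}, VSupp a M N r₁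
        (fun v r θ φ => Real.sin θ * (W v r * f v r θ φ)) :=
      fun v r θ φ hr hv => by simp [(hW.supp v r hr hv).1]
    have vq : ∀ {f : ℝ → ℝ → ℝ → ℝ → ℝ}, VSupp a M N₀ r₁
        (fun v r θ φ => Real.sin θ * (q v * f v r θ φ)) :=
      fun v r θ φ hr hv => by simp [hg.qsupp v hv]
    have I1 := (bc_sin.mul (bW.mul bx)).integrable hr₁' hrI vW
    have I2 := (bc_sin.mul (bW.mul be)).integrable hr₁' hrI vW
    have I3 := (bc_sin.mul (bq.mul (bx.add (S.regU.bc_tangD haM)))).integrable hr₁' hrI vq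
    have e1 := (bc_sin.mul (bW.mul (S.regU.bc_eDens (k := k) haM Z)))
    have e2 := (bc_sin.mul (bW.mul (S.reg₁.bc_tangD haM)))
    have e3 := (bc_sin.mul (bW.mul (S.reg₀.bc_tangD haM)))
    refine ⟨_, ((d1.add d2).add d3).congr_of_eventuallyEq ?_, ?_⟩
    · filter_upwards [Ioo_mem_nhds hrr.1 hrr.2] with s hs
      have hsI := Ioo_subset_Icc_self hs
      have j1 := e1.integrable hr₁' hsI vW
      have j2 := e2.integrable hr₁' hsI vW
      have j3 := e3.integrable hr₁' hsI vW
      refine Eq.trans ?_ (integral_add_add j1 j2 j3).symm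
      refine integral_congr_ae (Eventually.of_forall fun x => ?_)
      simp only [eTot]
      ring
    · rw [← integral_const_mul, ← integral_const_mul, ← integral_const_mul,
        integral_add_add i1 i2 i3,
        integral_sub_sub (I1.const_mul _) (I2.const_mul _) (I3.const_mul _)]
      refine integral_mono_ae (((I1.const_mul _).sub (I2.const_mul _)).sub (I3.const_mul _))
        ((i1.add i2).add i3) ?_
      filter_upwards [ae_flat] with x hx
      obtain ⟨v, θ, φ⟩ := x
      have hθ : θ ∈ Ioo 0 Real.pi := hx.1
      have hs := (Real.sin_pos_of_mem_Ioo hθ).le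
      obtain ⟨k1, -, k3⟩ := key v r θ φ hr' hθ
      have hg0 := hg.nonneg v
      have sA := Real.smoothTransition.nonneg (n - v + lam * (r - rp a M))
      have sB := Real.smoothTransition.nonneg (n + v + L * Real.log (r - rm a M))
      have sA1 := Real.smoothTransition.le_one (n - v + lam * (r - rp a M))
      have sB1 := Real.smoothTransition.le_one (n + v + L * Real.log (r - rm a M))
      have dA := deriv_stp_nonneg (n - v + lam * (r - rp a M))
      have dB := deriv_stp_nonneg (n + v + L * Real.log (r - rm a M))
      have hW0 : 0 ≤ W v r := cutW_nonneg hg.nonneg _ _ _ _ _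
      have hq0 := hg.qnonneg v
      obtain ⟨σ₁, hσ₁⟩ : ∃ X, X = g v * deriv stp (n - v + lam * (r - rp a M))
        * stp (n + v + L * Real.log (r - rm a M)) := ⟨_, rfl⟩
      obtain ⟨σ₂, hσ₂⟩ : ∃ X, X = g v * stp (n - v + lam * (r - rp a M))
        * deriv stp (n + v + L * Real.log (r - rm a M)) := ⟨_, rfl⟩
      have hσ₁0 : 0 ≤ σ₁ := by rw [hσ₁]; exact mul_nonneg (mul_nonneg hg0 dA) sB
      have hσ₂0 : 0 ≤ σ₂ := by rw [hσ₂]; exact mul_nonneg (mul_nonneg hg0 sA) dB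
      have hWr : cutWr a M g n lam L v r = lam * σ₁ + L / (r - rm a M) * σ₂ := by
        rw [hσ₁, hσ₂]; rfl
      have hWr0 : 0 ≤ cutWr a M g n lam L v r := by
        rw [hWr]
        have : 0 ≤ L / (r - rm a M) := div_nonneg hL (by linarith [hr.1])
        positivity
      -- Adding σ₁ and subtracting σ₂ removes the derivatives of the two cut-offs and leaves g'
      -- times the cut-offs.
      have hWv : |cutWv a M g n lam L v r + σ₁ - σ₂| ≤ ε * W v r + q v := by
        have : cutWv a M g n lam L v r + σ₁ - σ₂ = deriv g v *
            (stp (n - v + lam * (r - rp a M)) * stp (n + v + L * Real.log (r - rm a M))) := by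
          rw [hσ₁, hσ₂]; unfold cutWv; ring
        have hp0 := mul_nonneg sA sB
        have hp1 : stp (n - v + lam * (r - rp a M)) * stp (n + v + L * Real.log (r - rm a M)) ≤ 1 :=
          mul_le_one₀ sA1 sB sB1
        rw [this, abs_mul, abs_of_nonneg hp0]
        refine (mul_le_mul_of_nonneg_right (hg.slow v) hp0).trans ?_
        have h5 : q v * (stp (n - v + lam * (r - rp a M)) *
          stp (n + v + L * Real.log (r - rm a M))) ≤ q v := mul_le_of_le_one_right hq0 hp1
        have h6 : W v r = g v * (stp (n - v + lam * (r - rp a M)) *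
          stp (n + v + L * Real.log (r - rm a M))) := by rw [hWdef]; unfold cutW; ring
        rw [h6]
        linarith
      -- If σ₂ = 0 the value of μ is irrelevant, and one satisfying both lower bounds is chosen;
      -- this is possible since Δ < 0 at r.
      have hm : ∃ μ, C₁ ≤ μ ∧ C₁ ≤ μ * (-Delta a M r) ∧
          cutWr a M g n lam L v r = lam * σ₁ + μ * σ₂ := by
        rcases hμ v r hr with h | ⟨h1, h2⟩
        · have hz : σ₂ = 0 := by rcases h with h | h <;> simp [hσ₂, h]
          have hDl : 0 < -Delta a M r := by
            rw [Delta_eq haM]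
            have := mul_pos (sub_pos.2 hrr.2) (sub_pos.2 (hr₁'.trans hrr.1))
            linarith
          refine ⟨C₁ * (1 + 1 / (-Delta a M r)), ?_, ?_, by rw [hWr, hz]; ring⟩
          · have : 0 ≤ C₁ * (1 / (-Delta a M r)) := by positivity
            linarith
          · have : C₁ * (1 + 1 / (-Delta a M r)) * (-Delta a M r)
              = C₁ * (-Delta a M r) + C₁ := by
              rw [mul_add, add_mul, mul_one, mul_assoc C₁, one_div_mul_cancel hDl.ne', mul_one]
            rw [this]
            have : 0 ≤ C₁ * (-Delta a M r) := by positivity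
            linarith
        · exact ⟨_, h1, h2, hWr⟩
      obtain ⟨μ, hμ1, hμ2, hμ3⟩ := hm
      have hfin := k3 hW0 hq0 hσ₁0 hσ₂0 hμ1 hμ2 hμ3 hWv
      have hrc := hIoc hr'
      have bF := S.boundF v r θ φ hrc hθ
      have b1 := S.bound₁ v r θ φ hrc hθ
      have b0 := S.bound₀ v r θ φ hrc hθ
      have g1 := derTang_ge (a := a) (M := M) (f := f₁) v r θ φ
      have g0 := derTang_ge (a := a) (M := M) (f := f₀) v r θ φ
      have t1 := tangD_nonneg f₁ v r θ φ
      have t0 := tangD_nonneg f₀ v r θ φ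
      have tu := tangD_nonneg u v r θ φ
      have hx0 := hX v r θ φ hr'
      change c₀ * (-Delta a M r * ‖pR a M u v r θ φ‖ ^ 2 + tangD u v r θ φ)
        ≤ eDens a M k Z u v r θ φ at k1
      change W v r * (c₁ / 2 * ‖pR a M u v r θ φ‖ ^ 2 - C * eDens a M k Z u v r θ φ
          - C * ‖F v r θ φ‖ ^ 2) - C * q v * (‖pR a M u v r θ φ‖ ^ 2 + tangD u v r θ φ)
        ≤ cutWv a M g n lam L v r * eFlux a M k u v r θ φ
          + cutWr a M g n lam L v r * eDens a M k Z u v r θ φ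
          + W v r * eLow a M k Z br bv b u F v r θ φ at hfin
      have hue : tangD u v r θ φ ≤ 1 / c₀ * eDens a M k Z u v r θ φ := by
        rw [one_div, inv_mul_eq_div, le_div_iff₀ hc₀]
        nlinarith
      have he0 : 0 ≤ eDens a M k Z u v r θ φ := (mul_nonneg hc₀.le (add_nonneg hx0 tu)).trans k1
      have hF' : C * ‖F v r θ φ‖ ^ 2 ≤ C * |B₀| * tangD f₁ v r θ φ := by
        rw [mul_assoc]
        refine mul_le_mul_of_nonneg_left (bF.trans ?_) hC.le
        exact mul_le_mul_of_nonneg_right (le_abs_self _) t1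
      have hsum : W v r * (c₁ / 2 * ‖pR a M u v r θ φ‖ ^ 2)
          - C' * (W v r * eTot a M k Z u f₁ f₀ v r θ φ)
          ≤ W v r * (c₁ / 2 * ‖pR a M u v r θ φ‖ ^ 2 - C * eDens a M k Z u v r θ φ
          - C * ‖F v r θ φ‖ ^ 2) + W v r * derTang a M f₁ v r θ φ
          + W v r * derTang a M f₀ v r θ φ := by
        have : c₁ / 2 * ‖pR a M u v r θ φ‖ ^ 2 - C' * eTot a M k Z u f₁ f₀ v r θ φ
          ≤ (c₁ / 2 * ‖pR a M u v r θ φ‖ ^ 2 - C * eDens a M k Z u v r θ φ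
          - C * ‖F v r θ φ‖ ^ 2) + derTang a M f₁ v r θ φ + derTang a M f₀ v r θ φ := by
          have q1 : 0 ≤ (C * |B₀| + 2 + 1) * eDens a M k Z u v r θ φ := by positivity
          have q2 : 0 ≤ (C + 1 / c₀) * tangD f₁ v r θ φ := by positivity
          have q3 : 0 ≤ (C + 1 / c₀ + C * |B₀|) * tangD f₀ v r θ φ := by positivity
          unfold eTot
          rw [hC']
          linarith
        have := mul_le_mul_of_nonneg_left this hW0
        linarith
      have hq2 : 0 ≤ (C' - C) * (q v * (‖pR a M u v r θ φ‖ ^ 2 + tangD u v r θ φ)) := by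
        have : 0 ≤ C' - C := by linarith
        positivity
      -- The r-derivative of the weight is nonnegative, so its products with the energies of f₁ and
      -- f₀ may be dropped.
      have w1 := mul_nonneg hWr0 t1
      have w0 := mul_nonneg hWr0 t0
      have tot : c₁ / 2 * (W v r * ‖pR a M u v r θ φ‖ ^ 2)
          - C' * (W v r * eTot a M k Z u f₁ f₀ v r θ φ)
          - C' * (q v * (‖pR a M u v r θ φ‖ ^ 2 + tangD u v r θ φ))
          ≤ (cutWv a M g n lam L v r * eFlux a M k u v r θ φ
          + cutWr a M g n lam L v r * eDens a M k Z u v r θ φ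
          + W v r * eLow a M k Z br bv b u F v r θ φ)
          + (cutWr a M g n lam L v r * tangD f₁ v r θ φ + W v r * derTang a M f₁ v r θ φ)
          + (cutWr a M g n lam L v r * tangD f₀ v r θ φ + W v r * derTang a M f₀ v r θ φ) := by
        linarith
      have := mul_le_mul_of_nonneg_left tot hs
      dsimp only
      linarith


/-! ## Weighted estimates -/

theorem lintegral_le_of_monotone_tendsto {α : Type*} [MeasurableSpace α] {μ : Measure α}
    {f : ℕ → α → ENNReal} {F : α → ENNReal} {K : ENNReal} (hf : ∀ n, AEMeasurable (f n) μ)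
    (hm : ∀ᵐ x ∂μ, Monotone fun n => f n x)
    (hl : ∀ᵐ x ∂μ, Tendsto (fun n => f n x) atTop (𝓝 (F x))) (h : ∀ n, ∫⁻ x, f n x ∂μ ≤ K) :
    ∫⁻ x, F x ∂μ ≤ K :=
  le_of_tendsto' (lintegral_tendsto_of_tendsto_of_monotone hf hm hl) h

theorem ofReal_integral_flat {f : ℝ × ℝ × ℝ → ℝ} (hm : AEStronglyMeasurable f flat)
    (hi : Integrable (fun x => Real.sin x.2.1 * f x) flat)
    (h0 : ∀ x : ℝ × ℝ × ℝ, x.2.1 ∈ Ioo 0 Real.pi → 0 ≤ f x) :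
    ENNReal.ofReal (∫ x, Real.sin x.2.1 * f x ∂flat) = ∫⁻ x, ENNReal.ofReal (f x) ∂cyl := by
  rw [lintegral_cyl hm.aemeasurable.ennreal_ofReal, ofReal_integral_eq_lintegral_ofReal hi]
  · refine lintegral_congr_ae ?_
    filter_upwards [ae_flat] with x hx
    exact ENNReal.ofReal_mul (Real.sin_pos_of_mem_Ioo hx.1).le
  · filter_upwards [ae_flat] with x hx
    exact mul_nonneg (Real.sin_pos_of_mem_Ioo hx.1).le (h0 x hx.1)

section CutLimit

variable {a M : ℝ} {g : ℝ → ℝ}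

theorem monotone_cutW (hg : ∀ v, 0 ≤ g v) (l L v r : ℝ) :
    Monotone fun n : ℕ => cutW a M g n l L v r := by
  intro m n hmn
  have h : (m : ℝ) ≤ n := Nat.cast_le.2 hmn
  have h1 : stp (m - v + l * (r - rp a M)) ≤ stp (n - v + l * (r - rp a M)) :=
    Real.smoothTransition.monotone (by linarith)
  have h2 : stp (m + v + L * Real.log (r - rm a M)) ≤ stp (n + v + L * Real.log (r - rm a M)) :=
    Real.smoothTransition.monotone (by linarith)
  exact mul_le_mul (mul_le_mul_of_nonneg_left h1 (hg v)) h2 (Real.smoothTransition.nonneg _)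
    (mul_nonneg (hg v) (Real.smoothTransition.nonneg _))

theorem tendsto_cutW (l L v r : ℝ) :
    Tendsto (fun n : ℕ => cutW a M g n l L v r) atTop (𝓝 (g v)) := by
  refine tendsto_const_nhds.congr' ?_
  have e := tendsto_natCast_atTop_atTop (R := ℝ)
  filter_upwards [e.eventually_ge_atTop (1 + v - l * (r - rp a M)),
    e.eventually_ge_atTop (1 - v - L * Real.log (r - rm a M))] with n h1 h2
  unfold cutW
  rw [stp, Real.smoothTransition.one_of_one_le (by linarith),
    Real.smoothTransition.one_of_one_le (by linarith), mul_one, mul_one]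

theorem lintegral_le_of_cutW (hg : ∀ v, 0 ≤ g v) {l L r : ℝ} {f : ℝ × ℝ × ℝ → ℝ}
    {K : ENNReal} (h0 : ∀ x : ℝ × ℝ × ℝ, x.2.1 ∈ Ioo 0 Real.pi → 0 ≤ f x)
    (hm : ∀ n : ℕ, AEMeasurable (fun x => cutW a M g n l L x.1 r * f x) flat)
    (h : ∀ n : ℕ, ∫⁻ x, ENNReal.ofReal (cutW a M g n l L x.1 r * f x) ∂cyl ≤ K) :
    ∫⁻ x, ENNReal.ofReal (g x.1 * f x) ∂cyl ≤ K := by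
  refine lintegral_le_of_monotone_tendsto (fun n => ((hm n).mono_ac
    cyl_absolutelyContinuous).ennreal_ofReal) ?_ ?_ h
  · filter_upwards [ae_cyl] with x hx m n hmn
    exact ENNReal.ofReal_le_ofReal (mul_le_mul_of_nonneg_right (monotone_cutW hg l L x.1 r hmn)
      (h0 x hx.1))
  · refine Eventually.of_forall fun x => ?_
    exact (ENNReal.continuous_ofReal.tendsto _).comp ((tendsto_cutW l L x.1 r).mul_const _)

end CutLimit

theorem dTot_nonneg {a M : ℝ} (haM : |a| < M) {u f₁ f₀ : ℝ → ℝ → ℝ → ℝ → ℂ} {v r θ φ : ℝ}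
    (hr : r ∈ Icc (rm a M) (rp a M)) : 0 ≤ dTot a M u f₁ f₀ v r θ φ := by
  have h := mul_nonneg (by linarith [Delta_nonpos haM hr] : 0 ≤ -Delta a M r)
    (sq_nonneg ‖pR a M u v r θ φ‖)
  have := tangD_nonneg u v r θ φ
  have := tangD_nonneg f₁ v r θ φ
  have := tangD_nonneg f₀ v r θ φ
  unfold dTot
  linarith

-- For each cut-off parameter n, Grönwall's inequality gives a bound independent of n, and n → ∞
-- removes the cut-off by monotone convergence. The constants precede the fields and the weight, so
-- that the weight can be chosen after ε is known.
set_option maxHeartbeats 1000000 in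
theorem exists_weighted_estimate {a M : ℝ} (ha : 0 < |a|) (haM : |a| < M) (B₀ c₁ K : ℝ)
    (hc₁ : 0 < c₁) (hK : 0 ≤ K) :
    ∃ C₂ C₁ ε : ℝ, 0 < C₂ ∧ 0 < C₁ ∧ 0 < ε ∧
    ∀ {k r₀ r₂ : ℝ} {br : ℝ → ℝ} {bv : ℝ → ℝ → ℂ} {b : ℂ} {u F f₁ f₀ : ℝ → ℝ → ℝ → ℝ → ℂ},
      k ^ 2 = a ^ 2 → rm a M ≤ r₀ → r₂ ≤ rp a M → TeukSys a M k B₀ c₁ K r₀ r₂ br bv b u F f₁ f₀ →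
      ∀ {g q : ℝ → ℝ} {L N₀ D I : ℝ}, SlowWeight ε N₀ g q → 0 ≤ L → 0 ≤ D → 0 ≤ I →
        (∀ n v r : ℝ, 0 ≤ n → r ∈ Ioo r₀ r₂ →
          (g v = 0 ∨ deriv stp (n + v + L * Real.log (r - rm a M)) = 0) ∨
          (C₁ ≤ L / (r - rm a M) ∧ C₁ ≤ L / (r - rm a M) * (-Delta a M r))) →
        ∫⁻ x, ENNReal.ofReal (g x.1 * dTot a M u f₁ f₀ x.1 r₂ x.2.1 x.2.2) ∂cyl
          ≤ ENNReal.ofReal I →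
        ∀ r₁ ∈ Ioo r₀ r₂, (∀ r ∈ Ioo r₁ r₂, ∫ x, Real.sin x.2.1 * (q x.1 *
            (‖pR a M u x.1 r x.2.1 x.2.2‖ ^ 2 + tangD u x.1 r x.2.1 x.2.2)) ∂flat ≤ D) →
          ∫⁻ x, ENNReal.ofReal (g x.1 * dTot a M u f₁ f₀ x.1 r₁ x.2.1 x.2.2) ∂cyl
            ≤ ENNReal.ofReal (C₂ * (I + D)) ∧
          ∫⁻ r in Ioc r₁ r₂, ∫⁻ x, ENNReal.ofReal (g x.1 * ‖pR a M u x.1 r x.2.1 x.2.2‖ ^ 2) ∂cyl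
            ≤ ENNReal.ofReal (C₂ * (I + D)) := by
  obtain ⟨Z, c₀, C, lam, C₁, ε, hc₀, hC, hlam, hC₁, hε, hen⟩ :=
    exists_energy_ineq ha haM B₀ c₁ K hc₁ hK
  have hlt := rm_lt_rp haM
  obtain ⟨G, hG⟩ : ∃ X, X = Real.exp (C * (rp a M - rm a M)) * (C * (1 + (rp a M - rm a M))) :=
    ⟨_, rfl⟩
  have hG0 : 0 < G := by
    rw [hG]
    have : 0 < 1 + (rp a M - rm a M) := by linarith
    positivity
  refine ⟨G * (1 / c₀ + 2 / c₁), C₁, ε, by positivity, hC₁, hε, ?_⟩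
  intro k r₀ r₂ br bv b u F f₁ f₀ hk hr₀ hr₂ S g q L N₀ D I hg hL hD hI hμ hdata r₁ hr₁ hq
  obtain ⟨hcmp, hineq⟩ := hen hk hr₀ hr₂ S
  have hr₁' : rm a M < r₁ := hr₀.trans_lt hr₁.1
  have h12 := hr₁.2.le
  have hsub : Icc r₁ r₂ ⊆ Icc r₁ (rp a M) := Icc_subset_Icc_right hr₂
  have hoc : ∀ {r}, r ∈ Icc r₁ r₂ → r ∈ Ioc r₀ r₂ := fun h => ⟨hr₁.1.trans_le h.1, h.2⟩
  have hcc : ∀ {r}, r ∈ Icc r₁ r₂ → r ∈ Icc (rm a M) (rp a M) := fun h =>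
    ⟨hr₁'.le.trans h.1, h.2.trans hr₂⟩
  have hco : ∀ {r}, r ∈ Icc r₁ r₂ → r ∈ Ioc (rm a M) (rp a M) := fun h =>
    ⟨hr₁'.trans_le h.1, h.2.trans hr₂⟩
  have hreg := fun n : ℕ => cutW_reg (a := a) (M := M) hg.smooth (n := n) hlam.le hL r₁ hr₁'
  have bx := (S.regU.pR haM).sm.bc.norm_sq
  have be : BC a M (eTot a M k Z u f₁ f₀) :=
    ((S.regU.bc_eDens haM Z).add (S.reg₁.bc_tangD haM)).add (S.reg₀.bc_tangD haM)
  have bd : BC a M (dTot a M u f₁ f₀) :=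
    (((bc_Delta.neg.mul bx).add (S.regU.bc_tangD haM)).add (S.reg₁.bc_tangD haM)).add
      (S.reg₀.bc_tangD haM)
  have bW := fun n : ℕ => bc_of_continuousOn_vr (hreg n).cont
  have vW : ∀ (n : ℕ) {f : ℝ → ℝ → ℝ → ℝ → ℝ}, VSupp a M
      (n + L * |Real.log (rp a M - rm a M)|) r₁
      (fun v r θ φ => Real.sin θ * (cutW a M g n lam L v r * f v r θ φ)) :=
    fun n f v r θ φ hr hv => by simp [((hreg n).supp v r hr hv).1]
  have hW0 : ∀ (n : ℕ) v r, 0 ≤ cutW a M g n lam L v r := fun n v r => cutW_nonneg hg.nonneg _ _ _ _ _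
  have hInt : ∀ (n : ℕ) {f : ℝ → ℝ → ℝ → ℝ → ℝ}, BC a M f → ∀ r ∈ Icc r₁ r₂,
      Integrable (fun x : ℝ × ℝ × ℝ => Real.sin x.2.1 *
        (cutW a M g n lam L x.1 r * f x.1 r x.2.1 x.2.2)) flat := fun n f hf r hr =>
    (bc_sin.mul ((bW n).mul hf)).integrable hr₁' (hsub hr) (vW n)
  have hMeas : ∀ (n : ℕ) {f : ℝ → ℝ → ℝ → ℝ → ℝ}, BC a M f → ∀ r ∈ Icc r₁ r₂,
      AEStronglyMeasurable (fun x : ℝ × ℝ × ℝ =>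
        cutW a M g n lam L x.1 r * f x.1 r x.2.1 x.2.2) flat := fun n f hf r hr =>
    ((bW n).mul hf).aestronglyMeasurable (hco hr)
  have hLe : ∀ (n : ℕ) {f : ℝ → ℝ → ℝ → ℝ → ℝ}, BC a M f → ∀ r ∈ Icc r₁ r₂,
      (∀ v θ φ, θ ∈ Ioo 0 Real.pi → 0 ≤ f v r θ φ) →
      ENNReal.ofReal (∫ x, Real.sin x.2.1 * (cutW a M g n lam L x.1 r * f x.1 r x.2.1 x.2.2) ∂flat)
        = ∫⁻ x, ENNReal.ofReal (cutW a M g n lam L x.1 r * f x.1 r x.2.1 x.2.2) ∂cyl :=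
    fun n f hf r hr h0 => ofReal_integral_flat (hMeas n hf r hr) (hInt n hf r hr)
      fun x hx => mul_nonneg (hW0 n _ _) (h0 _ _ _ hx)
  have he0 : ∀ v r θ φ, r ∈ Icc r₁ r₂ → θ ∈ Ioo 0 Real.pi → 0 ≤ eTot a M k Z u f₁ f₀ v r θ φ :=
    fun v r θ φ hr hθ => (mul_nonneg hc₀.le (dTot_nonneg haM (hcc hr))).trans
      (hcmp v r θ φ (hoc hr) hθ).1
  let E : ℕ → ℝ → ℝ := fun n r => ∫ x, Real.sin x.2.1 *
    (cutW a M g n lam L x.1 r * eTot a M k Z u f₁ f₀ x.1 r x.2.1 x.2.2) ∂flat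
  let B : ℕ → ℝ → ℝ := fun n r => ∫ x, Real.sin x.2.1 *
    (cutW a M g n lam L x.1 r * ‖pR a M u x.1 r x.2.1 x.2.2‖ ^ 2) ∂flat
  have hEc : ∀ n, ContinuousOn (E n) (Icc r₁ r₂) := fun n =>
    ((bc_sin.mul ((bW n).mul be)).continuousOn_integral hr₁' (vW n)).mono hsub
  have hBc : ∀ n, ContinuousOn (B n) (Icc r₁ r₂) := fun n =>
    ((bc_sin.mul ((bW n).mul bx)).continuousOn_integral hr₁' (vW n)).mono hsub
  have hB0 : ∀ n, ∀ r ∈ Icc r₁ r₂, 0 ≤ B n r := fun n r hr => by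
    refine integral_nonneg_of_ae ?_
    filter_upwards [ae_flat] with x hx
    exact mul_nonneg (Real.sin_pos_of_mem_Ioo hx.1).le (mul_nonneg (hW0 n _ _) (sq_nonneg _))
  have hE0 : ∀ n, ∀ r ∈ Icc r₁ r₂, 0 ≤ E n r := fun n r hr => by
    refine integral_nonneg_of_ae ?_
    filter_upwards [ae_flat] with x hx
    exact mul_nonneg (Real.sin_pos_of_mem_Ioo hx.1).le (mul_nonneg (hW0 n _ _) (he0 _ _ _ _ hr hx.1))
  have hstep : ∀ n : ℕ, ∀ r ∈ Ioo r₁ r₂, ∃ E' : ℝ, HasDerivAt (E n) E' r ∧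
      c₁ / 2 * B n r - C * E n r - C * D ≤ E' := by
    intro n r hr
    obtain ⟨E', h1, h2⟩ := hineq (n := n) hg hL hr₁.1 (fun v ρ hρ => hμ n v ρ n.cast_nonneg
      ⟨hr₁.1.trans hρ.1, hρ.2⟩) r hr
    have := mul_le_mul_of_nonneg_left (hq r hr) hC.le
    exact ⟨E', h1, by simp only [E, B]; linarith⟩
  have hr₁m : r₁ ∈ Icc r₁ r₂ := left_mem_Icc.2 h12
  have hr₂m : r₂ ∈ Icc r₁ r₂ := right_mem_Icc.2 h12
  have hE2 : ∀ n, E n r₂ ≤ C * I := by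
    intro n
    rw [← ENNReal.ofReal_le_ofReal_iff (by positivity)]
    have e1 := hLe n be r₂ hr₂m (fun v θ φ hθ => he0 v r₂ θ φ hr₂m hθ)
    refine e1.le.trans ?_
    rw [ENNReal.ofReal_mul hC.le]
    refine le_trans ?_ (mul_le_mul_right hdata _)
    rw [← lintegral_const_mul' _ _ ENNReal.ofReal_ne_top]
    refine lintegral_mono_ae ?_
    filter_upwards [ae_cyl] with x hx
    rw [← ENNReal.ofReal_mul hC.le]
    apply ENNReal.ofReal_le_ofReal
    have h1 := (hcmp x.1 r₂ x.2.1 x.2.2 (hoc hr₂m) hx.1).2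
    have h2 := mul_le_mul (cutW_le (a := a) (M := M) hg.nonneg n lam L x.1 r₂) h1
      (he0 _ _ _ _ hr₂m hx.1) (hg.nonneg _)
    linarith
  have hgron : ∀ n, E n r₁ + c₁ / 2 * ∫ r in r₁..r₂, B n r ≤ G * (I + D) := by
    intro n
    choose! E' hE' using hstep n
    have := gronwall_backward h12 hC.le (by positivity : 0 ≤ c₁ / 2) (mul_nonneg hC.le hD)
      (hEc n) (hBc n) (hB0 n) (fun r hr => (hE' r hr).1) (fun r hr => (hE' r hr).2)
    refine this.trans ?_
    have hw : r₂ - r₁ ≤ rp a M - rm a M := by linarith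
    have hw0 : 0 ≤ r₂ - r₁ := by linarith
    have hG' : G * (I + D) = Real.exp (C * (rp a M - rm a M)) *
        (C * (1 + (rp a M - rm a M)) * (I + D)) := by rw [hG]; ring
    rw [hG']
    refine mul_le_mul ?_ ?_ ?_ (Real.exp_pos _).le
    · exact Real.exp_le_exp.2 (mul_le_mul_of_nonneg_left hw hC.le)
    · have h1 := hE2 n
      have h2 : C * D * (r₂ - r₁) ≤ C * D * (rp a M - rm a M) :=
        mul_le_mul_of_nonneg_left hw (by positivity)
      have h3 : 0 ≤ C * I * (rp a M - rm a M) := mul_nonneg (by positivity) (by linarith)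
      have h4 : 0 ≤ C * D := by positivity
      linarith
    · have := hE0 n r₂ hr₂m
      positivity
  have hGID : 0 ≤ G * (I + D) := by positivity
  have hBi : ∀ n, 0 ≤ ∫ r in r₁..r₂, B n r := fun n =>
    intervalIntegral.integral_nonneg h12 (hB0 n)
  constructor
  · refine lintegral_le_of_cutW hg.nonneg (a := a) (M := M) (l := lam) (L := L) (r := r₁)
      (f := fun x => dTot a M u f₁ f₀ x.1 r₁ x.2.1 x.2.2) (fun x _ => dTot_nonneg haM (hcc hr₁m))
      (fun n => (hMeas n bd r₁ hr₁m).aemeasurable) fun n => ?_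
    rw [← hLe n bd r₁ hr₁m (fun v θ φ _ => dTot_nonneg haM (hcc hr₁m))]
    apply ENNReal.ofReal_le_ofReal
    have h1 : c₀ * ∫ x, Real.sin x.2.1 *
        (cutW a M g n lam L x.1 r₁ * dTot a M u f₁ f₀ x.1 r₁ x.2.1 x.2.2) ∂flat ≤ E n r₁ := by
      rw [← integral_const_mul]
      refine integral_mono_ae ((hInt n bd r₁ hr₁m).const_mul _) (hInt n be r₁ hr₁m) ?_
      filter_upwards [ae_flat] with x hx
      have h1 := (hcmp x.1 r₁ x.2.1 x.2.2 (hoc hr₁m) hx.1).1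
      have := mul_le_mul_of_nonneg_left (mul_le_mul_of_nonneg_left h1 (hW0 n x.1 r₁))
        (Real.sin_pos_of_mem_Ioo hx.1).le
      linarith
    have h2 := hgron n
    have h3 : 0 ≤ c₁ / 2 * ∫ r in r₁..r₂, B n r := mul_nonneg (by positivity) (hBi n)
    have h4 : (∫ x, Real.sin x.2.1 *
        (cutW a M g n lam L x.1 r₁ * dTot a M u f₁ f₀ x.1 r₁ x.2.1 x.2.2) ∂flat)
        ≤ G * (I + D) * (1 / c₀) := by
      rw [mul_one_div, le_div_iff₀ hc₀]
      linarith
    have h5 : 0 ≤ G * (I + D) * (2 / c₁) := by positivity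
    linarith
  · have hΦ : ∀ n : ℕ, ∀ r ∈ Icc r₁ r₂, ∫⁻ x, ENNReal.ofReal (cutW a M g n lam L x.1 r *
        ‖pR a M u x.1 r x.2.1 x.2.2‖ ^ 2) ∂cyl = ENNReal.ofReal (B n r) := fun n r hr =>
      (hLe n bx r hr (fun _ _ _ _ => sq_nonneg _)).symm
    have hae : ∀ᵐ r ∂(volume.restrict (Ioc r₁ r₂)), r ∈ Icc r₁ r₂ := by
      filter_upwards [ae_restrict_mem measurableSet_Ioc] with r hr using Ioc_subset_Icc_self hr
    -- Monotone convergence is used twice: on each slice, and then for the integral over r.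
    refine lintegral_le_of_monotone_tendsto (f := fun n r => ENNReal.ofReal (B n r)) ?_ ?_ ?_ ?_
    · intro n
      exact (((hBc n).mono Ioc_subset_Icc_self).aemeasurable measurableSet_Ioc).ennreal_ofReal
    · filter_upwards [hae] with r hr m n hmn
      beta_reduce
      rw [← hΦ m r hr, ← hΦ n r hr]
      refine lintegral_mono fun x => ENNReal.ofReal_le_ofReal ?_
      exact mul_le_mul_of_nonneg_right (monotone_cutW hg.nonneg lam L x.1 r hmn) (sq_nonneg _)
    · filter_upwards [hae] with r hr
      simp only [← hΦ _ r hr]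
      refine lintegral_tendsto_of_tendsto_of_monotone (fun n => ((hMeas n bx r hr).aemeasurable.mono_ac
        cyl_absolutelyContinuous).ennreal_ofReal) ?_ ?_
      · refine Eventually.of_forall fun x m n hmn => ENNReal.ofReal_le_ofReal ?_
        exact mul_le_mul_of_nonneg_right (monotone_cutW hg.nonneg lam L x.1 r hmn) (sq_nonneg _)
      · refine Eventually.of_forall fun x => ?_
        exact (ENNReal.continuous_ofReal.tendsto _).comp ((tendsto_cutW lam L x.1 r).mul_const _)
    · intro n
      have hi : IntegrableOn (B n) (Ioc r₁ r₂) :=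
        ((hBc n).integrableOn_Icc).mono_set Ioc_subset_Icc_self
      rw [← ofReal_integral_eq_lintegral_ofReal hi (by
        filter_upwards [hae] with r hr using hB0 n r hr), ← intervalIntegral.integral_of_le h12]
      apply ENNReal.ofReal_le_ofReal
      have h2 := hgron n
      have h3 := hE0 n r₁ hr₁m
      have h4 : (∫ r in r₁..r₂, B n r) ≤ G * (I + D) * (2 / c₁) := by
        rw [mul_div_assoc', le_div_iff₀ hc₁]
        linarith
      have h5 : 0 ≤ G * (I + D) * (1 / c₀) := by positivity
      linarith


/-! ## Estimates near the event horizons and in the interior -/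

theorem lintegral_ofReal_le_mul {α : Type*} [MeasurableSpace α] {μ : Measure α} {f g : α → ℝ}
    {C : ℝ} (hC : 0 ≤ C) (h : ∀ᵐ x ∂μ, f x ≤ C * g x) :
    ∫⁻ x, ENNReal.ofReal (f x) ∂μ ≤ ENNReal.ofReal C * ∫⁻ x, ENNReal.ofReal (g x) ∂μ := by
  rw [← lintegral_const_mul' _ _ ENNReal.ofReal_ne_top]
  refine lintegral_mono_ae ?_
  filter_upwards [h] with x hx
  rw [← ENNReal.ofReal_mul hC]
  exact ENNReal.ofReal_le_ofReal hx

theorem lintegral_ofReal_lt_top_of_le {α : Type*} [MeasurableSpace α] {μ : Measure α} {f g : α → ℝ}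
    {C : ℝ} (hC : 0 ≤ C) (h : ∀ᵐ x ∂μ, f x ≤ C * g x)
    (hg : ∫⁻ x, ENNReal.ofReal (g x) ∂μ < ⊤) : ∫⁻ x, ENNReal.ofReal (f x) ∂μ < ⊤ :=
  (lintegral_ofReal_le_mul hC h).trans_lt (ENNReal.mul_lt_top ENNReal.ofReal_lt_top hg)

theorem measurableSet_ge (c : ℝ) : MeasurableSet {x : ℝ × ℝ × ℝ | c ≤ x.1} :=
  measurableSet_le measurable_const measurable_fst

/-- The derivative of the step lives on 1 ≤ v ≤ 2 and is put into q; the remaining part is of slow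
variation. -/
theorem slowWeight_cut {R p ε : ℝ} (hR : 0 < R) (hp : 0 ≤ p) (hε : 2 * p / R ≤ ε) :
    SlowWeight ε 2 (fun v => wgt R p v * stp (v - 1)) (fun v => wgt R p v * deriv stp (v - 1)) where
  smooth := (contDiff_wgt hR).mul ((Real.smoothTransition.contDiff (n := 1)).comp (by fun_prop))
  nonneg v := mul_nonneg (wgt_pos hR v).le (Real.smoothTransition.nonneg _)
  contq := (contDiff_wgt hR).continuous.mul (continuous_deriv_stp.comp (by fun_prop))
  qnonneg v := mul_nonneg (wgt_pos hR v).le (deriv_stp_nonneg _)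
  qsupp v hv := by
    rcases lt_abs.1 hv with h | h
    · rw [deriv_stp_of_one_lt (by linarith), mul_zero]
    · rw [deriv_stp_of_neg (by linarith), mul_zero]
  slow v := by
    have d1 : HasDerivAt (wgt R p) (deriv (wgt R p) v) v :=
      ((contDiff_wgt hR).differentiable (by simp) v).hasDerivAt
    have d2 : HasDerivAt (fun v => stp (v - 1)) (deriv stp (v - 1) * 1) v :=
      (hasDerivAt_stp _).comp v ((hasDerivAt_id v).sub_const 1)
    have e : deriv (fun v => wgt R p v * stp (v - 1)) v
        = deriv (wgt R p) v * stp (v - 1) + wgt R p v * (deriv stp (v - 1) * 1) :=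
      (d1.mul d2).deriv
    rw [e]
    have hs := Real.smoothTransition.nonneg (v - 1)
    have hw := (wgt_pos (q := p) hR v).le
    refine (abs_add_le _ _).trans ?_
    rw [abs_mul, abs_of_nonneg hs, mul_one, abs_of_nonneg (mul_nonneg hw (deriv_stp_nonneg _))]
    have h1 := (abs_deriv_wgt_le hR hp v).trans (mul_le_mul_of_nonneg_right hε hw)
    have h2 := mul_le_mul_of_nonneg_right h1 hs
    linarith

/-- Near r₊ the left edge of a cut-off cannot be controlled because Δ vanishes there. The weight
therefore starts at v = 1 and L = 0, so the second cut-off equals 1 wherever the weight is nonzero.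
At r₊ the energy involves only tangential derivatives, which are the data; at r₁ < r₊ it is
equivalent to the nondegenerate one. -/
theorem horizon_estimate {a M k B₀ c₁ r₀ p : ℝ} {br : ℝ → ℝ} {bv : ℝ → ℝ → ℂ} {b : ℂ}
    {u F f₁ f₀ : ℝ → ℝ → ℝ → ℝ → ℂ} (ha : 0 < |a|) (haM : |a| < M) (hc₁ : 0 < c₁) (hp : 0 ≤ p)
    (hk : k ^ 2 = a ^ 2) (hr₀ : rm a M ≤ r₀) (S : TeukSys a M k B₀ c₁ 0 r₀ (rp a M) br bv b u F f₁ f₀)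
    (hdata : ∫⁻ x in {x : ℝ × ℝ × ℝ | 1 ≤ x.1}, ENNReal.ofReal (x.1 ^ p *
      (tangD u x.1 (rp a M) x.2.1 x.2.2 + tangD f₁ x.1 (rp a M) x.2.1 x.2.2
        + tangD f₀ x.1 (rp a M) x.2.1 x.2.2)) ∂cyl < ⊤) {r₁ : ℝ} (hr₁ : r₁ ∈ Ioo r₀ (rp a M)) :
    ∫⁻ x in {x : ℝ × ℝ × ℝ | 2 ≤ x.1}, ENNReal.ofReal (x.1 ^ p *
      (‖pR a M u x.1 r₁ x.2.1 x.2.2‖ ^ 2 + tangD u x.1 r₁ x.2.1 x.2.2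
        + tangD f₁ x.1 r₁ x.2.1 x.2.2 + tangD f₀ x.1 r₁ x.2.1 x.2.2)) ∂cyl < ⊤ := by
  obtain ⟨C₂, C₁, ε, hC₂, hC₁, hε, hest⟩ := exists_weighted_estimate ha haM B₀ c₁ 0 hc₁ le_rfl
  obtain ⟨R, hR⟩ : ∃ X, X = 2 * p / ε + 1 := ⟨_, rfl⟩
  have hR0 : 0 < R := by rw [hR]; positivity
  have hRε : 2 * p / R ≤ ε := by
    rw [div_le_iff₀ hR0, hR, mul_add, mul_div_cancel₀ _ hε.ne']; linarith
  have hg := slowWeight_cut hR0 hp hRε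
  have hr₁' : rm a M < r₁ := hr₀.trans_lt hr₁.1
  set g : ℝ → ℝ := fun v => wgt R p v * stp (v - 1) with hgdef
  set q : ℝ → ℝ := fun v => wgt R p v * deriv stp (v - 1) with hqdef
  have bq : BC a M (fun v _ _ _ => q v) :=
    bc_of_continuousOn_vr (k := fun v _ => q v) (hg.contq.comp continuous_fst).continuousOn
  have bx := (S.regU.pR haM).sm.bc.norm_sq
  have vq : ∀ {f : ℝ → ℝ → ℝ → ℝ → ℝ}, VSupp a M 2 r₁
      (fun v r θ φ => Real.sin θ * (q v * f v r θ φ)) :=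
    fun v r θ φ hr hv => by simp [hg.qsupp v hv]
  have hcont := (bc_sin.mul (bq.mul (bx.add (S.regU.bc_tangD haM)))).continuousOn_integral hr₁' vq
  -- The error term is supported in |v| ≤ 2 and the field is regular up to r₊, so it is bounded on
  -- [r₁, r₊] by compactness.
  obtain ⟨D, hD⟩ := isCompact_Icc.exists_bound_of_continuousOn hcont
  have hD' : ∀ r ∈ Ioo r₁ (rp a M), ∫ x, Real.sin x.2.1 * (q x.1 *
      (‖pR a M u x.1 r x.2.1 x.2.2‖ ^ 2 + tangD u x.1 r x.2.1 x.2.2)) ∂flat ≤ |D| := fun r hr =>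
    (le_abs_self _).trans ((hD r (Ioo_subset_Icc_self hr)).trans (le_abs_self D))
  have hgz : ∀ v, v ≤ 1 → g v = 0 := fun v hv => by
    simp [hgdef, Real.smoothTransition.zero_of_nonpos (show v - 1 ≤ 0 by linarith)]
  have hDp : Delta a M (rp a M) = 0 := by rw [Delta_eq haM]; simp
  have hfin : ∫⁻ x, ENNReal.ofReal (g x.1 * dTot a M u f₁ f₀ x.1 (rp a M) x.2.1 x.2.2) ∂cyl < ⊤ := by
    have hz : ∀ x ∉ {x : ℝ × ℝ × ℝ | 1 ≤ x.1},
        ENNReal.ofReal (g x.1 * dTot a M u f₁ f₀ x.1 (rp a M) x.2.1 x.2.2) = 0 := fun x hx => by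
      rw [hgz x.1 (not_le.1 hx).le, zero_mul, ENNReal.ofReal_zero]
    rw [← setLIntegral_eq_of_support_subset (s := {x : ℝ × ℝ × ℝ | 1 ≤ x.1})
      (fun x hx => by_contra fun h => hx (hz x h))]
    refine lintegral_ofReal_lt_top_of_le (C := (R + 3) ^ p) (by positivity) ?_ hdata
    filter_upwards [ae_restrict_mem (measurableSet_ge 1)] with x hx
    have h1 : g x.1 ≤ (R + 3) ^ p * x.1 ^ p :=
      (mul_le_of_le_one_right (wgt_pos hR0 _).le (Real.smoothTransition.le_one _)).trans
        (wgt_le_rpow hR0 hp hx)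
    have h2 := tangD_nonneg u x.1 (rp a M) x.2.1 x.2.2
    have h3 := tangD_nonneg f₁ x.1 (rp a M) x.2.1 x.2.2
    have h4 := tangD_nonneg f₀ x.1 (rp a M) x.2.1 x.2.2
    unfold dTot
    rw [hDp, neg_zero, zero_mul, zero_add, ← mul_assoc]
    exact mul_le_mul_of_nonneg_right h1 (by positivity)
  have hres := (hest (I := (∫⁻ x, ENNReal.ofReal (g x.1 *
      dTot a M u f₁ f₀ x.1 (rp a M) x.2.1 x.2.2) ∂cyl).toReal) (L := 0) hk hr₀ le_rfl S hg le_rfl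
    (abs_nonneg D) ENNReal.toReal_nonneg ?_ (by rw [ENNReal.ofReal_toReal hfin.ne]) r₁ hr₁ hD').1
  · have hDl : 0 < -Delta a M r₁ := by
      rw [Delta_eq haM]
      have := mul_pos (sub_pos.2 hr₁.2) (sub_pos.2 hr₁')
      linarith
    have hlow : ∫⁻ x in {x : ℝ × ℝ × ℝ | 2 ≤ x.1}, ENNReal.ofReal (g x.1 *
        dTot a M u f₁ f₀ x.1 r₁ x.2.1 x.2.2) ∂cyl < ⊤ :=
      ((setLIntegral_le_lintegral _ _).trans hres).trans_lt ENNReal.ofReal_lt_top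
    refine lintegral_ofReal_lt_top_of_le (C := 1 / (-Delta a M r₁) + 1) (by positivity) ?_ hlow
    filter_upwards [ae_restrict_mem (measurableSet_ge 2)] with x hx
    have hx' : (2 : ℝ) ≤ x.1 := hx
    have h1 : x.1 ^ p ≤ g x.1 := by
      rw [hgdef]
      simp only [stp]
      rw [Real.smoothTransition.one_of_one_le (by linarith), mul_one]
      exact rpow_le_wgt hR0 hp (by linarith)
    have h2 := tangD_nonneg u x.1 r₁ x.2.1 x.2.2
    have h3 := tangD_nonneg f₁ x.1 r₁ x.2.1 x.2.2
    have h4 := tangD_nonneg f₀ x.1 r₁ x.2.1 x.2.2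
    have h5 := sq_nonneg ‖pR a M u x.1 r₁ x.2.1 x.2.2‖
    have h0 : 0 ≤ g x.1 := hg.nonneg _
    have h6 : ‖pR a M u x.1 r₁ x.2.1 x.2.2‖ ^ 2 + tangD u x.1 r₁ x.2.1 x.2.2
        + tangD f₁ x.1 r₁ x.2.1 x.2.2 + tangD f₀ x.1 r₁ x.2.1 x.2.2
        ≤ (1 / (-Delta a M r₁) + 1) * dTot a M u f₁ f₀ x.1 r₁ x.2.1 x.2.2 := by
      unfold dTot
      have e : (1 / (-Delta a M r₁) + 1) * (-Delta a M r₁ * ‖pR a M u x.1 r₁ x.2.1 x.2.2‖ ^ 2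
          + tangD u x.1 r₁ x.2.1 x.2.2 + tangD f₁ x.1 r₁ x.2.1 x.2.2 + tangD f₀ x.1 r₁ x.2.1 x.2.2)
          = (1 / (-Delta a M r₁) * (-Delta a M r₁)) * ‖pR a M u x.1 r₁ x.2.1 x.2.2‖ ^ 2
          + -Delta a M r₁ * ‖pR a M u x.1 r₁ x.2.1 x.2.2‖ ^ 2
          + (1 / (-Delta a M r₁) + 1) * (tangD u x.1 r₁ x.2.1 x.2.2
          + tangD f₁ x.1 r₁ x.2.1 x.2.2 + tangD f₀ x.1 r₁ x.2.1 x.2.2) := by ring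
      rw [e, one_div_mul_cancel hDl.ne']
      have : 0 ≤ 1 / (-Delta a M r₁) * (tangD u x.1 r₁ x.2.1 x.2.2
          + tangD f₁ x.1 r₁ x.2.1 x.2.2 + tangD f₀ x.1 r₁ x.2.1 x.2.2) := by positivity
      have : 0 ≤ -Delta a M r₁ * ‖pR a M u x.1 r₁ x.2.1 x.2.2‖ ^ 2 := by positivity
      linarith
    have := mul_le_mul h1 h6 (by positivity) h0
    linarith
  · intro n v r hn _
    left
    rcases le_or_gt v 1 with h | h
    · exact Or.inl (hgz v h)
    · right
      rw [zero_mul, add_zero]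
      exact deriv_stp_of_one_lt (by linarith)

/-! ### The two-sided weight -/

/-- A weight of slow variation comparable with the weights of `IsWeight`. -/
noncomputable def wgt2 (R qr ql v : ℝ) : ℝ := wgt R qr v + wgt R ql (-v)

theorem contDiff_wgt2 {R qr ql : ℝ} (hR : 0 < R) : ContDiff ℝ 1 (wgt2 R qr ql) :=
  (contDiff_wgt hR).add ((contDiff_wgt hR).comp contDiff_neg)

theorem wgt2_pos {R qr ql : ℝ} (hR : 0 < R) (v : ℝ) : 0 < wgt2 R qr ql v :=
  add_pos (wgt_pos hR v) (wgt_pos hR (-v))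

theorem slowWeight_wgt2 {R qr ql ε : ℝ} (hR : 0 < R) (hqr : 0 ≤ qr) (hql : 0 ≤ ql)
    (h1 : 2 * qr / R ≤ ε) (h2 : 2 * ql / R ≤ ε) : SlowWeight ε 0 (wgt2 R qr ql) (fun _ => 0) where
  smooth := contDiff_wgt2 hR
  nonneg v := (wgt2_pos hR v).le
  contq := continuous_const
  qnonneg _ := le_rfl
  qsupp _ _ := rfl
  slow v := by
    have d1 : HasDerivAt (wgt R qr) (deriv (wgt R qr) v) v :=
      ((contDiff_wgt hR).differentiable (by simp) v).hasDerivAt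
    have d2 : HasDerivAt (fun v => wgt R ql (-v)) (deriv (wgt R ql) (-v) * (-1)) v :=
      (((contDiff_wgt hR).differentiable (by simp) (-v)).hasDerivAt).comp v (hasDerivAt_neg v)
    have e : deriv (wgt2 R qr ql) v = deriv (wgt R qr) v + deriv (wgt R ql) (-v) * (-1) :=
      (d1.add d2).deriv
    rw [e]
    refine (abs_add_le _ _).trans ?_
    rw [abs_mul, abs_neg, abs_one, mul_one, add_zero]
    have e1 := (abs_deriv_wgt_le hR hqr v).trans
      (mul_le_mul_of_nonneg_right h1 (wgt_pos hR v).le)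
    have e2 := (abs_deriv_wgt_le hR hql (-v)).trans
      (mul_le_mul_of_nonneg_right h2 (wgt_pos hR (-v)).le)
    unfold wgt2
    linarith

/-- At each end one summand of `wgt2` is comparable to the prescribed power and the other one stays
bounded. On [-1, 1], where χ is arbitrary, compactness suffices. -/
theorem IsWeight.comparable {R qr ql : ℝ} {χ : ℝ → ℝ} (hχ : IsWeight qr ql χ) (hR : 0 < R)
    (hqr : 0 ≤ qr) (hql : 0 ≤ ql) :
    ∃ C : ℝ, 0 < C ∧ ∀ v, χ v ≤ C * wgt2 R qr ql v ∧ wgt2 R qr ql v ≤ C * χ v := by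
  have cw := (contDiff_wgt2 (qr := qr) (ql := ql) hR).continuous
  have hw := fun v => wgt2_pos (qr := qr) (ql := ql) hR v
  obtain ⟨A, hA⟩ := (isCompact_Icc (a := (-1 : ℝ)) (b := 1)).exists_bound_of_continuousOn
    (hχ.smooth.continuous.div cw fun v => (hw v).ne').continuousOn
  obtain ⟨B, hB⟩ := (isCompact_Icc (a := (-1 : ℝ)) (b := 1)).exists_bound_of_continuousOn
    (cw.div hχ.smooth.continuous fun v => (hχ.pos v).ne').continuousOn
  obtain ⟨P, hP⟩ : ∃ X, X = (R + 3) ^ qr + (R + 1) ^ ql + (R + 3) ^ ql + (R + 1) ^ qr := ⟨_, rfl⟩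
  have hP0 : 0 ≤ P := by rw [hP]; positivity
  refine ⟨1 + |A| + |B| + P, by positivity, fun v => ?_⟩
  have hAn := abs_nonneg A
  have hBn := abs_nonneg B
  have p1 : 0 ≤ (R + 3) ^ qr := by positivity
  have p2 : 0 ≤ (R + 1) ^ qr := by positivity
  have p3 : 0 ≤ (R + 3) ^ ql := by positivity
  have p4 : 0 ≤ (R + 1) ^ ql := by positivity
  have hC1 : (1 : ℝ) ≤ 1 + |A| + |B| + P := by linarith
  have hwv := (hw v).le
  have hχv := (hχ.pos v).le
  rcases le_or_gt 1 v with h | h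
  · have e1 : v ^ qr ≤ wgt R qr v := rpow_le_wgt hR hqr (by linarith)
    have e2 := wgt_le_rpow hR hqr h
    have e3 := wgt_le_of_nonpos (v := -v) hR hql (by linarith)
    have e4 := (wgt_pos (q := ql) hR (-v)).le
    have e5 : 1 ≤ v ^ qr := Real.one_le_rpow h hqr
    have hx := hχ.right v h
    have e6 : χ v ≤ wgt2 R qr ql v := by rw [hx]; unfold wgt2; linarith
    have e7 : wgt2 R qr ql v ≤ P * χ v := by
      rw [hx, hP]; unfold wgt2
      have := mul_le_mul_of_nonneg_left e5 p4
      have := mul_nonneg (add_nonneg p3 p2) (by linarith : 0 ≤ v ^ qr)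
      linarith
    exact ⟨e6.trans (le_mul_of_one_le_left hwv hC1),
      e7.trans (mul_le_mul_of_nonneg_right (by linarith) hχv)⟩
  rcases le_or_gt v (-1) with h' | h'
  · have e1 : (-v) ^ ql ≤ wgt R ql (-v) := rpow_le_wgt hR hql (by linarith)
    have e2 := wgt_le_rpow (v := -v) hR hql (by linarith)
    have e3 := wgt_le_of_nonpos (v := v) hR hqr (by linarith)
    have e4 := (wgt_pos (q := qr) hR v).le
    have e5 : 1 ≤ (-v) ^ ql := Real.one_le_rpow (by linarith) hql
    have hx : χ v = (-v) ^ ql := by rw [hχ.left v h', abs_of_neg (by linarith)]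
    have e6 : χ v ≤ wgt2 R qr ql v := by rw [hx]; unfold wgt2; linarith
    have e7 : wgt2 R qr ql v ≤ P * χ v := by
      rw [hx, hP]; unfold wgt2
      have := mul_le_mul_of_nonneg_left e5 p2
      have := mul_nonneg (add_nonneg p1 p4) (by linarith : 0 ≤ (-v) ^ ql)
      linarith
    exact ⟨e6.trans (le_mul_of_one_le_left hwv hC1),
      e7.trans (mul_le_mul_of_nonneg_right (by linarith) hχv)⟩
  · have hI : v ∈ Icc (-1 : ℝ) 1 := ⟨h'.le, h.le⟩
    have a1 := ((le_abs_self _).trans (hA v hI)).trans (le_abs_self A)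
    have b1 := ((le_abs_self _).trans (hB v hI)).trans (le_abs_self B)
    simp only [Pi.div_apply] at a1 b1
    rw [div_le_iff₀ (hw v)] at a1
    rw [div_le_iff₀ (hχ.pos v)] at b1
    exact ⟨a1.trans (mul_le_mul_of_nonneg_right (by linarith) hwv),
      b1.trans (mul_le_mul_of_nonneg_right (by linarith) hχv)⟩

/-- Away from the event horizon both edges of the cut-off can be controlled, so no error term q is
needed and the weight may be two-sided. The constant does not depend on r₁, which may thus tend to
r₋. -/
theorem interior_estimate {a M k B₀ c₁ K r₂ qr ql : ℝ} {br : ℝ → ℝ} {bv : ℝ → ℝ → ℂ} {b : ℂ}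
    {u F f₁ f₀ : ℝ → ℝ → ℝ → ℝ → ℂ} {χ : ℝ → ℝ} (ha : 0 < |a|) (haM : |a| < M) (hc₁ : 0 < c₁)
    (hK : 0 ≤ K) (hqr : 0 ≤ qr) (hql : 0 ≤ ql) (hχ : IsWeight qr ql χ)
    (hk : k ^ 2 = a ^ 2) (hr₂ : r₂ < rp a M) (h2m : rm a M < r₂)
    (S : TeukSys a M k B₀ c₁ K (rm a M) r₂ br bv b u F f₁ f₀)
    (hdata : ∫⁻ x, ENNReal.ofReal (χ x.1 * dTot a M u f₁ f₀ x.1 r₂ x.2.1 x.2.2) ∂cyl < ⊤) :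
    ∃ C : ℝ, 0 < C ∧ ∀ r₁ ∈ Ioo (rm a M) r₂,
      ∫⁻ x, ENNReal.ofReal (χ x.1 * dTot a M u f₁ f₀ x.1 r₁ x.2.1 x.2.2) ∂cyl
        ≤ ENNReal.ofReal C ∧
      ∫⁻ r in Ioc r₁ r₂, ∫⁻ x, ENNReal.ofReal (χ x.1 * ‖pR a M u x.1 r x.2.1 x.2.2‖ ^ 2) ∂cyl
        ≤ ENNReal.ofReal C := by
  obtain ⟨C₂, C₁, ε, hC₂, hC₁, hε, hest⟩ := exists_weighted_estimate ha haM B₀ c₁ K hc₁ hK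
  obtain ⟨R, hR⟩ : ∃ X, X = 2 * qr / ε + 2 * ql / ε + 1 := ⟨_, rfl⟩
  have hR0 : 0 < R := by rw [hR]; positivity
  have hRr : 2 * qr / R ≤ ε := by
    rw [div_le_iff₀ hR0, hR, mul_add, mul_add, mul_div_cancel₀ _ hε.ne', mul_div_cancel₀ _ hε.ne']
    linarith
  have hRl : 2 * ql / R ≤ ε := by
    rw [div_le_iff₀ hR0, hR, mul_add, mul_add, mul_div_cancel₀ _ hε.ne', mul_div_cancel₀ _ hε.ne']
    linarith
  have hg := slowWeight_wgt2 hR0 hqr hql hRr hRl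
  obtain ⟨A, hA, hcmp⟩ := hχ.comparable hR0 hqr hql
  have hlt := rm_lt_rp haM
  -- The two summands ensure L (r₊ - r) ≥ C₁ and L / (r - r₋) ≥ C₁ for r₋ < r < r₂.
  obtain ⟨L, hL⟩ : ∃ X, X = C₁ * (1 / (rp a M - r₂) + (rp a M - rm a M)) := ⟨_, rfl⟩
  have hgap : 0 < rp a M - r₂ := by linarith
  have hgap' : 0 < rp a M - rm a M := by linarith
  have hL0 : 0 ≤ L := by rw [hL]; positivity
  have hI : ∀ {r}, r ∈ Ioc (rm a M) r₂ → r ∈ Icc (rm a M) (rp a M) := fun h =>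
    ⟨h.1.le, h.2.trans hr₂.le⟩
  have hfin : ∫⁻ x, ENNReal.ofReal (wgt2 R qr ql x.1 * dTot a M u f₁ f₀ x.1 r₂ x.2.1 x.2.2) ∂cyl
      < ⊤ := by
    refine lintegral_ofReal_lt_top_of_le hA.le (Eventually.of_forall fun x => ?_) hdata
    rw [← mul_assoc]
    exact mul_le_mul_of_nonneg_right (hcmp x.1).2 (dTot_nonneg haM (hI ⟨h2m, le_rfl⟩))
  set I := (∫⁻ x, ENNReal.ofReal (wgt2 R qr ql x.1 *
    dTot a M u f₁ f₀ x.1 r₂ x.2.1 x.2.2) ∂cyl).toReal with hIdef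
  have hI0 : 0 ≤ I := ENNReal.toReal_nonneg
  refine ⟨A * (C₂ * I) + 1, by positivity, fun r₁ hr₁ => ?_⟩
  obtain ⟨e1, e2⟩ := hest (I := I) (D := 0) hk le_rfl hr₂.le S hg hL0 le_rfl hI0 (by
      intro n v r _ hr
      right
      have h1 : 0 < r - rm a M := sub_pos.2 hr.1
      have h2 : C₁ ≤ L * (rp a M - r) := by
        have e : C₁ = C₁ * (1 / (rp a M - r₂) * (rp a M - r₂)) := by
          rw [one_div_mul_cancel hgap.ne', mul_one]
        have e' : C₁ * (1 / (rp a M - r₂) * (rp a M - r₂)) ≤ L * (rp a M - r) := by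
          rw [hL, mul_assoc]
          refine mul_le_mul_of_nonneg_left ?_ hC₁.le
          refine mul_le_mul (by linarith) (by linarith [hr.2]) hgap.le (by positivity)
        linarith
      constructor
      · rw [le_div_iff₀ h1, hL]
        refine mul_le_mul_of_nonneg_left ?_ hC₁.le
        have : 0 < 1 / (rp a M - r₂) := by positivity
        linarith [hr.2]
      · have : L / (r - rm a M) * (-Delta a M r) = L * (rp a M - r) := by
          rw [Delta_eq haM]; field_simp; ring
        rw [this]; exact h2)
    (by rw [hIdef, ENNReal.ofReal_toReal hfin.ne]) r₁ hr₁ (fun r _ => by simp)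
  rw [add_zero] at e1 e2
  have hfinal : ENNReal.ofReal A * ENNReal.ofReal (C₂ * I) ≤ ENNReal.ofReal (A * (C₂ * I) + 1) := by
    rw [← ENNReal.ofReal_mul hA.le]; exact ENNReal.ofReal_le_ofReal (by linarith)
  constructor
  · refine (lintegral_ofReal_le_mul hA.le (Eventually.of_forall fun x => ?_)).trans
      ((mul_le_mul_right e1 _).trans hfinal)
    rw [← mul_assoc]
    exact mul_le_mul_of_nonneg_right (hcmp x.1).1 (dTot_nonneg haM (hI ⟨hr₁.1, hr₁.2.le⟩))
  · refine le_trans ?_ ((mul_le_mul_right e2 _).trans hfinal)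
    rw [← lintegral_const_mul' _ _ ENNReal.ofReal_ne_top]
    refine lintegral_mono fun r => lintegral_ofReal_le_mul hA.le (Eventually.of_forall fun x => ?_)
    rw [← mul_assoc]
    exact mul_le_mul_of_nonneg_right (hcmp x.1).1 (sq_nonneg _)


/-! ## Smooth spin weighted functions for arbitrary real angles -/

/-- The component `α(m, m)` for arbitrary real angles. -/
noncomputable def spinExt (α : Amb → (Amb →L[ℝ] Amb →L[ℝ] ℝ)) (Vp Vm θ Φ : ℝ) : ℂ :=
  (((α (Vp, Vm, sphPt θ Φ) (frame1 θ Φ) (frame1 θ Φ)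
      - α (Vp, Vm, sphPt θ Φ) (frame2 Φ) (frame2 Φ)) / 2 : ℝ) : ℂ)
    + Complex.I * ((α (Vp, Vm, sphPt θ Φ) (frame1 θ Φ) (frame2 Φ) : ℝ) : ℂ)

theorem sphPt_ne_zero (θ Φ : ℝ) : sphPt θ Φ ≠ 0 := by
  intro h
  have h0 : Real.sin θ * Real.cos Φ = 0 := by simpa [sphPt] using congrArg (fun x => x 0) h
  have h1 : Real.sin θ * Real.sin Φ = 0 := by simpa [sphPt] using congrArg (fun x => x 1) h
  have h2 : Real.cos θ = 0 := by simpa [sphPt] using congrArg (fun x => x 2) h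
  have e1 := Real.sin_sq_add_cos_sq θ
  have e2 := Real.sin_sq_add_cos_sq Φ
  have : Real.sin θ ^ 2 = (Real.sin θ * Real.cos Φ) ^ 2 + (Real.sin θ * Real.sin Φ) ^ 2 := by
    linear_combination (-Real.sin θ ^ 2) * e2
  rw [h0, h1] at this
  rw [h2, this] at e1
  norm_num at e1

theorem spinExt_periodic (α : Amb → (Amb →L[ℝ] Amb →L[ℝ] ℝ)) (Vp Vm θ Φ : ℝ) :
    spinExt α Vp Vm θ (Φ + 2 * Real.pi) = spinExt α Vp Vm θ Φ := by
  simp [spinExt, sphPt, frame1, frame2]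

/-- The horizontal coordinate vectors. -/
noncomputable def horiz (i : Fin 2) : Amb :=
  (0, 0, if i = 0 then !₂[(1 : ℝ), 0, 0] else !₂[(0 : ℝ), 1, 0])

theorem frame2_eq (Φ : ℝ) : frame2 Φ = (-Real.sin Φ) • horiz 0 + Real.cos Φ • horiz 1 := by
  unfold frame2 horiz
  refine Prod.ext (by simp) (Prod.ext (by simp) ?_)
  ext i
  fin_cases i <;> simp

theorem frame1_zero (Φ : ℝ) : frame1 0 Φ = Real.cos Φ • horiz 0 + Real.sin Φ • horiz 1 := by
  unfold frame1 horiz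
  refine Prod.ext (by simp) (Prod.ext (by simp) ?_)
  ext i
  fin_cases i <;> simp

theorem frame1_pi (Φ : ℝ) :
    frame1 Real.pi Φ = (-Real.cos Φ) • horiz 0 + (-Real.sin Φ) • horiz 1 := by
  unfold frame1 horiz
  refine Prod.ext (by simp) (Prod.ext (by simp) ?_)
  ext i
  fin_cases i <;> simp

theorem sphPt_zero (Φ : ℝ) : sphPt 0 Φ = sphPt 0 0 := by simp [sphPt]

theorem sphPt_pi (Φ : ℝ) : sphPt Real.pi Φ = sphPt Real.pi 0 := by simp [sphPt]

theorem hasDerivAt_cos_sub_sin (ε : ℂ) (hε : ε ^ 2 = -1) (K : ℂ) (w φ : ℝ) :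
    HasDerivAt (fun x : ℝ => K * ((Real.cos (x + w) : ℂ) + ε * (Real.sin (x + w) : ℂ)) ^ 2)
      (2 * ε * (K * ((Real.cos (φ + w) : ℂ) + ε * (Real.sin (φ + w) : ℂ)) ^ 2)) φ := by
  have h1 : HasDerivAt (fun x : ℝ => Real.cos (x + w)) (-Real.sin (φ + w) * 1) φ :=
    (Real.hasDerivAt_cos _).comp φ ((hasDerivAt_id φ).add_const w)
  have h2 : HasDerivAt (fun x : ℝ => Real.sin (x + w)) (Real.cos (φ + w) * 1) φ :=
    (Real.hasDerivAt_sin _).comp φ ((hasDerivAt_id φ).add_const w)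
  have h := ((h1.ofReal_comp.add (h2.ofReal_comp.const_mul ε)).pow 2).const_mul K
  refine h.congr_deriv ?_
  simp
  linear_combination (-2 * K * Complex.sin (φ + w) *
    (Complex.cos (φ + w) + ε * Complex.sin (φ + w))) * hε

/-- At a pole the frame is the horizontal frame rotated by the azimuth, with the opposite
orientation at the south pole: ε = 1 in the north and ε = -1 in the south. The (m, m) component of a
symmetric form then acquires the square of a phase. -/
theorem spin_rotation (L : Amb →L[ℝ] Amb →L[ℝ] ℝ) (hL : ∀ u w, L u w = L w u) (ε c s : ℝ) (hε : ε ^ 2 = 1) (e₁ e₂ : Amb) :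
    (((L ((ε * c) • e₁ + (ε * s) • e₂) ((ε * c) • e₁ + (ε * s) • e₂)
      - L ((-s) • e₁ + c • e₂) ((-s) • e₁ + c • e₂)) / 2 : ℝ) : ℂ)
      + Complex.I * ((L ((ε * c) • e₁ + (ε * s) • e₂) ((-s) • e₁ + c • e₂) : ℝ) : ℂ)
    = (((L e₁ e₁ - L e₂ e₂ : ℝ) : ℂ) / 2 + ε * Complex.I * (L e₁ e₂ : ℝ)) *
      ((c : ℂ) + (-ε * Complex.I) * (s : ℂ)) ^ 2 := by
  have hc : (ε : ℂ) ^ 2 = 1 := by exact_mod_cast hε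
  simp only [map_add, map_smul, ContinuousLinearMap.add_apply, ContinuousLinearMap.smul_apply,
    smul_eq_mul]
  rw [hL e₂ e₁]
  push_cast
  have hI := Complex.I_sq
  ring_nf
  simp only [Complex.I_sq, show Complex.I ^ 3 = -Complex.I by rw [pow_succ, Complex.I_sq]; ring,
    hc, show (ε : ℂ) ^ 3 = ε by rw [pow_succ, hc, one_mul]]
  ring

theorem spinExt_zero {α : Amb → (Amb →L[ℝ] Amb →L[ℝ] ℝ)} (hα : ∀ x u w, α x u w = α x w u)
    (Vp Vm : ℝ) : ∃ K : ℂ, ∀ Φ, spinExt α Vp Vm 0 Φ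
      = K * ((Real.cos Φ : ℂ) + (-Complex.I) * (Real.sin Φ : ℂ)) ^ 2 := by
  refine ⟨((α (Vp, Vm, sphPt 0 0) (horiz 0) (horiz 0)
    - α (Vp, Vm, sphPt 0 0) (horiz 1) (horiz 1) : ℝ) : ℂ) / 2
    + ((1 : ℝ) : ℂ) * Complex.I * (α (Vp, Vm, sphPt 0 0) (horiz 0) (horiz 1) : ℝ), fun Φ => ?_⟩
  have h := spin_rotation (α (Vp, Vm, sphPt 0 0)) (hα _) 1 (Real.cos Φ) (Real.sin Φ) (by norm_num)
    (horiz 0) (horiz 1)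
  simp only [one_mul] at h
  unfold spinExt
  rw [frame1_zero, frame2_eq, sphPt_zero, h]
  simp only [Complex.ofReal_one, neg_mul, one_mul]

theorem spinExt_pi {α : Amb → (Amb →L[ℝ] Amb →L[ℝ] ℝ)} (hα : ∀ x u w, α x u w = α x w u)
    (Vp Vm : ℝ) : ∃ K : ℂ, ∀ Φ, spinExt α Vp Vm Real.pi Φ
      = K * ((Real.cos Φ : ℂ) + Complex.I * (Real.sin Φ : ℂ)) ^ 2 := by
  refine ⟨((α (Vp, Vm, sphPt Real.pi 0) (horiz 0) (horiz 0)
    - α (Vp, Vm, sphPt Real.pi 0) (horiz 1) (horiz 1) : ℝ) : ℂ) / 2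
    + ((-1 : ℝ) : ℂ) * Complex.I * (α (Vp, Vm, sphPt Real.pi 0) (horiz 0) (horiz 1) : ℝ), fun Φ => ?_⟩
  have h := spin_rotation (α (Vp, Vm, sphPt Real.pi 0)) (hα _) (-1) (Real.cos Φ) (Real.sin Φ)
    (by norm_num) (horiz 0) (horiz 1)
  simp only [neg_mul, one_mul] at h
  unfold spinExt
  rw [frame1_pi, frame2_eq, sphPt_pi, h]
  simp only [Complex.ofReal_neg, Complex.ofReal_one, neg_mul, one_mul, neg_neg]

/-! ### Regularity of spin-weighted functions in the two coordinate systems. -/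

section Regularity

variable {a M : ℝ}

theorem contDiff_sphPt : ContDiff ℝ ∞ (fun x : ℝ × ℝ => sphPt x.1 x.2) := by
  unfold sphPt
  rw [contDiff_euclidean]
  intro i
  fin_cases i <;> simp <;> fun_prop

theorem contDiff_frame1 : ContDiff ℝ ∞ (fun x : ℝ × ℝ => frame1 x.1 x.2) := by
  unfold frame1
  refine contDiff_const.prodMk (contDiff_const.prodMk ?_)
  rw [contDiff_euclidean]
  intro i
  fin_cases i <;> simp <;> fun_prop

theorem contDiff_frame2 : ContDiff ℝ ∞ frame2 := by
  unfold frame2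
  refine contDiff_const.prodMk (contDiff_const.prodMk ?_)
  rw [contDiff_euclidean]
  intro i
  fin_cases i <;> simp <;> fun_prop

/-- The formula for α(m, m) makes sense and is smooth for all real angles. At the poles its
φ-dependence is a phase exp(∓2 i φ), which ∂_φ + 2 i cos θ annihilates; the shift w in φ does not
matter. -/
theorem spinReg_spinExt {α : Amb → (Amb →L[ℝ] Amb →L[ℝ] ℝ)}
    (hα : ContDiffOn ℝ ∞ α (Ici (0 : ℝ) ×ˢ Ici (0 : ℝ) ×ˢ ({0}ᶜ : Set (EuclideanSpace ℝ (Fin 3)))))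
    (hsymm : ∀ x u w, α x u w = α x w u) {p m w : ℝ → ℝ → ℝ}
    (hp : ContDiffOn ℝ ∞ (fun x : ℝ × ℝ × ℝ × ℝ => p x.1 x.2.1) (dom a M))
    (hm : ContDiffOn ℝ ∞ (fun x : ℝ × ℝ × ℝ × ℝ => m x.1 x.2.1) (dom a M))
    (hw : ContDiffOn ℝ ∞ (fun x : ℝ × ℝ × ℝ × ℝ => w x.1 x.2.1) (dom a M))
    (hp0 : ∀ v r, r ∈ Ioc (rm a M) (rp a M) → 0 ≤ p v r)
    (hm0 : ∀ v r, r ∈ Ioc (rm a M) (rp a M) → 0 ≤ m v r) :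
    SpinReg a M (fun v r θ φ => spinExt α (p v r) (m v r) θ (φ + w v r)) where
  sm := by
    have hang : ContDiffOn ℝ ∞ (fun x : ℝ × ℝ × ℝ × ℝ => (x.2.2.1, x.2.2.2 + w x.1 x.2.1))
        (dom a M) := by
      refine ContDiffOn.prodMk (by fun_prop) (ContDiffOn.add (by fun_prop) hw)
    have hX := hα.comp (hp.prodMk (hm.prodMk (contDiff_sphPt.comp_contDiffOn hang))) (by
      rintro ⟨v, r, θ, φ⟩ h
      exact ⟨hp0 _ _ (mem_dom.1 h), hm0 _ _ (mem_dom.1 h), sphPt_ne_zero _ _⟩)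
    have h1 := contDiff_frame1.comp_contDiffOn hang
    have h2 := contDiff_frame2.comp_contDiffOn (contDiff_snd.comp_contDiffOn hang)
    have e11 := (hX.clm_apply h1).clm_apply h1
    have e22 := (hX.clm_apply h2).clm_apply h2
    have e12 := (hX.clm_apply h1).clm_apply h2
    exact (Complex.ofRealCLM.contDiff.comp_contDiffOn ((e11.sub e22).div_const 2)).add
      (contDiffOn_const.mul (Complex.ofRealCLM.contDiff.comp_contDiffOn e12))
  per v r θ φ := by
    rw [show φ + 2 * Real.pi + w v r = (φ + w v r) + 2 * Real.pi by ring]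
    exact spinExt_periodic _ _ _ _ _
  north v r φ _ := by
    obtain ⟨K, hK⟩ := spinExt_zero hsymm (p v r) (m v r)
    have h := hasDerivAt_cos_sub_sin (-Complex.I) (by simp) K (w v r) φ
    unfold covPhi pPhi
    simp only [hK]
    rw [h.deriv, Real.cos_zero]
    push_cast
    ring
  south v r φ _ := by
    obtain ⟨K, hK⟩ := spinExt_pi hsymm (p v r) (m v r)
    have h := hasDerivAt_cos_sub_sin Complex.I (by simp) K (w v r) φ
    unfold covPhi pPhi
    simp only [hK]
    rw [h.deriv, Real.cos_pi]
    push_cast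
    ring

theorem SpinReg.mul_vr {u : ℝ → ℝ → ℝ → ℝ → ℂ} (hu : SpinReg a M u) {k : ℝ → ℝ → ℂ}
    (hk : Sm a M (fun v r _ _ => k v r)) : SpinReg a M (fun v r θ φ => k v r * u v r θ φ) where
  sm := hk.mul hu.sm
  per v r θ φ := by rw [hu.per]
  north v r φ hr := by
    have h := (hu.sm.hasDerivAt_phi (v := v) (θ := 0) (φ := φ) hr).const_mul (k v r)
    have e : Kerr.pPhi (fun v r θ φ => k v r * u v r θ φ) v r 0 φ = k v r * Kerr.pPhi u v r 0 φ :=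
      h.deriv
    have := hu.north v r φ hr
    unfold Kerr.covPhi at this ⊢
    rw [e]
    linear_combination k v r * this
  south v r φ hr := by
    have h := (hu.sm.hasDerivAt_phi (v := v) (θ := Real.pi) (φ := φ) hr).const_mul (k v r)
    have e : Kerr.pPhi (fun v r θ φ => k v r * u v r θ φ) v r Real.pi φ
      = k v r * Kerr.pPhi u v r Real.pi φ := h.deriv
    have := hu.south v r φ hr
    unfold Kerr.covPhi at this ⊢
    rw [e]
    linear_combination k v r * this

theorem contDiffOn_log : ContDiffOn ℝ ∞ (fun x : ℝ × ℝ × ℝ × ℝ => Real.log (x.2.1 - rm a M))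
    (dom a M) := by
  refine ContDiffOn.log (by fun_prop) ?_
  rintro ⟨v, r, θ, φ⟩ h
  have := (mem_dom.1 h).1
  simp only [ne_eq]
  linarith

theorem contDiffOn_regP (c : ℝ) :
    ContDiffOn ℝ ∞ (fun x : ℝ × ℝ × ℝ × ℝ => regP a M c x.2.1) (dom a M) := by
  unfold regP
  exact ContDiffOn.add (by fun_prop) (contDiffOn_const.mul contDiffOn_log)

theorem contDiffOn_phiP (c b : ℝ) :
    ContDiffOn ℝ ∞ (fun x : ℝ × ℝ × ℝ × ℝ => phiP a M c b x.2.1) (dom a M) := by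
  unfold phiP
  exact ContDiffOn.add (by fun_prop) (contDiffOn_const.mul contDiffOn_log)

theorem contDiffOn_other (c : ℝ) : ContDiffOn ℝ ∞ (fun x : ℝ × ℝ × ℝ × ℝ =>
    Real.exp (-(kp a M * x.1)) * ((rp a M - x.2.1) * Real.exp (2 * kp a M * regP a M c x.2.1)))
    (dom a M) := by
  refine ContDiffOn.mul (by fun_prop) (ContDiffOn.mul (by fun_prop) ?_)
  exact (contDiffOn_const.mul (contDiffOn_regP c)).exp

/-- Smooth spin `2`-weighted functions are regular in `(v₊, r, θ, φ₊)` coordinates. -/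
theorem spinReg_inPlus {α : Amb → (Amb →L[ℝ] Amb →L[ℝ] ℝ)}
    (hα : ContDiffOn ℝ ∞ α (Ici (0 : ℝ) ×ˢ Ici (0 : ℝ) ×ˢ ({0}ᶜ : Set (EuclideanSpace ℝ (Fin 3)))))
    (hsymm : ∀ x u w, α x u w = α x w u) (c b : ℝ) :
    SpinReg a M (inPlus a M c b (spinExt α)) := by
  have h := spinReg_spinExt (a := a) (M := M) hα hsymm (p := fun v _ => Real.exp (kp a M * v))
    (m := fun v r => Real.exp (-(kp a M * v)) *
      ((rp a M - r) * Real.exp (2 * kp a M * regP a M c r)))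
    (w := fun v r => -(omegaP a M * v) + phiP a M c b r) (by fun_prop) (contDiffOn_other c)
    (ContDiffOn.add (by fun_prop) (contDiffOn_phiP c b)) (fun _ _ _ => (Real.exp_pos _).le)
    (fun _ r hr => mul_nonneg (Real.exp_pos _).le
      (mul_nonneg (by linarith [hr.2]) (Real.exp_pos _).le))
  have e : inPlus a M c b (spinExt α) = fun v r θ φ => spinExt α (Real.exp (kp a M * v))
      (Real.exp (-(kp a M * v)) * ((rp a M - r) * Real.exp (2 * kp a M * regP a M c r))) θ
      (φ + (-(omegaP a M * v) + phiP a M c b r)) := by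
    funext v r θ φ
    unfold inPlus
    congr 1
    ring
  rw [e]
  exact h

/-- The rescaled field is regular in `(v₋, r, θ, φ₋)` coordinates. -/
theorem spinReg_hatField {α : Amb → (Amb →L[ℝ] Amb →L[ℝ] ℝ)}
    (hα : ContDiffOn ℝ ∞ α (Ici (0 : ℝ) ×ˢ Ici (0 : ℝ) ×ˢ ({0}ᶜ : Set (EuclideanSpace ℝ (Fin 3)))))
    (hsymm : ∀ x u w, α x u w = α x w u) (c b : ℝ) :
    SpinReg a M (hatField a M c b (spinExt α)) := by
  have h := spinReg_spinExt (a := a) (M := M) hα hsymm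
    (p := fun v r => Real.exp (-(kp a M * v)) *
      ((rp a M - r) * Real.exp (2 * kp a M * regP a M c r)))
    (m := fun v _ => Real.exp (kp a M * v))
    (w := fun v r => omegaP a M * v - phiP a M c b r) (contDiffOn_other c) (by fun_prop)
    (ContDiffOn.sub (by fun_prop) (contDiffOn_phiP c b))
    (fun _ r hr => mul_nonneg (Real.exp_pos _).le
      (mul_nonneg (by linarith [hr.2]) (Real.exp_pos _).le)) (fun _ _ _ => (Real.exp_pos _).le)
  have e : inMinus a M c b (spinExt α) = fun v r θ φ => spinExt α
      (Real.exp (-(kp a M * v)) * ((rp a M - r) * Real.exp (2 * kp a M * regP a M c r)))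
      (Real.exp (kp a M * v)) θ (φ + (omegaP a M * v - phiP a M c b r)) := by
    funext v r θ φ
    unfold inMinus
    congr 1
    ring
  rw [← e] at h
  refine h.mul_vr (k := fun v r => (((Real.exp (-(kp a M * v)) *
    Real.exp (2 * kp a M * regP a M c r) / (r - rm a M)) ^ 2 : ℝ) : ℂ)) ?_
  refine Complex.ofRealCLM.contDiff.comp_contDiffOn (ContDiffOn.pow (ContDiffOn.div
    (ContDiffOn.mul (by fun_prop) (contDiffOn_const.mul (contDiffOn_regP c)).exp) (by fun_prop) ?_) 2)
  rintro ⟨v, r, θ, φ⟩ hx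
  have := (mem_dom.1 hx).1
  simp only [ne_eq]
  linarith

end Regularity


/-! ## Equality away from the poles -/

/-- Equality for `r ∈ R` and `θ ∈ (0, π)`. -/
def EqT (R : Set ℝ) (f g : ℝ → ℝ → ℝ → ℝ → ℂ) : Prop :=
  ∀ v r θ φ, r ∈ R → θ ∈ Ioo 0 Real.pi → f v r θ φ = g v r θ φ

section EqT

variable {a M : ℝ} {R : Set ℝ} {f g : ℝ → ℝ → ℝ → ℝ → ℂ}

theorem EqT.symm (h : EqT R f g) : EqT R g f := fun v r θ φ hr hθ => (h v r θ φ hr hθ).symm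

theorem EqT.mono (h : EqT R f g) {R' : Set ℝ} (hR : R' ⊆ R) : EqT R' f g :=
  fun v r θ φ hr hθ => h v r θ φ (hR hr) hθ

theorem EqT.pV (h : EqT R f g) : EqT R (pV f) (pV g) := fun v r θ φ hr hθ => by
  unfold Kerr.pV
  congr 1
  funext x
  exact h x r θ φ hr hθ

theorem EqT.pPhi (h : EqT R f g) : EqT R (pPhi f) (pPhi g) := fun v r θ φ hr hθ => by
  unfold Kerr.pPhi
  congr 1
  funext x
  exact h v r θ x hr hθ

theorem EqT.pTheta (h : EqT R f g) : EqT R (pTheta f) (pTheta g) := fun v r θ φ hr hθ => by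
  unfold Kerr.pTheta
  refine Filter.EventuallyEq.deriv_eq ?_
  filter_upwards [Ioo_mem_nhds hθ.1 hθ.2] with x hx using h v r x φ hr hx

theorem EqT.pR (h : EqT (Ioc (rm a M) (rp a M)) f g) :
    EqT (Ioc (rm a M) (rp a M)) (pR a M f) (pR a M g) := fun v r θ φ hr hθ => by
  unfold Kerr.pR
  exact derivWithin_congr (fun x hx => h v x θ φ hx hθ) (h v r θ φ hr hθ)

theorem EqT.pR_Ioo (h : EqT (Ioo (rm a M) (rp a M)) f g) :
    EqT (Ioo (rm a M) (rp a M)) (Kerr.pR a M f) (Kerr.pR a M g) := fun v r θ φ hr hθ => by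
  unfold Kerr.pR
  refine Filter.EventuallyEq.derivWithin_eq ?_ (h v r θ φ hr hθ)
  filter_upwards [nhdsWithin_le_nhds (Ioo_mem_nhds hr.1 hr.2)] with x hx using h v x θ φ hx hθ

theorem EqT.covD (h : EqT R f g) : EqT R (covD f) (covD g) := fun v r θ φ hr hθ => by
  unfold Kerr.covD Kerr.covPhi
  rw [h.pPhi v r θ φ hr hθ, h v r θ φ hr hθ]

theorem EqT.tangD (h : EqT R f g) {v r θ φ : ℝ} (hr : r ∈ R) (hθ : θ ∈ Ioo 0 Real.pi) :
    tangD f v r θ φ = tangD g v r θ φ := by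
  unfold Kerr.tangD
  rw [h.pV v r θ φ hr hθ, h.pTheta v r θ φ hr hθ, h.covD v r θ φ hr hθ, h v r θ φ hr hθ]

theorem EqT.spinLap (h : EqT R f g) : EqT R (spinLap 2 f) (spinLap 2 g) := fun v r θ φ hr hθ => by
  unfold Kerr.spinLap
  have e : deriv (fun x => (Real.sin x : ℂ) * Kerr.pTheta f v r x φ) θ
      = deriv (fun x => (Real.sin x : ℂ) * Kerr.pTheta g v r x φ) θ := by
    refine Filter.EventuallyEq.deriv_eq ?_
    filter_upwards [Ioo_mem_nhds hθ.1 hθ.2] with x hx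
    rw [h.pTheta v r x φ hr hx]
  rw [e, h.pPhi.pPhi v r θ φ hr hθ, h.pPhi v r θ φ hr hθ, h v r θ φ hr hθ]

theorem EqT.opGen (h : EqT (Ioo (rm a M) (rp a M)) f g) (k : ℝ) (br : ℝ → ℝ) (bv : ℝ → ℝ → ℂ)
    (b : ℂ) : EqT (Ioo (rm a M) (rp a M)) (opGen a M k br bv b f) (opGen a M k br bv b g) :=
  fun v r θ φ hr hθ => by
    unfold Kerr.opGen
    rw [h.pV.pV v r θ φ hr hθ, h.pPhi.pV v r θ φ hr hθ, h.pR_Ioo.pV v r θ φ hr hθ,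
      h.pR_Ioo.pPhi v r θ φ hr hθ, h.pR_Ioo.pR_Ioo v r θ φ hr hθ, h.pV v r θ φ hr hθ,
      h.pR_Ioo v r θ φ hr hθ, h.spinLap v r θ φ hr hθ, h v r θ φ hr hθ]

end EqT

/-! ## The energies in terms of `tangD` -/

/-- The three operators are the spin-weighted generators of rotations. Their sum of squares does not
depend on φ and is the covariant gradient squared plus s² |f|², with s = 2. -/
theorem sum_norm_Z_sq (f : ℝ → ℝ → ℝ → ℝ → ℂ) {v r θ φ : ℝ} (hθ : θ ∈ Ioo 0 Real.pi) :
    ∑ i : Fin 3, ‖Z 2 i f v r θ φ‖ ^ 2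
      = ‖pTheta f v r θ φ‖ ^ 2 + ‖covD f v r θ φ‖ ^ 2 + 4 * ‖f v r θ φ‖ ^ 2 := by
  have hs : (Real.sin θ : ℂ) ≠ 0 := Complex.ofReal_ne_zero.2 (Real.sin_pos_of_mem_Ioo hθ).ne'
  have hp := pPhi_eq_covD (u := f) (v := v) (r := r) (φ := φ) hθ
  have hsc : (Real.sin θ : ℂ) ^ 2 + (Real.cos θ : ℂ) ^ 2 = 1 := by
    exact_mod_cast Real.sin_sq_add_cos_sq θ
  have hw : -Complex.I * ((2 : ℝ) : ℂ) * (1 / (Real.sin θ : ℂ)) * f v r θ φ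
      - (Real.cos θ : ℂ) / (Real.sin θ : ℂ) * pPhi f v r θ φ
      = -(2 * Complex.I * (Real.sin θ : ℂ) * f v r θ φ + (Real.cos θ : ℂ) * covD f v r θ φ) := by
    rw [hp]
    field_simp
    push_cast at hsc ⊢
    linear_combination (2 * Complex.I * f v r θ φ) * hsc
  simp only [Fin.sum_univ_three, Z, Matrix.cons_val_zero, Matrix.cons_val_one, Matrix.cons_val]
  rw [hw, hp]
  generalize pTheta f v r θ φ = t
  generalize covD f v r θ φ = Y
  generalize f v r θ φ = u
  have h1 := Real.sin_sq_add_cos_sq θ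
  have h2 := Real.sin_sq_add_cos_sq φ
  simp only [← Complex.normSq_eq_norm_sq, Complex.normSq_apply]
  generalize Real.sin θ = s at *
  generalize Real.cos θ = c at *
  generalize Real.sin φ = S at *
  generalize Real.cos φ = C at *
  simp
  have hc : c ^ 2 = 1 - s ^ 2 := by linarith
  have hC : C ^ 2 = 1 - S ^ 2 := by linarith
  ring_nf
  rw [hC]
  ring_nf
  rw [hc]
  ring

theorem tangEnergy_eq (f : ℝ → ℝ → ℝ → ℝ → ℂ) {v r θ φ : ℝ} (hθ : θ ∈ Ioo 0 Real.pi) :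
    tangEnergy f v r θ φ = tangD f v r θ φ + 4 * ‖f v r θ φ‖ ^ 2 := by
  unfold tangEnergy tangD tangSq
  rw [sum_norm_Z_sq f hθ]
  ring

theorem energyDensity_le {a M w : ℝ} (f : ℝ → ℝ → ℝ → ℝ → ℂ) {v r θ φ : ℝ}
    (hθ : θ ∈ Ioo 0 Real.pi) :
    energyDensity a M w f v r θ φ ≤ w * ‖pR a M f v r θ φ‖ ^ 2 + 5 * tangD f v r θ φ := by
  unfold energyDensity tangD tangSq
  rw [sum_norm_Z_sq f hθ]
  nlinarith [sq_nonneg ‖pV f v r θ φ‖, sq_nonneg ‖pTheta f v r θ φ‖, sq_nonneg ‖covD f v r θ φ‖]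

theorem norm_pPhi_sq_le (f : ℝ → ℝ → ℝ → ℝ → ℂ) {v r θ φ : ℝ} (hθ : θ ∈ Ioo 0 Real.pi) :
    ‖pPhi f v r θ φ‖ ^ 2 ≤ 8 * tangD f v r θ φ := by
  have h := norm_z_le (Real.abs_sin_le_one θ) (Real.abs_cos_le_one θ)
    (pPhi_eq_covD (u := f) (v := v) (r := r) (φ := φ) hθ)
  have h2 : ‖pPhi f v r θ φ‖ ^ 2 ≤ (‖covD f v r θ φ‖ + 2 * ‖f v r θ φ‖) ^ 2 := by gcongr
  unfold tangD tangSq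
  nlinarith [sq_nonneg ‖pV f v r θ φ‖, sq_nonneg ‖pTheta f v r θ φ‖, sq_nonneg ‖covD f v r θ φ‖,
    sq_nonneg (‖covD f v r θ φ‖ - 2 * ‖f v r θ φ‖)]

/-! ## Commutation with `∂_r` -/

/-- Generalised Teukolsky operators with the coefficients that occur. -/
noncomputable def opT (a M k β γ : ℝ) (δ b : ℂ) (u : ℝ → ℝ → ℝ → ℝ → ℂ) :
    ℝ → ℝ → ℝ → ℝ → ℂ :=
  opGen a M k (fun r => β * (r - M)) (fun r θ => (γ : ℂ) * r + δ * (Real.cos θ : ℂ)) b u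

section Commute

variable {a M k β γ : ℝ} {δ b : ℂ} {u : ℝ → ℝ → ℝ → ℝ → ℂ}

theorem Sm.spinLap_eq (haM : |a| < M) (hu : Sm a M u) {v r θ φ : ℝ}
    (hr : r ∈ Ioc (rm a M) (rp a M)) :
    spinLap 2 u v r θ φ = 1 / (Real.sin θ : ℂ) * ((Real.cos θ : ℂ) * Kerr.pTheta u v r θ φ
        + (Real.sin θ : ℂ) * Kerr.pTheta (Kerr.pTheta u) v r θ φ)
      + 1 / (Real.sin θ : ℂ) ^ 2 * Kerr.pPhi (Kerr.pPhi u) v r θ φ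
      + 2 * (2 : ℝ) * Complex.I * ((Real.cos θ : ℂ) / (Real.sin θ : ℂ) ^ 2) * Kerr.pPhi u v r θ φ
      - (((2 : ℝ) : ℂ) ^ 2 * ((Real.cos θ : ℂ) ^ 2 / (Real.sin θ : ℂ) ^ 2) - (2 : ℝ)) * u v r θ φ := by
  unfold spinLap
  rw [(hasDerivAt_sin_pTheta haM hu hr).deriv]

theorem Sm.hasDerivAt_spinLap_r (haM : |a| < M) (hu : Sm a M u) {v r θ φ : ℝ}
    (hr : r ∈ Ioo (rm a M) (rp a M)) :
    HasDerivAt (fun x => spinLap 2 u v x θ φ) (spinLap 2 (Kerr.pR a M u) v r θ φ) r := by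
  have hrc := Ioo_subset_Ioc_self hr
  have d0 := hu.hasDerivAt_r (v := v) (θ := θ) (φ := φ) hr
  have d1 := (hu.pTheta haM).hasDerivAt_r (v := v) (θ := θ) (φ := φ) hr
  have d2 := ((hu.pTheta haM).pTheta haM).hasDerivAt_r (v := v) (θ := θ) (φ := φ) hr
  have d3 := (hu.pPhi haM).hasDerivAt_r (v := v) (θ := θ) (φ := φ) hr
  have d4 := ((hu.pPhi haM).pPhi haM).hasDerivAt_r (v := v) (θ := θ) (φ := φ) hr
  have e1 := hu.pTheta_pR haM v r θ φ hrc
  have e2 := (((hu.pTheta_pR haM).pTheta).trans ((hu.pTheta haM).pTheta_pR haM)) v r θ φ hrc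
  have e3 := hu.pPhi_pR haM v r θ φ hrc
  have e4 := (((hu.pPhi_pR haM).pPhi).trans ((hu.pPhi haM).pPhi_pR haM)) v r θ φ hrc
  rw [← e1] at d1
  rw [← e2] at d2
  rw [← e3] at d3
  rw [← e4] at d4
  have h := (((((d1.const_mul (Real.cos θ : ℂ)).add (d2.const_mul (Real.sin θ : ℂ))).const_mul
    (1 / (Real.sin θ : ℂ))).add (d4.const_mul (1 / (Real.sin θ : ℂ) ^ 2))).add
    (d3.const_mul (2 * (2 : ℝ) * Complex.I * ((Real.cos θ : ℂ) / (Real.sin θ : ℂ) ^ 2)))).sub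
    (d0.const_mul (((2 : ℝ) : ℂ) ^ 2 * ((Real.cos θ : ℂ) ^ 2 / (Real.sin θ : ℂ) ^ 2) - (2 : ℝ)))
  rw [(hu.pR haM).spinLap_eq haM hrc]
  refine h.congr_of_eventuallyEq ?_
  filter_upwards [Ioo_mem_nhds hr.1 hr.2] with x hx
  rw [hu.spinLap_eq haM (Ioo_subset_Ioc_self hx)]
  rfl

/-- Differentiating the r-dependent coefficients shifts the lower order ones: Δ' = 2 (r - M) raises
β by 2, the derivative of 2 (r² + a²) raises γ by 4, and β (r - M) adds β to the potential. The
increase of β is the gain of red-shift under commutation. -/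
theorem Sm.hasDerivAt_opT_r (haM : |a| < M) (hu : Sm a M u) {v r θ φ : ℝ}
    (hr : r ∈ Ioo (rm a M) (rp a M)) :
    HasDerivAt (fun x => opT a M k β γ δ b u v x θ φ)
      (opT a M k (β + 2) (γ + 4) δ (b + β) (Kerr.pR a M u) v r θ φ
        + γ * Kerr.pV u v r θ φ) r := by
  have hrc := Ioo_subset_Ioc_self hr
  have hx := hu.pR haM
  have hy := hu.pV haM
  have hz := hu.pPhi haM
  have d0 := hu.hasDerivAt_r (v := v) (θ := θ) (φ := φ) hr
  have d1 := (hy.pV haM).hasDerivAt_r (v := v) (θ := θ) (φ := φ) hr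
  have d2 := (hz.pV haM).hasDerivAt_r (v := v) (θ := θ) (φ := φ) hr
  have d3 := (hx.pV haM).hasDerivAt_r (v := v) (θ := θ) (φ := φ) hr
  have d4 := (hx.pPhi haM).hasDerivAt_r (v := v) (θ := θ) (φ := φ) hr
  have d5 := (hx.pR haM).hasDerivAt_r (v := v) (θ := θ) (φ := φ) hr
  have d6 := hy.hasDerivAt_r (v := v) (θ := θ) (φ := φ) hr
  have d7 := hx.hasDerivAt_r (v := v) (θ := θ) (φ := φ) hr
  have d8 := hu.hasDerivAt_spinLap_r haM (v := v) (θ := θ) (φ := φ) hr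
  have e1 := (((hu.pV_pR haM).pV).trans (hy.pV_pR haM)) v r θ φ hrc
  have e2 := (((hu.pPhi_pR haM).pV).trans (hz.pV_pR haM)) v r θ φ hrc
  have e3 := (hx.pV_pR haM) v r θ φ hrc
  have e4 := (hx.pPhi_pR haM) v r θ φ hrc
  have e6 := (hu.pV_pR haM) v r θ φ hrc
  rw [← e1] at d1
  rw [← e2] at d2
  rw [← e3] at d3
  rw [← e4] at d4
  rw [← e6] at d6
  have cr : HasDerivAt (fun x : ℝ => (x : ℂ)) 1 r := by
    simpa using (hasDerivAt_id r).ofReal_comp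
  have ch : HasDerivAt (fun x : ℝ => 2 * ((x : ℂ) ^ 2 + (a : ℂ) ^ 2)) (4 * (r : ℂ)) r := by
    refine (((cr.pow 2).add_const ((a : ℂ) ^ 2)).const_mul 2).congr_deriv ?_
    simp; ring
  have cD : HasDerivAt (fun x : ℝ => (Delta a M x : ℂ)) ((2 * (r - M) : ℝ) : ℂ) r :=
    (hasDerivAt_Delta a M r).ofReal_comp
  have cv : HasDerivAt (fun x : ℝ => (γ : ℂ) * x + δ * (Real.cos θ : ℂ)) γ r := by
    simpa using (cr.const_mul (γ : ℂ)).add_const (δ * (Real.cos θ : ℂ))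
  have cb : HasDerivAt (fun x : ℝ => ((β * (x - M) : ℝ) : ℂ)) (β : ℂ) r := by
    have := ((((hasDerivAt_id r).sub_const M).const_mul β)).ofReal_comp
    simpa using this
  have h := ((((((((d1.const_mul ((a : ℂ) ^ 2 * (Real.sin θ : ℂ) ^ 2)).add
    (d2.const_mul (2 * (k : ℂ)))).add (ch.mul d3)).add (d4.const_mul (2 * (k : ℂ)))).add
    (cD.mul d5)).add (cv.mul d6)).add (cb.mul d7)).add d8).add (d0.const_mul b)
  refine h.congr_deriv ?_
  unfold opT opGen
  push_cast
  ring

/-- The `r`-derivative of a solution of a generalised Teukolsky equation solves another one. -/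
theorem opT_pR_eq {F : ℝ → ℝ → ℝ → ℝ → ℂ} (haM : |a| < M) (hu : Sm a M u)
    (h : EqT (Ioo (rm a M) (rp a M)) (opT a M k β γ δ b u) F) :
    EqT (Ioo (rm a M) (rp a M)) (opT a M k (β + 2) (γ + 4) δ (b + β) (Kerr.pR a M u))
      (fun v r θ φ => Kerr.pR a M F v r θ φ - γ * Kerr.pV u v r θ φ) := by
  intro v r θ φ hr hθ
  have h1 := h.pR_Ioo v r θ φ hr hθ
  have h2 : Kerr.pR a M (opT a M k β γ δ b u) v r θ φ = _ :=
    (hu.hasDerivAt_opT_r haM hr).hasDerivWithinAt.derivWithin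
      (uniqueDiffOn_Ioc _ _ r (Ioo_subset_Ioc_self hr))
  rw [h2] at h1
  linear_combination h1

end Commute


/-! ## Change between the two coordinate systems -/

/-- A function of `(v₋, r, θ, φ₋)` in the coordinates `(v₊, r, θ, φ₊)`. -/
noncomputable def pull (a M c b : ℝ) (g : ℝ → ℝ → ℝ → ℝ → ℂ) : ℝ → ℝ → ℝ → ℝ → ℂ :=
  fun v r θ φ => g (2 * rStar a M c r - v) r θ (φ - 2 * rBar a M b r)

section Pull

variable {a M c b : ℝ} {g : ℝ → ℝ → ℝ → ℝ → ℂ}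

theorem Sm.hasDerivAt_pull_v (hg : Sm a M g) {v r θ φ : ℝ} (hr : r ∈ Ioc (rm a M) (rp a M)) :
    HasDerivAt (fun x => pull a M c b g x r θ φ) (-pull a M c b (Kerr.pV g) v r θ φ) v := by
  have h := HasDerivAt.scomp v (hg.hasDerivAt_v (v := 2 * rStar a M c r - v) (θ := θ)
    (φ := φ - 2 * rBar a M b r) hr) ((hasDerivAt_id v).const_sub (2 * rStar a M c r))
  refine h.congr_deriv ?_
  simp [pull]

theorem Sm.hasDerivAt_pull_phi (hg : Sm a M g) {v r θ φ : ℝ} (hr : r ∈ Ioc (rm a M) (rp a M)) :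
    HasDerivAt (fun x => pull a M c b g v r θ x) (pull a M c b (Kerr.pPhi g) v r θ φ) φ := by
  have h := HasDerivAt.scomp φ (hg.hasDerivAt_phi (v := 2 * rStar a M c r - v) (θ := θ)
    (φ := φ - 2 * rBar a M b r) hr) ((hasDerivAt_id φ).sub_const (2 * rBar a M b r))
  refine h.congr_deriv ?_
  simp [pull]

/-- The derivatives of r* and of the angle shift bring in factors 1/Δ. They are cleared by the
factor Δ² in `pullR`. -/
theorem Sm.hasDerivAt_pull_r (ha : 0 < |a|) (haM : |a| < M) (hg : Sm a M g) {v r θ φ : ℝ}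
    (hr : r ∈ Ioo (rm a M) (rp a M)) :
    HasDerivAt (fun x => pull a M c b g v x θ φ) (pull a M c b (Kerr.pR a M g) v r θ φ
      + 2 * ((r : ℂ) ^ 2 + (a : ℂ) ^ 2) / (Delta a M r : ℂ) * pull a M c b (Kerr.pV g) v r θ φ
      - 2 * a / (Delta a M r : ℂ) * pull a M c b (Kerr.pPhi g) v r θ φ) r := by
  have hrc := Ioo_subset_Ioc_self hr
  have h1 := ((hasDerivAt_rStar ha haM c hr).const_mul 2).sub_const v
  have h2 := ((hasDerivAt_rBar haM b hr).const_mul 2).const_sub φ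
  have hc : HasDerivWithinAt (fun x : ℝ => (2 * rStar a M c x - v, x, θ, φ - 2 * rBar a M b x))
      (2 * ((r ^ 2 + a ^ 2) / Delta a M r), 1, 0, -(2 * (a / Delta a M r)))
      (Ioo (rm a M) (rp a M)) r :=
    h1.hasDerivWithinAt.prodMk ((hasDerivWithinAt_id r _).prodMk
      ((hasDerivWithinAt_const r _ θ).prodMk h2.hasDerivWithinAt))
  have h := hg.hasDerivWithinAt_line hc (fun x hx => mem_dom.2 (Ioo_subset_Ioc_self hx))
    (mem_dom.2 hrc)
  refine (h.hasDerivAt (Ioo_mem_nhds hr.1 hr.2)).congr_deriv ?_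
  have hsplit : ((2 * ((r ^ 2 + a ^ 2) / Delta a M r), 1, 0, -(2 * (a / Delta a M r))) :
      ℝ × ℝ × ℝ × ℝ) = (2 * ((r ^ 2 + a ^ 2) / Delta a M r)) • ((1, 0, 0, 0) : ℝ × ℝ × ℝ × ℝ)
      + (0, 1, 0, 0) + (-(2 * (a / Delta a M r))) • ((0, 0, 0, 1) : ℝ × ℝ × ℝ × ℝ) := by
    simp
  rw [hsplit]
  simp only [map_add, map_smul]
  have e1 := hg.pV_eq (2 * rStar a M c r - v) r θ (φ - 2 * rBar a M b r) hrc
  have e2 := hg.pR_eq (2 * rStar a M c r - v) r θ (φ - 2 * rBar a M b r) hrc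
  have e3 := hg.pPhi_eq (2 * rStar a M c r - v) r θ (φ - 2 * rBar a M b r) hrc
  unfold Kerr.pd at e1 e2 e3
  unfold pull
  rw [e1, e2, e3]
  simp only [Complex.real_smul]
  push_cast
  ring

/-- The `r`-derivative of `Δ² pull U`. -/
noncomputable def pullR (a M c b : ℝ) (U : ℝ → ℝ → ℝ → ℝ → ℂ) : ℝ → ℝ → ℝ → ℝ → ℂ :=
  fun v r θ φ => (Delta a M r : ℂ) ^ 2 * pull a M c b (pR a M U) v r θ φ
    + 2 * ((r : ℂ) ^ 2 + (a : ℂ) ^ 2) * (Delta a M r : ℂ) * pull a M c b (pV U) v r θ φ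
    - 2 * a * (Delta a M r : ℂ) * pull a M c b (pPhi U) v r θ φ
    + 4 * (Delta a M r : ℂ) * ((r : ℂ) - M) * pull a M c b U v r θ φ

theorem Delta_neg (haM : |a| < M) {r : ℝ} (hr : r ∈ Ioo (rm a M) (rp a M)) : Delta a M r < 0 := by
  rw [Delta_eq haM]
  exact mul_neg_of_neg_of_pos (by linarith [hr.2]) (by linarith [hr.1])

theorem hasDerivAt_ofReal_id (r : ℝ) : HasDerivAt (fun x : ℝ => (x : ℂ)) 1 r := by
  simpa using (hasDerivAt_id r).ofReal_comp

theorem hasDerivAt_Delta_complex (a M r : ℝ) :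
    HasDerivAt (fun x : ℝ => (Delta a M x : ℂ)) (2 * ((r : ℂ) - M)) r := by
  have := (hasDerivAt_Delta a M r).ofReal_comp
  push_cast at this
  exact this

theorem Sm.hasDerivAt_Delta_sq_pull (ha : 0 < |a|) (haM : |a| < M) (hg : Sm a M g) {v r θ φ : ℝ}
    (hr : r ∈ Ioo (rm a M) (rp a M)) :
    HasDerivAt (fun x => (Delta a M x : ℂ) ^ 2 * pull a M c b g v x θ φ)
      (pullR a M c b g v r θ φ) r := by
  have hD : (Delta a M r : ℂ) ≠ 0 := Complex.ofReal_ne_zero.2 (Delta_neg haM hr).ne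
  have h := ((hasDerivAt_Delta_complex a M r).pow 2).mul
    (hg.hasDerivAt_pull_r (c := c) (b := b) (v := v) (θ := θ) (φ := φ) ha haM hr)
  refine h.congr_deriv ?_
  unfold pullR
  simp
  field_simp
  ring

theorem Sm.hasDerivAt_pullR (ha : 0 < |a|) (haM : |a| < M) (hg : Sm a M g) {v r θ φ : ℝ}
    (hr : r ∈ Ioo (rm a M) (rp a M)) :
    HasDerivAt (fun x => pullR a M c b g v x θ φ)
      ((Delta a M r : ℂ) ^ 2 * pull a M c b (Kerr.pR a M (Kerr.pR a M g)) v r θ φ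
      + 4 * ((r : ℂ) ^ 2 + (a : ℂ) ^ 2) * (Delta a M r : ℂ)
        * pull a M c b (Kerr.pV (Kerr.pR a M g)) v r θ φ
      - 4 * a * (Delta a M r : ℂ) * pull a M c b (Kerr.pPhi (Kerr.pR a M g)) v r θ φ
      + 4 * ((r : ℂ) ^ 2 + (a : ℂ) ^ 2) ^ 2 * pull a M c b (Kerr.pV (Kerr.pV g)) v r θ φ
      - 8 * a * ((r : ℂ) ^ 2 + (a : ℂ) ^ 2) * pull a M c b (Kerr.pV (Kerr.pPhi g)) v r θ φ
      + 4 * (a : ℂ) ^ 2 * pull a M c b (Kerr.pPhi (Kerr.pPhi g)) v r θ φ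
      + 8 * (Delta a M r : ℂ) * ((r : ℂ) - M) * pull a M c b (Kerr.pR a M g) v r θ φ
      + (4 * r * (Delta a M r : ℂ) + 12 * ((r : ℂ) ^ 2 + (a : ℂ) ^ 2) * ((r : ℂ) - M))
        * pull a M c b (Kerr.pV g) v r θ φ
      - 12 * a * ((r : ℂ) - M) * pull a M c b (Kerr.pPhi g) v r θ φ
      + (8 * ((r : ℂ) - M) ^ 2 + 4 * (Delta a M r : ℂ)) * pull a M c b g v r θ φ) r := by
  have hrc := Ioo_subset_Ioc_self hr
  have hD : (Delta a M r : ℂ) ≠ 0 := Complex.ofReal_ne_zero.2 (Delta_neg haM hr).ne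
  have d0 := hg.hasDerivAt_pull_r (c := c) (b := b) (v := v) (θ := θ) (φ := φ) ha haM hr
  have d1 := (hg.pR haM).hasDerivAt_pull_r (c := c) (b := b) (v := v) (θ := θ) (φ := φ) ha haM hr
  have d2 := (hg.pV haM).hasDerivAt_pull_r (c := c) (b := b) (v := v) (θ := θ) (φ := φ) ha haM hr
  have d3 := (hg.pPhi haM).hasDerivAt_pull_r (c := c) (b := b) (v := v) (θ := θ) (φ := φ) ha haM hr
  have e1 : pull a M c b (Kerr.pR a M (Kerr.pV g)) v r θ φ
    = pull a M c b (Kerr.pV (Kerr.pR a M g)) v r θ φ := ((hg.pV_pR haM) _ _ _ _ hrc).symm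
  have e2 : pull a M c b (Kerr.pR a M (Kerr.pPhi g)) v r θ φ
    = pull a M c b (Kerr.pPhi (Kerr.pR a M g)) v r θ φ := ((hg.pPhi_pR haM) _ _ _ _ hrc).symm
  have e3 : pull a M c b (Kerr.pPhi (Kerr.pV g)) v r θ φ
    = pull a M c b (Kerr.pV (Kerr.pPhi g)) v r θ φ := ((hg.pV_pPhi haM) _ _ _ _ hrc).symm
  rw [e1, e3] at d2
  rw [e2] at d3
  have cr := hasDerivAt_ofReal_id r
  have cD := hasDerivAt_Delta_complex a M r
  have ch : HasDerivAt (fun x : ℝ => 2 * ((x : ℂ) ^ 2 + (a : ℂ) ^ 2)) (4 * (r : ℂ)) r := by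
    refine (((cr.pow 2).add_const ((a : ℂ) ^ 2)).const_mul 2).congr_deriv ?_
    simp; ring
  have h := (((((cD.pow 2).mul d1).add ((ch.mul cD).mul d2)).sub
    ((cD.const_mul (2 * (a : ℂ))).mul d3))).add
    (((cD.const_mul 4).mul (cr.sub_const (M : ℂ))).mul d0)
  refine h.congr_deriv ?_
  simp
  field_simp
  ring

theorem spinLap_pull (k : ℂ) (v r θ φ : ℝ) :
    spinLap 2 (fun v r θ φ => k * pull a M c b g v r θ φ) v r θ φ
      = k * pull a M c b (spinLap 2 g) v r θ φ := by
  have e1 : ∀ θ φ, pTheta (fun v r θ φ => k * pull a M c b g v r θ φ) v r θ φ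
      = k * pTheta g (2 * rStar a M c r - v) r θ (φ - 2 * rBar a M b r) := fun θ φ => by
    unfold pTheta pull
    exact deriv_const_mul_field _
  have e2 : ∀ θ φ, pPhi (fun v r θ φ => k * pull a M c b g v r θ φ) v r θ φ
      = k * pPhi g (2 * rStar a M c r - v) r θ (φ - 2 * rBar a M b r) := fun θ φ => by
    unfold pPhi pull
    rw [deriv_const_mul_field]
    congr 1
    exact deriv_comp_sub_const (f := fun x => g (2 * rStar a M c r - v) r θ x) _ _
  have e3 : pPhi (pPhi (fun v r θ φ => k * pull a M c b g v r θ φ)) v r θ φ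
      = k * pPhi (pPhi g) (2 * rStar a M c r - v) r θ (φ - 2 * rBar a M b r) := by
    change deriv (fun x => pPhi (fun v r θ φ => k * pull a M c b g v r θ φ) v r θ x) φ = _
    simp only [e2]
    rw [deriv_const_mul_field]
    congr 1
    exact deriv_comp_sub_const (f := fun x => pPhi g (2 * rStar a M c r - v) r θ x) _ _
  unfold spinLap
  rw [e3, e2]
  simp only [e1]
  have e4 : deriv (fun x => (Real.sin x : ℂ) *
      (k * pTheta g (2 * rStar a M c r - v) r x (φ - 2 * rBar a M b r))) θ
      = k * deriv (fun x => (Real.sin x : ℂ) *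
      pTheta g (2 * rStar a M c r - v) r x (φ - 2 * rBar a M b r)) θ := by
    rw [← deriv_const_mul_field]
    congr 1
    funext x
    ring
  rw [e4]
  unfold pull
  ring

/-- The equation of `U` when `Δ² pull U` satisfies the Teukolsky equation. -/
theorem opT_pull (ha : 0 < |a|) (haM : |a| < M) {U ψ : ℝ → ℝ → ℝ → ℝ → ℂ} (hU : Sm a M U)
    (hψ : EqT (Ioo (rm a M) (rp a M)) ψ
      (fun v r θ φ => (Delta a M r : ℂ) ^ 2 * pull a M c b U v r θ φ))
    {v r θ φ : ℝ} (hr : r ∈ Ioo (rm a M) (rp a M)) (hθ : θ ∈ Ioo 0 Real.pi) :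
    opT a M a (-2) (-6) (-4 * Complex.I * a) (-4) ψ v r θ φ
      = (Delta a M r : ℂ) ^ 2 *
        pull a M c b (opT a M (-a) 6 10 (4 * Complex.I * a) 0 U) v r θ φ := by
  have hrc := Ioo_subset_Ioc_self hr
  have hy := hU.pV haM
  have hz := hU.pPhi haM
  have hx := hU.pR haM
  unfold opT
  rw [hψ.opGen _ _ _ _ v r θ φ hr hθ]
  set Ψ : ℝ → ℝ → ℝ → ℝ → ℂ := fun v r θ φ => (Delta a M r : ℂ) ^ 2 * pull a M c b U v r θ φ
    with hΨ
  have pv : ∀ v θ φ, pV Ψ v r θ φ = (Delta a M r : ℂ) ^ 2 * -pull a M c b (pV U) v r θ φ :=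
    fun v θ φ => ((hU.hasDerivAt_pull_v (c := c) (b := b) hrc).const_mul _).deriv
  have pp : ∀ v θ φ, pPhi Ψ v r θ φ = (Delta a M r : ℂ) ^ 2 * pull a M c b (pPhi U) v r θ φ :=
    fun v θ φ => ((hU.hasDerivAt_pull_phi (c := c) (b := b) hrc).const_mul _).deriv
  have pr : ∀ r ∈ Ioo (rm a M) (rp a M), ∀ v θ φ, pR a M Ψ v r θ φ = pullR a M c b U v r θ φ :=
    fun r hr v θ φ => (hU.hasDerivAt_Delta_sq_pull (c := c) (b := b) ha haM hr).hasDerivWithinAt.derivWithin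
      (uniqueDiffOn_Ioc _ _ r (Ioo_subset_Ioc_self hr))
  have pvv : pV (pV Ψ) v r θ φ = (Delta a M r : ℂ) ^ 2 * pull a M c b (pV (pV U)) v r θ φ := by
    change deriv (fun x => pV Ψ x r θ φ) v = _
    simp only [pv]
    refine HasDerivAt.deriv ?_
    refine ((hy.hasDerivAt_pull_v (c := c) (b := b) hrc).neg.const_mul _).congr_deriv ?_
    rw [neg_neg]
  have pvp : pV (pPhi Ψ) v r θ φ = -((Delta a M r : ℂ) ^ 2 * pull a M c b (pV (pPhi U)) v r θ φ) := by
    change deriv (fun x => pPhi Ψ x r θ φ) v = _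
    simp only [pp]
    refine HasDerivAt.deriv ?_
    refine ((hz.hasDerivAt_pull_v (c := c) (b := b) hrc).const_mul _).congr_deriv ?_
    rw [mul_neg]
  have e3 : pull a M c b (pPhi (pV U)) v r θ φ
    = pull a M c b (pV (pPhi U)) v r θ φ := ((hU.pV_pPhi haM) _ _ _ _ hrc).symm
  have pvr : pV (pR a M Ψ) v r θ φ = -((Delta a M r : ℂ) ^ 2 * pull a M c b (pV (pR a M U)) v r θ φ
      + 2 * ((r : ℂ) ^ 2 + (a : ℂ) ^ 2) * (Delta a M r : ℂ) * pull a M c b (pV (pV U)) v r θ φ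
      - 2 * a * (Delta a M r : ℂ) * pull a M c b (pV (pPhi U)) v r θ φ
      + 4 * (Delta a M r : ℂ) * ((r : ℂ) - M) * pull a M c b (pV U) v r θ φ) := by
    change deriv (fun x => pR a M Ψ x r θ φ) v = _
    simp only [pr r hr]
    unfold pullR
    refine HasDerivAt.deriv ?_
    refine (((((hx.hasDerivAt_pull_v (c := c) (b := b) hrc).const_mul _).add
      ((hy.hasDerivAt_pull_v (c := c) (b := b) hrc).const_mul _)).sub
      ((hz.hasDerivAt_pull_v (c := c) (b := b) hrc).const_mul _)).add
      ((hU.hasDerivAt_pull_v (c := c) (b := b) hrc).const_mul _)).congr_deriv ?_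
    ring
  have ppr : pPhi (pR a M Ψ) v r θ φ = (Delta a M r : ℂ) ^ 2 * pull a M c b (pPhi (pR a M U)) v r θ φ
      + 2 * ((r : ℂ) ^ 2 + (a : ℂ) ^ 2) * (Delta a M r : ℂ) * pull a M c b (pPhi (pV U)) v r θ φ
      - 2 * a * (Delta a M r : ℂ) * pull a M c b (pPhi (pPhi U)) v r θ φ
      + 4 * (Delta a M r : ℂ) * ((r : ℂ) - M) * pull a M c b (pPhi U) v r θ φ := by
    change deriv (fun x => pR a M Ψ v r θ x) φ = _
    simp only [pr r hr]
    unfold pullR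
    exact (((((hx.hasDerivAt_pull_phi (c := c) (b := b) hrc).const_mul _).add
      ((hy.hasDerivAt_pull_phi (c := c) (b := b) hrc).const_mul _)).sub
      ((hz.hasDerivAt_pull_phi (c := c) (b := b) hrc).const_mul _)).add
      ((hU.hasDerivAt_pull_phi (c := c) (b := b) hrc).const_mul _)).deriv
  have hpr : EqT (Ioo (rm a M) (rp a M)) (pR a M Ψ) (pullR a M c b U) :=
    fun v r θ φ hr _ => pr r hr v θ φ
  have prr := (hpr.pR_Ioo v r θ φ hr hθ).trans
    ((hU.hasDerivAt_pullR (c := c) (b := b) ha haM hr).hasDerivWithinAt.derivWithin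
      (uniqueDiffOn_Ioc _ _ r hrc))
  have lap : spinLap 2 Ψ v r θ φ = (Delta a M r : ℂ) ^ 2 * pull a M c b (spinLap 2 U) v r θ φ :=
    spinLap_pull (g := U) ((Delta a M r : ℂ) ^ 2) v r θ φ
  have hop : pull a M c b (opGen a M (-a) (fun r => 6 * (r - M))
      (fun r θ => ((10 : ℝ) : ℂ) * r + 4 * Complex.I * a * (Real.cos θ : ℂ)) 0 U) v r θ φ
      = (a : ℂ) ^ 2 * (Real.sin θ : ℂ) ^ 2 * pull a M c b (pV (pV U)) v r θ φ
      - 2 * a * pull a M c b (pV (pPhi U)) v r θ φ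
      + 2 * ((r : ℂ) ^ 2 + (a : ℂ) ^ 2) * pull a M c b (pV (pR a M U)) v r θ φ
      - 2 * a * pull a M c b (pPhi (pR a M U)) v r θ φ
      + (Delta a M r : ℂ) * pull a M c b (pR a M (pR a M U)) v r θ φ
      + (10 * r + 4 * Complex.I * a * (Real.cos θ : ℂ)) * pull a M c b (pV U) v r θ φ
      + 6 * ((r : ℂ) - M) * pull a M c b (pR a M U) v r θ φ
      + pull a M c b (spinLap 2 U) v r θ φ := by
    unfold pull opGen
    push_cast
    ring
  rw [hop]
  unfold opGen
  -- All derivatives of Δ² times the pullback are now pullbacks of derivatives of U with polynomial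
  -- coefficients, so the identity can be checked coefficient by coefficient.
  rw [pvv, pvp, pvr, ppr, prr, pv, pr r hr, lap, e3]
  unfold pullR
  rw [hΨ]
  push_cast
  ring

end Pull


/-! ## The Teukolsky field and its rescaling as regular solutions -/

/-- `P` solves the Teukolsky equation in the interior, and `U` is `Δ⁻² P` in the coordinates
`(v₋, r, θ, φ₋)`; both are regular up to `r = r₊`. -/
structure RegularPair (a M c b : ℝ) (P U : ℝ → ℝ → ℝ → ℝ → ℂ) : Prop where
  regP : SpinReg a M P
  regU : SpinReg a M U
  eqn : EqT (Ioo (rm a M) (rp a M)) (opT a M a (-2) (-6) (-4 * Complex.I * a) (-4) P)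
    (fun _ _ _ _ => 0)
  rel : EqT (Ioo (rm a M) (rp a M)) P
    (fun v r θ φ => (Delta a M r : ℂ) ^ 2 * pull a M c b U v r θ φ)

section Fields

variable {a M c b : ℝ}

theorem teukolsky_eq_opT (g : ℝ → ℝ → ℝ → ℝ → ℂ) (v r θ φ : ℝ) :
    teukolsky a M 2 g v r θ φ = opT a M a (-2) (-6) (-4 * Complex.I * a) (-4) g v r θ φ := by
  unfold teukolsky opT opGen
  push_cast
  ring

/-- The values of f for θ outside (0, π) are arbitrary. The calculus on all real angles is therefore
carried out for the extension given by α, and f only enters through `EqT`. -/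
theorem IsSpin2.exists_spinExt {f : ℝ → ℝ → ℝ → ℝ → ℂ} (h : IsSpin2 f) :
    ∃ α : Amb → (Amb →L[ℝ] Amb →L[ℝ] ℝ),
      ContDiffOn ℝ ∞ α (Ici (0 : ℝ) ×ˢ Ici (0 : ℝ) ×ˢ ({0}ᶜ : Set (EuclideanSpace ℝ (Fin 3)))) ∧
      (∀ x u w, α x u w = α x w u) ∧
      EqT (Ioc (rm a M) (rp a M)) (inPlus a M c b f) (inPlus a M c b (spinExt α)) ∧
      EqT (Ioc (rm a M) (rp a M)) (hatField a M c b f) (hatField a M c b (spinExt α)) := by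
  obtain ⟨α, hα, hs, hf⟩ := h
  have hpos : ∀ v : ℝ, ∀ r ∈ Ioc (rm a M) (rp a M), 0 ≤ Real.exp (-(kp a M * v)) *
      ((rp a M - r) * Real.exp (2 * kp a M * regP a M c r)) := fun v r hr =>
    mul_nonneg (Real.exp_pos _).le (mul_nonneg (by linarith [hr.2]) (Real.exp_pos _).le)
  refine ⟨α, hα, hs, fun v r θ φ hr hθ => ?_, fun v r θ φ hr hθ => ?_⟩
  · exact hf _ _ _ _ (Real.exp_pos _).le (hpos v r hr) hθ
  · unfold hatField inMinus
    rw [hf _ _ _ _ (hpos v r hr) (Real.exp_pos _).le hθ]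
    rfl

theorem RegularField.exists_regularPair {ψ ψt : ℝ → ℝ → ℝ → ℝ → ℂ} (ha : 0 < |a|) (haM : |a| < M)
    (h : RegularField a M c b ψ ψt) :
    ∃ P U, RegularPair a M c b P U ∧
      EqT (Ioc (rm a M) (rp a M)) (inPlus a M c b ψ) P ∧
      EqT (Ioc (rm a M) (rp a M)) (hatField a M c b ψt) U := by
  obtain ⟨α, hα, hs, hP, -⟩ := h.spin.exists_spinExt (a := a) (M := M) (c := c) (b := b)
  obtain ⟨α', hα', hs', -, hU⟩ := h.spin_t.exists_spinExt (a := a) (M := M) (c := c) (b := b)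
  have hP' := hP.mono (R' := Ioo (rm a M) (rp a M)) Ioo_subset_Ioc_self
  have hU' := hU.mono (R' := Ioo (rm a M) (rp a M)) Ioo_subset_Ioc_self
  refine ⟨_, _, ⟨spinReg_inPlus hα hs c b, spinReg_hatField hα' hs' c b, ?_, ?_⟩, hP, hU⟩
  · intro v r θ φ hr hθ
    rw [← h.equation v r θ φ (Ioo_subset_Ioc_self hr) hθ, teukolsky_eq_opT]
    exact hP'.symm.opGen _ _ _ _ v r θ φ hr hθ
  · intro v r θ φ hr hθ
    have hD : ((Delta a M r ^ 2 : ℝ) : ℂ) ≠ 0 :=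
      Complex.ofReal_ne_zero.2 (pow_ne_zero 2 (Delta_neg haM hr).ne)
    have e1 := hP' v r θ φ hr hθ
    have e2 := hU' (2 * rStar a M c r - v) r θ (φ - 2 * rBar a M b r) hr hθ
    rw [h.hatField_eq haM hr hθ] at e2
    -- The Boyer–Lindquist coordinates of the point are t = v - r* and φ shifted back by `rBar`.
    have e3 := inPlus_eq ha haM c b ψ (v - rStar a M c r) θ (φ - rBar a M b r) hr.2
    have e4 := inMinus_eq ha haM c b ψ (v - rStar a M c r) θ (φ - rBar a M b r) hr.2
    rw [← e3] at e4
    rw [show v - rStar a M c r + rStar a M c r = v by ring,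
      show φ - rBar a M b r + rBar a M b r = φ by ring,
      show rStar a M c r - (v - rStar a M c r) = 2 * rStar a M c r - v by ring,
      show φ - rBar a M b r - rBar a M b r = φ - 2 * rBar a M b r by ring] at e4
    rw [← e1]
    unfold pull
    beta_reduce
    rw [← e2, e4, ← Complex.ofReal_pow, mul_div_cancel₀ _ hD]

variable {P U : ℝ → ℝ → ℝ → ℝ → ℂ}

/-- `opT_pull` is read at the point with the given (v₋, φ₋), and the factor Δ² is cancelled. The
coefficient of ∂_r is now 6 (r - M), so the red-shift at r₊ is favourable without commutation. -/
theorem RegularPair.eqn_rescaled (ha : 0 < |a|) (haM : |a| < M) (h : RegularPair a M c b P U) :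
    EqT (Ioo (rm a M) (rp a M)) (opT a M (-a) 6 10 (4 * Complex.I * a) 0 U)
      (fun _ _ _ _ => 0) := by
  intro v r θ φ hr hθ
  have hD : (Delta a M r : ℂ) ^ 2 ≠ 0 :=
    pow_ne_zero 2 (Complex.ofReal_ne_zero.2 (Delta_neg haM hr).ne)
  have e := opT_pull ha haM h.regU.sm h.rel (v := 2 * rStar a M c r - v) (φ := φ + 2 * rBar a M b r)
    hr hθ
  rw [h.eqn _ _ _ _ hr hθ] at e
  unfold pull at e
  rw [sub_sub_cancel, add_sub_cancel_right] at e
  exact (mul_eq_zero.1 e.symm).resolve_left hD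

/-- Two commutations take β from -2 to 0 and to 2. The first one produces the source 6 ∂_v P; the
second differentiates it and adds 2 ∂_v ∂_r P. -/
theorem RegularPair.eqn_pR_pR (haM : |a| < M) (h : RegularPair a M c b P U) :
    EqT (Ioo (rm a M) (rp a M)) (opT a M a 2 2 (-4 * Complex.I * a) (-6) (pR a M (pR a M P)))
      (fun v r θ φ => 8 * pV (pR a M P) v r θ φ) := by
  have h1 := opT_pR_eq haM h.regP.sm h.eqn
  have h1' : EqT (Ioo (rm a M) (rp a M))
      (opT a M a (-2 + 2) (-6 + 4) (-4 * Complex.I * a) (-4 + ((-2 : ℝ) : ℂ)) (pR a M P))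
      (fun v r θ φ => 6 * pV P v r θ φ) := fun v r θ φ hr hθ => by
    rw [h1 v r θ φ hr hθ]
    have : pR a M (fun _ _ _ _ => (0 : ℂ)) v r θ φ = 0 := by simp [pR]
    beta_reduce
    rw [this]
    push_cast
    ring
  have h2 := opT_pR_eq haM (h.regP.pR haM).sm h1'
  intro v r θ φ hr hθ
  have h3 := h2 v r θ φ hr hθ
  have hrc := Ioo_subset_Ioc_self hr
  have e : pR a M (fun v r θ φ => 6 * pV P v r θ φ) v r θ φ = 6 * pV (pR a M P) v r θ φ := by
    rw [h.regP.sm.pV_pR haM v r θ φ hrc]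
    exact (((h.regP.sm.pV haM).hasDerivWithinAt_r hrc).const_mul 6).derivWithin
      (uniqueDiffOn_Ioc _ _ r hrc)
  beta_reduce at h3
  rw [e] at h3
  norm_num at h3 ⊢
  rw [h3]
  ring

end Fields

/-! ## The three Teukolsky systems -/

section Systems

variable {a M c b : ℝ} {P U : ℝ → ℝ → ℝ → ℝ → ℂ}

theorem spinReg_zero : SpinReg a M (fun _ _ _ _ => 0) where
  sm := sm_const 0
  per _ _ _ _ := rfl
  north v r φ _ := by simp [covPhi, pPhi]
  south v r φ _ := by simp [covPhi, pPhi]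

theorem tangD_zero (v r θ φ : ℝ) : tangD (fun _ _ _ _ => (0 : ℂ)) v r θ φ = 0 := by
  simp [tangD, tangSq, covD, covPhi, pPhi, pV, pTheta]

theorem pR_zero : pR a M (fun _ _ _ _ => (0 : ℂ)) = fun _ _ _ _ => 0 := by
  funext v r θ φ
  simp [pR]

/-- Bounds for the coefficients come from |r - M| ≤ M and 0 < r ≤ 2 M. The number 64 is the square
of the factor 8 in the only nonzero source. -/
theorem teukSys_opT {k β γ c₁ K r₀ r₂ : ℝ} {δ b : ℂ} {u F f₁ f₀ : ℝ → ℝ → ℝ → ℝ → ℂ}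
    (ha : 0 < |a|) (haM : |a| < M) (hu : SpinReg a M u) (h₁ : SpinReg a M f₁)
    (h₀ : SpinReg a M f₀) (heq : EqT (Ioo (rm a M) (rp a M)) (opT a M k β γ δ b u) F)
    (hFb : ∀ v r θ φ, ‖F v r θ φ‖ ^ 2 ≤ 64 * tangD f₁ v r θ φ)
    (hb₁ : ∀ v r θ φ, tangD (pR a M f₁) v r θ φ ≤ tangD u v r θ φ)
    (hb₀ : ∀ v r θ φ, tangD (pR a M f₀) v r θ φ ≤ tangD f₁ v r θ φ)
    (hr₀ : rm a M ≤ r₀) (hr₂ : r₂ ≤ rp a M)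
    (hκ : ∀ r ∈ Ioc r₀ r₂, c₁ ≤ β * (r - M) - (r - M) + K * (-Delta a M r)) :
    TeukSys a M k (64 + |β| * M + |γ| * (2 * M) + ‖δ‖ + ‖b + 2‖) c₁ K r₀ r₂
      (fun r => β * (r - M)) (fun r θ => (γ : ℂ) * r + δ * (Real.cos θ : ℂ)) b u F f₁ f₀ := by
  have hM : 0 < M := ha.trans haM
  have hm := rm_pos ha haM
  have hs := rp_add_rm (a := a) (M := M)
  have n1 : 0 ≤ |β| * M := by positivity
  have n2 : 0 ≤ |γ| * (2 * M) := by positivity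
  have n3 := norm_nonneg δ
  have n4 := norm_nonneg (b + 2)
  refine ⟨hu, h₁, h₀, heq, fun v r θ φ _ _ => (hFb v r θ φ).trans ?_,
    fun v r θ φ _ _ => hb₁ v r θ φ, fun v r θ φ _ _ => hb₀ v r θ φ, fun r hr => ?_,
    fun r θ hr => ?_, by linarith, hκ⟩
  · exact mul_le_mul_of_nonneg_right (by linarith) (tangD_nonneg _ _ _ _ _)
  · rw [abs_mul]
    have : |r - M| ≤ M := abs_le.2 ⟨by linarith [hr.1], by linarith [hr.2]⟩
    have := mul_le_mul_of_nonneg_left this (abs_nonneg β)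
    linarith
  · have e1 : ‖(γ : ℂ) * r‖ ≤ |γ| * (2 * M) := by
      rw [norm_mul, Complex.norm_real, Complex.norm_real]
      refine mul_le_mul_of_nonneg_left ?_ (abs_nonneg γ)
      rw [Real.norm_eq_abs, abs_of_pos (by linarith [hr.1])]
      linarith [hr.2]
    have e2 : ‖δ * (Real.cos θ : ℂ)‖ ≤ ‖δ‖ := by
      rw [norm_mul, Complex.norm_real]
      exact mul_le_of_le_one_right n3 (Real.abs_cos_le_one θ)
    have := norm_add_le ((γ : ℂ) * r) (δ * (Real.cos θ : ℂ))
    linarith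

/-- With β = 2 the red-shift coefficient is r - M, positive in the upper half of (M, r₊). The source
8 ∂_v ∂_r P is tangential in ∂_r P, so ∂_r P and P join the system. -/
theorem RegularPair.exists_teukSys_right (ha : 0 < |a|) (haM : |a| < M)
    (h : RegularPair a M c b P U) :
    ∃ B₀ br bv b₀ F, TeukSys a M a B₀ ((rp a M - M) / 2) 0 ((M + rp a M) / 2) (rp a M) br bv b₀
      (pR a M (pR a M P)) F (pR a M P) P := by
  have h1 := h.regP.pR haM
  have h2 := h1.pR haM
  have hlt := rm_lt_rp haM
  have hs := rp_add_rm (a := a) (M := M)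
  refine ⟨_, _, _, _, _, teukSys_opT ha haM h2 h1 h.regP
    (h.eqn_pR_pR haM) (fun v r θ φ => ?_) (fun _ _ _ _ => le_rfl) (fun _ _ _ _ => le_rfl)
    (by linarith) le_rfl (fun r hr => by linarith [hr.1])⟩
  rw [norm_mul, mul_pow]
  unfold tangD tangSq
  norm_num
  nlinarith [sq_nonneg ‖pTheta (pR a M P) v r θ φ‖, sq_nonneg ‖covD (pR a M P) v r θ φ‖,
    sq_nonneg ‖pR a M P v r θ φ‖]

/-- With β = 6 the red-shift coefficient is 5 (r - M) and the equation has no source. -/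
theorem RegularPair.exists_teukSys_left (ha : 0 < |a|) (haM : |a| < M)
    (h : RegularPair a M c b P U) :
    ∃ B₀ br bv b₀ F, TeukSys a M (-a) B₀ ((rp a M - M) / 2) 0 ((M + rp a M) / 2) (rp a M) br bv b₀
      U F (fun _ _ _ _ => 0) (fun _ _ _ _ => 0) := by
  have hlt := rm_lt_rp haM
  have hs := rp_add_rm (a := a) (M := M)
  refine ⟨_, _, _, _, _, teukSys_opT ha haM h.regU spinReg_zero spinReg_zero
    (h.eqn_rescaled ha haM) (fun v r θ φ => ?_) (fun v r θ φ => ?_) (fun v r θ φ => ?_)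
    (by linarith) le_rfl (fun r hr => by linarith [hr.1])⟩
  · rw [tangD_zero]; simp
  · rw [pR_zero, tangD_zero]; exact tangD_nonneg _ _ _ _ _
  · rw [pR_zero]

/-- With β = -2 the coefficient is -3 (r - M), which equals 3 (M - r₋) > 0 at the Cauchy horizon.
For larger r it is compensated: K (-Δ) ≥ 8 (r - r₋) on (r₋, r₂], more than the 3 (r - r₋) that are
lost. -/
theorem RegularPair.exists_teukSys_interior (ha : 0 < |a|) (haM : |a| < M)
    (h : RegularPair a M c b P U) {r₂ : ℝ} (hr₂ : r₂ < rp a M) :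
    ∃ B₀ br bv b₀ F, TeukSys a M a B₀ (rp a M - M) (8 / (rp a M - r₂)) (rm a M) r₂ br bv b₀
      P F (fun _ _ _ _ => 0) (fun _ _ _ _ => 0) := by
  have hlt := rm_lt_rp haM
  have hs := rp_add_rm (a := a) (M := M)
  refine ⟨_, _, _, _, _, teukSys_opT ha haM h.regP spinReg_zero spinReg_zero
    h.eqn (fun v r θ φ => ?_) (fun v r θ φ => ?_) (fun v r θ φ => ?_)
    le_rfl hr₂.le (fun r hr => ?_)⟩
  · rw [tangD_zero]; simp
  · rw [pR_zero, tangD_zero]; exact tangD_nonneg _ _ _ _ _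
  · rw [pR_zero]
  · have hg : 0 < rp a M - r₂ := by linarith
    have hD : -Delta a M r = (rp a M - r) * (r - rm a M) := by rw [Delta_eq haM]; ring
    rw [hD]
    have h1 : 8 ≤ 8 / (rp a M - r₂) * (rp a M - r) := by
      rw [div_mul_eq_mul_div, le_div_iff₀ hg]
      linarith [hr.2]
    have h2 := mul_le_mul_of_nonneg_right h1 (sub_nonneg.2 hr.1.le)
    linarith [hr.1]

end Systems

/-! ## Decay on a hypersurface of constant `r` near the event horizons -/

section Horizons

variable {a M c b : ℝ} {P U : ℝ → ℝ → ℝ → ℝ → ℂ}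

theorem BC.aemeasurable_cyl {f : ℝ → ℝ → ℝ → ℝ → ℝ} (hf : BC a M f) {r : ℝ}
    (hr : r ∈ Ioc (rm a M) (rp a M)) :
    AEMeasurable (fun x : ℝ × ℝ × ℝ => f x.1 r x.2.1 x.2.2) cyl :=
  ((hf.aestronglyMeasurable hr).mono_ac cyl_absolutelyContinuous).aemeasurable

theorem lintegral_ofReal_mul_add_lt_top {α : Type*} [MeasurableSpace α] {μ : Measure α}
    {w f g : α → ℝ} (hw : AEMeasurable w μ) (hf : AEMeasurable f μ)
    (h₁ : ∫⁻ x, ENNReal.ofReal (w x * f x) ∂μ < ⊤) (h₂ : ∫⁻ x, ENNReal.ofReal (w x * g x) ∂μ < ⊤) :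
    ∫⁻ x, ENNReal.ofReal (w x * (f x + g x)) ∂μ < ⊤ := by
  refine lt_of_le_of_lt (lintegral_mono fun x => ?_)
    ((lintegral_add_left' (hw.mul hf).ennreal_ofReal _).trans_lt (ENNReal.add_lt_top.2 ⟨h₁, h₂⟩))
  simp only [mul_add]
  exact ENNReal.ofReal_add_le

theorem HorizonFinite.tangD_lt_top {q : ℝ} {f g : ℝ → ℝ → ℝ → ℝ → ℂ} (haM : |a| < M)
    (h : HorizonFinite a M q f) (hfg : EqT (Ioc (rm a M) (rp a M)) f g) :
    ∫⁻ x in {x : ℝ × ℝ × ℝ | 1 ≤ x.1}, ENNReal.ofReal (x.1 ^ q *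
      tangD g x.1 (rp a M) x.2.1 x.2.2) ∂cyl < ⊤ := by
  refine lintegral_ofReal_lt_top_of_le zero_le_one ?_ h
  filter_upwards [ae_restrict_mem (measurableSet_ge 1), ae_restrict_of_ae ae_cyl] with x hx hθ
  have hr : rp a M ∈ Ioc (rm a M) (rp a M) := ⟨rm_lt_rp haM, le_rfl⟩
  have h1 : 0 ≤ x.1 ^ q := Real.rpow_nonneg (zero_le_one.trans hx) q
  rw [one_mul, ← hfg.tangD hr hθ.1, tangEnergy_eq f hθ.1]
  exact mul_le_mul_of_nonneg_left (by nlinarith [sq_nonneg ‖f x.1 (rp a M) x.2.1 x.2.2‖]) h1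

/-- The horizon data for P, ∂_r P and ∂_r² P feed the commuted system. Its energy at r₁ contains
|∂_r P|² as the zeroth order part of the energy of ∂_r P. -/
theorem RegularPair.right_decay {q r₁ : ℝ} {f : ℝ → ℝ → ℝ → ℝ → ℂ} (ha : 0 < |a|) (haM : |a| < M)
    (h : RegularPair a M c b P U) (hq : 0 ≤ q) (hf : EqT (Ioc (rm a M) (rp a M)) f P)
    (hd : DecayRight a M q f) (hr₁ : r₁ ∈ Ioo ((M + rp a M) / 2) (rp a M)) :
    ∫⁻ x in {x : ℝ × ℝ × ℝ | 2 ≤ x.1}, ENNReal.ofReal (x.1 ^ q *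
      (‖pR a M P x.1 r₁ x.2.1 x.2.2‖ ^ 2 + tangD P x.1 r₁ x.2.1 x.2.2)) ∂cyl < ⊤ := by
  obtain ⟨B₀, br, bv, b₀, F, S⟩ := h.exists_teukSys_right ha haM
  have hlt := rm_lt_rp haM
  have hs := rp_add_rm (a := a) (M := M)
  have hr : rp a M ∈ Ioc (rm a M) (rp a M) := ⟨hlt, le_rfl⟩
  have d0 := ((hd 0 0 0 (by norm_num) (by norm_num)).1).tangD_lt_top haM hf
  have d1 := ((hd 0 0 1 (by norm_num) (by norm_num)).1).tangD_lt_top haM hf.pR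
  have d2 := ((hd 0 0 2 (by norm_num) (by norm_num)).1).tangD_lt_top haM hf.pR.pR
  have hw : AEMeasurable (fun x : ℝ × ℝ × ℝ => x.1 ^ q) (cyl.restrict {x | 1 ≤ x.1}) := by
    fun_prop
  have m2 := ((S.regU.bc_tangD haM).aemeasurable_cyl hr).restrict (s := {x | 1 ≤ x.1})
  have m1 := ((S.reg₁.bc_tangD haM).aemeasurable_cyl hr).restrict (s := {x | 1 ≤ x.1})
  have e := horizon_estimate ha haM (by linarith) hq rfl (by linarith) S
    (lintegral_ofReal_mul_add_lt_top hw (m2.add m1)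
      (lintegral_ofReal_mul_add_lt_top hw m2 d2 d1) d0) hr₁
  refine lintegral_ofReal_lt_top_of_le zero_le_one ?_ e
  filter_upwards [ae_restrict_mem (measurableSet_ge 2)] with x hx
  have h1 : 0 ≤ x.1 ^ q := Real.rpow_nonneg (zero_le_two.trans hx) q
  rw [one_mul]
  refine mul_le_mul_of_nonneg_left ?_ h1
  have t2 := tangD_nonneg (pR a M (pR a M P)) x.1 r₁ x.2.1 x.2.2
  have t1 : ‖pR a M P x.1 r₁ x.2.1 x.2.2‖ ^ 2 ≤ tangD (pR a M P) x.1 r₁ x.2.1 x.2.2 := by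
    unfold tangD tangSq
    nlinarith [sq_nonneg ‖pTheta (pR a M P) x.1 r₁ x.2.1 x.2.2‖,
      sq_nonneg ‖covD (pR a M P) x.1 r₁ x.2.1 x.2.2‖, sq_nonneg ‖pV (pR a M P) x.1 r₁ x.2.1 x.2.2‖]
  nlinarith [sq_nonneg ‖pR a M (pR a M (pR a M P)) x.1 r₁ x.2.1 x.2.2‖]

theorem RegularPair.left_decay {q r₁ : ℝ} {f : ℝ → ℝ → ℝ → ℝ → ℂ} (ha : 0 < |a|) (haM : |a| < M)
    (h : RegularPair a M c b P U) (hq : 0 ≤ q) (hf : EqT (Ioc (rm a M) (rp a M)) f U)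
    (hd : DecayLeft a M q f) (hr₁ : r₁ ∈ Ioo ((M + rp a M) / 2) (rp a M)) :
    ∫⁻ x in {x : ℝ × ℝ × ℝ | 2 ≤ x.1}, ENNReal.ofReal (x.1 ^ q *
      (‖pR a M U x.1 r₁ x.2.1 x.2.2‖ ^ 2 + tangD U x.1 r₁ x.2.1 x.2.2)) ∂cyl < ⊤ := by
  obtain ⟨B₀, br, bv, b₀, F, S⟩ := h.exists_teukSys_left ha haM
  have hlt := rm_lt_rp haM
  have hs := rp_add_rm (a := a) (M := M)
  have d0 := ((hd 0 0 0 (by norm_num)).1).tangD_lt_top haM hf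
  have e := horizon_estimate ha haM (by linarith) hq (neg_sq a) (by linarith) S
    (by simpa only [tangD_zero, add_zero] using d0) hr₁
  simpa only [tangD_zero, add_zero] using e

end Horizons


/-! ## Reflection and rotation of the cylinder -/

/-- Any two intervals of length T are fundamental domains for the translations by T. -/
theorem setLIntegral_Ioo_shift {f : ℝ → ENNReal} {T : ℝ} (hT : 0 < T) (hf : Function.Periodic f T)
    (β : ℝ) : ∫⁻ x in Ioo 0 T, f (x - β) = ∫⁻ x in Ioo 0 T, f x := by
  have h1 : ∫⁻ x in Ioc (-β) (-β + T), f x = ∫⁻ x in Ioc 0 (0 + T), f x := by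
    refine (isAddFundamentalDomain_Ioc hT (-β)).setLIntegral_eq (isAddFundamentalDomain_Ioc hT 0) f ?_
    rintro ⟨g, hg⟩ x
    obtain ⟨n, rfl⟩ := AddSubgroup.mem_zmultiples_iff.1 hg
    have := hf.zsmul n x
    rw [add_comm] at this
    exact this
  have h2 := (measurePreserving_sub_right volume β).setLIntegral_comp_preimage_emb
    (MeasurableEquiv.subRight β).measurableEmbedding f (Ioc (-β) (-β + T))
  have h3 : (fun x => x - β) ⁻¹' Ioc (-β) (-β + T) = Ioc 0 T := by
    ext x
    simp only [mem_preimage, mem_Ioc]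
    constructor <;> rintro ⟨h, h'⟩ <;> constructor <;> linarith
  rw [h3, h1, zero_add] at h2
  rw [setLIntegral_congr Ioo_ae_eq_Ioc, setLIntegral_congr Ioo_ae_eq_Ioc]
  exact h2

theorem lintegral_flat {F : ℝ × ℝ × ℝ → ENNReal} (hF : Measurable F) :
    ∫⁻ x, F x ∂flat
      = ∫⁻ v, ∫⁻ θ in Ioo 0 Real.pi, ∫⁻ φ in Ioo 0 (2 * Real.pi), F (v, θ, φ) := by
  rw [flat_eq, lintegral_prod _ hF.aemeasurable]
  refine lintegral_congr fun v => ?_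
  exact lintegral_prod (fun y => F (v, y)) (hF.comp measurable_prodMk_left).aemeasurable

/-- On a slice of constant r the two coordinate systems differ by a reflection in v and a rotation
in φ, and these preserve the measure. -/
theorem lintegral_cyl_reflect {F : ℝ × ℝ × ℝ → ENNReal} (hF : Measurable F)
    (per : ∀ v θ φ, F (v, θ, φ + 2 * Real.pi) = F (v, θ, φ)) (s β : ℝ) :
    ∫⁻ x, F (s - x.1, x.2.1, x.2.2 - β) ∂cyl = ∫⁻ x, F x ∂cyl := by
  have hF' : Measurable fun x : ℝ × ℝ × ℝ => F (s - x.1, x.2.1, x.2.2 - β) :=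
    hF.comp (by fun_prop)
  rw [lintegral_cyl hF'.aemeasurable, lintegral_cyl hF.aemeasurable,
    lintegral_flat (F := fun x => ENNReal.ofReal (Real.sin x.2.1) *
      F (s - x.1, x.2.1, x.2.2 - β)) (measurable_sinDensity.mul hF'),
    lintegral_flat (F := fun x => ENNReal.ofReal (Real.sin x.2.1) * F x)
      (measurable_sinDensity.mul hF)]
  have h := lintegral_sub_left_eq_self (μ := (volume : Measure ℝ)) (fun v =>
    ∫⁻ θ in Ioo 0 Real.pi, ∫⁻ φ in Ioo 0 (2 * Real.pi),
      ENNReal.ofReal (Real.sin θ) * F (v, θ, φ)) s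
  rw [← h]
  refine lintegral_congr fun v => lintegral_congr fun θ => ?_
  exact setLIntegral_Ioo_shift (f := fun φ => ENNReal.ofReal (Real.sin θ) * F (s - v, θ, φ))
    Real.two_pi_pos (fun φ => by beta_reduce; rw [per]) β

theorem sphMeasure_univ_lt_top : sphMeasure univ < ⊤ := by
  rw [sphMeasure, withDensity_apply _ MeasurableSet.univ, Measure.restrict_univ]
  refine lt_of_le_of_lt (lintegral_mono (g := fun _ => 1) fun x =>
    ENNReal.ofReal_le_one.2 (Real.sin_le_one _)) ?_
  rw [lintegral_const, one_mul, Measure.restrict_apply_univ]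
  exact (((Metric.isBounded_Ioo 0 Real.pi)).prod (Metric.isBounded_Ioo 0 (2 * Real.pi))).measure_lt_top

theorem cyl_slab_lt_top (L : ℝ) : cyl {x | x.1 ∈ Icc (-L) L} < ⊤ := by
  have : {x : ℝ × ℝ × ℝ | x.1 ∈ Icc (-L) L} = Icc (-L) L ×ˢ univ := by ext; simp
  rw [this, cyl]
  refine (Measure.prod_prod_le _ _).trans_lt (ENNReal.mul_lt_top ?_ sphMeasure_univ_lt_top)
  simp

/-! ## The transfer to the coordinates `(v₊, r, θ, φ₊)` -/

/-- The nondegenerate energy density. -/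
noncomputable def fullD (a M : ℝ) (f : ℝ → ℝ → ℝ → ℝ → ℂ) (v r θ φ : ℝ) : ℝ :=
  ‖pR a M f v r θ φ‖ ^ 2 + tangD f v r θ φ

section Transfer

variable {a M c b : ℝ} {P U f : ℝ → ℝ → ℝ → ℝ → ℂ}

theorem fullD_nonneg (f : ℝ → ℝ → ℝ → ℝ → ℂ) (v r θ φ : ℝ) : 0 ≤ fullD a M f v r θ φ :=
  add_nonneg (sq_nonneg _) (tangD_nonneg _ _ _ _ _)

theorem SpinReg.bc_fullD (haM : |a| < M) (hf : SpinReg a M f) : BC a M (fullD a M f) :=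
  (hf.pR haM).sm.bc.norm_sq.add (hf.bc_tangD haM)

theorem SpinReg.fullD_periodic (haM : |a| < M) (hf : SpinReg a M f) (v r θ φ : ℝ) :
    fullD a M f v r θ (φ + 2 * Real.pi) = fullD a M f v r θ φ := by
  have e : Kerr.pTheta f v r θ (φ + 2 * Real.pi) = Kerr.pTheta f v r θ φ := by
    unfold Kerr.pTheta
    simp only [hf.per]
  unfold fullD tangD tangSq covD covPhi
  rw [(hf.pR haM).per, (hf.pV haM).per, (hf.pPhi haM).per, hf.per, e]

theorem tangD_mul_pull (D : ℂ) (v r θ φ : ℝ) :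
    tangD (fun v r θ φ => D * pull a M c b U v r θ φ) v r θ φ
      = ‖D‖ ^ 2 * tangD U (2 * rStar a M c r - v) r θ (φ - 2 * rBar a M b r) := by
  have e1 : pV (fun v r θ φ => D * pull a M c b U v r θ φ) v r θ φ
      = D * -pV U (2 * rStar a M c r - v) r θ (φ - 2 * rBar a M b r) := by
    unfold pV
    rw [deriv_const_mul_field]
    congr 1
    exact deriv_comp_const_sub (f := fun x => U x r θ (φ - 2 * rBar a M b r)) _ _
  have e2 : pPhi (fun v r θ φ => D * pull a M c b U v r θ φ) v r θ φ
      = D * pPhi U (2 * rStar a M c r - v) r θ (φ - 2 * rBar a M b r) := by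
    unfold pPhi
    rw [deriv_const_mul_field]
    congr 1
    exact deriv_comp_sub_const (f := fun x => U (2 * rStar a M c r - v) r θ x) _ _
  have e3 : pTheta (fun v r θ φ => D * pull a M c b U v r θ φ) v r θ φ
      = D * pTheta U (2 * rStar a M c r - v) r θ (φ - 2 * rBar a M b r) := by
    unfold pTheta
    rw [deriv_const_mul_field]
    rfl
  have e4 : covD (fun v r θ φ => D * pull a M c b U v r θ φ) v r θ φ
      = D * covD U (2 * rStar a M c r - v) r θ (φ - 2 * rBar a M b r) := by
    unfold covD covPhi
    rw [e2]
    unfold pull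
    ring
  unfold tangD tangSq
  rw [e1, e3, e4]
  unfold pull
  simp only [norm_mul, norm_neg]
  ring

theorem norm_sq_four_le (p q s t : ℂ) :
    ‖p + q - s + t‖ ^ 2 ≤ 4 * (‖p‖ ^ 2 + ‖q‖ ^ 2 + ‖s‖ ^ 2 + ‖t‖ ^ 2) := by
  have h1 := norm_sq_add_le (p + q) (-s + t)
  have h2 := norm_sq_add_le p q
  have h3 := norm_sq_add_le (-s) t
  rw [norm_neg] at h3
  rw [show p + q - s + t = p + q + (-s + t) by ring]
  linarith

/-- At a fixed r inside (r₋, r₊) the coefficients of `pullR` are finite, so the change of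
coordinates costs only a constant. -/
theorem RegularPair.exists_fullD_le (ha : 0 < |a|) (haM : |a| < M) (h : RegularPair a M c b P U)
    {r : ℝ} (hr : r ∈ Ioo (rm a M) (rp a M)) :
    ∃ C, 0 ≤ C ∧ ∀ v θ φ, θ ∈ Ioo 0 Real.pi → fullD a M P v r θ φ
      ≤ C * fullD a M U (2 * rStar a M c r - v) r θ (φ - 2 * rBar a M b r) := by
  obtain ⟨A, hA⟩ : ∃ X, X = (Delta a M r : ℂ) ^ 2 := ⟨_, rfl⟩
  obtain ⟨B, hB⟩ : ∃ X, X = 2 * ((r : ℂ) ^ 2 + (a : ℂ) ^ 2) * (Delta a M r : ℂ) := ⟨_, rfl⟩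
  obtain ⟨C, hC⟩ : ∃ X, X = 2 * (a : ℂ) * (Delta a M r : ℂ) := ⟨_, rfl⟩
  obtain ⟨D, hD⟩ : ∃ X, X = 4 * (Delta a M r : ℂ) * ((r : ℂ) - M) := ⟨_, rfl⟩
  refine ⟨4 * (‖A‖ ^ 2 + ‖B‖ ^ 2 + 8 * ‖C‖ ^ 2 + ‖D‖ ^ 2) + ‖A‖ ^ 2, by positivity,
    fun v θ φ hθ => ?_⟩
  have er : pR a M P v r θ φ = pullR a M c b U v r θ φ :=
    (h.rel.pR_Ioo v r θ φ hr hθ).trans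
      ((h.regU.sm.hasDerivAt_Delta_sq_pull (c := c) (b := b) ha haM hr).hasDerivWithinAt.derivWithin
        (uniqueDiffOn_Ioc _ _ r (Ioo_subset_Ioc_self hr)))
  have et : tangD P v r θ φ
      = ‖A‖ ^ 2 * tangD U (2 * rStar a M c r - v) r θ (φ - 2 * rBar a M b r) := by
    rw [h.rel.tangD hr hθ, hA, ← tangD_mul_pull]
    rfl
  unfold fullD
  rw [er, et]
  unfold pullR pull
  rw [← hA, ← hB, ← hC, ← hD]
  generalize 2 * rStar a M c r - v = w
  generalize φ - 2 * rBar a M b r = η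
  have h4 := norm_sq_four_le (A * pR a M U w r θ η) (B * pV U w r θ η) (C * pPhi U w r θ η)
    (D * U w r θ η)
  have hz := norm_pPhi_sq_le U (v := w) (r := r) (φ := η) hθ
  have hy : ‖pV U w r θ η‖ ^ 2 ≤ tangD U w r θ η := by
    unfold tangD tangSq
    nlinarith [sq_nonneg ‖pTheta U w r θ η‖, sq_nonneg ‖covD U w r θ η‖, sq_nonneg ‖U w r θ η‖]
  have hu : ‖U w r θ η‖ ^ 2 ≤ tangD U w r θ η := by
    unfold tangD tangSq
    nlinarith [sq_nonneg ‖pTheta U w r θ η‖, sq_nonneg ‖covD U w r θ η‖, sq_nonneg ‖pV U w r θ η‖]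
  have ht := tangD_nonneg U w r θ η
  simp only [norm_mul, mul_pow] at h4
  have k1 := mul_le_mul_of_nonneg_left hy (sq_nonneg ‖B‖)
  have k2 := mul_le_mul_of_nonneg_left hz (sq_nonneg ‖C‖)
  have k3 := mul_le_mul_of_nonneg_left hu (sq_nonneg ‖D‖)
  have k4 : 0 ≤ (4 * (‖B‖ ^ 2 + 8 * ‖C‖ ^ 2 + ‖D‖ ^ 2) + ‖A‖ ^ 2) * ‖pR a M U w r θ η‖ ^ 2 := by
    positivity
  have k5 := mul_nonneg (sq_nonneg ‖A‖) ht
  linarith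

/-- Continuity holds only for 0 < θ < π. The indicator turns the integrand into a Borel function
everywhere, as the reflection lemma requires. -/
theorem SpinReg.measurable_weighted (haM : |a| < M) (hf : SpinReg a M f) {r : ℝ}
    (hr : r ∈ Ioc (rm a M) (rp a M)) (q : ℝ) :
    Measurable (indicator {x : ℝ × ℝ × ℝ | 2 ≤ x.1 ∧ x.2.1 ∈ Ioo 0 Real.pi}
      fun x => ENNReal.ofReal (x.1 ^ q * fullD a M f x.1 r x.2.1 x.2.2)) := by
  classical
  have hs : MeasurableSet {x : ℝ × ℝ × ℝ | x.2.1 ∈ Ioo 0 Real.pi} :=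
    measurableSet_Ioo.preimage (by fun_prop)
  have h1 : ContinuousOn (fun x : ℝ × ℝ × ℝ => fullD a M f x.1 r x.2.1 x.2.2)
      {x : ℝ × ℝ × ℝ | x.2.1 ∈ Ioo 0 Real.pi} :=
    (hf.bc_fullD haM).cont.comp (f := fun x : ℝ × ℝ × ℝ => (x.1, r, x.2.1, x.2.2)) (by fun_prop)
      fun ⟨v, θ, φ⟩ h => mem_regn.2 ⟨hr, h⟩
  have h2 := h1.measurable_piecewise (g := 0) continuousOn_const hs
  rw [piecewise_eq_indicator] at h2
  have h3 := ((by fun_prop : Measurable fun x : ℝ × ℝ × ℝ => x.1 ^ q).mul h2).ennreal_ofReal.indicator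
    ((measurableSet_ge 2).inter hs)
  convert h3 using 1
  funext x
  by_cases hx : x ∈ {x : ℝ × ℝ × ℝ | 2 ≤ x.1 ∧ x.2.1 ∈ Ioo 0 Real.pi}
  · rw [indicator_of_mem hx]
    erw [indicator_of_mem hx]
    simp only [Pi.mul_apply]
    rw [indicator_of_mem (show x ∈ {x : ℝ × ℝ × ℝ | x.2.1 ∈ Ioo 0 Real.pi} from hx.2)]
  · rw [indicator_of_notMem hx]
    erw [indicator_of_notMem hx]

theorem RegularPair.left_transfer {q r : ℝ} (ha : 0 < |a|) (haM : |a| < M)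
    (h : RegularPair a M c b P U) (hq : 0 ≤ q) (hr : r ∈ Ioo (rm a M) (rp a M))
    (hU : ∫⁻ x in {x : ℝ × ℝ × ℝ | 2 ≤ x.1}, ENNReal.ofReal (x.1 ^ q *
      fullD a M U x.1 r x.2.1 x.2.2) ∂cyl < ⊤) :
    ∃ L : ℝ, 2 ≤ L ∧ ∫⁻ x in {x : ℝ × ℝ × ℝ | x.1 ≤ -L}, ENNReal.ofReal (|x.1| ^ q *
      fullD a M P x.1 r x.2.1 x.2.2) ∂cyl < ⊤ := by
  obtain ⟨C, hC, hle⟩ := h.exists_fullD_le ha haM hr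
  have hm := h.regU.measurable_weighted haM (Ioo_subset_Ioc_self hr) q
  set F := indicator {x : ℝ × ℝ × ℝ | 2 ≤ x.1 ∧ x.2.1 ∈ Ioo 0 Real.pi}
      fun x => ENNReal.ofReal (x.1 ^ q * fullD a M U x.1 r x.2.1 x.2.2) with hF
  have hper : ∀ v θ φ, F (v, θ, φ + 2 * Real.pi) = F (v, θ, φ) := by
    intro v θ φ
    simp only [hF, indicator, mem_ofPred_eq, h.regU.fullD_periodic haM]
  have href := lintegral_cyl_reflect hm hper (2 * rStar a M c r) (2 * rBar a M b r)
  have hfin : ∫⁻ x, F x ∂cyl < ⊤ := by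
    refine lt_of_le_of_lt ?_ hU
    rw [← lintegral_indicator (measurableSet_ge 2)]
    refine lintegral_mono fun x => ?_
    exact indicator_le_indicator_of_subset (fun x hx => hx.1) (fun _ => zero_le) x
  rw [← href] at hfin
  set σ := rStar a M c r
  -- For v ≤ -(4 |σ| + 2) the reflected variable 2 σ - v is at least 2, and |v| ≤ 2 (2 σ - v), so
  -- the weights are comparable.
  refine ⟨4 * |σ| + 2, by linarith [abs_nonneg σ], ?_⟩
  have hsm : MeasurableSet {x : ℝ × ℝ × ℝ | x.1 ≤ -(4 * |σ| + 2)} :=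
    measurableSet_le measurable_fst measurable_const
  refine lt_of_le_of_lt ?_ (ENNReal.mul_lt_top (a := ENNReal.ofReal (2 ^ q * C))
    ENNReal.ofReal_lt_top hfin)
  rw [← lintegral_const_mul' _ _ ENNReal.ofReal_ne_top]
  refine (lintegral_mono_ae ?_).trans (setLIntegral_le_lintegral _ _)
  filter_upwards [ae_restrict_mem hsm, ae_restrict_of_ae ae_cyl] with x hx hθ
  have h0 := abs_nonneg σ
  have h1 := neg_abs_le σ
  have h2 := le_abs_self σ
  have hx' : x.1 ≤ -(4 * |σ| + 2) := hx
  have hw : 2 ≤ 2 * σ - x.1 := by linarith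
  have hmem : (2 * σ - x.1, x.2.1, x.2.2 - 2 * rBar a M b r)
    ∈ {x : ℝ × ℝ × ℝ | 2 ≤ x.1 ∧ x.2.1 ∈ Ioo 0 Real.pi} := ⟨hw, hθ.1⟩
  simp only [hF]
  rw [indicator_of_mem hmem, ← ENNReal.ofReal_mul (by positivity)]
  refine ENNReal.ofReal_le_ofReal ?_
  have hv : |x.1| ≤ 2 * (2 * σ - x.1) := by
    rw [abs_of_neg (by linarith)]
    linarith
  have hv' : |x.1| ^ q ≤ 2 ^ q * (2 * σ - x.1) ^ q := by
    rw [← Real.mul_rpow (by norm_num) (by linarith)]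
    exact Real.rpow_le_rpow (abs_nonneg _) hv hq
  have := mul_le_mul hv' (hle x.1 x.2.1 x.2.2 hθ.1) (fullD_nonneg _ _ _ _ _)
    (mul_nonneg (by positivity) (Real.rpow_nonneg (by linarith) q))
  calc _ ≤ _ := this
    _ = _ := by ring

theorem BC.slab_lt_top {g : ℝ → ℝ → ℝ → ℝ → ℝ} {w : ℝ → ℝ} (hg : BC a M g) (hw : Continuous w)
    {r : ℝ} (hr : r ∈ Ioc (rm a M) (rp a M)) (L : ℝ) :
    ∫⁻ x in {x : ℝ × ℝ × ℝ | x.1 ∈ Icc (-L) L}, ENNReal.ofReal (w x.1 *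
      g x.1 r x.2.1 x.2.2) ∂cyl < ⊤ := by
  obtain ⟨C, hC, hb⟩ := hg.bdd L r hr.1
  obtain ⟨D, hD⟩ := (isCompact_Icc (a := -L) (b := L)).exists_bound_of_continuousOn hw.continuousOn
  have hs : MeasurableSet {x : ℝ × ℝ × ℝ | x.1 ∈ Icc (-L) L} := measurableSet_Icc.preimage (by fun_prop)
  refine lt_of_le_of_lt (lintegral_mono_ae (g := fun _ => ENNReal.ofReal (|D| * C)) ?_) ?_
  · filter_upwards [ae_restrict_mem hs, ae_restrict_of_ae ae_cyl] with x hx hθ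
    refine ENNReal.ofReal_le_ofReal ((le_abs_self _).trans ?_)
    rw [abs_mul]
    exact mul_le_mul ((hD x.1 hx).trans (le_abs_self D))
      (hb _ _ _ _ (abs_le.2 hx) ⟨le_rfl, hr.2⟩ hθ.1 (Ioo_subset_Icc_self hθ.2)) (abs_nonneg _)
      (abs_nonneg _)
  · rw [lintegral_const, Measure.restrict_apply_univ]
    exact ENNReal.mul_lt_top ENNReal.ofReal_lt_top (cyl_slab_lt_top L)

/-- The line is covered by v ≥ 2 (right data), v ≤ -L (left data) and a compact interval on which
the field is bounded. -/
theorem RegularPair.weighted_slice_lt_top {qr ql r : ℝ} {χ : ℝ → ℝ} {f fh : ℝ → ℝ → ℝ → ℝ → ℂ}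
    (ha : 0 < |a|) (haM : |a| < M) (h : RegularPair a M c b P U) (hqr : 0 ≤ qr) (hql : 0 ≤ ql)
    (hχ : IsWeight qr ql χ) (hf : EqT (Ioc (rm a M) (rp a M)) f P) (hd : DecayRight a M qr f)
    (hfh : EqT (Ioc (rm a M) (rp a M)) fh U) (hdh : DecayLeft a M ql fh)
    (hr : r ∈ Ioo ((M + rp a M) / 2) (rp a M)) :
    ∫⁻ x, ENNReal.ofReal (χ x.1 * fullD a M P x.1 r x.2.1 x.2.2) ∂cyl < ⊤ := by
  have hlt := rm_lt_rp haM
  have hs := rp_add_rm (a := a) (M := M)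
  have hr' : r ∈ Ioo (rm a M) (rp a M) := ⟨by linarith [hr.1], hr.2⟩
  have hR := h.right_decay ha haM hqr hf hd hr
  obtain ⟨L, hL, hLe⟩ := h.left_transfer ha haM hql hr' (h.left_decay ha haM hql hfh hdh hr)
  have hC := (h.regP.bc_fullD haM).slab_lt_top hχ.smooth.continuous (Ioo_subset_Ioc_self hr') L
  have hsL : MeasurableSet {x : ℝ × ℝ × ℝ | x.1 ≤ -L} :=
    measurableSet_le measurable_fst measurable_const
  have hcov : (univ : Set (ℝ × ℝ × ℝ)) ⊆
      {x | 2 ≤ x.1} ∪ {x | x.1 ≤ -L} ∪ {x | x.1 ∈ Icc (-L) L} := by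
    intro x _
    by_cases h1 : x.1 ≤ -L
    · exact Or.inl (Or.inr h1)
    by_cases h2 : 2 ≤ x.1
    · exact Or.inl (Or.inl h2)
    · exact Or.inr ⟨(not_le.1 h1).le, by linarith [not_le.1 h2]⟩
  rw [← setLIntegral_univ]
  refine (lintegral_mono_set hcov).trans_lt ((lintegral_union_le _ _ _).trans_lt
    (ENNReal.add_lt_top.2 ⟨(lintegral_union_le _ _ _).trans_lt (ENNReal.add_lt_top.2 ⟨?_, ?_⟩), hC⟩))
  · refine lintegral_ofReal_lt_top_of_le zero_le_one ?_ hR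
    filter_upwards [ae_restrict_mem (measurableSet_ge 2)] with x hx
    rw [hχ.right x.1 (one_le_two.trans hx), one_mul]
    rfl
  · refine lintegral_ofReal_lt_top_of_le zero_le_one ?_ hLe
    filter_upwards [ae_restrict_mem hsL] with x hx
    have hx' : x.1 ≤ -L := hx
    rw [hχ.left x.1 (by linarith), one_mul]

end Transfer


/-! ## The bounds up to the Cauchy horizon -/

/-- The weighted energy bounds up to `r = r₋`. -/
structure InteriorBound (a M : ℝ) (χ : ℝ → ℝ) (P : ℝ → ℝ → ℝ → ℝ → ℂ) (ρ C : ℝ) : Prop where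
  mem : ρ ∈ Ioo (rm a M) (rp a M)
  slices : ∀ r ∈ Ioo (rm a M) ρ, ∫⁻ x, ENNReal.ofReal (χ x.1 *
    (-Delta a M r * ‖pR a M P x.1 r x.2.1 x.2.2‖ ^ 2 + tangD P x.1 r x.2.1 x.2.2)) ∂cyl
      ≤ ENNReal.ofReal C
  bulk : ∫⁻ r in Ioc (rm a M) ρ, ∫⁻ x, ENNReal.ofReal (χ x.1 *
    ‖pR a M P x.1 r x.2.1 x.2.2‖ ^ 2) ∂cyl ≤ ENNReal.ofReal C

section Bounds

variable {a M c b : ℝ} {P U f : ℝ → ℝ → ℝ → ℝ → ℂ} {χ : ℝ → ℝ}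

/-- The interior estimate stops short of r₋; exhausting the interval from inside extends the bulk
bound to it. -/
theorem setLIntegral_Ioc_le_of_forall {g : ℝ → ENNReal} {s t : ℝ} {K : ENNReal} (hst : s < t)
    (h : ∀ r ∈ Ioo s t, ∫⁻ x in Ioc r t, g x ≤ K) : ∫⁻ x in Ioc s t, g x ≤ K := by
  have hd : 0 < t - s := sub_pos.2 hst
  set u : ℕ → ℝ := fun n => s + (t - s) / (n + 2) with hu
  have hanti : Antitone u := by
    intro m n hmn
    have : (m : ℝ) ≤ n := Nat.cast_le.2 hmn
    have : (t - s) / ((n : ℝ) + 2) ≤ (t - s) / ((m : ℝ) + 2) := by gcongr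
    simp only [hu]
    linarith
  have hmem : ∀ n, u n ∈ Ioo s t := by
    intro n
    have hn : (0 : ℝ) ≤ n := Nat.cast_nonneg n
    refine ⟨by simp only [hu]; linarith [div_pos hd (by linarith : (0 : ℝ) < n + 2)], ?_⟩
    have : (t - s) / ((n : ℝ) + 2) < t - s := div_lt_self hd (by linarith)
    simp only [hu]
    linarith
  have hU : Ioc s t = ⋃ n, Ioc (u n) t := by
    ext x
    simp only [mem_Ioc, mem_iUnion]
    constructor
    · rintro ⟨h1, h2⟩
      obtain ⟨n, hn⟩ := exists_nat_gt ((t - s) / (x - s))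
      refine ⟨n, ?_, h2⟩
      have hx : 0 < x - s := sub_pos.2 h1
      rw [div_lt_iff₀ hx] at hn
      have : (t - s) / ((n : ℝ) + 2) < x - s := by
        rw [div_lt_iff₀ (by positivity)]
        linarith
      simp only [hu]
      linarith
    · rintro ⟨n, h1, h2⟩
      exact ⟨(hmem n).1.trans h1, h2⟩
  rw [hU, setLIntegral_iUnion_of_directed]
  · exact iSup_le fun n => h _ (hmem n)
  · exact (fun i j => ⟨max i j, Ioc_subset_Ioc_left (hanti (le_max_left i j)),
      Ioc_subset_Ioc_left (hanti (le_max_right i j))⟩)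

theorem RegularPair.exists_interiorBound {qr ql : ℝ} {fh : ℝ → ℝ → ℝ → ℝ → ℂ}
    (ha : 0 < |a|) (haM : |a| < M) (h : RegularPair a M c b P U) (hqr : 0 ≤ qr) (hql : 0 ≤ ql)
    (hχ : IsWeight qr ql χ) (hf : EqT (Ioc (rm a M) (rp a M)) f P) (hd : DecayRight a M qr f)
    (hfh : EqT (Ioc (rm a M) (rp a M)) fh U) (hdh : DecayLeft a M ql fh) :
    ∃ ρ C, 0 < C ∧ InteriorBound a M χ P ρ C := by
  have hlt := rm_lt_rp haM
  have hs := rp_add_rm (a := a) (M := M)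
  -- The midpoint of ((M + r₊)/2, r₊), the range in which both horizon estimates apply. It is the
  -- starting slice for the interior.
  obtain ⟨ρ, hρ⟩ : ∃ X, X = (M + 3 * rp a M) / 4 := ⟨_, rfl⟩
  have hρ' : ρ ∈ Ioo ((M + rp a M) / 2) (rp a M) := ⟨by linarith, by linarith⟩
  have hρm : rm a M < ρ := by linarith
  have hfin := h.weighted_slice_lt_top ha haM hqr hql hχ hf hd hfh hdh hρ'
  obtain ⟨B₀, br, bv, b₀, F, S⟩ := h.exists_teukSys_interior ha haM hρ'.2
  have hK : 0 ≤ 8 / (rp a M - ρ) := div_nonneg (by norm_num) (by linarith [hρ'.2])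
  have hdT : ∀ v r θ φ, dTot a M P (fun _ _ _ _ => 0) (fun _ _ _ _ => 0) v r θ φ
      = -Delta a M r * ‖pR a M P v r θ φ‖ ^ 2 + tangD P v r θ φ := by
    intro v r θ φ
    unfold dTot
    rw [tangD_zero, add_zero, add_zero]
  have hdata : ∫⁻ x, ENNReal.ofReal (χ x.1 * dTot a M P (fun _ _ _ _ => 0) (fun _ _ _ _ => 0)
      x.1 ρ x.2.1 x.2.2) ∂cyl < ⊤ := by
    refine lintegral_ofReal_lt_top_of_le (C := |Delta a M ρ| + 1) (by positivity)
      (Eventually.of_forall fun x => ?_) hfin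
    rw [hdT]
    have h1 := tangD_nonneg P x.1 ρ x.2.1 x.2.2
    have h2 := neg_le_abs (Delta a M ρ)
    have h3 : 0 ≤ |Delta a M ρ| * tangD P x.1 ρ x.2.1 x.2.2 := by positivity
    have h4 := mul_le_mul_of_nonneg_right h2 (sq_nonneg ‖pR a M P x.1 ρ x.2.1 x.2.2‖)
    rw [mul_left_comm]
    refine mul_le_mul_of_nonneg_left ?_ (hχ.pos x.1).le
    unfold fullD
    nlinarith [sq_nonneg ‖pR a M P x.1 ρ x.2.1 x.2.2‖]
  obtain ⟨C, hC, hest⟩ := interior_estimate ha haM (by linarith) hK hqr hql hχ rfl hρ'.2 hρm S hdata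
  simp only [hdT] at hest
  exact ⟨ρ, C, hC, ⟨hρm, hρ'.2⟩, fun r hr => (hest r hr).1,
    setLIntegral_Ioc_le_of_forall hρm fun r hr => (hest r hr).2⟩

/-- The nondegenerate |∂_r ψ|² is taken from the bulk bound. The tangential part comes from the
uniform bounds on slices, integrated over an interval of finite length. -/
theorem InteriorBound.energy_estimate {ρ C : ℝ} (haM : |a| < M) (hP : SpinReg a M P)
    (hχ : ∀ v, 0 < χ v) (hχc : Continuous χ) (hC : 0 < C) (h : InteriorBound a M χ P ρ C)
    (hf : EqT (Ioc (rm a M) (rp a M)) f P) {r₁ : ℝ} (hr₁ : r₁ ∈ Ioo (rm a M) (rp a M)) :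
    ∃ re ∈ Ioo (rm a M) r₁, ∃ C : ℝ, 0 < C ∧
      (∫⁻ r in Ioc (rm a M) re, ∫⁻ x,
          ENNReal.ofReal (χ x.1 * energyDensity a M 1 f x.1 r x.2.1 x.2.2) ∂cyl
        ≤ ENNReal.ofReal C) ∧
      ∀ r ∈ Ioc (rm a M) re,
        ∫⁻ x, ENNReal.ofReal (χ x.1 *
            energyDensity a M |Delta a M r| f x.1 r x.2.1 x.2.2) ∂cyl
          ≤ ENNReal.ofReal C := by
  have hlt := rm_lt_rp haM
  obtain ⟨re, hre⟩ : ∃ re, rm a M < re ∧ re < min r₁ ρ := exists_between (lt_min hr₁.1 h.mem.1)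
  have hre1 := hre.2.trans_le (min_le_left _ _)
  have hre2 := hre.2.trans_le (min_le_right _ _)
  have hmem : ∀ r ∈ Ioc (rm a M) re, r ∈ Ioo (rm a M) ρ := fun r hr => ⟨hr.1, hr.2.trans_lt hre2⟩
  have hmem' : ∀ r ∈ Ioc (rm a M) re, r ∈ Ioo (rm a M) (rp a M) := fun r hr =>
    ⟨hr.1, (hmem r hr).2.trans h.mem.2⟩
  have htang : ∀ r ∈ Ioc (rm a M) re, ∫⁻ x, ENNReal.ofReal (χ x.1 *
      (-Delta a M r * ‖pR a M P x.1 r x.2.1 x.2.2‖ ^ 2 + tangD P x.1 r x.2.1 x.2.2)) ∂cyl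
      ≤ ENNReal.ofReal C := fun r hr => h.slices r (hmem r hr)
  have hden : ∀ w, ∀ r ∈ Ioc (rm a M) re, ∀ᵐ x ∂cyl, energyDensity a M w f x.1 r x.2.1 x.2.2
      ≤ w * ‖pR a M P x.1 r x.2.1 x.2.2‖ ^ 2 + 5 * tangD P x.1 r x.2.1 x.2.2 := by
    intro w r hr
    have hrc := Ioo_subset_Ioc_self (hmem' r hr)
    filter_upwards [ae_cyl] with x hx
    rw [← hf.pR _ _ _ _ hrc hx.1, ← hf.tangD hrc hx.1]
    exact energyDensity_le f hx.1
  refine ⟨re, ⟨hre.1, hre1⟩, 5 * C + C + 5 * C * (re - rm a M), ?_, ?_, ?_⟩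
  · have := mul_pos hC (sub_pos.2 hre.1)
    linarith
  · have hin : ∀ r ∈ Ioc (rm a M) re, ∫⁻ x,
        ENNReal.ofReal (χ x.1 * energyDensity a M 1 f x.1 r x.2.1 x.2.2) ∂cyl
        ≤ ∫⁻ x, ENNReal.ofReal (χ x.1 * ‖pR a M P x.1 r x.2.1 x.2.2‖ ^ 2) ∂cyl
          + ENNReal.ofReal (5 * C) := by
      intro r hr
      have hrc := Ioo_subset_Ioc_self (hmem' r hr)
      have hm : AEMeasurable (fun x : ℝ × ℝ × ℝ => χ x.1 * ‖pR a M P x.1 r x.2.1 x.2.2‖ ^ 2) cyl :=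
        (hχc.measurable.comp measurable_fst).aemeasurable.mul
          ((hP.pR haM).sm.bc.norm_sq.aemeasurable_cyl hrc)
      have h5 : ∫⁻ x, ENNReal.ofReal (χ x.1 * (5 * tangD P x.1 r x.2.1 x.2.2)) ∂cyl
          ≤ ENNReal.ofReal (5 * C) := by
        rw [ENNReal.ofReal_mul (by norm_num)]
        refine (lintegral_ofReal_le_mul (C := 5) (by norm_num) (Eventually.of_forall fun x => ?_)).trans
          (mul_le_mul_right (htang r hr) _)
        have hD := (Delta_neg haM (hmem' r hr)).le
        have : 0 ≤ -Delta a M r * ‖pR a M P x.1 r x.2.1 x.2.2‖ ^ 2 :=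
          mul_nonneg (by linarith) (sq_nonneg _)
        have := mul_nonneg (hχ x.1).le this
        linarith
      refine le_trans (lintegral_mono_ae ?_)
        ((lintegral_add_left' hm.ennreal_ofReal
          fun x => ENNReal.ofReal (χ x.1 * (5 * tangD P x.1 r x.2.1 x.2.2))).le.trans
            (add_le_add le_rfl h5))
      filter_upwards [hden 1 r hr] with x hx
      refine (ENNReal.ofReal_le_ofReal (mul_le_mul_of_nonneg_left hx (hχ x.1).le)).trans ?_
      rw [one_mul, mul_add]
      exact ENNReal.ofReal_add_le
    refine (setLIntegral_mono' measurableSet_Ioc hin).trans ?_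
    rw [lintegral_add_right _ measurable_const, lintegral_const, Measure.restrict_apply_univ,
      Real.volume_Ioc, ← ENNReal.ofReal_mul (by positivity)]
    refine (add_le_add (lintegral_mono_set (Ioc_subset_Ioc_right hre2.le)) le_rfl).trans ?_
    refine (add_le_add h.bulk le_rfl).trans ?_
    rw [← ENNReal.ofReal_add hC.le (mul_nonneg (by positivity) (sub_pos.2 hre.1).le)]
    exact ENNReal.ofReal_le_ofReal (by linarith)
  · intro r hr
    refine (lintegral_ofReal_le_mul (C := 5) (by norm_num) ?_).trans
      ((mul_le_mul_right (htang r hr) _).trans ?_)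
    · filter_upwards [hden |Delta a M r| r hr] with x hx
      have hD := Delta_neg haM (hmem' r hr)
      rw [abs_of_neg hD] at hx ⊢
      have h1 := mul_le_mul_of_nonneg_left hx (hχ x.1).le
      have h2 := mul_nonneg (hχ x.1).le
        (mul_nonneg (neg_nonneg.2 hD.le) (sq_nonneg ‖pR a M P x.1 r x.2.1 x.2.2‖))
      linarith
    · rw [← ENNReal.ofReal_mul (by norm_num)]
      refine ENNReal.ofReal_le_ofReal ?_
      have := mul_pos hC (sub_pos.2 hre.1)
      linarith

/-! ## The limit at the Cauchy horizon -/

/-- The fundamental theorem of calculus followed by Cauchy–Schwarz in r. -/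
theorem Sm.norm_sub_sq_le (haM : |a| < M) (hP : Sm a M P) {v s t θ φ : ℝ} (hs : rm a M < s)
    (hst : s ≤ t) (ht : t < rp a M) :
    ‖P v t θ φ - P v s θ φ‖ ^ 2 ≤ (t - s) * ∫ r in s..t, ‖Kerr.pR a M P v r θ φ‖ ^ 2 := by
  rcases hst.eq_or_lt with rfl | hlt
  · simp
  have hd : 0 < t - s := sub_pos.2 hlt
  have hIcc : ∀ r ∈ Icc s t, r ∈ Ioo (rm a M) (rp a M) := fun r hr =>
    ⟨hs.trans_le hr.1, hr.2.trans_lt ht⟩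
  have hc : ContinuousOn (fun r => Kerr.pR a M P v r θ φ) (Icc s t) :=
    (hP.pR haM).continuousOn.comp (f := fun r : ℝ => (v, r, θ, φ)) (by fun_prop)
      fun r hr => mem_dom.2 (Ioo_subset_Ioc_self (hIcc r hr))
  have hc1 := hc.norm.intervalIntegrable_of_Icc (μ := volume) hst
  have hc2 : IntervalIntegrable (fun r => ‖Kerr.pR a M P v r θ φ‖ ^ 2) volume s t :=
    (hc.norm.pow 2).intervalIntegrable_of_Icc hst
  have hftc := intervalIntegral.integral_eq_sub_of_hasDerivAt (a := s) (b := t)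
    (f := fun r => P v r θ φ) (f' := fun r => Kerr.pR a M P v r θ φ)
    (fun r hr => hP.hasDerivAt_r (hIcc r (by rwa [uIcc_of_le hst] at hr)))
    (hc.intervalIntegrable_of_Icc hst)
  have hn : ‖P v t θ φ - P v s θ φ‖ ≤ ∫ r in s..t, ‖Kerr.pR a M P v r θ φ‖ := by
    rw [← hftc]
    exact intervalIntegral.norm_integral_le_integral_norm hst
  set I := ∫ r in s..t, ‖Kerr.pR a M P v r θ φ‖ with hI
  set J := ∫ r in s..t, ‖Kerr.pR a M P v r θ φ‖ ^ 2 with hJ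
  -- Cauchy–Schwarz as nonnegativity of the variance: a square minus its tangent line at the mean.
  have hvar : 0 ≤ ∫ r in s..t, (‖Kerr.pR a M P v r θ φ‖ ^ 2
      - (2 * (I / (t - s)) * ‖Kerr.pR a M P v r θ φ‖ - (I / (t - s)) ^ 2)) :=
    intervalIntegral.integral_nonneg hst fun r _ => by
      nlinarith [sq_nonneg (‖Kerr.pR a M P v r θ φ‖ - I / (t - s))]
  rw [intervalIntegral.integral_sub hc2 ((hc1.const_mul _).sub intervalIntegrable_const),
    intervalIntegral.integral_sub (hc1.const_mul _) intervalIntegrable_const,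
    intervalIntegral.integral_const_mul, intervalIntegral.integral_const, ← hI, ← hJ,
    smul_eq_mul] at hvar
  have e : J - (2 * (I / (t - s)) * I - (t - s) * (I / (t - s)) ^ 2) = J - I ^ 2 / (t - s) := by
    field_simp
    ring
  rw [e, sub_nonneg, div_le_iff₀ hd] at hvar
  calc _ ≤ I ^ 2 := by gcongr
    _ ≤ _ := by linarith

instance : IsFiniteMeasure sphMeasure := ⟨sphMeasure_univ_lt_top⟩

instance : SFinite cyl := by
  unfold cyl
  infer_instance

/-- The square of the `L²` norm of `∂_r P` along the ingoing curves. -/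
noncomputable def radialSq (a M ρ : ℝ) (P : ℝ → ℝ → ℝ → ℝ → ℂ) (x : ℝ × ℝ × ℝ) : ENNReal :=
  ∫⁻ r in Ioc (rm a M) ρ, ENNReal.ofReal (‖pR a M P x.1 r x.2.1 x.2.2‖ ^ 2)

theorem Sm.exists_measurable_regn {g : ℝ → ℝ → ℝ → ℝ → ℂ} (hg : Sm a M g) :
    ∃ G : ℝ × ℝ × ℝ × ℝ → ℂ, Measurable G ∧ ∀ v r θ φ, r ∈ Ioc (rm a M) (rp a M) →
      θ ∈ Ioo 0 Real.pi → G (v, r, θ, φ) = g v r θ φ := by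
  classical
  have hs : MeasurableSet (regn a M) := MeasurableSet.univ.prod
    (measurableSet_Ioc.prod (measurableSet_Ioo.prod MeasurableSet.univ))
  refine ⟨_, (hg.bc.cont).measurable_piecewise (g := 0) continuousOn_const hs,
    fun v r θ φ hr hθ => ?_⟩
  rw [piecewise_eq_of_mem _ _ _ (mem_regn.2 ⟨hr, hθ⟩)]
  rfl

/-- Tonelli's theorem applied to the bulk bound. A Borel function agreeing with ∂_r P where it
matters makes the exchange of integrals legitimate. -/
theorem InteriorBound.radialSq_spec {ρ C : ℝ} (haM : |a| < M) (hP : SpinReg a M P)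
    (hχ : ∀ v, 0 < χ v) (hχc : Continuous χ) (h : InteriorBound a M χ P ρ C) :
    AEMeasurable (radialSq a M ρ P) cyl ∧
      ∫⁻ x, ENNReal.ofReal (χ x.1) * radialSq a M ρ P x ∂cyl ≤ ENNReal.ofReal C := by
  obtain ⟨G, hG, hGe⟩ := (hP.pR haM).sm.exists_measurable_regn
  have hH : Measurable fun y : (ℝ × ℝ × ℝ) × ℝ =>
      ENNReal.ofReal (‖G (y.1.1, y.2, y.1.2.1, y.1.2.2)‖ ^ 2) :=
    ((hG.comp (by fun_prop)).norm.pow_const 2).ennreal_ofReal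
  have hmem : ∀ r ∈ Ioc (rm a M) ρ, r ∈ Ioc (rm a M) (rp a M) := fun r hr =>
    ⟨hr.1, hr.2.trans h.mem.2.le⟩
  have heq : ∀ x : ℝ × ℝ × ℝ, x.2.1 ∈ Ioo 0 Real.pi → radialSq a M ρ P x
      = ∫⁻ r in Ioc (rm a M) ρ, ENNReal.ofReal (‖G (x.1, r, x.2.1, x.2.2)‖ ^ 2) := by
    intro x hx
    refine setLIntegral_congr_fun measurableSet_Ioc fun r hr => ?_
    simp only [hGe _ _ _ _ (hmem r hr) hx]
  constructor
  · refine AEMeasurable.congr (Measurable.lintegral_prod_right' (ν := volume.restrict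
      (Ioc (rm a M) ρ)) hH).aemeasurable ?_
    filter_upwards [ae_cyl] with x hx
    exact (heq x hx.1).symm
  · have hH' : Measurable fun y : (ℝ × ℝ × ℝ) × ℝ =>
      ENNReal.ofReal (χ y.1.1) * ENNReal.ofReal (‖G (y.1.1, y.2, y.1.2.1, y.1.2.2)‖ ^ 2) :=
      ((hχc.measurable.comp (by fun_prop)).ennreal_ofReal).mul hH
    calc ∫⁻ x, ENNReal.ofReal (χ x.1) * radialSq a M ρ P x ∂cyl
        = ∫⁻ x, (∫⁻ r in Ioc (rm a M) ρ, ENNReal.ofReal (χ x.1) *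
            ENNReal.ofReal (‖G (x.1, r, x.2.1, x.2.2)‖ ^ 2)) ∂cyl := by
          refine lintegral_congr_ae ?_
          filter_upwards [ae_cyl] with x hx
          rw [heq x hx.1, lintegral_const_mul' _ _ ENNReal.ofReal_ne_top]
      _ = ∫⁻ r in Ioc (rm a M) ρ, ∫⁻ x, ENNReal.ofReal (χ x.1) *
            ENNReal.ofReal (‖G (x.1, r, x.2.1, x.2.2)‖ ^ 2) ∂cyl :=
          lintegral_lintegral_swap hH'.aemeasurable
      _ = ∫⁻ r in Ioc (rm a M) ρ, ∫⁻ x, ENNReal.ofReal (χ x.1 *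
            ‖pR a M P x.1 r x.2.1 x.2.2‖ ^ 2) ∂cyl := by
          refine setLIntegral_congr_fun measurableSet_Ioc fun r hr => ?_
          refine lintegral_congr_ae ?_
          filter_upwards [ae_cyl] with x hx
          rw [hGe _ _ _ _ (hmem r hr) hx.1, ENNReal.ofReal_mul (hχ x.1).le]
      _ ≤ _ := h.bulk

theorem Sm.norm_sub_sq_le_radialSq (haM : |a| < M) (hP : Sm a M P) {ρ : ℝ} (hρ : ρ < rp a M)
    {x : ℝ × ℝ × ℝ} (hx : radialSq a M ρ P x < ⊤) {s t : ℝ} (hs : rm a M < s)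
    (hst : s ≤ t) (ht : t ≤ ρ) :
    ‖P x.1 t x.2.1 x.2.2 - P x.1 s x.2.1 x.2.2‖ ^ 2 ≤ (t - s) * (radialSq a M ρ P x).toReal := by
  refine (hP.norm_sub_sq_le haM hs hst (ht.trans_lt hρ)).trans
    (mul_le_mul_of_nonneg_left ?_ (sub_nonneg.2 hst))
  rw [← ENNReal.ofReal_le_iff_le_toReal hx.ne, intervalIntegral.integral_of_le hst,
    ofReal_integral_eq_lintegral_ofReal]
  · exact lintegral_mono_set (Ioc_subset_Ioc hs.le ht)
  · have hc : ContinuousOn (fun r => Kerr.pR a M P x.1 r x.2.1 x.2.2) (Icc s t) :=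
      (hP.pR haM).continuousOn.comp (f := fun r : ℝ => (x.1, r, x.2.1, x.2.2)) (by fun_prop)
        fun r hr => mem_dom.2 ⟨hs.trans_le hr.1, hr.2.trans (ht.trans hρ.le)⟩
    exact ((hc.norm.pow 2).integrableOn_Icc).mono_set Ioc_subset_Icc_self
  · exact Eventually.of_forall fun r => sq_nonneg _

/-- The Hölder bound with exponent 1/2 makes the values along a sequence decreasing to s a Cauchy
sequence. Passing to the limit in the bound with r fixed gives the rate for every r. -/
theorem exists_tendsto_of_norm_sub_sq_le {p : ℝ → ℂ} {s t G : ℝ} {u : ℕ → ℝ}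
    (hu : ∀ n, u n ∈ Ioc s t) (hanti : Antitone u) (hlim : Tendsto u atTop (𝓝 s))
    (h : ∀ r r', s < r → r ≤ r' → r' ≤ t → ‖p r' - p r‖ ^ 2 ≤ (r' - r) * G) (hG : 0 ≤ G) :
    Tendsto (fun n => p (u n)) atTop (𝓝 (limUnder atTop fun n => p (u n))) ∧
      ∀ r ∈ Ioc s t, ‖p r - limUnder atTop fun n => p (u n)‖ ^ 2 ≤ (r - s) * G := by
  have hb : Tendsto (fun n => Real.sqrt ((u n - s) * G)) atTop (𝓝 0) := by
    have := ((hlim.sub_const s).mul_const G).sqrt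
    simpa using this
  have hdist : ∀ n m N, N ≤ n → N ≤ m → dist (p (u n)) (p (u m)) ≤ Real.sqrt ((u N - s) * G) := by
    intro n m N hn hm
    wlog hnm : n ≤ m generalizing n m
    · rw [dist_comm]
      exact this m n hm hn (le_of_not_ge hnm)
    rw [dist_eq_norm]
    refine Real.le_sqrt_of_sq_le ((h _ _ (hu m).1 (hanti hnm) (hu n).2).trans ?_)
    exact mul_le_mul_of_nonneg_right (by linarith [hanti hn, (hu m).1]) hG
  have ht := (cauchySeq_of_le_tendsto_0 _ hdist hb).tendsto_limUnder
  refine ⟨ht, fun r hr => ?_⟩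
  have h1 := ((tendsto_const_nhds (x := p r)).sub ht).norm.pow 2
  have h2 : Tendsto (fun n => (r - u n) * G) atTop (𝓝 ((r - s) * G)) :=
    (tendsto_const_nhds.sub hlim).mul_const G
  refine le_of_tendsto_of_tendsto h1 h2 ?_
  filter_upwards [hlim.eventually (gt_mem_nhds hr.1)] with n hn
  exact h _ _ (hu n).1 hn.le hr.2

/-- `ψm` is the limit of the slices of `f` at `r = r₋`, with a controlled rate. -/
structure SliceLimit (a M : ℝ) (χ : ℝ → ℝ) (f : ℝ → ℝ → ℝ → ℝ → ℂ) (ψm : ℝ × ℝ × ℝ → ℂ)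
    (G : ℝ × ℝ × ℝ → ℝ) (ρ : ℝ) : Prop where
  mem : ρ ∈ Ioo (rm a M) (rp a M)
  meas_lim : AEStronglyMeasurable ψm cyl
  meas_G : AEMeasurable G cyl
  nonneg : ∀ x, 0 ≤ G x
  weighted_G : ∫⁻ x, ENNReal.ofReal (χ x.1 * G x) ∂cyl < ⊤
  near : ∀ᵐ x ∂cyl, ∀ r ∈ Ioc (rm a M) ρ,
    ‖f x.1 r x.2.1 x.2.2 - ψm x‖ ^ 2 ≤ (r - rm a M) * G x
  meas : ∀ R : ℝ → ℝ, Measurable R → (∀ v, R v ∈ Ioc (rm a M) (rp a M)) →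
    AEStronglyMeasurable (fun x : ℝ × ℝ × ℝ => f x.1 (R x.1) x.2.1 x.2.2) cyl
  bdd : ∀ N r₁ : ℝ, rm a M < r₁ → ∃ C : ℝ, 0 ≤ C ∧ ∀ᵐ x ∂cyl, |x.1| ≤ N →
    ∀ r ∈ Icc r₁ (rp a M), ‖f x.1 r x.2.1 x.2.2‖ ^ 2 ≤ C
  weighted : ∀ r ∈ Ioo (rm a M) ρ,
    ∫⁻ x, ENNReal.ofReal (χ x.1 * ‖f x.1 r x.2.1 x.2.2‖ ^ 2) ∂cyl < ⊤

/-- The estimate on each radial curve holds wherever `radialSq` is finite, hence outside one null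
set that does not depend on r. This uniformity is needed later on Σ, where r varies with v₊. -/
theorem InteriorBound.exists_sliceLimit {ρ C : ℝ} (haM : |a| < M) (hP : SpinReg a M P)
    (hχ : ∀ v, 0 < χ v) (hχc : Continuous χ) (h : InteriorBound a M χ P ρ C)
    (hf : EqT (Ioc (rm a M) (rp a M)) f P) : ∃ ψm G, SliceLimit a M χ f ψm G ρ := by
  obtain ⟨hGm, hGi⟩ := h.radialSq_spec haM hP hχ hχc
  have hd : 0 < ρ - rm a M := sub_pos.2 h.mem.1
  obtain ⟨u, hanti, hu, hlim⟩ := exists_seq_strictAnti_tendsto' h.mem.1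
  have hmem : ∀ r ∈ Ioc (rm a M) ρ, r ∈ Ioc (rm a M) (rp a M) := fun r hr =>
    ⟨hr.1, hr.2.trans h.mem.2.le⟩
  -- The weighted integral is finite and the weight is positive, so `radialSq` is finite almost
  -- everywhere.
  have hGfin : ∀ᵐ x ∂cyl, radialSq a M ρ P x < ⊤ := by
    filter_upwards [ae_lt_top' ((hχc.measurable.comp measurable_fst).ennreal_ofReal.aemeasurable.mul
      hGm) (hGi.trans_lt ENNReal.ofReal_lt_top).ne] with x hx
    by_contra hcon
    simp only [Function.comp_apply, Pi.mul_apply, not_lt_top_iff.1 hcon,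
      ENNReal.mul_top (ENNReal.ofReal_pos.2 (hχ x.1)).ne'] at hx
    exact lt_irrefl _ hx
  have hkey : ∀ᵐ x ∂cyl, Tendsto (fun n => P x.1 (u n) x.2.1 x.2.2) atTop
        (𝓝 (limUnder atTop fun n => P x.1 (u n) x.2.1 x.2.2)) ∧
      ∀ r ∈ Ioc (rm a M) ρ, ‖P x.1 r x.2.1 x.2.2 - limUnder atTop fun n => P x.1 (u n) x.2.1 x.2.2‖ ^ 2
        ≤ (r - rm a M) * (radialSq a M ρ P x).toReal := by
    filter_upwards [hGfin] with x hx
    exact exists_tendsto_of_norm_sub_sq_le (p := fun r => P x.1 r x.2.1 x.2.2)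
      (fun n => Ioo_subset_Ioc_self (hu n)) hanti.antitone hlim
      (fun r r' h1 h2 h3 => hP.sm.norm_sub_sq_le_radialSq haM h.mem.2 hx h1 h2 h3)
      ENNReal.toReal_nonneg
  have hmeas : ∀ R : ℝ → ℝ, Measurable R → (∀ v, R v ∈ Ioc (rm a M) (rp a M)) →
      AEStronglyMeasurable (fun x : ℝ × ℝ × ℝ => P x.1 (R x.1) x.2.1 x.2.2) cyl := by
    intro R hR hRm
    obtain ⟨G, hG, hGe⟩ := hP.sm.exists_measurable_regn
    have hm : Measurable fun x : ℝ × ℝ × ℝ => G (x.1, R x.1, x.2.1, x.2.2) := hG.comp (by fun_prop)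
    refine hm.aestronglyMeasurable.congr ?_
    filter_upwards [ae_cyl] with x hx
    exact hGe _ _ _ _ (hRm _) hx.1
  refine ⟨fun x => limUnder atTop fun n => P x.1 (u n) x.2.1 x.2.2,
    fun x => (radialSq a M ρ P x).toReal, h.mem, ?_, hGm.ennreal_toReal,
    fun x => ENNReal.toReal_nonneg, ?_, ?_, ?_, ?_, ?_⟩
  · refine aestronglyMeasurable_of_tendsto_ae atTop (fun n => hmeas (fun _ => u n) measurable_const
      fun _ => hmem _ (Ioo_subset_Ioc_self (hu n))) ?_
    filter_upwards [hkey] with x hx using hx.1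
  · refine lt_of_le_of_lt (lintegral_mono fun x => ?_) (hGi.trans_lt ENNReal.ofReal_lt_top)
    rw [ENNReal.ofReal_mul (hχ x.1).le]
    exact mul_le_mul_right ENNReal.ofReal_toReal_le _
  · filter_upwards [hkey, ae_cyl] with x hx hθ r hr
    rw [hf _ _ _ _ (hmem r hr) hθ.1]
    exact hx.2 r hr
  · intro R hR hRm
    refine (hmeas R hR hRm).congr ?_
    filter_upwards [ae_cyl] with x hx
    exact (hf _ _ _ _ (hRm _) hx.1).symm
  · intro N r₁ hr₁
    obtain ⟨C, hC, hb⟩ := hP.sm.bc.norm_sq.bdd N r₁ hr₁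
    refine ⟨C, hC, ?_⟩
    filter_upwards [ae_cyl] with x hx hN r hr
    rw [hf _ _ _ _ ⟨hr₁.trans_le hr.1, hr.2⟩ hx.1]
    exact (le_abs_self _).trans (hb _ _ _ _ hN hr hx.1 (Ioo_subset_Icc_self hx.2))
  · intro r hr
    refine lintegral_ofReal_lt_top_of_le zero_le_one ?_
      ((h.slices r hr).trans_lt ENNReal.ofReal_lt_top)
    have hr' : r ∈ Ioo (rm a M) (rp a M) := ⟨hr.1, hr.2.trans h.mem.2⟩
    filter_upwards [ae_cyl] with x hx
    rw [hf _ _ _ _ (Ioo_subset_Ioc_self hr') hx.1, one_mul]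
    refine mul_le_mul_of_nonneg_left ?_ (hχ x.1).le
    have hD := Delta_neg haM hr'
    have := mul_nonneg (neg_nonneg.2 hD.le) (sq_nonneg ‖pR a M P x.1 r x.2.1 x.2.2‖)
    unfold tangD tangSq
    nlinarith [sq_nonneg ‖pTheta P x.1 r x.2.1 x.2.2‖,
      sq_nonneg ‖covD P x.1 r x.2.1 x.2.2‖, sq_nonneg ‖pV P x.1 r x.2.1 x.2.2‖]

end Bounds


/-! ### Square integrability and convergence at the Cauchy horizon. -/

theorem IsWeight.exists_pos_le {qr ql : ℝ} {χ : ℝ → ℝ} (hχ : IsWeight qr ql χ) (hqr : 0 ≤ qr)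
    (hql : 0 ≤ ql) : ∃ m, 0 < m ∧ ∀ v, m ≤ χ v := by
  obtain ⟨w, -, hw⟩ := (isCompact_Icc (a := (-1 : ℝ)) (b := 1)).exists_isMinOn
    ⟨0, by norm_num⟩ hχ.smooth.continuous.continuousOn
  refine ⟨min 1 (χ w), lt_min one_pos (hχ.pos w), fun v => ?_⟩
  rcases le_total 1 v with h1 | h1
  · rw [hχ.right v h1]
    exact (min_le_left _ _).trans (Real.one_le_rpow h1 hqr)
  rcases le_total v (-1) with h2 | h2
  · rw [hχ.left v h2]
    exact (min_le_left _ _).trans (Real.one_le_rpow (by rw [abs_of_neg (by linarith)]; linarith) hql)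
  · exact (min_le_right _ _).trans (hw ⟨h2, h1⟩)

theorem memLp_two_of_lintegral_lt_top {α : Type*} [MeasurableSpace α] {μ : Measure α} {f : α → ℂ}
    (hf : AEStronglyMeasurable f μ) (h : ∫⁻ x, ENNReal.ofReal (‖f x‖ ^ 2) ∂μ < ⊤) :
    MemLp f 2 μ :=
  (memLp_two_iff_integrable_sq_norm hf).2 ⟨hf.norm.pow 2, (hasFiniteIntegral_iff_ofReal
    (Eventually.of_forall fun x => sq_nonneg ‖f x‖)).2 h⟩

section Limit

variable {a M ρ m : ℝ} {χ : ℝ → ℝ} {f : ℝ → ℝ → ℝ → ℝ → ℂ} {ψm : ℝ × ℝ × ℝ → ℂ}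
  {G : ℝ × ℝ × ℝ → ℝ}

theorem lintegral_lt_top_of_weighted (hm : 0 < m) (hχ : ∀ v, m ≤ χ v) {g : ℝ × ℝ × ℝ → ℝ}
    (hg : ∀ x, 0 ≤ g x) (h : ∫⁻ x, ENNReal.ofReal (χ x.1 * g x) ∂cyl < ⊤) :
    ∫⁻ x, ENNReal.ofReal (g x) ∂cyl < ⊤ := by
  refine lintegral_ofReal_lt_top_of_le (C := 1 / m) (by positivity)
    (Eventually.of_forall fun x => ?_) h
  rw [← mul_assoc]
  refine le_mul_of_one_le_left (hg x) ?_
  rw [one_div, inv_mul_eq_div, one_le_div hm]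
  exact hχ x.1

/-- One slice suffices: |ψm|² ≤ 2 |f(r)|² + 2 (r - r₋) G, and both terms have finite weighted
integrals. -/
theorem SliceLimit.weighted_lim (S : SliceLimit a M χ f ψm G ρ) (hχ : ∀ v, 0 < χ v)
    (hχc : Continuous χ) : ∫⁻ x, ENNReal.ofReal (χ x.1 * ‖ψm x‖ ^ 2) ∂cyl < ⊤ := by
  obtain ⟨r, hr⟩ := exists_between S.mem.1
  have hχm : AEMeasurable (fun x : ℝ × ℝ × ℝ => χ x.1) cyl :=
    (hχc.measurable.comp measurable_fst).aemeasurable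
  have hsm := S.meas (fun _ => r) measurable_const (fun _ => ⟨hr.1, hr.2.le.trans S.mem.2.le⟩)
  have h := lintegral_ofReal_mul_add_lt_top hχm (hsm.norm.aemeasurable.pow_const 2) (S.weighted r hr)
    S.weighted_G
  refine lintegral_ofReal_lt_top_of_le (C := 2 + 2 * (r - rm a M))
    (by linarith [hr.1]) ?_ h
  filter_upwards [S.near] with x hx
  have h1 := hx r (Ioo_subset_Ioc_self hr)
  have h2 := norm_sq_add_le (f x.1 r x.2.1 x.2.2) (-(f x.1 r x.2.1 x.2.2 - ψm x))
  rw [norm_neg, show f x.1 r x.2.1 x.2.2 + -(f x.1 r x.2.1 x.2.2 - ψm x) = ψm x by ring] at h2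
  have h3 := S.nonneg x
  have h4 : 0 ≤ (r - rm a M) * ‖f x.1 r x.2.1 x.2.2‖ ^ 2 :=
    mul_nonneg (by linarith [hr.1]) (sq_nonneg _)
  rw [mul_left_comm]
  refine mul_le_mul_of_nonneg_left ?_ (hχ x.1).le
  linarith

theorem SliceLimit.memLp_slice (S : SliceLimit a M χ f ψm G ρ) (hm : 0 < m) (hχ : ∀ v, m ≤ χ v)
    {r : ℝ} (hr : r ∈ Ioo (rm a M) ρ) : MemLp (slice f r) 2 cyl :=
  memLp_two_of_lintegral_lt_top
    (S.meas (fun _ => r) measurable_const fun _ => ⟨hr.1, hr.2.le.trans S.mem.2.le⟩)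
    (lintegral_lt_top_of_weighted hm hχ (fun _ => sq_nonneg _) (S.weighted r hr))

/-- The square of the L² distance is at most (r - r₋) ∫ G. -/
theorem SliceLimit.tendsto_eLpNorm (S : SliceLimit a M χ f ψm G ρ) (hm : 0 < m)
    (hχ : ∀ v, m ≤ χ v) :
    Tendsto (fun r => eLpNorm (slice f r - ψm) 2 cyl) (𝓝[>] (rm a M)) (𝓝 0) := by
  have hK := lintegral_lt_top_of_weighted hm hχ S.nonneg S.weighted_G
  set K := ∫⁻ x, ENNReal.ofReal (G x) ∂cyl
  have h1 : Tendsto (fun r => ENNReal.ofReal (r - rm a M)) (𝓝[>] (rm a M)) (𝓝 0) := by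
    have : Tendsto (fun r => ENNReal.ofReal (r - rm a M)) (𝓝 (rm a M))
        (𝓝 (ENNReal.ofReal (rm a M - rm a M))) :=
      (ENNReal.continuous_ofReal.comp (continuous_id.sub continuous_const)).tendsto _
    rw [sub_self, ENNReal.ofReal_zero] at this
    exact this.mono_left nhdsWithin_le_nhds
  have h2 := (ENNReal.continuous_rpow_const (y := 1 / 2)).tendsto _ |>.comp
    (ENNReal.Tendsto.mul_const h1 (Or.inr hK.ne))
  rw [zero_mul, ENNReal.zero_rpow_of_pos (by norm_num)] at h2
  refine tendsto_of_tendsto_of_tendsto_of_le_of_le' tendsto_const_nhds h2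
    (Eventually.of_forall fun _ => zero_le) ?_
  filter_upwards [Ioo_mem_nhdsGT S.mem.1] with r hr
  rw [eLpNorm_eq_lintegral_rpow_enorm_toReal (by norm_num) (by norm_num)]
  simp only [ENNReal.toReal_ofNat, Function.comp_apply]
  refine ENNReal.rpow_le_rpow ?_ (by norm_num)
  refine le_trans (lintegral_mono_ae ?_)
    (lintegral_ofReal_le_mul (f := fun x => (r - rm a M) * G x) (g := G) (sub_nonneg.2 hr.1.le)
      (Eventually.of_forall fun x => le_rfl))
  filter_upwards [S.near] with x hx
  rw [ENNReal.rpow_ofNat, ← ofReal_norm, ← ENNReal.ofReal_pow (norm_nonneg _)]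
  exact ENNReal.ofReal_le_ofReal (hx r (Ioo_subset_Ioc_self hr))

end Limit

/-! ## The hypersurface `Σ` -/

section Sigma

variable {a M c v₀ : ℝ}

theorem strictAntiOn_two_rStar_sub (ha : 0 < |a|) (haM : |a| < M) :
    StrictAntiOn (fun r => 2 * rStar a M c r - r) (Ioo (rm a M) (rp a M)) := by
  have hder : ∀ r ∈ Ioo (rm a M) (rp a M), HasDerivAt (fun r => 2 * rStar a M c r - r)
      (2 * ((r ^ 2 + a ^ 2) / Delta a M r) - 1) r := fun r hr =>
    ((hasDerivAt_rStar ha haM c hr).const_mul 2).sub (hasDerivAt_id r)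
  refine strictAntiOn_of_deriv_neg (convex_Ioo _ _)
    (fun r hr => (hder r hr).continuousAt.continuousWithinAt) fun r hr => ?_
  rw [interior_Ioo] at hr
  rw [(hder r hr).deriv]
  have := div_nonpos_of_nonneg_of_nonpos (by positivity : 0 ≤ r ^ 2 + a ^ 2) (Delta_neg haM hr).le
  linarith

/-- Monotonicity makes the graph function Borel and keeps it away from r₋ when v is bounded above.
-/
theorem antitone_rSigma (ha : 0 < |a|) (haM : |a| < M) : Antitone (rSigma a M c v₀) := by
  intro v w hvw
  obtain ⟨h1, e1⟩ := rSigma_spec ha haM c v₀ v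
  obtain ⟨h2, e2⟩ := rSigma_spec ha haM c v₀ w
  by_contra hcon
  have := strictAntiOn_two_rStar_sub (c := c) ha haM h1 h2 (not_le.1 hcon)
  unfold fMinus at e1 e2
  simp only at this
  linarith

/-- The function 2 r* contains log(r - r₋) / κ₋, so f⁻ = v₀ can be solved for log(r - r₋) = κ₋ (v +
remainder). The remainder is bounded below, because r < r₊ and log(r₊ - r) is bounded above; since
κ₋ < 0 this is the direction required. -/
theorem exists_rSigma_sub_le (ha : 0 < |a|) (haM : |a| < M) :
    ∃ A, 0 < A ∧ ∀ v, rSigma a M c v₀ v - rm a M ≤ A * Real.exp (km a M * v) := by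
  have hkm := km_neg ha haM
  have hkp := kp_pos ha haM
  refine ⟨Real.exp (km a M * (v₀ - rm a M - 2 * c - rp a M - Real.log (rp a M - rm a M) / kp a M)),
    Real.exp_pos _, fun v => ?_⟩
  obtain ⟨h1, e1⟩ := rSigma_spec ha haM c v₀ v
  set r := rSigma a M c v₀ v
  have hr : 0 < r - rm a M := sub_pos.2 h1.1
  have hlog : Real.log (rp a M - r) ≤ Real.log (rp a M - rm a M) :=
    Real.log_le_log (sub_pos.2 h1.2) (by linarith [h1.1])
  have hlog' : Real.log (rp a M - r) / kp a M ≤ Real.log (rp a M - rm a M) / kp a M := by gcongr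
  rw [← Real.exp_add, ← Real.log_le_iff_le_exp hr]
  have e2 : Real.log (r - rm a M)
      = km a M * (v + v₀ - rm a M - 2 * c - r - Real.log (rp a M - r) / kp a M) := by
    rw [← e1]
    unfold fMinus rStar
    have := hkm.ne
    have := hkp.ne'
    field_simp
    ring
  rw [e2, ← mul_add]
  refine mul_le_mul_of_nonpos_left ?_ hkm.le
  linarith [h1.2]

end Sigma

/-! ## Backwards propagation -/

section Backwards

variable {a M c v₀ ρ m : ℝ} {χ : ℝ → ℝ} {f : ℝ → ℝ → ℝ → ℝ → ℂ} {ψm : ℝ × ℝ × ℝ → ℂ}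
  {G : ℝ × ℝ × ℝ → ℝ}

/-- Used with ε = exp(κ₋ v / 2): the distance is at most ε √(A g) and the difference of squares is
linear in it, whence the factor 1/2 in the exponent. -/
theorem abs_sq_norm_sub_le {p q : ℂ} {ε A g : ℝ} (hε : 0 < ε) (hε1 : ε ≤ 1) (hA : 0 ≤ A * g)
    (h : ‖p - q‖ ^ 2 ≤ A * ε ^ 2 * g) :
    |‖q‖ ^ 2 - ‖p‖ ^ 2| ≤ ε * (‖q‖ ^ 2 + 2 * A * g) := by
  have h1 := abs_norm_sub_norm_le q p
  rw [norm_sub_rev] at h1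
  have h2 : ‖q‖ + ‖p‖ ≤ 2 * ‖q‖ + ‖p - q‖ := by linarith [(abs_le.1 h1).1]
  have e : |‖q‖ ^ 2 - ‖p‖ ^ 2| = |‖q‖ - ‖p‖| * (‖q‖ + ‖p‖) := by
    rw [show ‖q‖ ^ 2 - ‖p‖ ^ 2 = (‖q‖ - ‖p‖) * (‖q‖ + ‖p‖) by ring, abs_mul,
      abs_of_nonneg (add_nonneg (norm_nonneg q) (norm_nonneg p))]
  have h3 : |‖q‖ - ‖p‖| * (‖q‖ + ‖p‖) ≤ ‖p - q‖ * (2 * ‖q‖ + ‖p - q‖) :=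
    mul_le_mul h1 h2 (by positivity) (norm_nonneg _)
  have h4 : ‖p - q‖ * (2 * ‖q‖) ≤ ε * ‖q‖ ^ 2 + ε * (A * g) := by
    refine le_of_mul_le_mul_left ?_ hε
    nlinarith [sq_nonneg (ε * ‖q‖ - ‖p - q‖)]
  have h5 : ε ^ 2 * (A * g) ≤ ε * (A * g) := by
    refine mul_le_mul_of_nonneg_right ?_ hA
    nlinarith
  rw [e]
  linarith

/-- The difference of the squares on the Cauchy horizon and on `Σ`. -/
theorem SliceLimit.exists_abs_sub_le (ha : 0 < |a|) (haM : |a| < M)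
    (S : SliceLimit a M χ f ψm G ρ) :
    ∃ A v₁ : ℝ, 0 < A ∧ 1 ≤ v₁ ∧ ∀ᵐ x ∂cyl, v₁ ≤ x.1 →
      |‖ψm x‖ ^ 2 - ‖onSigma a M c v₀ f x‖ ^ 2|
        ≤ Real.exp (1 / 2 * km a M * x.1) * (‖ψm x‖ ^ 2 + 2 * A * G x) := by
  obtain ⟨A, hA, hle⟩ := exists_rSigma_sub_le (c := c) (v₀ := v₀) ha haM
  have hkm := km_neg ha haM
  have hlim : Tendsto (fun v => A * Real.exp (km a M * v)) atTop (𝓝 0) := by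
    have h1 : Tendsto (fun v => km a M * v) atTop atBot := tendsto_id.const_mul_atTop_of_neg hkm
    simpa using (Real.tendsto_exp_atBot.comp h1).const_mul A
  obtain ⟨v₂, hv₂⟩ := eventually_atTop.1 (hlim.eventually (gt_mem_nhds (sub_pos.2 S.mem.1)))
  refine ⟨A, max 1 v₂, hA, le_max_left _ _, ?_⟩
  filter_upwards [S.near] with x hx hv
  have hv1 := (le_max_left _ _).trans hv
  have hr := rSigma_spec ha haM c v₀ x.1
  have h1 := hx (rSigma a M c v₀ x.1)
    ⟨hr.1.1, by linarith [hle x.1, hv₂ x.1 ((le_max_right _ _).trans hv)]⟩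
  refine abs_sq_norm_sub_le (Real.exp_pos _) (Real.exp_le_one_iff.2 (by nlinarith))
    (mul_nonneg hA.le (S.nonneg x)) (h1.trans (mul_le_mul_of_nonneg_right ?_ (S.nonneg x)))
  refine (hle x.1).trans_eq ?_
  rw [← Real.exp_nat_mul]
  congr 2
  push_cast
  ring

theorem SliceLimit.memLp_lim (S : SliceLimit a M χ f ψm G ρ) (hχp : ∀ v, 0 < χ v)
    (hχc : Continuous χ) (hm : 0 < m) (hχ : ∀ v, m ≤ χ v) :
    MemLp ψm 2 cyl :=
  memLp_two_of_lintegral_lt_top S.meas_lim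
    (lintegral_lt_top_of_weighted hm hχ (fun _ => sq_nonneg _) (S.weighted_lim hχp hχc))

theorem SliceLimit.integrable_G (S : SliceLimit a M χ f ψm G ρ) (hm : 0 < m) (hχ : ∀ v, m ≤ χ v) :
    Integrable G cyl :=
  ⟨S.meas_G.aestronglyMeasurable, (hasFiniteIntegral_iff_ofReal
    (Eventually.of_forall S.nonneg)).2 (lintegral_lt_top_of_weighted hm hχ S.nonneg S.weighted_G)⟩

theorem SliceLimit.meas_sigma (ha : 0 < |a|) (haM : |a| < M) (S : SliceLimit a M χ f ψm G ρ) :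
    AEStronglyMeasurable (onSigma a M c v₀ f) cyl :=
  S.meas _ (antitone_rSigma ha haM).measurable
    fun v => Ioo_subset_Ioc_self (rSigma_spec ha haM c v₀ v).1

/-- The pointwise bound of `SliceLimit.exists_abs_sub_le` is integrated over v ≥ v', where the
exponential is at most its value at v'. The same bound yields integrability on Σ. -/
theorem SliceLimit.backwards_estimate (ha : 0 < |a|) (haM : |a| < M)
    (S : SliceLimit a M χ f ψm G ρ) (hψm : MemLp ψm 2 cyl) (hG : Integrable G cyl) :
    ∃ C : ℝ, 0 < C ∧ ∃ v₁ : ℝ, ∀ v' : ℝ, v₁ ≤ v' →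
      IntegrableOn (fun x => ‖ψm x‖ ^ 2) {x | v' ≤ x.1} cyl ∧
      IntegrableOn (fun x => ‖onSigma a M c v₀ f x‖ ^ 2) {x | v' ≤ x.1} cyl ∧
      |(∫ x in {x | v' ≤ x.1}, ‖ψm x‖ ^ 2 ∂cyl)
          - ∫ x in {x | v' ≤ x.1}, ‖onSigma a M c v₀ f x‖ ^ 2 ∂cyl|
        ≤ C * Real.exp (1 / 2 * km a M * v') := by
  obtain ⟨A, v₁, hA, hv₁, hle⟩ := S.exists_abs_sub_le (c := c) (v₀ := v₀) ha haM
  have hkm := km_neg ha haM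
  have i1 := (memLp_two_iff_integrable_sq_norm S.meas_lim).1 hψm
  have iH : Integrable (fun x => ‖ψm x‖ ^ 2 + 2 * A * G x) cyl := i1.add (hG.const_mul _)
  have hH0 : ∀ x, 0 ≤ ‖ψm x‖ ^ 2 + 2 * A * G x := fun x =>
    add_nonneg (sq_nonneg _) (mul_nonneg (by positivity) (S.nonneg x))
  have hI0 : 0 ≤ ∫ x, (‖ψm x‖ ^ 2 + 2 * A * G x) ∂cyl := integral_nonneg hH0
  refine ⟨(∫ x, (‖ψm x‖ ^ 2 + 2 * A * G x) ∂cyl) + 1, by linarith, v₁, fun v' hv' => ?_⟩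
  have hmono : ∀ᵐ x ∂cyl.restrict {x | v' ≤ x.1},
      |‖ψm x‖ ^ 2 - ‖onSigma a M c v₀ f x‖ ^ 2|
        ≤ Real.exp (1 / 2 * km a M * v') * (‖ψm x‖ ^ 2 + 2 * A * G x) := by
    filter_upwards [ae_restrict_mem (measurableSet_ge v'), ae_restrict_of_ae hle] with x hx h
    have hx' : v' ≤ x.1 := hx
    refine (h (hv'.trans hx')).trans (mul_le_mul_of_nonneg_right ?_ (hH0 x))
    exact Real.exp_le_exp.2 (by nlinarith)
  have i2 : IntegrableOn (fun x => ‖onSigma a M c v₀ f x‖ ^ 2) {x | v' ≤ x.1} cyl := by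
    refine Integrable.mono' ((i1.integrableOn (s := {x | v' ≤ x.1})).add (iH.integrableOn.const_mul
      (Real.exp (1 / 2 * km a M * v'))))
      ((S.meas_sigma ha haM).norm.pow 2).restrict ?_
    filter_upwards [hmono] with x hx
    rw [Real.norm_of_nonneg (sq_nonneg _)]
    simp only [Pi.add_apply]
    linarith [(abs_le.1 hx).1]
  refine ⟨i1.integrableOn, i2, ?_⟩
  rw [← integral_sub i1.integrableOn i2]
  refine (abs_integral_le_integral_abs).trans ?_
  refine (integral_mono_ae (i1.integrableOn.sub i2).abs (iH.integrableOn.const_mul _) hmono).trans ?_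
  rw [integral_const_mul, mul_comm]
  refine mul_le_mul_of_nonneg_right ?_ (Real.exp_pos _).le
  exact (setIntegral_le_integral iH (Eventually.of_forall hH0)).trans (by linarith)

theorem lintegral_rpow_mul_lt_top {p v₁ : ℝ} {F F' H : ℝ × ℝ × ℝ → ℝ}
    (hH : Integrable H cyl)
    (hslab : ∫⁻ x in {x : ℝ × ℝ × ℝ | x.1 ∈ Icc 1 v₁}, ENNReal.ofReal (x.1 ^ p * F' x) ∂cyl < ⊤)
    (hle : ∀ᵐ x ∂cyl, v₁ ≤ x.1 → x.1 ^ p * F' x ≤ x.1 ^ p * F x + H x) (hv₁ : 1 ≤ v₁)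
    (h : ∫⁻ x in {x : ℝ × ℝ × ℝ | 1 ≤ x.1}, ENNReal.ofReal (x.1 ^ p * F x) ∂cyl < ⊤) :
    ∫⁻ x in {x : ℝ × ℝ × ℝ | 1 ≤ x.1}, ENNReal.ofReal (x.1 ^ p * F' x) ∂cyl < ⊤ := by
  have hcov : {x : ℝ × ℝ × ℝ | 1 ≤ x.1} ⊆ {x | x.1 ∈ Icc 1 v₁} ∪ {x | v₁ ≤ x.1} := by
    intro x hx
    rcases le_total x.1 v₁ with h1 | h1
    · exact Or.inl ⟨hx, h1⟩
    · exact Or.inr h1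
  refine (lintegral_mono_set hcov).trans_lt ((lintegral_union_le _ _ _).trans_lt
    (ENNReal.add_lt_top.2 ⟨hslab, ?_⟩))
  have hH' : ∫⁻ x in {x : ℝ × ℝ × ℝ | v₁ ≤ x.1}, ENNReal.ofReal (H x) ∂cyl < ⊤ :=
    (setLIntegral_le_lintegral _ _).trans_lt hH.lintegral_lt_top
  have hF : ∫⁻ x in {x : ℝ × ℝ × ℝ | v₁ ≤ x.1}, ENNReal.ofReal (x.1 ^ p * F x) ∂cyl < ⊤ :=
    (lintegral_mono_set fun x hx => hv₁.trans hx).trans_lt h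
  refine lt_of_le_of_lt (lintegral_mono_ae ?_)
    ((lintegral_add_right' _ hH.aestronglyMeasurable.aemeasurable.restrict.ennreal_ofReal).trans_lt
      (ENNReal.add_lt_top.2 ⟨hF, hH'⟩))
  filter_upwards [ae_restrict_mem (measurableSet_ge v₁), ae_restrict_of_ae hle] with x hx hx'
  exact (ENNReal.ofReal_le_ofReal (hx' hx)).trans ENNReal.ofReal_add_le

/-- For large v the product v^p exp(κ₋ v / 2) is at most 1. The weighted difference of the squares
is then dominated by a fixed integrable function, so the two integrals are finite together; the
range 1 ≤ v ≤ v₁ contributes a finite amount to each. -/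
theorem SliceLimit.polynomial_iff (ha : 0 < |a|) (haM : |a| < M) (S : SliceLimit a M χ f ψm G ρ)
    (hψm : MemLp ψm 2 cyl) (hG : Integrable G cyl) {p : ℝ} (hp : 0 < p) :
    ∫⁻ x in {x | 1 ≤ x.1}, ENNReal.ofReal (x.1 ^ p * ‖ψm x‖ ^ 2) ∂cyl < ⊤ ↔
      ∫⁻ x in {x | 1 ≤ x.1}, ENNReal.ofReal (x.1 ^ p * ‖onSigma a M c v₀ f x‖ ^ 2) ∂cyl < ⊤ := by
  obtain ⟨A, v₂, hA, hv₂, hle⟩ := S.exists_abs_sub_le (c := c) (v₀ := v₀) ha haM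
  have hkm := km_neg ha haM
  obtain ⟨v₃, hv₃⟩ := eventually_atTop.1 ((tendsto_rpow_mul_exp_neg_mul_atTop_nhds_zero p
    (-(1 / 2 * km a M)) (by linarith)).eventually (gt_mem_nhds one_pos))
  obtain ⟨v₁, hv₁⟩ : ∃ X, X = max v₂ v₃ := ⟨_, rfl⟩
  have h12 : v₂ ≤ v₁ := hv₁ ▸ le_max_left _ _
  have h13 : v₃ ≤ v₁ := hv₁ ▸ le_max_right _ _
  have h1 : 1 ≤ v₁ := hv₂.trans h12
  have i1 := (memLp_two_iff_integrable_sq_norm S.meas_lim).1 hψm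
  have iH : Integrable (fun x => ‖ψm x‖ ^ 2 + 2 * A * G x) cyl := i1.add (hG.const_mul _)
  have hH0 : ∀ x, 0 ≤ ‖ψm x‖ ^ 2 + 2 * A * G x := fun x =>
    add_nonneg (sq_nonneg _) (mul_nonneg (by positivity) (S.nonneg x))
  have hms : MeasurableSet {x : ℝ × ℝ × ℝ | x.1 ∈ Icc 1 v₁} := measurableSet_Icc.preimage (by fun_prop)
  have hdiff : ∀ᵐ x ∂cyl, v₁ ≤ x.1 → x.1 ^ p * |‖ψm x‖ ^ 2 - ‖onSigma a M c v₀ f x‖ ^ 2|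
      ≤ ‖ψm x‖ ^ 2 + 2 * A * G x := by
    filter_upwards [hle] with x hx hv
    have e1 := mul_le_mul_of_nonneg_left (hx (h12.trans hv))
      (Real.rpow_nonneg (by linarith : 0 ≤ x.1) p)
    have e2 := hv₃ x.1 (h13.trans hv)
    rw [neg_neg] at e2
    rw [← mul_assoc] at e1
    exact e1.trans (mul_le_of_le_one_left (hH0 x) e2.le)
  have hpow : ∀ x : ℝ × ℝ × ℝ, x.1 ∈ Icc 1 v₁ → x.1 ^ p ≤ v₁ ^ p := fun x hx =>
    Real.rpow_le_rpow (by linarith [hx.1]) hx.2 hp.le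
  constructor
  · refine lintegral_rpow_mul_lt_top iH ?_ ?_ h1
    -- On 1 ≤ v ≤ v₁ the surface stays in r ≥ `rSigma` at v₁, where the field is bounded.
    · obtain ⟨C, hC, hb⟩ := S.bdd v₁ (rSigma a M c v₀ v₁) (rSigma_spec ha haM c v₀ v₁).1.1
      refine lt_of_le_of_lt (lintegral_mono_ae (g := fun _ => ENNReal.ofReal (v₁ ^ p * C)) ?_) ?_
      · filter_upwards [ae_restrict_mem hms, ae_restrict_of_ae hb] with x hx hbx
        refine ENNReal.ofReal_le_ofReal (mul_le_mul (hpow x hx) ?_ (sq_nonneg _) (by positivity))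
        exact hbx (abs_le.2 ⟨by linarith [hx.1], hx.2⟩) _
          ⟨antitone_rSigma ha haM hx.2, (rSigma_spec ha haM c v₀ x.1).1.2.le⟩
      · rw [lintegral_const, Measure.restrict_apply_univ]
        refine ENNReal.mul_lt_top ENNReal.ofReal_lt_top ((measure_mono ?_).trans_lt
          (cyl_slab_lt_top v₁))
        exact fun x hx => ⟨by linarith [hx.1], hx.2⟩
    · filter_upwards [hdiff] with x hx hv
      have e1 := hx hv
      have e2 := mul_le_mul_of_nonneg_left
        (neg_abs_le (‖ψm x‖ ^ 2 - ‖onSigma a M c v₀ f x‖ ^ 2))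
        (Real.rpow_nonneg (by linarith : 0 ≤ x.1) p)
      linarith
  · refine lintegral_rpow_mul_lt_top iH ?_ ?_ h1
    · refine lintegral_ofReal_lt_top_of_le (C := v₁ ^ p) (by positivity) ?_
        ((setLIntegral_le_lintegral _ _).trans_lt i1.lintegral_lt_top)
      filter_upwards [ae_restrict_mem hms] with x hx
      exact mul_le_mul_of_nonneg_right (hpow x hx) (sq_nonneg _)
    · filter_upwards [hdiff] with x hx hv
      have e1 := hx hv
      have e2 := mul_le_mul_of_nonneg_left
        (le_abs_self (‖ψm x‖ ^ 2 - ‖onSigma a M c v₀ f x‖ ^ 2))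
        (Real.rpow_nonneg (by linarith : 0 ≤ x.1) p)
      linarith

end Backwards

end Kerr

theorem proposition4 (a M c b : ℝ) (ha : 0 < |a|) (haM : |a| < M)
    (p₀ : ℕ) (hp₀ : 2 ≤ p₀) (qr ql : ℝ) (hqr : 2 < qr) (hqr' : qr < 2 * p₀) (hql : 2 * p₀ ≤ ql)
    (χ : ℝ → ℝ) (hχ : IsWeight qr ql χ)
    (ψ ψt : ℝ → ℝ → ℝ → ℝ → ℂ) (hψ : RegularField a M c b ψ ψt)
    (hright : DecayRight a M qr (inPlus a M c b ψ))
    (hleft : DecayLeft a M ql (hatField a M c b ψt)) :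
    (∀ r₁ ∈ Ioo (rm a M) (rp a M), ∃ re ∈ Ioo (rm a M) r₁, ∃ C : ℝ, 0 < C ∧
      (∫⁻ r in Ioc (rm a M) re, ∫⁻ x,
          ENNReal.ofReal (χ x.1 *
            energyDensity a M 1 (inPlus a M c b ψ) x.1 r x.2.1 x.2.2) ∂cyl
        ≤ ENNReal.ofReal C) ∧
      ∀ r ∈ Ioc (rm a M) re,
        ∫⁻ x, ENNReal.ofReal (χ x.1 *
            energyDensity a M |Delta a M r| (inPlus a M c b ψ) x.1 r x.2.1 x.2.2) ∂cyl
          ≤ ENNReal.ofReal C) ∧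
    ∃ ψm : ℝ × ℝ × ℝ → ℂ,
      (MemLp ψm 2 cyl ∧
        (∀ᶠ r in 𝓝[>] (rm a M), MemLp (slice (inPlus a M c b ψ) r) 2 cyl) ∧
        Tendsto (fun r => eLpNorm (slice (inPlus a M c b ψ) r - ψm) 2 cyl)
          (𝓝[>] (rm a M)) (𝓝 0) ∧
        ∫⁻ x, ENNReal.ofReal (χ x.1 * ‖ψm x‖ ^ 2) ∂cyl < ⊤) ∧
      ∀ v₀ : ℝ,
        (∃ C : ℝ, 0 < C ∧ ∃ v₁ : ℝ, ∀ v' : ℝ, v₁ ≤ v' →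
          IntegrableOn (fun x => ‖ψm x‖ ^ 2) {x | v' ≤ x.1} cyl ∧
          IntegrableOn (fun x => ‖onSigma a M c v₀ (inPlus a M c b ψ) x‖ ^ 2)
            {x | v' ≤ x.1} cyl ∧
          |(∫ x in {x | v' ≤ x.1}, ‖ψm x‖ ^ 2 ∂cyl)
              - ∫ x in {x | v' ≤ x.1}, ‖onSigma a M c v₀ (inPlus a M c b ψ) x‖ ^ 2 ∂cyl|
            ≤ C * Real.exp (1 / 2 * km a M * v')) ∧
        ∀ p : ℝ, 0 < p →
          (∫⁻ x in {x | 1 ≤ x.1}, ENNReal.ofReal (x.1 ^ p * ‖ψm x‖ ^ 2) ∂cyl < ⊤ ↔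
            ∫⁻ x in {x | 1 ≤ x.1}, ENNReal.ofReal
              (x.1 ^ p * ‖onSigma a M c v₀ (inPlus a M c b ψ) x‖ ^ 2) ∂cyl < ⊤) := by
  have hql0 : 0 ≤ ql := le_trans (by positivity) hql
  have hqr0 : 0 ≤ qr := by linarith
  obtain ⟨P, U, hPU, hP, hU⟩ := hψ.exists_regularPair ha haM
  obtain ⟨ρ, C, hC, hbound⟩ :=
    hPU.exists_interiorBound ha haM hqr0 hql0 hχ hP hright hU hleft
  have hχc := hχ.smooth.continuous
  refine ⟨fun r₁ hr₁ => hbound.energy_estimate haM hPU.regP hχ.pos hχc hC hP hr₁, ?_⟩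
  obtain ⟨ψm, G, S⟩ := hbound.exists_sliceLimit haM hPU.regP hχ.pos hχc hP
  obtain ⟨m, hm, hmχ⟩ := hχ.exists_pos_le hqr0 hql0
  have hψm := S.memLp_lim hχ.pos hχc hm hmχ
  have hG := S.integrable_G hm hmχ
  refine ⟨ψm, ⟨hψm, ?_, S.tendsto_eLpNorm hm hmχ, S.weighted_lim hχ.pos hχc⟩, fun v₀ =>
    ⟨S.backwards_estimate ha haM hψm hG, fun p hp => S.polynomial_iff ha haM hψm hG hp⟩⟩
  filter_upwards [Ioo_mem_nhdsGT S.mem.1] with r hr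
  exact S.memLp_slice hm hmχ hr
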